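/- **Setting.** Fix integers $k,r,m\ge 1$ and $h_0\ge 1$, and let $p=p_n$, $q=q_n$, $T=T_n$ all tend to infinity as $n\to\infty$. All matrices and processes below may depend on $n$ (suppressed); $O$, $o$, $O_p$, $\asymp$ are as $n\to\infty$, and "constant" means independent of $n$, $t$ and the entry. Observe, for $1\le t\le T$, the $m\times q$ matrices $X_t$ and the $p\times q$ matrices $$Y_t=AX_t+RF_tC'+E_t ,\qquad W_t:=RF_tC'+E_t ,\qquad S_t:=AX_t+RF_tC',$$ where $A\in\mathbb R^{p\times m}$, $R\in\mathbb R^{p\times k}$, $C\in\mathbb R^{q\times r}$ are deterministic, $F_t$ is a latent random $k\times r$ matrix and $E_t$ is noise. Assume that $E F_t=0$; that $\mathrm{vec}(E_t)$ is white noise with mean $0$ and covariance matrix $\Sigma_e$, uncorrelated with the processes $(X_s)$ and $(F_s)$ at all times $1\le s,t\le T$; and that $\mathrm{Cov}(\mathrm{vec}\,X_t,\mathrm{vec}\,F_t)=0$ for each $t$. $\|\cdot\|_2$ is the spectral norm, and $\sigma_j$, $\lambda_j$ denote the $j$-th largest singular value and eigenvalue. For vector processes put $\Gamma_h(u,v)=\frac1{T-h}\sum_{t=1}^{T-h}\mathrm{Cov}(u_t,v_{t+h})$,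 and let $$\Sigma_f(h)=\Gamma_h(\mathrm{vec}F,\mathrm{vec}F),\quad M_1=\sum_{h=1}^{h_0}\sum_{i,j=1}^q\Omega_{ij}(h)\Omega_{ij}(h)',\quad \Omega_{ij}(h)=\Gamma_h(w_{\cdot,i},w_{\cdot,j}),$$ with $w_{t,i}$ the $i$-th column of $W_t$; $M_2$ is defined in the same way from $W_t'$. **Conditions.** 1. $(\mathrm{vec}Y_t,\mathrm{vec}X_t,\mathrm{vec}F_t)_{t\in\mathbb Z}$ is $\alpha$-mixing with coefficients bounded by a sequence $\alpha(l)$, not depending on $n$, with $\sum_{l\ge1}\alpha(l)^{1-2/\gamma}<\infty$ for some $\gamma>2$. 2. The absolute moments of order $2\gamma$ of all entries of $F_t,X_t,E_t$, $1\le t\le T$, are bounded by a constant. 3. For some fixed $h\in\{1,\dots,h_0\}$ and $k^*=\max(k,r)$: for all large $n$, $\Sigma_f(h)$ has rank at least $k^*$; $\|\Sigma_f(h)\|_2\asymp1\asymp\sigma_{k^*}(\Sigma_f(h))$; and for all large $n$, $\Gamma_h(F_{i\cdot},F_{i\cdot})\ne0$ for every row $i\le k$ and $\Gamma_h(F_{\cdot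 j},F_{\cdot j})\neq0$ for every column $j\le r$ of $F_t$. 4. $P_t=E(X_tX_t')$ is positive definite for $1\le t\le T$, $\frac1T\sum_{t=1}^TP_t-P\to0$ for positive definite matrices $P=P_n$, and $\lambda_{\min}(P)\asymp q$. 5. The entries of $\Sigma_e$ are bounded by a constant. 6. For constants $\delta_1,\delta_2\in[0,1]$: $\sigma_1(R)^2\asymp p^{1-\delta_1}\asymp\sigma_k(R)^2$ and $\sigma_1(C)^2\asymp q^{1-\delta_2}\asymp\sigma_r(C)^2$. 7. For all large $n$, $\lambda_1(M_1)>\dots>\lambda_k(M_1)>0$ and $\lambda_1(M_2)>\dots>\lambda_r(M_2)>0$; moreover the positivity is uniform: $\lambda_k(M_1)/\lambda_1(M_1)$ and $\lambda_r(M_2)/\lambda_1(M_2)$ are bounded below by a positive constant for all large $n$. **Estimators.** $\widehat A=\big(\frac1T\sum_{t=1}^T Y_tX_t'\big)\big(\frac1T\sum_{t=1}^T X_tX_t'\big)^{-1}$ and $\widehat W_t=Y_t-\widehat AX_t$. With $\widehat\Omega_{ij}(h)=\frac1{T-h}\sum_{t=1}^{T-h}\widehat w_{t,i}\widehat w_{t+h,j}'$,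 where $\widehat w_{t,i}$ is the $i$-th column of $\widehat W_t$, put $\widehat M_1=\sum_{h=1}^{h_0}\sum_{i,j=1}^q\widehat\Omega_{ij}(h)\widehat\Omega_{ij}(h)'$, and define $\widehat M_2$ in the same way from $\widehat W_t'$. $\widehat Q_1$ (resp. $\widehat Q_2$) has as columns orthonormal eigenvectors of $\widehat M_1$ (resp. $\widehat M_2$) for its $k$ (resp. $r$) largest eigenvalues, in any choice, and $\widehat S_t=\widehat AX_t+\widehat Q_1\widehat Q_1'\widehat W_t\widehat Q_2\widehat Q_2'$. **Theorem.** Under Conditions 1–7, if $p^{\delta_1}q^{\delta_2}T^{-1/2}=o(1)$ and $\|\Sigma_e\|_2$ is bounded, then for every choice of time points $t=t_n\in\{1,\dots,T_n\}$ $$p^{-1/2}q^{-1/2}\,\|\widehat S_t-S_t\|_2=O_p\!\left(p^{\delta_1/2}q^{\delta_2/2}T^{-1/2}+p^{-1/2}q^{-1/2}\right).$$ -/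

import Mathlib

open MeasureTheory ProbabilityTheory Filter Topology Asymptotics
open scoped Matrix

noncomputable section

namespace MatFactor

/-! ### Linear algebra -/

section LinAlg

variable {ι κ : Type*} [Fintype ι] [DecidableEq ι] [Fintype κ] [DecidableEq κ]

open scoped Matrix.Norms.L2Operator in
/-- The spectral norm of a real matrix (operator norm for the Euclidean norms). -/
def specNorm (M : Matrix ι κ ℝ) : ℝ := ‖M‖

/-- `singVal M j` is the `(j+1)`-st largest singular value of `M` (with multiplicity). -/
def singVal (M : Matrix ι κ ℝ) (j : ℕ) : ℝ := (Matrix.toEuclideanLin M).singularValues j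

open Classical in
/-- `eigDesc M j` is the `(j+1)`-st largest eigenvalue (with multiplicity) of the real symmetric
matrix `M`; by convention `0` if there is no such eigenvalue. -/
def eigDesc (M : Matrix ι ι ℝ) (j : ℕ) : ℝ :=
  if h : M.IsHermitian ∧ j < Fintype.card ι then h.1.eigenvalues₀ ⟨j, h.2⟩ else 0

/-- The columns of `Q` are orthonormal, and the `i`-th column is an eigenvector of `M` for the
`i`-th largest eigenvalue of `M`. -/
def IsTopEigvecs {d : ℕ} (M : Matrix ι ι ℝ) (Q : Matrix ι (Fin d) ℝ) : Prop :=
  Qᵀ * Q = 1 ∧ M * Q = Q * Matrix.diagonal (fun i : Fin d => eigDesc M i)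

/-- The symmetric matrix `M` has `d` distinct positive eigenvalues, namely its `d` largest ones. -/
def HasDistinctPosEig (M : Matrix ι ι ℝ) (d : ℕ) : Prop :=
  (∀ j < d, 0 < eigDesc M j) ∧ ∀ j, j + 1 < d → eigDesc M (j + 1) < eigDesc M j

end LinAlg

/-! ### The model and the estimators (for one sample of size `T`) -/

section Model

variable {p q k r m : ℕ}

/-- `W = R F Cᵀ + E`. -/
def residual (R : Matrix (Fin p) (Fin k) ℝ) (C : Matrix (Fin q) (Fin r) ℝ)
    (F : Matrix (Fin k) (Fin r) ℝ) (E : Matrix (Fin p) (Fin q) ℝ) : Matrix (Fin p) (Fin q) ℝ :=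
  R * F * Cᵀ + E

/-- The observation `Y = A X + R F Cᵀ + E`. -/
def observation (A : Matrix (Fin p) (Fin m) ℝ) (R : Matrix (Fin p) (Fin k) ℝ)
    (C : Matrix (Fin q) (Fin r) ℝ) (X : Matrix (Fin m) (Fin q) ℝ) (F : Matrix (Fin k) (Fin r) ℝ)
    (E : Matrix (Fin p) (Fin q) ℝ) : Matrix (Fin p) (Fin q) ℝ :=
  A * X + R * F * Cᵀ + E

/-- The total signal `S = A X + R F Cᵀ`. -/
def signal (A : Matrix (Fin p) (Fin m) ℝ) (R : Matrix (Fin p) (Fin k) ℝ)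
    (C : Matrix (Fin q) (Fin r) ℝ) (X : Matrix (Fin m) (Fin q) ℝ)
    (F : Matrix (Fin k) (Fin r) ℝ) : Matrix (Fin p) (Fin q) ℝ :=
  A * X + R * F * Cᵀ

/-- The least squares estimator of `A` from the observations at times `1, …, T`. -/
def lsEstimator (T : ℕ) (Y : ℤ → Matrix (Fin p) (Fin q) ℝ) (X : ℤ → Matrix (Fin m) (Fin q) ℝ) :
    Matrix (Fin p) (Fin m) ℝ :=
  ((T : ℝ)⁻¹ • ∑ t ∈ Finset.Icc (1 : ℤ) T, Y t * (X t)ᵀ) *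
    ((T : ℝ)⁻¹ • ∑ t ∈ Finset.Icc (1 : ℤ) T, X t * (X t)ᵀ)⁻¹

/-- `Ŵ_t = Y_t - Â X_t`. -/
def residualEst (T : ℕ) (Y : ℤ → Matrix (Fin p) (Fin q) ℝ) (X : ℤ → Matrix (Fin m) (Fin q) ℝ)
    (t : ℤ) : Matrix (Fin p) (Fin q) ℝ :=
  Y t - lsEstimator T Y X * X t

/-- The sample lagged moment matrix of two columns,
`(T-h)⁻¹ ∑_{t=1}^{T-h} w_{t,i} w_{t+h,j}ᵀ`, where `w_{t,i}` is the `i`-th column of `W_t`. -/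
def sampleOmega (T h : ℕ) (W : ℤ → Matrix (Fin p) (Fin q) ℝ) (i j : Fin q) :
    Matrix (Fin p) (Fin p) ℝ :=
  ((T : ℝ) - h)⁻¹ • ∑ t ∈ Finset.Icc (1 : ℤ) (T - h),
    Matrix.vecMulVec ((W t).col i) ((W (t + h)).col j)

/-- `∑_{h=1}^{h₀} ∑_{i,j} Ω̂_{ij}(h) Ω̂_{ij}(h)ᵀ`. -/
def sampleM (T h₀ : ℕ) (W : ℤ → Matrix (Fin p) (Fin q) ℝ) : Matrix (Fin p) (Fin p) ℝ :=
  ∑ h ∈ Finset.Icc 1 h₀, ∑ i : Fin q, ∑ j : Fin q,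
    sampleOmega T h W i j * (sampleOmega T h W i j)ᵀ

/-- The estimated total signal `Ŝ_t = Â X_t + Q̂₁ Q̂₁ᵀ Ŵ_t Q̂₂ Q̂₂ᵀ`. -/
def signalEst (T : ℕ) (Y : ℤ → Matrix (Fin p) (Fin q) ℝ) (X : ℤ → Matrix (Fin m) (Fin q) ℝ)
    (Q₁ : Matrix (Fin p) (Fin k) ℝ) (Q₂ : Matrix (Fin q) (Fin r) ℝ) (t : ℤ) :
    Matrix (Fin p) (Fin q) ℝ :=
  lsEstimator T Y X * X t + Q₁ * Q₁ᵀ * residualEst T Y X t * Q₂ * Q₂ᵀ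

end Model

/-! ### Probability -/

section Prob

variable {Ω : Type*} [MeasurableSpace Ω] (μ : Measure Ω) {ι κ : Type*}

/-- The cross-covariance matrix of two random vectors. -/
def covMat (u : Ω → ι → ℝ) (v : Ω → κ → ℝ) : Matrix ι κ ℝ :=
  Matrix.of fun i j => cov[fun ω => u ω i, fun ω => v ω j; μ]

/-- `(T-h)⁻¹ ∑_{t=1}^{T-h} Cov(u_t, v_{t+h})`. -/
def avgLagCov (T h : ℕ) (u : ℤ → Ω → ι → ℝ) (v : ℤ → Ω → κ → ℝ) : Matrix ι κ ℝ :=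
  ((T : ℝ) - h)⁻¹ • ∑ t ∈ Finset.Icc (1 : ℤ) (T - h), covMat μ (u t) (v (t + h))

/-- `∑_{h=1}^{h₀} ∑_{i,j} Ω_{ij}(h) Ω_{ij}(h)ᵀ`, with `Ω_{ij}(h)` the averaged lag-`h`
cross-covariance matrix of the `i`-th and `j`-th columns of the matrix process `W`. -/
def popM {p q : ℕ} (T h₀ : ℕ) (W : ℤ → Ω → Matrix (Fin p) (Fin q) ℝ) :
    Matrix (Fin p) (Fin p) ℝ :=
  ∑ h ∈ Finset.Icc 1 h₀, ∑ i : Fin q, ∑ j : Fin q,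
    avgLagCov μ T h (fun t ω => (W t ω).col i) (fun t ω => (W t ω).col j) *
      (avgLagCov μ T h (fun t ω => (W t ω).col i) (fun t ω => (W t ω).col j))ᵀ

/-- The averaged lag-`h` autocovariance matrix of `vec(F_t)`. -/
def sigmaF {k r : ℕ} (T h : ℕ) (F : ℤ → Ω → Matrix (Fin k) (Fin r) ℝ) :
    Matrix (Fin r × Fin k) (Fin r × Fin k) ℝ :=
  avgLagCov μ T h (fun t ω => (F t ω).vec) (fun t ω => (F t ω).vec)

/-- `E(X Xᵀ)`. -/
def secondMoment {m q : ℕ} (X : Ω → Matrix (Fin m) (Fin q) ℝ) : Matrix (Fin m) (Fin m) ℝ :=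
  Matrix.of fun l l' => ∫ ω, (X ω * (X ω)ᵀ) l l' ∂μ

/-- The strong (`α`-)mixing coefficient at lag `k` of a two-sided sequence `Z`:
the supremum over `i`, over `A` in the σ-field of `(Z_t)_{t ≤ i}` and over `B` in the σ-field of
`(Z_t)_{t ≥ i + k}` of `|P(A) P(B) - P(A ∩ B)|`. -/
def alphaMix {β : Type*} [MeasurableSpace β] (Z : ℤ → Ω → β) (k : ℕ) : ℝ :=
  sSup {d : ℝ | ∃ (i : ℤ) (A B : Set Ω),
    MeasurableSet[⨆ t ∈ Set.Iic i, MeasurableSpace.comap (Z t) inferInstance] A ∧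
    MeasurableSet[⨆ t ∈ Set.Ici (i + k), MeasurableSpace.comap (Z t) inferInstance] B ∧
    d = |μ.real A * μ.real B - μ.real (A ∩ B)|}

/-- All entries of `U_1, …, U_T` have absolute moment of order `s` at most `K`. -/
def MomentBound {a b : ℕ} (T : ℕ) (U : ℤ → Ω → Matrix (Fin a) (Fin b) ℝ) (s K : ℝ) : Prop :=
  ∀ t ∈ Finset.Icc (1 : ℤ) T, ∀ i j,
    ∫⁻ ω, ENNReal.ofReal (|U t ω i j| ^ s) ∂μ ≤ ENNReal.ofReal K

/-- `U_1, …, U_T` have mean zero. -/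
def Centered {a b : ℕ} (T : ℕ) (U : ℤ → Ω → Matrix (Fin a) (Fin b) ℝ) : Prop :=
  ∀ t ∈ Finset.Icc (1 : ℤ) T, ∀ i j, ∫ ω, U t ω i j ∂μ = 0

/-- `vec(E_1), …, vec(E_T)` is white noise with mean `0` and covariance matrix `S`. -/
def IsWhiteNoise {p q : ℕ} (T : ℕ) (E : ℤ → Ω → Matrix (Fin p) (Fin q) ℝ)
    (S : Matrix (Fin q × Fin p) (Fin q × Fin p) ℝ) : Prop :=
  Centered μ T E ∧ ∀ s ∈ Finset.Icc (1 : ℤ) T, ∀ t ∈ Finset.Icc (1 : ℤ) T,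
    covMat μ (fun ω => (E s ω).vec) (fun ω => (E t ω).vec) = if s = t then S else 0

/-- The processes `U` and `V` are uncorrelated (at all leads and lags) on times `1, …, T`. -/
def Uncorrelated {a b c d : ℕ} (T : ℕ) (U : ℤ → Ω → Matrix (Fin a) (Fin b) ℝ)
    (V : ℤ → Ω → Matrix (Fin c) (Fin d) ℝ) : Prop :=
  ∀ s ∈ Finset.Icc (1 : ℤ) T, ∀ t ∈ Finset.Icc (1 : ℤ) T,
    covMat μ (fun ω => (U s ω).vec) (fun ω => (V t ω).vec) = 0

/-- `x_n = O_p(b_n)` (the events need not be measurable: `μ` of a set is its outer measure). -/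
def IsBigOp (x : ℕ → Ω → ℝ) (b : ℕ → ℝ) : Prop :=
  ∀ ε : ℝ, 0 < ε → ∃ K : ℝ, ∀ᶠ n in atTop,
    μ {ω | K * b n < |x n ω|} ≤ ENNReal.ofReal ε

end Prob

end MatFactor

end

set_option linter.unusedSectionVars false

/-! Put g = √(pq), let ν = p^((1-δ₁)/2) q^((1-δ₂)/2) be the order of the loadings of vec F, and let
ρ = g²/(ν²√T) = p^δ₁ q^δ₂ T^(-1/2), which tends to 0. Multiplied by g, the claimed rate reads 1 +
νρ. This is proved for the Frobenius norm, which dominates the spectral norm.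

With D = Â - A and estimated bases V, V' of the loading spaces, `norm_signal_error_le` splits the
error into three kinds of terms. The regression error D X_t has order g/√T, which is at most νρ
because ν ≤ g. The projection errors R - VVᵀR and C - V'V'ᵀC have relative order ρ and contribute
νρ. The last term is the noise Vᵀ E_t V' that survives both projections.

Loading spaces. At positive lags the population autocovariances contain no noise. They factor
through the loadings and have order ν², and mixing makes the sample autocovariances of Ŵ differ from
them by O_p(g²/√T) = O_p(ν²ρ). One lag with a nonvanishing factor autocovariance forces the top
eigenvalue of M₁ to be at least a constant times ν⁴, and the uniform positivity passes this on to
the k-th one; likewise for M₂. Since V = M̂VΛ⁻¹ and M̂ is close to a matrix of the form R G, the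
column space of R is nearly that of V (`norm_sub_proj_le`).

Surviving noise. For fixed V and V' it is O_p(1), because the noise covariance has bounded spectral
norm. The estimated bases, however, depend on E_t. Substituting V = M̂VΛ⁻¹ on both sides leaves
forms xᵀ E_t z, with x and z flattened sample autocovariances. Each of these is the sum of its
population value, of noise products from times well before t, of noise products from times well
after t, and of a remainder of order νg/√T. The remainder is so small that ‖E_t‖ = O_p(g) suffices
(`isBigOp_remainder`, `isBigOp_crude`). The past and the future stay at distance L ≈ g²/ν² from t.
Monotone summable coefficients satisfy α(L)^(1-2/γ) = O(1/L), so decoupling changes E‖xᵀ E_t z‖² by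
at most ‖x‖²‖z‖² α(L)^(1-2/γ) pq = O(‖x‖²‖z‖² ν²) (`integral_norm_sq_le_of_sided`, `isBigOp_sided`).
The factor ν lost in this way is compensated, since past and future noise moments are smaller than
the population value by the factor ρ. Altogether the forms are O_p(ν⁴(1 + νρ)), and the eigenvalue
bounds turn this into 1 + νρ.

Decoupling needs a covariance inequality for random vectors whose constant does not depend on the
dimension (`AlphaLe.abs_sum_cov_le`). An inner product is an average of products of randomly signed
sums. Davydov's scalar inequality applies to each sign pattern, and Khintchine's inequality controls
the γ-th moments on average. -/

namespace MatFactor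

/-! ### Rayleigh quotients and Weyl's inequality for symmetric operators. -/

section SymmetricOperators

variable {H : Type*} [NormedAddCommGroup H] [InnerProductSpace ℝ H] [FiniteDimensional ℝ H]
  {n : ℕ} (hn : Module.finrank ℝ H = n)

theorem norm_sq_eq_sum_eigenvectorBasis {S : H →ₗ[ℝ] H} (hS : S.IsSymmetric) (x : H) :
    ‖x‖ ^ 2 = ∑ i, inner ℝ (hS.eigenvectorBasis hn i) x ^ 2 := by
  rw [← (hS.eigenvectorBasis hn).sum_sq_norm_inner_right x]
  simp

theorem inner_apply_eq_sum_eigenvalues {S : H →ₗ[ℝ] H} (hS : S.IsSymmetric) (x : H) :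
    inner ℝ (S x) x = ∑ i, hS.eigenvalues hn i * inner ℝ (hS.eigenvectorBasis hn i) x ^ 2 := by
  rw [← (hS.eigenvectorBasis hn).sum_inner_mul_inner (S x) x]
  refine Finset.sum_congr rfl fun i _ => ?_
  rw [hS x, hS.apply_eigenvectorBasis, inner_smul_right,
    real_inner_comm x]
  simp only [RCLike.ofReal_real_eq_id, id_eq]
  ring

theorem inner_apply_le_of_eigenvalues_le {S : H →ₗ[ℝ] H} (hS : S.IsSymmetric) (x : H) {c : ℝ}
    (h : ∀ i, hS.eigenvalues hn i ≤ c ∨ inner ℝ (hS.eigenvectorBasis hn i) x = 0) :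
    inner ℝ (S x) x ≤ c * ‖x‖ ^ 2 := by
  rw [inner_apply_eq_sum_eigenvalues hn hS, norm_sq_eq_sum_eigenvectorBasis hn hS, Finset.mul_sum]
  refine Finset.sum_le_sum fun i _ => ?_
  rcases h i with h | h
  · exact mul_le_mul_of_nonneg_right h (sq_nonneg _)
  · simp [h]

theorem le_inner_apply_of_le_eigenvalues {S : H →ₗ[ℝ] H} (hS : S.IsSymmetric) (x : H) {c : ℝ}
    (h : ∀ i, c ≤ hS.eigenvalues hn i ∨ inner ℝ (hS.eigenvectorBasis hn i) x = 0) :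
    c * ‖x‖ ^ 2 ≤ inner ℝ (S x) x := by
  rw [inner_apply_eq_sum_eigenvalues hn hS, norm_sq_eq_sum_eigenvectorBasis hn hS, Finset.mul_sum]
  refine Finset.sum_le_sum fun i _ => ?_
  rcases h i with h | h
  · exact mul_le_mul_of_nonneg_right h (sq_nonneg _)
  · simp [h]

/-- Monotonicity of the ordered eigenvalues (Weyl's inequality). -/
theorem eigenvalues_le_eigenvalues_add {S S' : H →ₗ[ℝ] H} (hS : S.IsSymmetric)
    (hS' : S'.IsSymmetric) {c : ℝ}
    (h : ∀ x, inner ℝ (S x) x ≤ inner ℝ (S' x) x + c * ‖x‖ ^ 2) (j : Fin n) :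
    hS.eigenvalues hn j ≤ hS'.eigenvalues hn j + c := by
  -- The j-th coordinate of φ is identically zero, so φ is not surjective and, by equality of
  -- dimensions, not injective. A kernel vector is spanned by eigenvectors of S with index at most j
  -- and also by eigenvectors of S' with index at least j, so both Rayleigh quotients are controlled
  -- at it.
  let φ : H →ₗ[ℝ] (Fin n → ℝ) := LinearMap.pi fun i =>
    if j < i then (innerₛₗ ℝ (hS.eigenvectorBasis hn i))
    else if i < j then (innerₛₗ ℝ (hS'.eigenvectorBasis hn i)) else 0
  have hφ : ¬ Function.Injective φ := by
    intro hinj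
    have hsurj : Function.Surjective φ :=
      (LinearMap.injective_iff_surjective_of_finrank_eq_finrank (by simp [hn])).1 hinj
    obtain ⟨x, hx⟩ := hsurj (Pi.single j 1)
    have := congrFun hx j
    simp [φ] at this
  obtain ⟨x, hx, hx0⟩ : ∃ x, φ x = 0 ∧ x ≠ 0 := by
    by_contra hcon
    push Not at hcon
    exact hφ ((injective_iff_map_eq_zero φ).2 hcon)
  have h1 : hS.eigenvalues hn j * ‖x‖ ^ 2 ≤ inner ℝ (S x) x := by
    refine le_inner_apply_of_le_eigenvalues hn hS x fun i => ?_
    by_cases hi : j < i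
    · right
      have := congrFun hx i
      simpa [φ, hi] using this
    · left
      exact hS.eigenvalues_antitone hn (not_lt.1 hi)
  have h2 : inner ℝ (S' x) x ≤ hS'.eigenvalues hn j * ‖x‖ ^ 2 := by
    refine inner_apply_le_of_eigenvalues_le hn hS' x fun i => ?_
    by_cases hi : i < j
    · right
      have := congrFun hx i
      simpa [φ, hi, hi.not_gt] using this
    · left
      exact hS'.eigenvalues_antitone hn (not_lt.1 hi)
  have hpos : 0 < ‖x‖ ^ 2 := by positivity
  nlinarith [h x]

theorem singularValues_last_mul_norm_le {H' : Type*} [NormedAddCommGroup H']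
    [InnerProductSpace ℝ H'] [FiniteDimensional ℝ H'] (hn : Module.finrank ℝ H = n)
    (hpos : 0 < n) (S : H →ₗ[ℝ] H') (x : H) :
    S.singularValues (n - 1) ^ 2 * ‖x‖ ^ 2 ≤ ‖S x‖ ^ 2 := by
  rw [S.sq_singularValues_of_lt hn (Nat.sub_lt hpos one_pos), ← real_inner_self_eq_norm_sq (S x),
    ← LinearMap.adjoint_inner_left, ← LinearMap.comp_apply]
  refine le_inner_apply_of_le_eigenvalues hn S.isSymmetric_adjoint_comp_self x fun i => Or.inl ?_
  exact S.isSymmetric_adjoint_comp_self.eigenvalues_antitone hn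
    (Fin.le_def.2 (Nat.le_sub_one_of_lt i.2))

end SymmetricOperators

open scoped Matrix.Norms.Frobenius

/-! ### Frobenius and spectral norms, smallest singular values, ordered eigenvalues. -/

section Frobenius

variable {ι κ ν : Type*} [Fintype ι] [Fintype κ] [Fintype ν]

theorem frob_sq (M : Matrix ι κ ℝ) : ‖M‖ ^ 2 = ∑ i, ∑ j, M i j ^ 2 := by
  rw [Matrix.frobenius_norm_def, ← Real.sqrt_eq_rpow, Real.sq_sqrt (by positivity)]
  simp

theorem frob_mul_le (M : Matrix ι κ ℝ) (M' : Matrix κ ν ℝ) : ‖M * M'‖ ≤ ‖M‖ * ‖M'‖ :=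
  Matrix.frobenius_norm_mul M M'

theorem frob_transpose (M : Matrix ι κ ℝ) : ‖Mᵀ‖ = ‖M‖ := Matrix.frobenius_norm_transpose M

theorem frob_sq_eq_sum_col (M : Matrix ι κ ℝ) : ‖M‖ ^ 2 = ∑ j, ‖WithLp.toLp 2 (M.col j)‖ ^ 2 := by
  rw [frob_sq, Finset.sum_comm]
  refine Finset.sum_congr rfl fun j _ => ?_
  rw [EuclideanSpace.norm_sq_eq]
  simp

theorem frob_replicateCol (y : ι → ℝ) :
    ‖Matrix.replicateCol (Fin 1) y‖ = ‖WithLp.toLp 2 y‖ := by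
  rw [← pow_left_inj₀ (norm_nonneg _) (norm_nonneg _) two_ne_zero, frob_sq_eq_sum_col]
  simp
  rfl

theorem dotProduct_eq_inner (x y : ι → ℝ) :
    x ⬝ᵥ y = inner ℝ (WithLp.toLp 2 x) (WithLp.toLp 2 y) := by
  simp [PiLp.inner_apply, dotProduct, mul_comm]

theorem dotProduct_self_eq_norm_sq (x : ι → ℝ) : x ⬝ᵥ x = ‖WithLp.toLp 2 x‖ ^ 2 := by
  rw [dotProduct_eq_inner, real_inner_self_eq_norm_sq]

variable [DecidableEq ι] [DecidableEq κ]

theorem specNorm_nonneg (M : Matrix ι κ ℝ) : 0 ≤ specNorm M := by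
  unfold specNorm
  rw [Matrix.l2_opNorm_def]
  positivity

theorem norm_mulVec_le_specNorm (M : Matrix ι κ ℝ) (x : κ → ℝ) :
    ‖WithLp.toLp 2 (M *ᵥ x)‖ ≤ specNorm M * ‖WithLp.toLp 2 x‖ := by
  exact Matrix.l2_opNorm_mulVec M (WithLp.toLp 2 x)

theorem norm_mulVec_le_frob (M : Matrix ι κ ℝ) (x : κ → ℝ) :
    ‖WithLp.toLp 2 (M *ᵥ x)‖ ≤ ‖M‖ * ‖WithLp.toLp 2 x‖ := by
  have h := frob_mul_le M (Matrix.replicateCol (Fin 1) x)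
  rwa [← Matrix.replicateCol_mulVec, frob_replicateCol,
    frob_replicateCol] at h

theorem specNorm_le_frob (M : Matrix ι κ ℝ) : specNorm M ≤ ‖M‖ := by
  unfold specNorm
  rw [Matrix.l2_opNorm_def]
  exact ContinuousLinearMap.opNorm_le_bound _ (norm_nonneg _) fun x => norm_mulVec_le_frob M x.ofLp

/-- The columns are images of unit vectors. The loadings have a fixed number of columns, so for them
the two norms are interchangeable up to constants. -/
theorem frob_sq_le_specNorm (M : Matrix ι κ ℝ) : ‖M‖ ^ 2 ≤ Fintype.card κ * specNorm M ^ 2 := by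
  rw [frob_sq_eq_sum_col]
  calc _ ≤ ∑ j : κ, specNorm M ^ 2 := by
        refine Finset.sum_le_sum fun j _ => ?_
        have h := norm_mulVec_le_specNorm M (Pi.single j 1)
        have h1 : ‖WithLp.toLp 2 (Pi.single j (1 : ℝ) : κ → ℝ)‖ = 1 := by simp
        rw [h1, mul_one, Matrix.mulVec_single_one] at h
        exact pow_le_pow_left₀ (norm_nonneg _) h 2
    _ = _ := by simp

theorem dotProduct_mulVec_le_specNorm (M : Matrix ι ι ℝ) (x : ι → ℝ) :
    x ⬝ᵥ M *ᵥ x ≤ specNorm M * (x ⬝ᵥ x) := by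
  rw [dotProduct_eq_inner, dotProduct_self_eq_norm_sq]
  refine (real_inner_le_norm _ _).trans ?_
  nlinarith [norm_mulVec_le_specNorm M x, norm_nonneg (WithLp.toLp 2 x)]

theorem abs_dotProduct_mulVec_le_frob (M : Matrix ι ι ℝ) (x : ι → ℝ) :
    |x ⬝ᵥ M *ᵥ x| ≤ ‖M‖ * (x ⬝ᵥ x) := by
  rw [dotProduct_eq_inner, dotProduct_self_eq_norm_sq]
  refine (abs_real_inner_le_norm _ _).trans ?_
  nlinarith [norm_mulVec_le_frob M x, norm_nonneg (WithLp.toLp 2 x)]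

theorem eigDesc_of_lt {M : Matrix ι ι ℝ} (hM : M.IsHermitian) {j : ℕ} (hj : j < Fintype.card ι) :
    eigDesc M j = hM.eigenvalues₀ ⟨j, hj⟩ := by
  unfold eigDesc
  rw [dif_pos ⟨hM, hj⟩]

theorem dotProduct_mulVec_eq_inner_apply (M : Matrix ι ι ℝ) (x : ι → ℝ) :
    x ⬝ᵥ M *ᵥ x = inner ℝ (Matrix.toEuclideanLin M (WithLp.toLp 2 x)) (WithLp.toLp 2 x) := by
  rw [dotProduct_eq_inner, real_inner_comm]
  rfl

/-- Weyl's inequality, the Frobenius norm of the difference bounding its quadratic form. -/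
theorem eigDesc_sub_le {M M' : Matrix ι ι ℝ} (hM : M.IsHermitian) (hM' : M'.IsHermitian)
    {j : ℕ} (hj : j < Fintype.card ι) : eigDesc M j - ‖M' - M‖ ≤ eigDesc M' j := by
  rw [eigDesc_of_lt hM hj, eigDesc_of_lt hM' hj, sub_le_iff_le_add]
  refine eigenvalues_le_eigenvalues_add _ _ _ (fun x => ?_) _
  have h := abs_dotProduct_mulVec_le_frob (M' - M) x.ofLp
  rw [Matrix.sub_mulVec, dotProduct_sub, dotProduct_mulVec_eq_inner_apply,
    dotProduct_mulVec_eq_inner_apply, dotProduct_self_eq_norm_sq] at h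
  have := (abs_le.1 h).1
  simp only [WithLp.toLp_ofLp] at this
  linarith

theorem dotProduct_mulVec_le_eigDesc_zero {M : Matrix ι ι ℝ} (hM : M.IsHermitian) (x : ι → ℝ) :
    x ⬝ᵥ M *ᵥ x ≤ eigDesc M 0 * (x ⬝ᵥ x) := by
  rcases isEmpty_or_nonempty ι with h | h
  · simp
  rw [dotProduct_mulVec_eq_inner_apply, dotProduct_self_eq_norm_sq,
    eigDesc_of_lt hM Fintype.card_pos]
  refine inner_apply_le_of_eigenvalues_le finrank_euclideanSpace
    (Matrix.isSymmetric_toEuclideanLin_iff.mpr hM) _ fun i => Or.inl ?_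
  exact hM.eigenvalues₀_antitone (Nat.zero_le _)

theorem eigDesc_last_mul_le {M : Matrix ι ι ℝ} (hM : M.IsHermitian) (x : ι → ℝ) :
    eigDesc M (Fintype.card ι - 1) * (x ⬝ᵥ x) ≤ x ⬝ᵥ M *ᵥ x := by
  rcases isEmpty_or_nonempty ι with h | h
  · simp
  have hc : 0 < Fintype.card ι := Fintype.card_pos
  rw [dotProduct_mulVec_eq_inner_apply, dotProduct_self_eq_norm_sq,
    eigDesc_of_lt hM (Nat.sub_lt hc one_pos)]
  refine le_inner_apply_of_le_eigenvalues finrank_euclideanSpace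
    (Matrix.isSymmetric_toEuclideanLin_iff.mpr hM) _ fun i => Or.inl ?_
  refine hM.eigenvalues₀_antitone ?_
  have := i.2
  exact Fin.le_def.2 (by simp; omega)

theorem eigDesc_antitone {M : Matrix ι ι ℝ} (hM : M.IsHermitian) {i j : ℕ} (hij : i ≤ j)
    (hj : j < Fintype.card ι) : eigDesc M j ≤ eigDesc M i := by
  rw [eigDesc_of_lt hM hj, eigDesc_of_lt hM (hij.trans_lt hj)]
  exact hM.eigenvalues₀_antitone hij

/-- Indices count from 0, so `Fintype.card κ - 1` is the smallest singular value; for loadings with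
k columns it is σ_k. -/
theorem singVal_last_mul_norm_le (M : Matrix ι κ ℝ) (x : κ → ℝ) :
    singVal M (Fintype.card κ - 1) ^ 2 * (x ⬝ᵥ x) ≤ (M *ᵥ x) ⬝ᵥ (M *ᵥ x) := by
  rcases isEmpty_or_nonempty κ with h | h
  · simp [dotProduct_self_eq_norm_sq]
  rw [dotProduct_self_eq_norm_sq, dotProduct_self_eq_norm_sq]
  have hc : 0 < Fintype.card κ := Fintype.card_pos
  have key := singularValues_last_mul_norm_le (finrank_euclideanSpace (𝕜 := ℝ) (ι := κ)) hc
    (Matrix.toEuclideanLin M) (WithLp.toLp 2 x)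
  exact key

theorem singVal_nonneg (M : Matrix ι κ ℝ) (j : ℕ) : 0 ≤ singVal M j :=
  LinearMap.singularValues_nonneg _ _

theorem singVal_last_mul_frob_le (M : Matrix ι κ ℝ) (B : Matrix κ ν ℝ) :
    singVal M (Fintype.card κ - 1) * ‖B‖ ≤ ‖M * B‖ := by
  refine le_of_sq_le_sq ?_ (norm_nonneg _)
  rw [mul_pow, frob_sq_eq_sum_col, frob_sq_eq_sum_col, Finset.mul_sum]
  refine Finset.sum_le_sum fun j _ => ?_
  have := singVal_last_mul_norm_le M (B.col j)
  rw [dotProduct_self_eq_norm_sq, dotProduct_self_eq_norm_sq] at this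
  exact this

/-- Cauchy-Schwarz gives ‖MB‖² = ⟨B, MᵀMB⟩ ≤ ‖B‖ ‖MᵀMB‖, and ‖MB‖ is at least the smallest singular
value times ‖B‖. -/
theorem singVal_last_sq_mul_frob_le (M : Matrix ι κ ℝ) (B : Matrix κ ν ℝ) :
    singVal M (Fintype.card κ - 1) ^ 2 * ‖B‖ ≤ ‖Mᵀ * M * B‖ := by
  rcases (norm_nonneg B).eq_or_lt with h | h
  · rw [← h]; simp
  have h1 := singVal_last_mul_frob_le M B
  have h2 : ‖M * B‖ ^ 2 ≤ ‖B‖ * ‖Mᵀ * M * B‖ := by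
    have : ‖M * B‖ ^ 2 = ∑ j, inner ℝ (WithLp.toLp 2 (B.col j))
        (WithLp.toLp 2 ((Mᵀ * M * B).col j)) := by
      rw [frob_sq_eq_sum_col]
      refine Finset.sum_congr rfl fun j _ => ?_
      rw [← dotProduct_self_eq_norm_sq, ← dotProduct_eq_inner]
      have e1 : (M * B).col j = M *ᵥ B.col j := rfl
      have e2 : (Mᵀ * M * B).col j = Mᵀ *ᵥ (M *ᵥ B.col j) := by
        rw [Matrix.mulVec_mulVec]; rfl
      rw [e1, e2, Matrix.dotProduct_mulVec (B.col j), Matrix.vecMul_transpose]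
    rw [this]
    calc _ ≤ ∑ j, ‖WithLp.toLp 2 (B.col j)‖ * ‖WithLp.toLp 2 ((Mᵀ * M * B).col j)‖ :=
          Finset.sum_le_sum fun j _ => real_inner_le_norm _ _
      _ ≤ √(∑ j, ‖WithLp.toLp 2 (B.col j)‖ ^ 2) *
            √(∑ j, ‖WithLp.toLp 2 ((Mᵀ * M * B).col j)‖ ^ 2) :=
          Real.sum_mul_le_sqrt_mul_sqrt _ _ _
      _ = _ := by
          rw [← frob_sq_eq_sum_col, ← frob_sq_eq_sum_col, Real.sqrt_sq (norm_nonneg _),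
            Real.sqrt_sq (norm_nonneg _)]
  have h3 : (singVal M (Fintype.card κ - 1) * ‖B‖) ^ 2 ≤ ‖M * B‖ ^ 2 :=
    pow_le_pow_left₀ (mul_nonneg (singVal_nonneg _ _) (norm_nonneg _)) h1 2
  have h4 : ‖B‖ * (singVal M (Fintype.card κ - 1) ^ 2 * ‖B‖) ≤ ‖B‖ * ‖Mᵀ * M * B‖ := by
    nlinarith
  exact le_of_mul_le_mul_left h4 h

end Frobenius

/-! ### Perturbation of the space of leading eigenvectors. -/

section TopEigenvectors

variable {ι : Type*} [Fintype ι] [DecidableEq ι] {d : ℕ}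

theorem frob_sq_of_orthonormal {Q : Matrix ι (Fin d) ℝ} (hQ : Qᵀ * Q = 1) : ‖Q‖ ^ 2 = d := by
  have h : ∀ j, ∑ i, Q i j ^ 2 = 1 := fun j => by
    have := congrFun (congrFun hQ j) j
    simpa [Matrix.mul_apply, sq] using this
  rw [frob_sq, Finset.sum_comm]
  simp [h]

/-- The inverse of the matrix of the leading eigenvalues. -/
noncomputable def invTopEig (M : Matrix ι ι ℝ) (d : ℕ) : Matrix (Fin d) (Fin d) ℝ :=
  Matrix.diagonal fun i => (eigDesc M i)⁻¹

variable {M : Matrix ι ι ℝ} {Q : Matrix ι (Fin d) ℝ} {c : ℝ}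

/-- This transfers the structure of M to its eigenvectors: if M is nearly R G, then Q is nearly in
the column space of R. It takes the place of a spectral gap argument, and it is used again to expose
the surviving noise. -/
theorem IsTopEigvecs.eq_mul (hQ : IsTopEigvecs M Q) (hpos : ∀ i : Fin d, eigDesc M i ≠ 0) :
    Q = M * Q * invTopEig M d := by
  rw [hQ.2, Matrix.mul_assoc, invTopEig, Matrix.diagonal_mul_diagonal]
  simp [hpos]

theorem norm_invTopEig_le (hc : 0 < c) (h : ∀ i : Fin d, c ≤ eigDesc M i) :
    ‖invTopEig M d‖ ≤ √d / c := by
  refine le_of_sq_le_sq ?_ (by positivity)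
  rw [frob_sq, div_pow, Real.sq_sqrt (Nat.cast_nonneg _)]
  calc _ = ∑ i : Fin d, (eigDesc M i)⁻¹ ^ 2 := by
        refine Finset.sum_congr rfl fun i _ => ?_
        rw [Finset.sum_eq_single i]
        · simp [invTopEig]
        · intro j _ hj
          simp [invTopEig, Matrix.diagonal_apply_ne _ hj.symm]
        · simp
    _ ≤ ∑ i : Fin d, (c ^ 2)⁻¹ := by
        refine Finset.sum_le_sum fun i _ => ?_
        rw [inv_pow]
        have := h i
        gcongr
    _ = _ := by simp [div_eq_mul_inv]

theorem le_eigDesc_of_le_last (hM : M.IsHermitian) (hd : d ≤ Fintype.card ι)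
    (h : c ≤ eigDesc M (d - 1)) (i : Fin d) : c ≤ eigDesc M i :=
  h.trans (eigDesc_antitone hM (Nat.le_sub_one_of_lt i.2)
    (by have := i.2; omega))

/-- If `M` is close to a matrix with range in the column space of `R`, then the leading
eigenvectors of `M` nearly span the column space of `R`. -/
theorem norm_sub_proj_le {R : Matrix ι (Fin d) ℝ} {G : Matrix (Fin d) ι ℝ} {δ : ℝ}
    (hQ : IsTopEigvecs M Q) (hc : 0 < c) (h : ∀ i : Fin d, c ≤ eigDesc M i)
    (hδ : ‖M - R * G‖ ≤ δ) (hsmall : δ * (d / c) ≤ 1 / 2) :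
    ‖R - Q * Qᵀ * R‖ ≤ 2 * (1 + d) * (δ * (d / c)) * ‖R‖ := by
  set ε := δ * (d / c) with hε
  have hpos : ∀ i : Fin d, eigDesc M i ≠ 0 := fun i => (hc.trans_le (h i)).ne'
  -- The coefficients with Q ≈ R B, read off from Q = M Q Λ⁻¹ and M ≈ R G.
  set B : Matrix (Fin d) (Fin d) ℝ := G * Q * invTopEig M d with hB
  have hQn : ‖Q‖ = √d := by
    rw [← frob_sq_of_orthonormal hQ.1, Real.sqrt_sq (norm_nonneg _)]
  have hδ0 : 0 ≤ δ := (norm_nonneg _).trans hδ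
  have hE : ‖Q - R * B‖ ≤ ε := by
    have h1 : Q - R * B = (M - R * G) * Q * invTopEig M d := by
      rw [Matrix.sub_mul, Matrix.sub_mul, ← hQ.eq_mul hpos, hB]
      simp only [Matrix.mul_assoc]
    rw [h1]
    calc _ ≤ ‖M - R * G‖ * ‖Q‖ * ‖invTopEig M d‖ :=
          (frob_mul_le _ _).trans
            (mul_le_mul_of_nonneg_right (frob_mul_le _ _) (norm_nonneg _))
      _ ≤ δ * √d * (√d / c) := by
          rw [hQn]
          gcongr
          exact norm_invTopEig_le hc h
      _ = ε := by
          rw [hε]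
          have := Real.mul_self_sqrt (Nat.cast_nonneg (α := ℝ) d)
          field_simp
          nlinarith
  have hε0 : 0 ≤ ε := (norm_nonneg _).trans hE
  have hQv : ∀ y : Fin d → ℝ, ‖WithLp.toLp 2 (Q *ᵥ y)‖ = ‖WithLp.toLp 2 y‖ := fun y => by
    have : ‖WithLp.toLp 2 (Q *ᵥ y)‖ ^ 2 = ‖WithLp.toLp 2 y‖ ^ 2 := by
      rw [← dotProduct_self_eq_norm_sq, ← dotProduct_self_eq_norm_sq, Matrix.dotProduct_mulVec,
        ← Matrix.mulVec_transpose, Matrix.mulVec_mulVec, hQ.1, Matrix.one_mulVec]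
    exact (pow_left_inj₀ (norm_nonneg _) (norm_nonneg _) two_ne_zero).1 this
  -- Q is an isometry and ‖Q - RB‖ ≤ 1/2, so R B keeps at least half of every length. Hence B is
  -- invertible and ‖B⁻¹‖ ≤ 2‖R‖.
  have hRB : ∀ y : Fin d → ℝ, ‖WithLp.toLp 2 y‖ ≤ 2 * ‖WithLp.toLp 2 ((R * B) *ᵥ y)‖ := fun y => by
    have h1 := norm_mulVec_le_frob (Q - R * B) y
    have h2 : WithLp.toLp 2 (Q *ᵥ y) =
        WithLp.toLp 2 ((R * B) *ᵥ y) + WithLp.toLp 2 ((Q - R * B) *ᵥ y) := by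
      rw [Matrix.sub_mulVec, ← WithLp.toLp_add]
      congr 1
      abel
    have h3 := norm_add_le (WithLp.toLp 2 ((R * B) *ᵥ y)) (WithLp.toLp 2 ((Q - R * B) *ᵥ y))
    rw [← h2, hQv] at h3
    have h4 : ‖Q - R * B‖ * ‖WithLp.toLp 2 y‖ ≤ 1 / 2 * ‖WithLp.toLp 2 y‖ :=
      mul_le_mul_of_nonneg_right (hE.trans hsmall) (norm_nonneg _)
    linarith
  have hBinj : Function.Injective B.mulVec := by
    intro y z hyz
    have h1 := hRB (y - z)
    rw [← Matrix.mulVec_mulVec, Matrix.mulVec_sub, sub_eq_zero.2 hyz] at h1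
    simp only [Matrix.mulVec_zero, WithLp.toLp_zero, norm_zero, mul_zero, norm_le_zero_iff,
      WithLp.toLp_eq_zero] at h1
    exact sub_eq_zero.1 h1
  have hBu : IsUnit B := Matrix.mulVec_injective_iff_isUnit.1 hBinj
  have hBdet : IsUnit B.det := (Matrix.isUnit_iff_isUnit_det B).1 hBu
  set V : Matrix (Fin d) (Fin d) ℝ := B⁻¹ with hV
  have hRV : R * B * V = R := by
    rw [hV, Matrix.mul_assoc, Matrix.mul_nonsing_inv _ hBdet, Matrix.mul_one]
  have hVn : ‖V‖ ≤ 2 * ‖R‖ := by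
    refine le_of_sq_le_sq ?_ (by positivity)
    rw [mul_pow, frob_sq_eq_sum_col, frob_sq_eq_sum_col, Finset.mul_sum]
    refine Finset.sum_le_sum fun j _ => ?_
    have h1 := hRB (V.col j)
    have h2 : (R * B) *ᵥ V.col j = R.col j := by
      conv_rhs => rw [← hRV]
      rfl
    rw [h2] at h1
    calc _ ≤ (2 * ‖WithLp.toLp 2 (R.col j)‖) ^ 2 := pow_le_pow_left₀ (norm_nonneg _) h1 2
      _ = _ := by ring
  -- The projection 1 - QQᵀ kills Q and R = (RB)B⁻¹, so only (RB - Q)B⁻¹ is left.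
  have hkey : R - Q * Qᵀ * R = (R * B - Q) * V - Q * Qᵀ * ((R * B - Q) * V) := by
    have h1 : (R * B - Q) * V = R - Q * V := by rw [Matrix.sub_mul, hRV]
    rw [h1, Matrix.mul_sub]
    have h2 : Q * Qᵀ * (Q * V) = Q * V := by
      rw [Matrix.mul_assoc, ← Matrix.mul_assoc Qᵀ, hQ.1, Matrix.one_mul]
    rw [h2]
    abel
  have hX : ‖(R * B - Q) * V‖ ≤ ε * (2 * ‖R‖) := by
    refine (frob_mul_le _ _).trans ?_
    rw [norm_sub_rev]
    gcongr
  have hQQ : ‖Q * Qᵀ‖ ≤ d := by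
    refine (frob_mul_le _ _).trans ?_
    rw [frob_transpose, hQn, Real.mul_self_sqrt (Nat.cast_nonneg _)]
  rw [hkey]
  calc _ ≤ ‖(R * B - Q) * V‖ + ‖Q * Qᵀ‖ * ‖(R * B - Q) * V‖ :=
        (norm_sub_le _ _).trans (add_le_add le_rfl (frob_mul_le _ _))
    _ ≤ ε * (2 * ‖R‖) + d * (ε * (2 * ‖R‖)) := by gcongr
    _ = _ := by ring

end TopEigenvectors

end MatFactor

namespace MatFactor

/-! ### Calculus of O_p and of events with probability tending to one. -/

section BigOp

variable {Ω : Type*} [MeasurableSpace Ω] {μ : Measure Ω}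

/-- The events `P n` have probability tending to `1` (in the sense of outer measures). -/
def HoldsWhp (μ : Measure Ω) (P : ℕ → Ω → Prop) : Prop :=
  Tendsto (fun n => μ {ω | ¬ P n ω}) atTop (𝓝 0)

theorem HoldsWhp.mono {P P' : ℕ → Ω → Prop} (h : HoldsWhp μ P)
    (himp : ∀ᶠ n in atTop, ∀ ω, P n ω → P' n ω) : HoldsWhp μ P' := by
  refine tendsto_of_tendsto_of_tendsto_of_le_of_le' tendsto_const_nhds h
    (Eventually.of_forall fun n => zero_le) ?_
  filter_upwards [himp] with n hn
  exact measure_mono fun ω hω hP => hω (hn ω hP)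

theorem HoldsWhp.and {P P' : ℕ → Ω → Prop} (h : HoldsWhp μ P) (h' : HoldsWhp μ P') :
    HoldsWhp μ fun n ω => P n ω ∧ P' n ω := by
  have hs := h.add h'
  rw [add_zero] at hs
  refine tendsto_of_tendsto_of_tendsto_of_le_of_le tendsto_const_nhds hs
    (fun n => zero_le) fun n => ?_
  refine (measure_mono fun ω hω => ?_).trans (measure_union_le _ _)
  by_cases hP : P n ω
  · exact Or.inr fun h2 => hω ⟨hP, h2⟩
  · exact Or.inl hP

theorem HoldsWhp.of_eventually {P : ℕ → Ω → Prop} (h : ∀ᶠ n in atTop, ∀ ω, P n ω) :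
    HoldsWhp μ P := by
  refine tendsto_const_nhds.congr' ?_
  filter_upwards [h] with n hn
  simp [hn]

theorem IsBigOp.exists_pos {x : ℕ → Ω → ℝ} {b : ℕ → ℝ} (h : IsBigOp μ x b)
    (hb : ∀ᶠ n in atTop, 0 ≤ b n) {ε : ℝ} (hε : 0 < ε) :
    ∃ K : ℝ, 0 < K ∧ ∀ᶠ n in atTop, μ {ω | K * b n < |x n ω|} ≤ ENNReal.ofReal ε := by
  obtain ⟨K, hK⟩ := h ε hε
  refine ⟨max K 1, by positivity, ?_⟩
  filter_upwards [hK, hb] with n hn hbn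
  refine (measure_mono fun ω hω => ?_).trans hn
  exact lt_of_le_of_lt (mul_le_mul_of_nonneg_right (le_max_left _ _) hbn) hω

/-- The event on which the comparison fails eventually has probability below ε/2, which the
definition of O_p absorbs. -/
theorem IsBigOp.mono_whp {x y : ℕ → Ω → ℝ} {b : ℕ → ℝ} (h : IsBigOp μ y b)
    (hxy : HoldsWhp μ fun n ω => |x n ω| ≤ |y n ω|) : IsBigOp μ x b := by
  intro ε hε
  obtain ⟨K, hK⟩ := h (ε / 2) (half_pos hε)
  refine ⟨K, ?_⟩
  have h0 : (0 : ENNReal) < ENNReal.ofReal (ε / 2) := ENNReal.ofReal_pos.2 (half_pos hε)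
  filter_upwards [hK, hxy.eventually (gt_mem_nhds h0)] with n hn hn'
  calc _ ≤ μ ({ω | K * b n < |y n ω|} ∪ {ω | ¬ |x n ω| ≤ |y n ω|}) := by
        refine measure_mono fun ω hω => ?_
        by_cases h1 : |x n ω| ≤ |y n ω|
        · exact Or.inl (lt_of_lt_of_le hω h1)
        · exact Or.inr h1
    _ ≤ _ := measure_union_le _ _
    _ ≤ ENNReal.ofReal (ε / 2) + ENNReal.ofReal (ε / 2) := add_le_add hn hn'.le
    _ = _ := by rw [← ENNReal.ofReal_add (half_pos hε).le (half_pos hε).le, add_halves]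

theorem IsBigOp.mono {x y : ℕ → Ω → ℝ} {b : ℕ → ℝ} (h : IsBigOp μ y b)
    (hxy : ∀ᶠ n in atTop, ∀ ω, |x n ω| ≤ |y n ω|) : IsBigOp μ x b :=
  h.mono_whp (.of_eventually hxy)

theorem IsBigOp.rate_mono {x : ℕ → Ω → ℝ} {b b' : ℕ → ℝ} (h : IsBigOp μ x b) {C : ℝ}
    (hb : ∀ᶠ n in atTop, 0 ≤ b n) (hbb : ∀ᶠ n in atTop, b n ≤ C * b' n) : IsBigOp μ x b' := by
  intro ε hε
  obtain ⟨K, hK0, hK⟩ := h.exists_pos hb hε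
  refine ⟨K * C, ?_⟩
  filter_upwards [hK, hbb] with n hn hbn
  refine (measure_mono fun ω hω => ?_).trans hn
  have : K * b n ≤ K * C * b' n := by nlinarith
  exact lt_of_le_of_lt this hω

theorem IsBigOp.add {x y : ℕ → Ω → ℝ} {b b' : ℕ → ℝ} (hx : IsBigOp μ x b) (hy : IsBigOp μ y b')
    (hb : ∀ᶠ n in atTop, 0 ≤ b n) (hb' : ∀ᶠ n in atTop, 0 ≤ b' n) :
    IsBigOp μ (fun n ω => x n ω + y n ω) (fun n => b n + b' n) := by
  intro ε hε
  obtain ⟨K, hK0, hK⟩ := hx.exists_pos hb (half_pos hε)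
  obtain ⟨K', hK0', hK'⟩ := hy.exists_pos hb' (half_pos hε)
  refine ⟨K + K', ?_⟩
  filter_upwards [hK, hK', hb, hb'] with n hn hn' hbn hbn'
  calc _ ≤ μ ({ω | K * b n < |x n ω|} ∪ {ω | K' * b' n < |y n ω|}) := by
        refine measure_mono fun ω hω => ?_
        by_contra hcon
        simp only [Set.mem_union, Set.mem_ofPred_eq, not_or, not_lt] at hcon hω
        have := abs_add_le (x n ω) (y n ω)
        nlinarith
    _ ≤ _ := measure_union_le _ _
    _ ≤ ENNReal.ofReal (ε / 2) + ENNReal.ofReal (ε / 2) := add_le_add hn hn'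
    _ = _ := by rw [← ENNReal.ofReal_add (half_pos hε).le (half_pos hε).le, add_halves]

theorem IsBigOp.add_same {x y : ℕ → Ω → ℝ} {b : ℕ → ℝ} (hx : IsBigOp μ x b) (hy : IsBigOp μ y b)
    (hb : ∀ᶠ n in atTop, 0 ≤ b n) : IsBigOp μ (fun n ω => x n ω + y n ω) b :=
  (hx.add hy hb hb).rate_mono (C := 2) (hb.mono fun n hn => by positivity)
    (Eventually.of_forall fun n => by linarith)

theorem IsBigOp.mul {x y : ℕ → Ω → ℝ} {b b' : ℕ → ℝ} (hx : IsBigOp μ x b) (hy : IsBigOp μ y b')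
    (hb : ∀ᶠ n in atTop, 0 ≤ b n) (hb' : ∀ᶠ n in atTop, 0 ≤ b' n) :
    IsBigOp μ (fun n ω => x n ω * y n ω) (fun n => b n * b' n) := by
  intro ε hε
  obtain ⟨K, hK0, hK⟩ := hx.exists_pos hb (half_pos hε)
  obtain ⟨K', hK0', hK'⟩ := hy.exists_pos hb' (half_pos hε)
  refine ⟨K * K', ?_⟩
  filter_upwards [hK, hK', hb, hb'] with n hn hn' hbn hbn'
  calc _ ≤ μ ({ω | K * b n < |x n ω|} ∪ {ω | K' * b' n < |y n ω|}) := by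
        refine measure_mono fun ω hω => ?_
        by_contra hcon
        simp only [Set.mem_union, Set.mem_ofPred_eq, not_or, not_lt, abs_mul] at hcon hω
        have := mul_le_mul hcon.1 hcon.2 (abs_nonneg _) (by positivity)
        nlinarith
    _ ≤ _ := measure_union_le _ _
    _ ≤ ENNReal.ofReal (ε / 2) + ENNReal.ofReal (ε / 2) := add_le_add hn hn'
    _ = _ := by rw [← ENNReal.ofReal_add (half_pos hε).le (half_pos hε).le, add_halves]

theorem IsBigOp.of_le {x : ℕ → Ω → ℝ} {b : ℕ → ℝ} {C : ℝ}
    (h : ∀ᶠ n in atTop, ∀ ω, |x n ω| ≤ C * b n) : IsBigOp μ x b := by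
  intro ε _
  refine ⟨C, ?_⟩
  filter_upwards [h] with n hn
  have : {ω | C * b n < |x n ω|} = ∅ := Set.eq_empty_of_forall_notMem fun ω hω =>
    (hn ω).not_gt hω
  simp [this]

theorem IsBigOp.const_mul {x : ℕ → Ω → ℝ} {b : ℕ → ℝ} (h : IsBigOp μ x b) (C : ℝ)
    (hb : ∀ᶠ n in atTop, 0 ≤ b n) : IsBigOp μ (fun n ω => C * x n ω) b := by
  have h1 : IsBigOp μ (fun (_ : ℕ) (_ : Ω) => C) fun _ => 1 :=
    IsBigOp.of_le (C := |C|) (Eventually.of_forall fun _ _ => by simp)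
  simpa using h1.mul h (Eventually.of_forall fun _ => zero_le_one) hb

theorem IsBigOp.sum {ι : Type*} (s : Finset ι) {x : ι → ℕ → Ω → ℝ} {b : ℕ → ℝ}
    (h : ∀ i ∈ s, IsBigOp μ (x i) b) (hb : ∀ᶠ n in atTop, 0 ≤ b n) :
    IsBigOp μ (fun n ω => ∑ i ∈ s, x i n ω) b := by
  classical
  induction s using Finset.induction_on with
  | empty =>
    refine IsBigOp.of_le (C := 0) (Eventually.of_forall fun n ω => ?_)
    simp
  | insert i s hi ih =>
    simp only [Finset.sum_insert hi]
    exact (h i (Finset.mem_insert_self _ _)).add_same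
      (ih fun j hj => h j (Finset.mem_insert_of_mem hj)) hb

theorem IsBigOp.holdsWhp {x : ℕ → Ω → ℝ} {b : ℕ → ℝ} (h : IsBigOp μ x b)
    (hb : Tendsto b atTop (𝓝 0)) {c : ℝ} (hc : 0 < c) : HoldsWhp μ fun n ω => |x n ω| ≤ c := by
  rw [HoldsWhp, ENNReal.tendsto_nhds_zero]
  intro ε hε
  obtain ⟨δ, hδ, hδε⟩ : ∃ δ : ℝ, 0 < δ ∧ ENNReal.ofReal δ ≤ ε := by
    rcases eq_or_ne ε ⊤ with rfl | hne
    · exact ⟨1, one_pos, le_top⟩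
    · exact ⟨ε.toReal, ENNReal.toReal_pos hε.ne' hne, by rw [ENNReal.ofReal_toReal hne]⟩
  obtain ⟨K, hK⟩ := h δ hδ
  have h0 : Tendsto (fun n => K * b n) atTop (𝓝 0) := by simpa using hb.const_mul K
  filter_upwards [hK, h0.eventually (gt_mem_nhds hc)] with n hn hn'
  refine (measure_mono fun ω hω => ?_).trans (hn.trans hδε)
  exact hn'.trans (not_le.1 hω)

/-- A bound on the truncated second moment on an event of large probability suffices. -/
theorem IsBigOp.of_integral_sq {x : ℕ → Ω → ℝ} {b : ℕ → ℝ} {C : ℝ}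
    (hb : ∀ᶠ n in atTop, 0 < b n)
    (h : ∀ᶠ n in atTop, Integrable (fun ω => x n ω ^ 2) μ ∧ ∫ ω, x n ω ^ 2 ∂μ ≤ C * b n ^ 2) :
    IsBigOp μ x b := by
  intro ε hε
  -- Then |C| ≤ ε K², so the Chebyshev bound C/K² is at most ε; the added 1 keeps K positive.
  set K := √(|C| / ε) + 1 with hK
  have hKpos : 0 < K := by positivity
  refine ⟨K, ?_⟩
  filter_upwards [hb, h] with n hbn hn
  have h1 := mul_meas_ge_le_integral_of_nonneg
    (Eventually.of_forall fun ω => sq_nonneg (x n ω)) hn.1 ((K * b n) ^ 2)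
  have hsub : {ω | K * b n < |x n ω|} ⊆ {ω | (K * b n) ^ 2 ≤ x n ω ^ 2} := fun ω hω => by
    rw [Set.mem_ofPred_eq, ← sq_abs (x n ω)]
    exact pow_le_pow_left₀ (by positivity) (le_of_lt hω) 2
  have hKε : |C| ≤ ε * K ^ 2 := by
    have h2 : |C| / ε ≤ K ^ 2 := by
      have := Real.sq_sqrt (show 0 ≤ |C| / ε by positivity)
      nlinarith [Real.sqrt_nonneg (|C| / ε)]
    rw [div_le_iff₀ hε] at h2
    linarith
  have hpos : 0 < (K * b n) ^ 2 := by positivity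
  have hfin : μ {ω | (K * b n) ^ 2 ≤ x n ω ^ 2} ≠ ⊤ := (hn.1.measure_ge_lt_top hpos).ne
  have h3 : μ.real {ω | (K * b n) ^ 2 ≤ x n ω ^ 2} ≤ ε := by
    have h4 : (K * b n) ^ 2 * μ.real {ω | (K * b n) ^ 2 ≤ x n ω ^ 2} ≤ (K * b n) ^ 2 * ε := by
      refine (h1.trans hn.2).trans ?_
      have := mul_le_mul_of_nonneg_right ((le_abs_self C).trans hKε) (sq_nonneg (b n))
      nlinarith
    exact le_of_mul_le_mul_left h4 hpos
  calc _ ≤ μ {ω | (K * b n) ^ 2 ≤ x n ω ^ 2} := measure_mono hsub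
    _ = ENNReal.ofReal (μ.real {ω | (K * b n) ^ 2 ≤ x n ω ^ 2}) := by
        rw [Measure.real, ENNReal.ofReal_toReal hfin]
    _ ≤ _ := ENNReal.ofReal_le_ofReal h3

end BigOp

end MatFactor

namespace MatFactor

/-! ### Davydov's covariance inequality for α-mixing σ-fields. -/

section Davydov

variable {Ω : Type*} {m m₁ m₂ m₁' m₂' : MeasurableSpace Ω} {m₀ : MeasurableSpace Ω}
  {μ : Measure Ω}

/-- The strong mixing coefficient of two σ-fields is at most `a`. -/
def AlphaLe {Ω : Type*} (m₁ m₂ : MeasurableSpace Ω) {m₀ : MeasurableSpace Ω} (μ : Measure Ω)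
    (a : ℝ) : Prop :=
  ∀ A B : Set Ω, MeasurableSet[m₁] A → MeasurableSet[m₂] B →
    |μ.real A * μ.real B - μ.real (A ∩ B)| ≤ a

theorem AlphaLe.symm {a : ℝ} (h : AlphaLe m₁ m₂ μ a) :
    AlphaLe m₂ m₁ μ a := fun A B hA hB => by
  rw [mul_comm, Set.inter_comm]
  exact h B A hB hA

theorem AlphaLe.nonneg {a : ℝ} (h : AlphaLe m₁ m₂ μ a) : 0 ≤ a :=
  (abs_nonneg _).trans (h ∅ ∅ (@MeasurableSet.empty _ m₁) (@MeasurableSet.empty _ m₂))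

theorem AlphaLe.mono {a a' : ℝ} (h : AlphaLe m₁ m₂ μ a)
    (h₁ : m₁' ≤ m₁) (h₂ : m₂' ≤ m₂) (ha : a ≤ a') : AlphaLe m₁' m₂' μ a' :=
  fun A B hA hB => (h A B (h₁ A hA) (h₂ B hB)).trans ha

variable [IsProbabilityMeasure μ]

/-- The `±1`-valued function of a set. -/
noncomputable def signOn (A : Set Ω) : Ω → ℝ := fun ω => 2 * A.indicator (fun _ => (1 : ℝ)) ω - 1

theorem abs_signOn_le (A : Set Ω) (ω : Ω) : |signOn A ω| ≤ 1 := by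
  by_cases h : ω ∈ A <;> norm_num [signOn, h]

theorem measurable_signOn {A : Set Ω} (hA : MeasurableSet[m] A) :
    Measurable[m] (signOn A) :=
  ((measurable_const.indicator hA).const_mul 2).sub_const 1

theorem integrable_of_abs_le {f : Ω → ℝ} (hf : Measurable f) {c : ℝ} (h : ∀ ω, |f ω| ≤ c) :
    Integrable f μ :=
  Integrable.of_bound hf.aestronglyMeasurable c (Eventually.of_forall h)

/-- Let g be the conditional expectation of the centred η given m. The covariance is E(ξg), at most
c E|g| in absolute value, and |g| = sign(g) g with an m-measurable sign. -/
theorem exists_cov_le_cov_signOn (hm : m ≤ m₀) {ξ η : Ω → ℝ} {c : ℝ}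
    (hξ : Measurable[m] ξ) (hξc : ∀ ω, |ξ ω| ≤ c) (hη : Integrable η μ) :
    ∃ A, MeasurableSet[m] A ∧ |∫ ω, ξ ω * η ω ∂μ - (∫ ω, ξ ω ∂μ) * ∫ ω, η ω ∂μ| ≤
      c * (∫ ω, signOn A ω * η ω ∂μ - (∫ ω, signOn A ω ∂μ) * ∫ ω, η ω ∂μ) := by
  set e := ∫ ω, η ω ∂μ
  set η' : Ω → ℝ := fun ω => η ω - e with hη'
  have hη'i : Integrable η' μ := hη.sub (integrable_const _)
  set g : Ω → ℝ := μ[η' | m] with hg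
  have hgi : Integrable g μ := integrable_condExp
  have hgm : Measurable[m] g := stronglyMeasurable_condExp.measurable
  have hpull : ∀ {f : Ω → ℝ} {C : ℝ}, Measurable[m] f → (∀ ω, |f ω| ≤ C) →
      ∫ ω, f ω * η ω ∂μ - (∫ ω, f ω ∂μ) * e = ∫ ω, f ω * g ω ∂μ := by
    intro f C hf hC
    have hfi : Integrable f μ := integrable_of_abs_le (hf.mono hm le_rfl) hC
    have h1 : Integrable (fun ω => f ω * η ω) μ :=
      hη.bdd_mul (hf.mono hm le_rfl).aestronglyMeasurable (Eventually.of_forall hC)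
    have h2 : Integrable (fun ω => f ω * η' ω) μ :=
      hη'i.bdd_mul (hf.mono hm le_rfl).aestronglyMeasurable (Eventually.of_forall hC)
    have h3 : μ[fun ω => f ω * η' ω | m] =ᵐ[μ] fun ω => f ω * g ω :=
      condExp_mul_of_stronglyMeasurable_left hf.stronglyMeasurable h2 hη'i
    calc _ = ∫ ω, f ω * η' ω ∂μ := by
          rw [← integral_mul_const, ← integral_sub h1 (hfi.mul_const _)]
          congr 1 with ω
          simp only [hη']
          ring
      _ = ∫ ω, (μ[fun ω => f ω * η' ω | m]) ω ∂μ := (integral_condExp hm).symm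
      _ = _ := integral_congr_ae h3
  refine ⟨{ω | 0 ≤ g ω}, measurableSet_le measurable_const hgm, ?_⟩
  have hA : MeasurableSet[m] {ω | 0 ≤ g ω} := measurableSet_le measurable_const hgm
  rw [hpull hξ hξc, hpull (measurable_signOn hA) (abs_signOn_le _), ← integral_const_mul]
  refine abs_integral_le_integral_abs.trans (integral_mono_of_nonneg
    (Eventually.of_forall fun ω => abs_nonneg _) ?_ (Eventually.of_forall fun ω => ?_))
  · exact (hgi.bdd_mul ((measurable_signOn hA).mono hm le_rfl).aestronglyMeasurable
      (Eventually.of_forall (abs_signOn_le _))).const_mul c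
  · have hs : signOn {ω | 0 ≤ g ω} ω * g ω = |g ω| := by
      by_cases h : 0 ≤ g ω
      · simp [signOn, h, abs_of_nonneg h]; ring
      · simp [signOn, h, abs_of_neg (not_le.1 h)]
    simp only [abs_mul, hs]
    exact mul_le_mul_of_nonneg_right (hξc ω) (abs_nonneg _)

theorem cov_signOn_signOn {A B : Set Ω} (hA : MeasurableSet A) (hB : MeasurableSet B) :
    ∫ ω, signOn A ω * signOn B ω ∂μ - (∫ ω, signOn A ω ∂μ) * ∫ ω, signOn B ω ∂μ =
      4 * (μ.real (A ∩ B) - μ.real A * μ.real B) := by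
  have hi : ∀ {C : Set Ω}, MeasurableSet C → Integrable (C.indicator fun _ => (1 : ℝ)) μ :=
    fun hC => (integrable_const _).indicator hC
  have h1 : ∀ {C : Set Ω}, MeasurableSet C → ∫ ω, signOn C ω ∂μ = 2 * μ.real C - 1 := fun hC => by
    simp only [signOn]
    rw [integral_sub ((hi hC).const_mul 2) (integrable_const _), integral_const_mul,
      integral_indicator_const _ hC]
    simp
  have h2 : ∀ ω, signOn A ω * signOn B ω =
      4 * (A ∩ B).indicator (fun _ => (1 : ℝ)) ω - 2 * A.indicator (fun _ => (1 : ℝ)) ω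
        - 2 * B.indicator (fun _ => (1 : ℝ)) ω + 1 := fun ω => by
    by_cases ha : ω ∈ A <;> by_cases hb : ω ∈ B <;> simp [signOn, ha, hb] <;> norm_num
  simp only [h2]
  rw [integral_add, integral_sub, integral_sub, integral_const_mul, integral_const_mul,
    integral_const_mul, integral_indicator_const _ hA, integral_indicator_const _ hB,
    integral_indicator_const _ (hA.inter hB), h1 hA, h1 hB]
  · simp; ring
  · exact (hi (hA.inter hB)).const_mul 4
  · exact (hi hA).const_mul 2
  · exact ((hi (hA.inter hB)).const_mul 4).sub ((hi hA).const_mul 2)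
  · exact (hi hB).const_mul 2
  · exact (((hi (hA.inter hB)).const_mul 4).sub ((hi hA).const_mul 2)).sub ((hi hB).const_mul 2)
  · exact integrable_const _

/-- The covariance inequality for bounded functions of `α`-mixing σ-fields. -/
theorem AlphaLe.abs_cov_le_of_bounded {a : ℝ}
    (h : AlphaLe m₁ m₂ μ a) (hm₁ : m₁ ≤ m₀) (hm₂ : m₂ ≤ m₀) {ξ η : Ω → ℝ} {c : ℝ} (hc : 0 ≤ c)
    (hξ : Measurable[m₁] ξ) (hη : Measurable[m₂] η) (hξc : ∀ ω, |ξ ω| ≤ c)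
    (hηc : ∀ ω, |η ω| ≤ c) :
    |∫ ω, ξ ω * η ω ∂μ - (∫ ω, ξ ω ∂μ) * ∫ ω, η ω ∂μ| ≤ 4 * a * c ^ 2 := by
  have hηi : Integrable η μ := integrable_of_abs_le (hη.mono hm₂ le_rfl) hηc
  -- Both variables are replaced in turn by signs, each time at the cost of a factor c. The
  -- covariance of two signs is four times a mixing defect.
  obtain ⟨A, hA, h1⟩ := exists_cov_le_cov_signOn hm₁ hξ hξc hηi
  have hui : Integrable (signOn A) μ :=
    integrable_of_abs_le ((measurable_signOn hA).mono hm₁ le_rfl) (abs_signOn_le A)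
  obtain ⟨B, hB, h2⟩ := exists_cov_le_cov_signOn hm₂ hη hηc hui
  have h3 : ∫ ω, signOn A ω * η ω ∂μ - (∫ ω, signOn A ω ∂μ) * ∫ ω, η ω ∂μ ≤
      c * (∫ ω, signOn B ω * signOn A ω ∂μ - (∫ ω, signOn B ω ∂μ) * ∫ ω, signOn A ω ∂μ) := by
    refine le_trans ?_ ((le_abs_self _).trans h2)
    rw [mul_comm (∫ ω, signOn A ω ∂μ)]
    simp only [mul_comm (signOn A _)]
    exact le_rfl
  rw [cov_signOn_signOn (hm₂ _ hB) (hm₁ _ hA)] at h3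
  have h4 := h A B hA hB
  rw [abs_sub_comm, Set.inter_comm, mul_comm (μ.real A)] at h4
  have h5 := (le_abs_self _).trans h4
  calc _ ≤ c * (c * (4 * a)) := h1.trans (mul_le_mul_of_nonneg_left
        (h3.trans (mul_le_mul_of_nonneg_left (by linarith) hc)) hc)
    _ = _ := by ring

/-- Truncation at level `c`. -/
noncomputable def truncAt (c x : ℝ) : ℝ := if |x| ≤ c then x else 0

theorem abs_truncAt_le {c : ℝ} (hc : 0 ≤ c) (x : ℝ) : |truncAt c x| ≤ c := by
  unfold truncAt; split_ifs with h
  · exact h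
  · simpa using hc

theorem measurable_truncAt (c : ℝ) : Measurable (truncAt c) :=
  Measurable.ite (measurableSet_le measurable_norm measurable_const) measurable_id measurable_const

/-- If both variables are within the level, nothing changes. Otherwise the larger modulus M exceeds
c, and |xy| ≤ M² = M^(2-γ) M^γ ≤ c^(2-γ) M^γ. -/
theorem abs_mul_sub_truncAt_le {c γ : ℝ} (hc : 0 < c) (hγ : 2 ≤ γ) (x y : ℝ) :
    |x * y - truncAt c x * truncAt c y| ≤ c ^ (2 - γ) * (|x| ^ γ + |y| ^ γ) := by
  have hr : 0 ≤ c ^ (2 - γ) * (|x| ^ γ + |y| ^ γ) := by positivity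
  have key : ∀ M, c < M → M ^ 2 ≤ c ^ (2 - γ) * M ^ γ := fun M hM => by
    have hM0 : 0 < M := hc.trans hM
    have h1 : M ^ (2 - γ) ≤ c ^ (2 - γ) :=
      Real.rpow_le_rpow_of_nonpos hc hM.le (by linarith)
    calc M ^ 2 = M ^ (2 - γ) * M ^ γ := by
          rw [← Real.rpow_add hM0, sub_add_cancel, Real.rpow_two]
      _ ≤ _ := by gcongr
  have big : c < max |x| |y| → |x * y| ≤ c ^ (2 - γ) * (|x| ^ γ + |y| ^ γ) := fun h => by
    have h1 := key _ h
    have h2 : |x * y| ≤ max |x| |y| ^ 2 := by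
      rw [abs_mul, sq]
      exact mul_le_mul (le_max_left _ _) (le_max_right _ _) (abs_nonneg _)
        ((abs_nonneg _).trans (le_max_left _ _))
    have h3 : max |x| |y| ^ γ ≤ |x| ^ γ + |y| ^ γ := by
      rcases max_choice |x| |y| with h | h <;> rw [h]
      · linarith [Real.rpow_nonneg (abs_nonneg y) γ]
      · linarith [Real.rpow_nonneg (abs_nonneg x) γ]
    exact (h2.trans h1).trans (mul_le_mul_of_nonneg_left h3 (by positivity))
  unfold truncAt
  split_ifs with h1 h2 h2
  · simpa using hr
  · simpa using big (lt_max_of_lt_right (not_le.1 h2))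
  · simpa using big (lt_max_of_lt_left (not_le.1 h1))
  · simpa using big (lt_max_of_lt_left (not_le.1 h1))

theorem integrable_of_rpow {γ : ℝ} (hγ : 1 ≤ γ) {ξ : Ω → ℝ} (hξ : Measurable ξ)
    (h : Integrable (fun ω => |ξ ω| ^ γ) μ) : Integrable ξ μ := by
  refine Integrable.mono' (h.add (integrable_const 1)) hξ.aestronglyMeasurable
    (Eventually.of_forall fun ω => ?_)
  rw [Real.norm_eq_abs]
  rcases le_total |ξ ω| 1 with h1 | h1
  · have := Real.rpow_nonneg (abs_nonneg (ξ ω)) γ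
    simp only [Pi.add_apply]; linarith
  · have := Real.rpow_le_rpow_of_exponent_le h1 hγ
    rw [Real.rpow_one] at this
    simp only [Pi.add_apply]; linarith

theorem integrable_mul_of_rpow {γ : ℝ} (hγ : 2 ≤ γ) {ξ η : Ω → ℝ} (hξ : Measurable ξ)
    (hη : Measurable η) (h : Integrable (fun ω => |ξ ω| ^ γ) μ)
    (h' : Integrable (fun ω => |η ω| ^ γ) μ) : Integrable (fun ω => ξ ω * η ω) μ := by
  refine Integrable.mono' ((h.add h').add (integrable_const 1)) (hξ.mul hη).aestronglyMeasurable
    (Eventually.of_forall fun ω => ?_)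
  have h1 := abs_mul_sub_truncAt_le one_pos hγ (ξ ω) (η ω)
  have h2 : |truncAt 1 (ξ ω) * truncAt 1 (η ω)| ≤ 1 := by
    rw [abs_mul]
    exact mul_le_one₀ (abs_truncAt_le zero_le_one _) (abs_nonneg _) (abs_truncAt_le zero_le_one _)
  rw [Real.one_rpow, one_mul] at h1
  simp only [Pi.add_apply, Real.norm_eq_abs]
  have h3 := abs_sub_abs_le_abs_sub (ξ ω * η ω) (truncAt 1 (ξ ω) * truncAt 1 (η ω))
  linarith

/-- An additive form of Davydov's covariance inequality. -/
theorem AlphaLe.abs_cov_le_add {a : ℝ}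
    (h : AlphaLe m₁ m₂ μ a) (hm₁ : m₁ ≤ m₀) (hm₂ : m₂ ≤ m₀) {γ : ℝ} (hγ : 2 ≤ γ) {ξ η : Ω → ℝ}
    (hξ : Measurable[m₁] ξ) (hη : Measurable[m₂] η)
    (hξi : Integrable (fun ω => |ξ ω| ^ γ) μ) (hηi : Integrable (fun ω => |η ω| ^ γ) μ)
    {c : ℝ} (hc : 0 < c) :
    |∫ ω, ξ ω * η ω ∂μ - (∫ ω, ξ ω ∂μ) * ∫ ω, η ω ∂μ| ≤
      4 * a * c ^ 2 + 2 * c ^ (2 - γ) * (∫ ω, |ξ ω| ^ γ ∂μ + ∫ ω, |η ω| ^ γ ∂μ) := by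
  have hξm := hξ.mono hm₁ le_rfl
  have hηm := hη.mono hm₂ le_rfl
  have iξ : Integrable ξ μ := integrable_of_rpow (by linarith) hξm hξi
  have iη : Integrable η μ := integrable_of_rpow (by linarith) hηm hηi
  have iξη := integrable_mul_of_rpow hγ hξm hηm hξi hηi
  set ξ' : Ω → ℝ := fun ω => truncAt c (ξ ω) with hξ'
  set η' : Ω → ℝ := fun ω => truncAt c (η ω) with hη'
  have mξ' : Measurable[m₁] ξ' := (measurable_truncAt c).comp hξ
  have mη' : Measurable[m₂] η' := (measurable_truncAt c).comp hη
  have bξ' : ∀ ω, |ξ' ω| ≤ c := fun ω => abs_truncAt_le hc.le _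
  have bη' : ∀ ω, |η' ω| ≤ c := fun ω => abs_truncAt_le hc.le _
  have iξ' : Integrable ξ' μ := integrable_of_abs_le (mξ'.mono hm₁ le_rfl) bξ'
  have iη' : Integrable η' μ := integrable_of_abs_le (mη'.mono hm₂ le_rfl) bη'
  have iξη' : Integrable (fun ω => ξ' ω * η' ω) μ :=
    iη'.bdd_mul (mξ'.mono hm₁ le_rfl).aestronglyMeasurable (Eventually.of_forall bξ')
  have h0 := h.abs_cov_le_of_bounded hm₁ hm₂ hc.le mξ' mη' bξ' bη'
  have h1 : |∫ ω, ξ ω * η ω ∂μ - ∫ ω, ξ' ω * η' ω ∂μ| ≤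
      c ^ (2 - γ) * (∫ ω, |ξ ω| ^ γ ∂μ + ∫ ω, |η ω| ^ γ ∂μ) := by
    rw [← integral_sub iξη iξη', ← integral_add hξi hηi, ← integral_const_mul]
    refine abs_integral_le_integral_abs.trans (integral_mono (iξη.sub iξη').abs
      ((hξi.add hηi).const_mul _) fun ω => ?_)
    exact abs_mul_sub_truncAt_le hc hγ _ _
  -- The product of the means is the integral of ξ(ω)η(ω') over two separate arguments, so the
  -- pointwise truncation bound applies once more.
  have h2 : |(∫ ω, ξ ω ∂μ) * (∫ ω, η ω ∂μ) - (∫ ω, ξ' ω ∂μ) * ∫ ω, η' ω ∂μ| ≤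
      c ^ (2 - γ) * (∫ ω, |ξ ω| ^ γ ∂μ + ∫ ω, |η ω| ^ γ ∂μ) := by
    have h3 : ∀ ω', |(∫ ω, ξ ω ∂μ) * η ω' - (∫ ω, ξ' ω ∂μ) * η' ω'| ≤
        c ^ (2 - γ) * (∫ ω, |ξ ω| ^ γ ∂μ + |η ω'| ^ γ) := fun ω' => by
      rw [← integral_mul_const, ← integral_mul_const,
        ← integral_sub (iξ.mul_const _) (iξ'.mul_const _)]
      have h4 : ∫ ω, |ξ ω| ^ γ ∂μ + |η ω'| ^ γ = ∫ ω, (|ξ ω| ^ γ + |η ω'| ^ γ) ∂μ := by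
        rw [integral_add hξi (integrable_const _)]; simp
      rw [h4, ← integral_const_mul]
      refine abs_integral_le_integral_abs.trans (integral_mono
        ((iξ.mul_const _).sub (iξ'.mul_const _)).abs
        ((hξi.add (integrable_const _)).const_mul _) fun ω => ?_)
      exact abs_mul_sub_truncAt_le hc hγ _ _
    rw [← integral_const_mul, ← integral_const_mul,
      ← integral_sub (iη.const_mul _) (iη'.const_mul _)]
    have h4 : ∫ ω, |ξ ω| ^ γ ∂μ + ∫ ω, |η ω| ^ γ ∂μ =
        ∫ ω', (∫ ω, |ξ ω| ^ γ ∂μ + |η ω'| ^ γ) ∂μ := by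
      rw [integral_add (integrable_const _) hηi]; simp
    rw [h4, ← integral_const_mul]
    exact abs_integral_le_integral_abs.trans (integral_mono
      ((iη.const_mul _).sub (iη'.const_mul _)).abs
      (((integrable_const _).add hηi).const_mul _) h3)
  rw [abs_le] at *
  constructor <;> nlinarith

end Davydov

/-! ### Random signs and Khintchine's inequality. -/

section Khintchine

variable {I : Type*} [Fintype I]

/-- The sign attached to a boolean. -/
def sgn (b : Bool) : ℝ := if b then 1 else -1

theorem sgn_not (b : Bool) : sgn (!b) = -sgn b := by cases b <;> simp [sgn]

theorem sgn_mul_self (b : Bool) : sgn b * sgn b = 1 := by cases b <;> simp [sgn]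

variable [DecidableEq I]

theorem sum_sgn_mul_sgn (i j : I) :
    ∑ e : I → Bool, sgn (e i) * sgn (e j) = if i = j then 2 ^ Fintype.card I else 0 := by
  split_ifs with h
  · subst h
    simp [sgn_mul_self]
  -- Flipping the i-th sign permutes the sign patterns and negates the summand.
  · let φ : (I → Bool) ≃ (I → Bool) := Function.Involutive.toPerm
      (fun e => Function.update e i (!e i)) fun e => by simp
    have h1 := Equiv.sum_comp φ fun e => sgn (e i) * sgn (e j)
    have h2 : ∀ e, sgn (φ e i) * sgn (φ e j) = -(sgn (e i) * sgn (e j)) := fun e => by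
      have hφ : φ e = Function.update e i (!e i) := rfl
      simp [hφ, sgn_not, Function.update_of_ne (Ne.symm h)]
    simp only [h2, Finset.sum_neg_distrib] at h1
    linarith

/-- An inner product is an average of products of scalars. This reduces a sum of covariances of
coordinates to scalar covariances. -/
theorem sum_sgn_inner_mul (x y : I → ℝ) :
    ∑ e : I → Bool, (∑ i, sgn (e i) * x i) * (∑ i, sgn (e i) * y i) =
      2 ^ Fintype.card I * ∑ i, x i * y i := by
  simp only [Finset.sum_mul_sum]
  rw [Finset.sum_comm]
  simp only [Finset.sum_comm (s := (Finset.univ : Finset (I → Bool)))]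
  have h : ∀ i j, ∑ e : I → Bool, sgn (e i) * x i * (sgn (e j) * y j) =
      x i * y j * if i = j then 2 ^ Fintype.card I else 0 := fun i j => by
    rw [← sum_sgn_mul_sgn, Finset.mul_sum]
    exact Finset.sum_congr rfl fun e _ => by ring
  simp only [h, mul_ite, mul_zero, Finset.sum_ite_eq, Finset.mem_univ, if_true]
  rw [Finset.mul_sum]
  exact Finset.sum_congr rfl fun i _ => by ring

/-- The sum over sign patterns factors over the coordinates, and cosh x ≤ exp(x²/2). -/
theorem sum_exp_sgn_le (x : I → ℝ) :
    ∑ e : I → Bool, Real.exp (∑ i, sgn (e i) * x i) ≤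
      2 ^ Fintype.card I * Real.exp ((∑ i, x i ^ 2) / 2) := by
  have h1 : ∑ e : I → Bool, Real.exp (∑ i, sgn (e i) * x i) =
      ∏ i, ∑ b : Bool, Real.exp (sgn b * x i) := by
    rw [Finset.prod_univ_sum, Fintype.piFinset_univ]
    exact Finset.sum_congr rfl fun e _ => Real.exp_sum _ _
  rw [h1, Finset.sum_div, Real.exp_sum]
  have h2 : (2 : ℝ) ^ Fintype.card I = ∏ _i : I, (2 : ℝ) := by simp
  rw [h2, ← Finset.prod_mul_distrib]
  refine Finset.prod_le_prod (fun i _ => by positivity) fun i _ => ?_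
  have := Real.cosh_le_exp_half_sq (x i)
  rw [Real.cosh_eq] at this
  simp [sgn]
  linarith

/-- The constant in Khintchine's inequality. -/
noncomputable def khinConst (γ : ℝ) : ℝ := γ ^ γ * (2 * Real.exp (1 / 2))

theorem khinConst_nonneg {γ : ℝ} (hγ : 0 < γ) : 0 ≤ khinConst γ := by
  unfold khinConst; positivity

/-- Apply u ≤ exp u at u = |y|/γ and raise to the power γ. -/
theorem abs_rpow_le_exp {γ : ℝ} (hγ : 0 < γ) (y : ℝ) :
    |y| ^ γ ≤ γ ^ γ * (Real.exp y + Real.exp (-y)) := by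
  have h1 : |y| / γ ≤ Real.exp (|y| / γ) := by
    linarith [Real.add_one_le_exp (|y| / γ)]
  have h2 : |y| ≤ γ * Real.exp (|y| / γ) := by
    rw [div_le_iff₀ hγ] at h1; linarith
  calc |y| ^ γ ≤ (γ * Real.exp (|y| / γ)) ^ γ := Real.rpow_le_rpow (abs_nonneg _) h2 hγ.le
    _ = γ ^ γ * Real.exp |y| := by
        rw [Real.mul_rpow hγ.le (Real.exp_pos _).le, ← Real.exp_mul, div_mul_cancel₀ _ hγ.ne']
    _ ≤ _ := by
        gcongr
        rcases abs_choice y with h | h <;> rw [h]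
        · linarith [Real.exp_pos (-y)]
        · linarith [Real.exp_pos y]

/-- Khintchine's inequality. -/
theorem sum_abs_sgn_rpow_le {γ : ℝ} (hγ : 0 < γ) (x : I → ℝ) :
    ∑ e : I → Bool, |∑ i, sgn (e i) * x i| ^ γ ≤
      2 ^ Fintype.card I * (khinConst γ * (∑ i, x i ^ 2) ^ (γ / 2)) := by
  set s := ∑ i, x i ^ 2 with hs
  have hs0 : 0 ≤ s := Finset.sum_nonneg fun i _ => sq_nonneg _
  rcases hs0.eq_or_lt with h0 | hpos
  · have hx : ∀ i, x i = 0 := fun i => by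
      have := (Finset.sum_eq_zero_iff_of_nonneg fun i _ => sq_nonneg (x i)).1 h0.symm i
        (Finset.mem_univ i)
      exact pow_eq_zero_iff two_ne_zero |>.1 this
    simp [hx, Real.zero_rpow hγ.ne', ← h0, (half_pos hγ).ne']
  set r := √s with hr
  have hrpos : 0 < r := Real.sqrt_pos.2 hpos
  have hr2 : r ^ 2 = s := Real.sq_sqrt hs0
  -- By homogeneity it suffices to treat unit vectors, for which the exponential moments are at most
  -- exp(1/2).
  set z : I → ℝ := fun i => x i / r with hz
  have hz1 : ∑ i, z i ^ 2 = 1 := by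
    simp only [hz, div_pow, ← Finset.sum_div]
    rw [hr2, ← hs, div_self hpos.ne']
  have hunit : ∑ e : I → Bool, |∑ i, sgn (e i) * z i| ^ γ ≤ 2 ^ Fintype.card I * khinConst γ := by
    have h1 := sum_exp_sgn_le z
    have h2 := sum_exp_sgn_le fun i => -z i
    simp only [neg_sq, hz1, mul_neg, Finset.sum_neg_distrib] at h1 h2
    calc _ ≤ ∑ e : I → Bool, γ ^ γ *
          (Real.exp (∑ i, sgn (e i) * z i) + Real.exp (-∑ i, sgn (e i) * z i)) :=
          Finset.sum_le_sum fun e _ => abs_rpow_le_exp hγ _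
      _ ≤ γ ^ γ * (2 ^ Fintype.card I * Real.exp (1 / 2) +
            2 ^ Fintype.card I * Real.exp (1 / 2)) := by
          rw [← Finset.mul_sum, Finset.sum_add_distrib]
          gcongr
      _ = _ := by unfold khinConst; ring
  have hrγ : s ^ (γ / 2) = r ^ γ := by
    rw [← hr2, ← Real.rpow_two, ← Real.rpow_mul hrpos.le]
    congr 1; ring
  have hx : ∀ e : I → Bool, |∑ i, sgn (e i) * x i| ^ γ =
      r ^ γ * |∑ i, sgn (e i) * z i| ^ γ := fun e => by
    rw [← Real.mul_rpow hrpos.le (abs_nonneg _)]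
    congr 1
    have habs : r * |∑ i, sgn (e i) * z i| = |r * ∑ i, sgn (e i) * z i| := by
      rw [abs_mul, abs_of_pos hrpos]
    rw [habs, Finset.mul_sum]
    congr 1
    refine Finset.sum_congr rfl fun i _ => ?_
    simp only [hz]
    field_simp
  simp only [hx]
  rw [← Finset.mul_sum, hrγ]
  have := mul_le_mul_of_nonneg_left hunit (Real.rpow_nonneg hrpos.le γ)
  linarith

end Khintchine

/-! ### Dimension-free covariance inequality for random vectors. -/

section HilbertCovariance

variable {Ω : Type*} {m₁ m₂ : MeasurableSpace Ω} {m₀ : MeasurableSpace Ω} {μ : Measure Ω}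
  [IsProbabilityMeasure μ] {I : Type*} [Fintype I]

/-- This bound depends on the dimension and serves only the integrability of the signed sums. -/
theorem abs_sgn_sum_rpow_le {γ : ℝ} (hγ : 0 ≤ γ) (e : I → Bool) (x : I → ℝ) :
    |∑ i, sgn (e i) * x i| ^ γ ≤ (Fintype.card I : ℝ) ^ (γ / 2) * (∑ i, x i ^ 2) ^ (γ / 2) := by
  have hs0 : 0 ≤ ∑ i, x i ^ 2 := Finset.sum_nonneg fun i _ => sq_nonneg _
  have h1 : |∑ i, sgn (e i) * x i| ^ 2 ≤ Fintype.card I * ∑ i, x i ^ 2 := by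
    rw [sq_abs]
    refine (Finset.sum_mul_sq_le_sq_mul_sq _ _ _).trans ?_
    gcongr
    simp [sq, sgn_mul_self]
  rw [← Real.mul_rpow (Nat.cast_nonneg _) hs0]
  calc _ = (|∑ i, sgn (e i) * x i| ^ 2) ^ (γ / 2) := by
        rw [← Real.rpow_two, ← Real.rpow_mul (abs_nonneg _)]
        congr 1; ring
    _ ≤ _ := Real.rpow_le_rpow (by positivity) h1 (by positivity)

/-- Davydov's covariance inequality for random vectors, with a constant that does not depend on
the dimension. -/
theorem AlphaLe.abs_sum_cov_le_add {a : ℝ}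
    (h : AlphaLe m₁ m₂ μ a) (hm₁ : m₁ ≤ m₀) (hm₂ : m₂ ≤ m₀) {γ : ℝ} (hγ : 2 ≤ γ)
    {ξ η : I → Ω → ℝ} (hξ : ∀ i, Measurable[m₁] (ξ i)) (hη : ∀ i, Measurable[m₂] (η i))
    (hξi : Integrable (fun ω => (∑ i, ξ i ω ^ 2) ^ (γ / 2)) μ)
    (hηi : Integrable (fun ω => (∑ i, η i ω ^ 2) ^ (γ / 2)) μ) {c : ℝ} (hc : 0 < c) :
    |∑ i, (∫ ω, ξ i ω * η i ω ∂μ - (∫ ω, ξ i ω ∂μ) * ∫ ω, η i ω ∂μ)| ≤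
      4 * a * c ^ 2 + 2 * c ^ (2 - γ) * (khinConst γ *
        (∫ ω, (∑ i, ξ i ω ^ 2) ^ (γ / 2) ∂μ + ∫ ω, (∑ i, η i ω ^ 2) ^ (γ / 2) ∂μ)) := by
  classical
  have hγ0 : 0 < γ := by linarith
  have mξ : ∀ i, Measurable (ξ i) := fun i => (hξ i).mono hm₁ le_rfl
  have mη : ∀ i, Measurable (η i) := fun i => (hη i).mono hm₂ le_rfl
  have hsm₁ : ∀ e : I → Bool, Measurable[m₁] fun ω => ∑ i, sgn (e i) * ξ i ω := fun e =>
    Finset.measurable_fun_sum _ fun i _ => (hξ i).const_mul _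
  have hsm₂ : ∀ e : I → Bool, Measurable[m₂] fun ω => ∑ i, sgn (e i) * η i ω := fun e =>
    Finset.measurable_fun_sum _ fun i _ => (hη i).const_mul _
  have hsm : ∀ {ζ : I → Ω → ℝ}, (∀ i, Measurable (ζ i)) →
      ∀ e : I → Bool, Measurable fun ω => ∑ i, sgn (e i) * ζ i ω := fun hζ e =>
    Finset.measurable_fun_sum _ fun i _ => (hζ i).const_mul _
  have hpow : ∀ {ζ : I → Ω → ℝ}, (∀ i, Measurable (ζ i)) →
      Integrable (fun ω => (∑ i, ζ i ω ^ 2) ^ (γ / 2)) μ → ∀ e : I → Bool,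
      Integrable (fun ω => |∑ i, sgn (e i) * ζ i ω| ^ γ) μ := fun hζ hi e => by
    refine Integrable.mono' (hi.const_mul ((Fintype.card I : ℝ) ^ (γ / 2)))
      ((hsm hζ e).norm.pow_const γ).aestronglyMeasurable (Eventually.of_forall fun ω => ?_)
    rw [Real.norm_eq_abs, abs_of_nonneg (by positivity)]
    exact abs_sgn_sum_rpow_le hγ0.le e _
  have hone : ∀ {ζ : I → Ω → ℝ}, (∀ i, Measurable (ζ i)) →
      Integrable (fun ω => (∑ i, ζ i ω ^ 2) ^ (γ / 2)) μ → ∀ i,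
      Integrable (fun ω => |ζ i ω| ^ γ) μ := fun {ζ} hζ hi i => by
    refine Integrable.mono' hi ((hζ i).norm.pow_const γ).aestronglyMeasurable
      (Eventually.of_forall fun ω => ?_)
    rw [Real.norm_eq_abs, abs_of_nonneg (by positivity)]
    calc |ζ i ω| ^ γ = (ζ i ω ^ 2) ^ (γ / 2) := by
          rw [← sq_abs, ← Real.rpow_two, ← Real.rpow_mul (abs_nonneg _)]
          congr 1; ring
      _ ≤ _ := Real.rpow_le_rpow (sq_nonneg _)
        (Finset.single_le_sum (f := fun i => ζ i ω ^ 2) (fun j _ => sq_nonneg _)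
          (Finset.mem_univ i)) (by positivity)
  have i1 : ∀ i j, Integrable (fun ω => ξ i ω * η j ω) μ := fun i j =>
    integrable_mul_of_rpow hγ (mξ i) (mη j) (hone mξ hξi i) (hone mη hηi j)
  have iξ : ∀ i, Integrable (ξ i) μ := fun i =>
    integrable_of_rpow (by linarith) (mξ i) (hone mξ hξi i)
  have iη : ∀ i, Integrable (η i) μ := fun i =>
    integrable_of_rpow (by linarith) (mη i) (hone mη hηi i)
  have iξe : ∀ e : I → Bool, Integrable (fun ω => ∑ i, sgn (e i) * ξ i ω) μ := fun e =>
    integrable_finsetSum _ fun i _ => (iξ i).const_mul _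
  have iηe : ∀ e : I → Bool, Integrable (fun ω => ∑ i, sgn (e i) * η i ω) μ := fun e =>
    integrable_finsetSum _ fun i _ => (iη i).const_mul _
  set n : ℝ := 2 ^ Fintype.card I with hn
  have hnpos : 0 < n := by positivity
  -- Averaged over all sign patterns, the scalar covariances of the signed sums recover the sum of
  -- the coordinate covariances.
  have hcov : n * ∑ i, (∫ ω, ξ i ω * η i ω ∂μ - (∫ ω, ξ i ω ∂μ) * ∫ ω, η i ω ∂μ) =
      ∑ e : I → Bool, (∫ ω, (∑ i, sgn (e i) * ξ i ω) * (∑ i, sgn (e i) * η i ω) ∂μ -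
        (∫ ω, ∑ i, sgn (e i) * ξ i ω ∂μ) * ∫ ω, ∑ i, sgn (e i) * η i ω ∂μ) := by
    rw [Finset.sum_sub_distrib, Finset.sum_sub_distrib, mul_sub]
    congr 1
    · rw [← integral_finsetSum _ fun i _ => i1 i i, ← integral_const_mul,
        ← integral_finsetSum]
      · refine integral_congr_ae (Eventually.of_forall fun ω => ?_)
        simp only
        rw [sum_sgn_inner_mul]
      · intro e _
        exact integrable_mul_of_rpow hγ (hsm mξ e) (hsm mη e) (hpow mξ hξi e) (hpow mη hηi e)
    · rw [hn, ← sum_sgn_inner_mul]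
      refine Finset.sum_congr rfl fun e _ => ?_
      rw [integral_finsetSum _ fun i _ => (iξ i).const_mul _,
        integral_finsetSum _ fun i _ => (iη i).const_mul _]
      simp only [integral_const_mul]
  -- Khintchine's inequality, pointwise in ω, bounds the average γ-th moment of the signed sums by
  -- that of the Euclidean norm without a factor depending on the dimension.
  have hkh : ∀ {ζ : I → Ω → ℝ}, (∀ i, Measurable (ζ i)) →
      Integrable (fun ω => (∑ i, ζ i ω ^ 2) ^ (γ / 2)) μ →
      ∑ e : I → Bool, ∫ ω, |∑ i, sgn (e i) * ζ i ω| ^ γ ∂μ ≤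
        n * (khinConst γ * ∫ ω, (∑ i, ζ i ω ^ 2) ^ (γ / 2) ∂μ) := fun hζ hi => by
    rw [← integral_finsetSum _ fun e _ => hpow hζ hi e, ← integral_const_mul,
      ← integral_const_mul]
    exact integral_mono (integrable_finsetSum _ fun e _ => hpow hζ hi e)
      ((hi.const_mul _).const_mul _) fun ω => sum_abs_sgn_rpow_le hγ0 _
  have hsum : n * |∑ i, (∫ ω, ξ i ω * η i ω ∂μ - (∫ ω, ξ i ω ∂μ) * ∫ ω, η i ω ∂μ)| ≤
      n * (4 * a * c ^ 2 + 2 * c ^ (2 - γ) * (khinConst γ *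
        (∫ ω, (∑ i, ξ i ω ^ 2) ^ (γ / 2) ∂μ + ∫ ω, (∑ i, η i ω ^ 2) ^ (γ / 2) ∂μ))) := by
    rw [← abs_of_pos hnpos, ← abs_mul, abs_of_pos hnpos, hcov]
    refine (Finset.abs_sum_le_sum_abs _ _).trans ((Finset.sum_le_sum fun e _ =>
      h.abs_cov_le_add hm₁ hm₂ hγ (hsm₁ e) (hsm₂ e) (hpow mξ hξi e) (hpow mη hηi e) hc).trans ?_)
    have hcard : ∑ _e : I → Bool, 4 * a * c ^ 2 = n * (4 * a * c ^ 2) := by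
      simp [hn]
    rw [Finset.sum_add_distrib, hcard, ← Finset.mul_sum, Finset.sum_add_distrib]
    have h1 := hkh mξ hξi
    have h2 := hkh mη hηi
    have h3 : 0 ≤ 2 * c ^ (2 - γ) := by positivity
    nlinarith [mul_le_mul_of_nonneg_left (add_le_add h1 h2) h3]
  exact le_of_mul_le_mul_left hsum hnpos

/-- The constant in the covariance inequality for random vectors. -/
noncomputable def covConst (γ : ℝ) : ℝ := 4 + 4 * khinConst γ

/-- After scaling both vectors to moments at most one, the truncation level c = a^(-1/γ) makes both
terms of the additive inequality multiples of a^(1-2/γ). This level requires a > 0, so the bound is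
proved for every a' > a and passed to the limit. -/
theorem AlphaLe.abs_sum_cov_le {a : ℝ}
    (h : AlphaLe m₁ m₂ μ a) (hm₁ : m₁ ≤ m₀) (hm₂ : m₂ ≤ m₀) {γ : ℝ} (hγ : 2 < γ)
    {ξ η : I → Ω → ℝ} (hξ : ∀ i, Measurable[m₁] (ξ i)) (hη : ∀ i, Measurable[m₂] (η i))
    (hξi : Integrable (fun ω => (∑ i, ξ i ω ^ 2) ^ (γ / 2)) μ)
    (hηi : Integrable (fun ω => (∑ i, η i ω ^ 2) ^ (γ / 2)) μ) {x y : ℝ} (hx : 0 < x) (hy : 0 < y)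
    (hξx : ∫ ω, (∑ i, ξ i ω ^ 2) ^ (γ / 2) ∂μ ≤ x ^ γ)
    (hηy : ∫ ω, (∑ i, η i ω ^ 2) ^ (γ / 2) ∂μ ≤ y ^ γ) :
    |∑ i, (∫ ω, ξ i ω * η i ω ∂μ - (∫ ω, ξ i ω ∂μ) * ∫ ω, η i ω ∂μ)| ≤
      covConst γ * a ^ (1 - 2 / γ) * (x * y) := by
  have hγ0 : 0 < γ := by linarith
  have hκ : 0 < 1 - 2 / γ := by rw [sub_pos, div_lt_one hγ0]; exact hγ
  have main : ∀ a', 0 < a' → AlphaLe m₁ m₂ μ a' →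
      |∑ i, (∫ ω, ξ i ω * η i ω ∂μ - (∫ ω, ξ i ω ∂μ) * ∫ ω, η i ω ∂μ)| ≤
      covConst γ * a' ^ (1 - 2 / γ) * (x * y) := by
    intro a' ha' h'
    have hscale : ∀ {ζ : I → Ω → ℝ} {z : ℝ}, 0 < z →
        ∀ ω, (∑ i, (z⁻¹ * ζ i ω) ^ 2) ^ (γ / 2) = (z ^ γ)⁻¹ * (∑ i, ζ i ω ^ 2) ^ (γ / 2) := by
      intro ζ z hz ω
      have h1 : ∑ i, (z⁻¹ * ζ i ω) ^ 2 = (z⁻¹) ^ 2 * ∑ i, ζ i ω ^ 2 := by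
        rw [Finset.mul_sum]; exact Finset.sum_congr rfl fun i _ => mul_pow _ _ _
      rw [h1, Real.mul_rpow (by positivity) (Finset.sum_nonneg fun i _ => sq_nonneg _),
        ← Real.rpow_two, ← Real.rpow_mul (by positivity), Real.inv_rpow hz.le]
      congr 3; ring
    have hc : 0 < a' ^ (-1 / γ) := by positivity
    have hb := h'.abs_sum_cov_le_add hm₁ hm₂ hγ.le (ξ := fun i ω => x⁻¹ * ξ i ω)
      (η := fun i ω => y⁻¹ * η i ω) (fun i => (hξ i).const_mul _) (fun i => (hη i).const_mul _)
      (by simp only [hscale hx]; exact hξi.const_mul _)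
      (by simp only [hscale hy]; exact hηi.const_mul _) hc
    simp only [hscale hx, hscale hy, integral_const_mul] at hb
    have e1 : ∀ i, ∫ ω, x⁻¹ * ξ i ω * (y⁻¹ * η i ω) ∂μ - (x⁻¹ * ∫ ω, ξ i ω ∂μ) *
        (y⁻¹ * ∫ ω, η i ω ∂μ) =
        (x * y)⁻¹ * (∫ ω, ξ i ω * η i ω ∂μ - (∫ ω, ξ i ω ∂μ) * ∫ ω, η i ω ∂μ) := fun i => by
      rw [mul_sub, ← integral_const_mul (x * y)⁻¹ fun ω => ξ i ω * η i ω]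
      congr 1
      · refine integral_congr_ae (Eventually.of_forall fun ω => ?_)
        simp only [mul_inv]
        ring
      · rw [mul_inv]; ring
    simp only [e1, ← Finset.mul_sum, abs_mul] at hb
    rw [abs_of_pos (show 0 < (x * y)⁻¹ by positivity), inv_mul_le_iff₀ (by positivity)] at hb
    refine hb.trans ?_
    have e2 : a' * (a' ^ (-1 / γ)) ^ 2 = a' ^ (1 - 2 / γ) := by
      rw [← Real.rpow_two, ← Real.rpow_mul ha'.le]
      nth_rewrite 1 [← Real.rpow_one a']
      rw [← Real.rpow_add ha']
      congr 1; ring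
    have e3 : (a' ^ (-1 / γ)) ^ (2 - γ) = a' ^ (1 - 2 / γ) := by
      rw [← Real.rpow_mul ha'.le]
      congr 1; field_simp; ring
    have e4 : (x ^ γ)⁻¹ * ∫ ω, (∑ i, ξ i ω ^ 2) ^ (γ / 2) ∂μ ≤ 1 := by
      rw [inv_mul_le_iff₀ (by positivity)]; simpa using hξx
    have e5 : (y ^ γ)⁻¹ * ∫ ω, (∑ i, η i ω ^ 2) ^ (γ / 2) ∂μ ≤ 1 := by
      rw [inv_mul_le_iff₀ (by positivity)]; simpa using hηy
    rw [mul_assoc 4, e2, e3]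
    have hk := khinConst_nonneg hγ0
    have hp : 0 ≤ a' ^ (1 - 2 / γ) := by positivity
    have e6 := mul_le_mul_of_nonneg_left (add_le_add e4 e5) hk
    have e7 := mul_le_mul_of_nonneg_left e6 (mul_nonneg zero_le_two hp)
    have : 4 * a' ^ (1 - 2 / γ) + 2 * a' ^ (1 - 2 / γ) * (khinConst γ *
        ((x ^ γ)⁻¹ * ∫ ω, (∑ i, ξ i ω ^ 2) ^ (γ / 2) ∂μ +
          (y ^ γ)⁻¹ * ∫ ω, (∑ i, η i ω ^ 2) ^ (γ / 2) ∂μ)) ≤ covConst γ * a' ^ (1 - 2 / γ) := by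
      unfold covConst; linarith
    calc _ ≤ x * y * (covConst γ * a' ^ (1 - 2 / γ)) := by gcongr
      _ = _ := by ring
  have ha := h.nonneg
  have hlim : Tendsto (fun a' => covConst γ * a' ^ (1 - 2 / γ) * (x * y)) (𝓝[>] a)
      (𝓝 (covConst γ * a ^ (1 - 2 / γ) * (x * y))) := by
    have : ContinuousAt (fun a' : ℝ => covConst γ * a' ^ (1 - 2 / γ) * (x * y)) a :=
      (continuousAt_const.mul (Real.continuousAt_rpow_const _ _ (Or.inr hκ.le))).mul
        continuousAt_const
    exact this.tendsto.mono_left nhdsWithin_le_nhds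
  refine ge_of_tendsto hlim ?_
  filter_upwards [self_mem_nhdsWithin] with a' ha'
  exact main a' (ha.trans_lt ha') (h.mono le_rfl le_rfl (le_of_lt ha'))

end HilbertCovariance

end MatFactor

namespace MatFactor

/-! ### Variance of sums of mixing sequences. -/

section ScalarVariance

variable {Ω : Type*} {m₁ m₂ : MeasurableSpace Ω} {m₀ : MeasurableSpace Ω} {μ : Measure Ω}
  [IsProbabilityMeasure μ]

theorem sq_rpow_half {γ : ℝ} (x : ℝ) : (x ^ 2) ^ (γ / 2) = |x| ^ γ := by
  rw [← sq_abs, ← Real.rpow_two, ← Real.rpow_mul (abs_nonneg _)]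
  congr 1; ring

/-- Davydov's covariance inequality. -/
theorem AlphaLe.abs_cov_le {a : ℝ} (h : AlphaLe m₁ m₂ μ a) (hm₁ : m₁ ≤ m₀) (hm₂ : m₂ ≤ m₀)
    {γ : ℝ} (hγ : 2 < γ) {ξ η : Ω → ℝ} (hξ : Measurable[m₁] ξ) (hη : Measurable[m₂] η)
    (hξi : Integrable (fun ω => |ξ ω| ^ γ) μ) (hηi : Integrable (fun ω => |η ω| ^ γ) μ)
    {x : ℝ} (hx : 0 < x) (hξx : ∫ ω, |ξ ω| ^ γ ∂μ ≤ x ^ γ) (hηx : ∫ ω, |η ω| ^ γ ∂μ ≤ x ^ γ) :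
    |∫ ω, ξ ω * η ω ∂μ - (∫ ω, ξ ω ∂μ) * ∫ ω, η ω ∂μ| ≤
      covConst γ * a ^ (1 - 2 / γ) * x ^ 2 := by
  have := h.abs_sum_cov_le hm₁ hm₂ hγ (I := Unit) (ξ := fun _ => ξ) (η := fun _ => η)
    (fun _ => hξ) (fun _ => hη) (by simpa [sq_rpow_half] using hξi)
    (by simpa [sq_rpow_half] using hηi) hx hx (by simpa [sq_rpow_half] using hξx)
    (by simpa [sq_rpow_half] using hηx)
  simpa [sq] using this

theorem alphaLe_one : AlphaLe m₀ m₀ μ 1 := fun A B _ _ => by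
  have h1 := measureReal_nonneg (μ := μ) (s := A)
  have h2 := measureReal_nonneg (μ := μ) (s := B)
  have h3 := measureReal_nonneg (μ := μ) (s := A ∩ B)
  have h4 := measureReal_le_one (μ := μ) (s := A)
  have h5 := measureReal_le_one (μ := μ) (s := B)
  have h6 := measureReal_le_one (μ := μ) (s := A ∩ B)
  rw [abs_le]
  constructor <;> nlinarith

/-- On either side of t the distance to t determines s, so each value of g is used at most twice. -/
theorem sum_natAbs_le {g : ℕ → ℝ} {G : ℝ}
    (hG : ∀ s : Finset ℕ, ∑ l ∈ s, g l ≤ G) (S : Finset ℤ) (t : ℤ) :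
    ∑ s ∈ S, g (s - t).natAbs ≤ 2 * G := by
  have hpart : ∀ S' : Finset ℤ, Set.InjOn (fun s : ℤ => (s - t).natAbs) S' →
      ∑ s ∈ S', g (s - t).natAbs ≤ G := fun S' hS' => by
    rw [← Finset.sum_image (f := g) hS']
    exact hG _
  rw [← Finset.sum_filter_add_sum_filter_not S (fun s => t ≤ s), two_mul]
  refine add_le_add (hpart _ ?_) (hpart _ ?_)
  · intro x hx y hy hxy
    simp only [Finset.coe_filter, Set.mem_ofPred_eq] at hx hy hxy
    omega
  · intro x hx y hy hxy
    simp only [Finset.coe_filter, Set.mem_ofPred_eq] at hx hy hxy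
    omega

/-- The σ-field generated by the times up to `s`. -/
abbrev pastField (𝔉 : ℤ → MeasurableSpace Ω) (s : ℤ) : MeasurableSpace Ω := ⨆ t ∈ Set.Iic s, 𝔉 t

/-- The σ-field generated by the times from `s` on. -/
abbrev futureField (𝔉 : ℤ → MeasurableSpace Ω) (s : ℤ) : MeasurableSpace Ω := ⨆ t ∈ Set.Ici s, 𝔉 t

variable {𝔉 : ℤ → MeasurableSpace Ω}

theorem le_pastField {s t : ℤ} (h : t ≤ s) : 𝔉 t ≤ pastField 𝔉 s :=
  le_iSup₂_of_le (f := fun t _ => 𝔉 t) t h le_rfl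

theorem le_futureField {s t : ℤ} (h : s ≤ t) : 𝔉 t ≤ futureField 𝔉 s :=
  le_iSup₂_of_le (f := fun t _ => 𝔉 t) t h le_rfl

theorem pastField_le (h : ∀ t, 𝔉 t ≤ m₀) (s : ℤ) : pastField 𝔉 s ≤ m₀ := iSup₂_le fun t _ => h t

theorem futureField_le (h : ∀ t, 𝔉 t ≤ m₀) (s : ℤ) : futureField 𝔉 s ≤ m₀ :=
  iSup₂_le fun t _ => h t

/-- A family of σ-fields that is `α`-mixing with summable coefficients. -/
structure Mixing {m₀ : MeasurableSpace Ω} (μ : Measure Ω) (𝔉 : ℤ → MeasurableSpace Ω)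
    (γ : ℝ) (a : ℕ → ℝ) (A : ℝ) : Prop where
  le : ∀ t, 𝔉 t ≤ m₀
  alphaLe : ∀ (i : ℤ) (l : ℕ), 1 ≤ l → AlphaLe (pastField 𝔉 i) (futureField 𝔉 (i + l)) μ (a l)
  sum_le : ∀ s : Finset ℕ, ∑ l ∈ s, a (l + 1) ^ (1 - 2 / γ) ≤ A

/-- The decay profile of the covariances of functionals of `h + 1` consecutive times. -/
noncomputable def covDecay (γ : ℝ) (a : ℕ → ℝ) (h l : ℕ) : ℝ :=
  if l ≤ h then 1 else a (l - h) ^ (1 - 2 / γ)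

namespace Mixing

variable {γ A : ℝ} {a : ℕ → ℝ}

theorem nonneg (hmx : Mixing μ 𝔉 γ a A) {l : ℕ} (hl : 1 ≤ l) : 0 ≤ a l :=
  (hmx.alphaLe 0 l hl).nonneg

theorem covDecay_nonneg (hmx : Mixing μ 𝔉 γ a A) (h l : ℕ) : 0 ≤ covDecay γ a h l := by
  unfold covDecay
  split_ifs with hl
  · exact zero_le_one
  · exact Real.rpow_nonneg (hmx.nonneg (by omega)) _

theorem sum_covDecay_le (hmx : Mixing μ 𝔉 γ a A) (h : ℕ) (s : Finset ℕ) :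
    ∑ l ∈ s, covDecay γ a h l ≤ (h + 1) + A := by
  rw [← Finset.sum_filter_add_sum_filter_not s (fun l => l ≤ h)]
  refine add_le_add ?_ ?_
  · calc _ ≤ ∑ l ∈ Finset.range (h + 1), covDecay γ a h l := by
          refine Finset.sum_le_sum_of_subset_of_nonneg (fun l hl => ?_)
            fun l _ _ => hmx.covDecay_nonneg h l
          simp only [Finset.mem_filter] at hl
          exact Finset.mem_range.2 (by omega)
      _ = ∑ l ∈ Finset.range (h + 1), (1 : ℝ) := by
          refine Finset.sum_congr rfl fun l hl => ?_
          rw [covDecay, if_pos (Nat.lt_succ_iff.1 (Finset.mem_range.1 hl))]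
      _ = _ := by simp
  · have hinj : Set.InjOn (fun l => l - h - 1) (s.filter fun l => ¬ l ≤ h) := by
      intro x hx y hy hxy
      simp only [Finset.coe_filter, Set.mem_ofPred_eq] at hx hy hxy
      omega
    refine le_trans (le_of_eq ?_) (hmx.sum_le ((s.filter fun l => ¬ l ≤ h).image
      fun l => l - h - 1))
    rw [Finset.sum_image hinj]
    refine Finset.sum_congr rfl fun l hl => ?_
    simp only [Finset.mem_filter] at hl
    rw [covDecay, if_neg hl.2]
    congr 2
    omega

/-- Since ξ s depends only on times from s to s + h, a lag l > h leaves a gap of l - h between the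
two blocks. At shorter lags mixing says nothing, and the trivial coefficient one is used. -/
theorem abs_cov_le_covDecay (hmx : Mixing μ 𝔉 γ a A) (hγ : 2 < γ) {h : ℕ} {ξ : ℤ → Ω → ℝ}
    {S : Finset ℤ} {x : ℝ} (hx : 0 < x)
    (hξp : ∀ s, Measurable[pastField 𝔉 (s + h)] (ξ s))
    (hξf : ∀ s, Measurable[futureField 𝔉 s] (ξ s))
    (hξi : ∀ s ∈ S, Integrable (fun ω => |ξ s ω| ^ γ) μ)
    (hξx : ∀ s ∈ S, ∫ ω, |ξ s ω| ^ γ ∂μ ≤ x ^ γ) {s t : ℤ} (hs : s ∈ S) (ht : t ∈ S) :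
    |∫ ω, ξ s ω * ξ t ω ∂μ - (∫ ω, ξ s ω ∂μ) * ∫ ω, ξ t ω ∂μ| ≤
      covConst γ * covDecay γ a h (s - t).natAbs * x ^ 2 := by
  have hm : ∀ s, Measurable (ξ s) := fun s => (hξp s).mono (pastField_le hmx.le _) le_rfl
  wlog hst : s ≤ t generalizing s t
  · have h1 := this ht hs (not_le.1 hst).le
    rw [← Int.natAbs_neg, neg_sub, mul_comm (∫ ω, ξ s ω ∂μ)]
    simp only [mul_comm (ξ s _)]
    exact h1
  unfold covDecay
  split_ifs with hl
  · have := alphaLe_one.abs_cov_le le_rfl le_rfl hγ (hm s) (hm t) (hξi s hs) (hξi t ht) hx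
      (hξx s hs) (hξx t ht)
    rwa [Real.one_rpow] at this
  · have h1 := hmx.alphaLe (s + h) ((s - t).natAbs - h) (by omega)
    have e : s + h + (((s - t).natAbs - h : ℕ) : ℤ) = t := by omega
    rw [e] at h1
    exact h1.abs_cov_le (pastField_le hmx.le _) (futureField_le hmx.le _) hγ (hξp s) (hξf t)
      (hξi s hs) (hξi t ht) hx (hξx s hs) (hξx t ht)

/-- For each fixed time the covariances with all other times have a bounded sum, so the variance
grows only linearly in the number of terms. -/
theorem integral_sq_sum_le (hmx : Mixing μ 𝔉 γ a A) (hγ : 2 < γ) {h : ℕ} {ξ : ℤ → Ω → ℝ}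
    {S : Finset ℤ} {x : ℝ} (hx : 0 < x)
    (hξp : ∀ s, Measurable[pastField 𝔉 (s + h)] (ξ s))
    (hξf : ∀ s, Measurable[futureField 𝔉 s] (ξ s))
    (hξi : ∀ s ∈ S, Integrable (fun ω => |ξ s ω| ^ γ) μ)
    (hξx : ∀ s ∈ S, ∫ ω, |ξ s ω| ^ γ ∂μ ≤ x ^ γ) :
    Integrable (fun ω => (∑ s ∈ S, (ξ s ω - ∫ ω', ξ s ω' ∂μ)) ^ 2) μ ∧
    ∫ ω, (∑ s ∈ S, (ξ s ω - ∫ ω', ξ s ω' ∂μ)) ^ 2 ∂μ ≤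
      covConst γ * (2 * ((h + 1) + A)) * x ^ 2 * S.card := by
  have hm : ∀ s, Measurable (ξ s) := fun s => (hξp s).mono (pastField_le hmx.le _) le_rfl
  have hi : ∀ s ∈ S, Integrable (ξ s) μ := fun s hs =>
    integrable_of_rpow (by linarith) (hm s) (hξi s hs)
  have hij : ∀ s ∈ S, ∀ t ∈ S, Integrable (fun ω => ξ s ω * ξ t ω) μ := fun s hs t ht =>
    integrable_mul_of_rpow hγ.le (hm s) (hm t) (hξi s hs) (hξi t ht)
  have hexp : ∀ s t ω, (ξ s ω - ∫ ω', ξ s ω' ∂μ) * (ξ t ω - ∫ ω', ξ t ω' ∂μ) =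
      ξ s ω * ξ t ω - ξ s ω * (∫ ω', ξ t ω' ∂μ) - (∫ ω', ξ s ω' ∂μ) * ξ t ω +
        (∫ ω', ξ s ω' ∂μ) * ∫ ω', ξ t ω' ∂μ := fun s t ω => by ring
  have hint : ∀ s ∈ S, ∀ t ∈ S,
      Integrable (fun ω => (ξ s ω - ∫ ω', ξ s ω' ∂μ) * (ξ t ω - ∫ ω', ξ t ω' ∂μ)) μ :=
    fun s hs t ht => by
      simp only [hexp]
      exact (((hij s hs t ht).sub ((hi s hs).mul_const _)).sub ((hi t ht).const_mul _)).add
        (integrable_const _)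
  have hval : ∀ s ∈ S, ∀ t ∈ S,
      ∫ ω, (ξ s ω - ∫ ω', ξ s ω' ∂μ) * (ξ t ω - ∫ ω', ξ t ω' ∂μ) ∂μ =
        ∫ ω, ξ s ω * ξ t ω ∂μ - (∫ ω, ξ s ω ∂μ) * ∫ ω, ξ t ω ∂μ := fun s hs t ht => by
    simp only [hexp]
    rw [integral_add, integral_sub, integral_sub, integral_mul_const, integral_const_mul]
    · simp
    · exact hij s hs t ht
    · exact (hi s hs).mul_const _
    · exact (hij s hs t ht).sub ((hi s hs).mul_const _)
    · exact (hi t ht).const_mul _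
    · exact ((hij s hs t ht).sub ((hi s hs).mul_const _)).sub ((hi t ht).const_mul _)
    · exact integrable_const _
  simp only [sq (Finset.sum _ _), Finset.sum_mul_sum]
  refine ⟨integrable_finsetSum _ fun s hs => integrable_finsetSum _ fun t ht => hint s hs t ht, ?_⟩
  rw [integral_finsetSum _ fun s hs => integrable_finsetSum _ fun t ht => hint s hs t ht]
  have hk : 0 ≤ covConst γ := by
    have := khinConst_nonneg (show 0 < γ by linarith)
    unfold covConst; linarith
  calc _ = ∑ s ∈ S, ∑ t ∈ S, (∫ ω, ξ s ω * ξ t ω ∂μ - (∫ ω, ξ s ω ∂μ) * ∫ ω, ξ t ω ∂μ) := by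
        refine Finset.sum_congr rfl fun s hs => ?_
        rw [integral_finsetSum _ fun t ht => hint s hs t ht]
        exact Finset.sum_congr rfl fun t ht => hval s hs t ht
    _ ≤ ∑ t ∈ S, ∑ s ∈ S, covConst γ * covDecay γ a h (s - t).natAbs * x ^ 2 := by
        rw [Finset.sum_comm]
        exact Finset.sum_le_sum fun t ht => Finset.sum_le_sum fun s hs => (le_abs_self _).trans
          (hmx.abs_cov_le_covDecay hγ hx hξp hξf hξi hξx hs ht)
    _ ≤ ∑ t ∈ S, covConst γ * (2 * ((h + 1) + A)) * x ^ 2 := by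
        refine Finset.sum_le_sum fun t _ => ?_
        rw [← Finset.sum_mul, ← Finset.mul_sum]
        have := sum_natAbs_le (hmx.sum_covDecay_le h) S t
        gcongr
    _ = _ := by rw [Finset.sum_const, nsmul_eq_mul]; ring

end Mixing

end ScalarVariance

open scoped Matrix.Norms.Frobenius

/-! ### Second moments of lagged sample cross moments. -/

section CrossMoment

variable {I J I' J' : Type*}

/-- `c ∑_{s ∈ S} u_s v_{s+h}ᵀ`. -/
def crossMoment (c : ℝ) (S : Finset ℤ) (h : ℕ) (u : ℤ → I → ℝ) (v : ℤ → J → ℝ) : Matrix I J ℝ :=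
  Matrix.of fun i j => c * ∑ s ∈ S, u s i * v (s + h) j

variable (c : ℝ) (S : Finset ℤ) (h : ℕ)

theorem crossMoment_add_left (u u' : ℤ → I → ℝ) (v : ℤ → J → ℝ) :
    crossMoment c S h (fun s => u s + u' s) v = crossMoment c S h u v + crossMoment c S h u' v := by
  ext i j
  simp [crossMoment, add_mul, Finset.sum_add_distrib, mul_add]

theorem crossMoment_sub_left (u u' : ℤ → I → ℝ) (v : ℤ → J → ℝ) :
    crossMoment c S h (fun s => u s - u' s) v = crossMoment c S h u v - crossMoment c S h u' v := by
  ext i j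
  simp [crossMoment, sub_mul, Finset.sum_sub_distrib, mul_sub]

theorem crossMoment_add_right (u : ℤ → I → ℝ) (v v' : ℤ → J → ℝ) :
    crossMoment c S h u (fun s => v s + v' s) = crossMoment c S h u v + crossMoment c S h u v' := by
  ext i j
  simp [crossMoment, mul_add, Finset.sum_add_distrib]

theorem crossMoment_sub_right (u : ℤ → I → ℝ) (v v' : ℤ → J → ℝ) :
    crossMoment c S h u (fun s => v s - v' s) = crossMoment c S h u v - crossMoment c S h u v' := by
  ext i j
  simp [crossMoment, mul_sub, Finset.sum_sub_distrib]

theorem crossMoment_mulVec_left [Fintype I] (M : Matrix I' I ℝ) (u : ℤ → I → ℝ) (v : ℤ → J → ℝ) :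
    crossMoment c S h (fun s => M *ᵥ u s) v = M * crossMoment c S h u v := by
  ext i j
  simp only [crossMoment, Matrix.of_apply, Matrix.mulVec, dotProduct, Matrix.mul_apply,
    Finset.mul_sum, Finset.sum_mul]
  rw [Finset.sum_comm]
  exact Finset.sum_congr rfl fun _ _ => Finset.sum_congr rfl fun _ _ => by ring

theorem crossMoment_mulVec_right [Fintype J] (M : Matrix J' J ℝ) (u : ℤ → I → ℝ)
    (v : ℤ → J → ℝ) :
    crossMoment c S h u (fun s => M *ᵥ v s) = crossMoment c S h u v * Mᵀ := by
  ext i j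
  simp only [crossMoment, Matrix.of_apply, Matrix.mulVec, dotProduct, Matrix.mul_apply,
    Finset.mul_sum, Finset.sum_mul, Matrix.transpose_apply]
  rw [Finset.sum_comm]
  exact Finset.sum_congr rfl fun _ _ => Finset.sum_congr rfl fun _ _ => by ring

variable {Ω : Type*} {m₀ : MeasurableSpace Ω} {μ : Measure Ω}

/-- The expectation of `crossMoment`. -/
noncomputable def meanCross (μ : Measure Ω) (c : ℝ) (S : Finset ℤ) (h : ℕ) (u : ℤ → Ω → I → ℝ)
    (v : ℤ → Ω → J → ℝ) : Matrix I J ℝ :=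
  Matrix.of fun i j => c * ∑ s ∈ S, ∫ ω, u s ω i * v (s + h) ω j ∂μ

/-- An adapted vector process with uniformly bounded moments of order `2γ` on `1, …, T`. -/
structure BoundedProc {m₀ : MeasurableSpace Ω} (μ : Measure Ω) (𝔉 : ℤ → MeasurableSpace Ω)
    (γ K : ℝ) (T : ℕ) (u : ℤ → Ω → I → ℝ) : Prop where
  meas : ∀ t i, Measurable[𝔉 t] fun ω => u t ω i
  integrable : ∀ t ∈ Finset.Icc (1 : ℤ) T, ∀ i, Integrable (fun ω => |u t ω i| ^ (2 * γ)) μ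
  le : ∀ t ∈ Finset.Icc (1 : ℤ) T, ∀ i, ∫ ω, |u t ω i| ^ (2 * γ) ∂μ ≤ K

/-- The times `s` for which `s` and `s + h` belong to the sample. -/
def Admissible (T : ℕ) (h : ℕ) (S : Finset ℤ) : Prop := ∀ s ∈ S, 1 ≤ s ∧ s + h ≤ T

theorem abs_mul_rpow_le {γ : ℝ} (x y : ℝ) :
    |x * y| ^ γ ≤ |x| ^ (2 * γ) + |y| ^ (2 * γ) := by
  have h1 : ∀ z : ℝ, |z| ^ (2 * γ) = (|z| ^ γ) ^ 2 := fun z => by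
    rw [← Real.rpow_two, ← Real.rpow_mul (abs_nonneg _), mul_comm]
  rw [abs_mul, Real.mul_rpow (abs_nonneg _) (abs_nonneg _), h1, h1]
  nlinarith [sq_nonneg (|x| ^ γ - |y| ^ γ), sq_nonneg (|x| ^ γ), sq_nonneg (|y| ^ γ)]

theorem sq_le_one_add_rpow {γ : ℝ} (hγ : 2 ≤ γ) (x : ℝ) : x ^ 2 ≤ 1 + |x| ^ γ := by
  rw [← sq_abs]
  rcases le_total |x| 1 with h1 | h1
  · have := Real.rpow_nonneg (abs_nonneg x) γ
    nlinarith [abs_nonneg x]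
  · have := Real.rpow_le_rpow_of_exponent_le h1 hγ
    rw [Real.rpow_two] at this
    linarith

variable {𝔉 : ℤ → MeasurableSpace Ω} {γ K A : ℝ} {T : ℕ} {a : ℕ → ℝ}
  {u : ℤ → Ω → I → ℝ} {v : ℤ → Ω → J → ℝ} [IsProbabilityMeasure μ]

/-- The constant in the variance bound for lagged sample moments. -/
noncomputable def varConst (γ K A : ℝ) (h : ℕ) : ℝ :=
  covConst γ * (2 * ((h + 1) + A)) * ((2 * K) ^ (1 / γ)) ^ 2

namespace BoundedProc

theorem measurable (hu : BoundedProc μ 𝔉 γ K T u) (hmx : Mixing μ 𝔉 γ a A) (t : ℤ) (i : I) :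
    Measurable fun ω => u t ω i := (hu.meas t i).mono (hmx.le t) le_rfl

theorem integrable_mul_rpow (hu : BoundedProc μ 𝔉 γ K T u) (hv : BoundedProc μ 𝔉 γ K T v)
    (hmx : Mixing μ 𝔉 γ a A) {s t : ℤ} (hs : s ∈ Finset.Icc (1 : ℤ) T)
    (ht : t ∈ Finset.Icc (1 : ℤ) T) (i : I) (j : J) :
    Integrable (fun ω => |u s ω i * v t ω j| ^ γ) μ ∧
      ∫ ω, |u s ω i * v t ω j| ^ γ ∂μ ≤ 2 * K := by
  have hd := (hu.integrable s hs i).add (hv.integrable t ht j)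
  have hi : Integrable (fun ω => |u s ω i * v t ω j| ^ γ) μ := by
    refine Integrable.mono' hd (((hu.measurable hmx s i).mul
      (hv.measurable hmx t j)).norm.pow_const γ).aestronglyMeasurable
      (Eventually.of_forall fun ω => ?_)
    rw [Real.norm_eq_abs, abs_of_nonneg (by positivity)]
    exact abs_mul_rpow_le _ _
  refine ⟨hi, (integral_mono hi hd fun ω => abs_mul_rpow_le _ _).trans ?_⟩
  simp only [Pi.add_apply]
  rw [integral_add (hu.integrable s hs i) (hv.integrable t ht j)]
  linarith [hu.le s hs i, hv.le t ht j]

theorem integrable_mul (hu : BoundedProc μ 𝔉 γ K T u) (hv : BoundedProc μ 𝔉 γ K T v)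
    (hmx : Mixing μ 𝔉 γ a A) (hγ : 2 < γ) {s t : ℤ} (hs : s ∈ Finset.Icc (1 : ℤ) T)
    (ht : t ∈ Finset.Icc (1 : ℤ) T) (i : I) (j : J) :
    Integrable (fun ω => u s ω i * v t ω j) μ :=
  integrable_of_rpow (by linarith) ((hu.measurable hmx s i).mul (hv.measurable hmx t j))
    (hu.integrable_mul_rpow hv hmx hs ht i j).1

theorem integrable_mul_sq (hu : BoundedProc μ 𝔉 γ K T u) (hv : BoundedProc μ 𝔉 γ K T v)
    (hmx : Mixing μ 𝔉 γ a A) (hγ : 2 < γ) {s t : ℤ} (hs : s ∈ Finset.Icc (1 : ℤ) T)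
    (ht : t ∈ Finset.Icc (1 : ℤ) T) (i : I) (j : J) :
    Integrable (fun ω => (u s ω i * v t ω j) ^ 2) μ ∧
      ∫ ω, (u s ω i * v t ω j) ^ 2 ∂μ ≤ 1 + 2 * K := by
  obtain ⟨h1, h2⟩ := hu.integrable_mul_rpow hv hmx hs ht i j
  have hd := (integrable_const (μ := μ) (1 : ℝ)).add h1
  have hi : Integrable (fun ω => (u s ω i * v t ω j) ^ 2) μ := by
    refine Integrable.mono' hd (((hu.measurable hmx s i).mul
      (hv.measurable hmx t j)).pow_const 2).aestronglyMeasurable (Eventually.of_forall fun ω => ?_)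
    rw [Real.norm_eq_abs, abs_of_nonneg (by positivity)]
    exact sq_le_one_add_rpow hγ.le _
  refine ⟨hi, (integral_mono hi hd fun ω => sq_le_one_add_rpow hγ.le _).trans ?_⟩
  simp only [Pi.add_apply]
  rw [integral_add (integrable_const _) h1]
  simpa using h2

theorem abs_integral_mul_le (hu : BoundedProc μ 𝔉 γ K T u) (hv : BoundedProc μ 𝔉 γ K T v)
    (hmx : Mixing μ 𝔉 γ a A) (hγ : 2 < γ) {s t : ℤ} (hs : s ∈ Finset.Icc (1 : ℤ) T)
    (ht : t ∈ Finset.Icc (1 : ℤ) T) (i : I) (j : J) :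
    |∫ ω, u s ω i * v t ω j ∂μ| ≤ 2 + 2 * K := by
  obtain ⟨h1, h2⟩ := hu.integrable_mul_sq hv hmx hγ hs ht i j
  calc _ ≤ ∫ ω, |u s ω i * v t ω j| ∂μ := abs_integral_le_integral_abs
    _ ≤ ∫ ω, (1 + (u s ω i * v t ω j) ^ 2) ∂μ := by
        refine integral_mono (hu.integrable_mul hv hmx hγ hs ht i j).abs
          ((integrable_const _).add h1) fun ω => ?_
        simp only
        nlinarith [sq_abs (u s ω i * v t ω j), sq_nonneg (|u s ω i * v t ω j| - 1)]
    _ ≤ _ := by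
        rw [integral_add (integrable_const _) h1]
        simp; linarith

theorem integrable_sq (hu : BoundedProc μ 𝔉 γ K T u)
    (hmx : Mixing μ 𝔉 γ a A) (hγ : 2 < γ) {t : ℤ} (ht : t ∈ Finset.Icc (1 : ℤ) T) (i : I) :
    Integrable (fun ω => u t ω i ^ 2) μ ∧ ∫ ω, u t ω i ^ 2 ∂μ ≤ 1 + K := by
  have h1 := hu.integrable t ht i
  have hd := (integrable_const (μ := μ) (1 : ℝ)).add h1
  have hi : Integrable (fun ω => u t ω i ^ 2) μ := by
    refine Integrable.mono' hd ((hu.measurable hmx t i).pow_const 2).aestronglyMeasurable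
      (Eventually.of_forall fun ω => ?_)
    rw [Real.norm_eq_abs, abs_of_nonneg (by positivity)]
    exact sq_le_one_add_rpow (by linarith) _
  refine ⟨hi, (integral_mono hi hd fun ω => sq_le_one_add_rpow (by linarith) _).trans ?_⟩
  simp only [Pi.add_apply]
  rw [integral_add (integrable_const _) h1]
  simpa using hu.le t ht i

variable {c S h}

theorem integral_crossMoment_sub_sq_le (hu : BoundedProc μ 𝔉 γ K T u)
    (hv : BoundedProc μ 𝔉 γ K T v) (hmx : Mixing μ 𝔉 γ a A) (hγ : 2 < γ) (hK : 0 < K)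
    (hS : Admissible T h S) (i : I) (j : J) :
    Integrable (fun ω => (crossMoment c S h (fun t => u t ω) (fun t => v t ω) i j -
      meanCross μ c S h u v i j) ^ 2) μ ∧
    ∫ ω, (crossMoment c S h (fun t => u t ω) (fun t => v t ω) i j -
      meanCross μ c S h u v i j) ^ 2 ∂μ ≤ c ^ 2 * (varConst γ K A h * S.card) := by
  have hγ0 : 0 < γ := by linarith
  have hin : ∀ s ∈ S, s ∈ Finset.Icc (1 : ℤ) T ∧ s + h ∈ Finset.Icc (1 : ℤ) T := fun s hs => by
    have := hS s hs
    simp only [Finset.mem_Icc]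
    omega
  have hx : (0 : ℝ) < (2 * K) ^ (1 / γ) := by positivity
  -- A product of two entries with 2γ-th moments at most K has γ-th moment at most 2K; this is why
  -- moments of order 2γ are needed.
  have hxx : ((2 * K) ^ (1 / γ)) ^ γ = 2 * K := by
    rw [← Real.rpow_mul (by positivity), one_div_mul_cancel hγ0.ne', Real.rpow_one]
  have key := hmx.integral_sq_sum_le hγ (h := h) (ξ := fun s ω => u s ω i * v (s + h) ω j) (S := S)
    hx
    (fun s => ((hu.meas s i).mono (le_pastField (by omega)) le_rfl).mul
      ((hv.meas (s + h) j).mono (le_pastField le_rfl) le_rfl))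
    (fun s => ((hu.meas s i).mono (le_futureField le_rfl) le_rfl).mul
      ((hv.meas (s + h) j).mono (le_futureField (by omega)) le_rfl))
    (fun s hs => (hu.integrable_mul_rpow hv hmx (hin s hs).1 (hin s hs).2 i j).1)
    (fun s hs => by
      rw [hxx]
      exact (hu.integrable_mul_rpow hv hmx (hin s hs).1 (hin s hs).2 i j).2)
  have e : ∀ ω, (crossMoment c S h (fun t => u t ω) (fun t => v t ω) i j -
      meanCross μ c S h u v i j) ^ 2 = c ^ 2 *
      (∑ s ∈ S, (u s ω i * v (s + h) ω j - ∫ ω', u s ω' i * v (s + h) ω' j ∂μ)) ^ 2 := fun ω => by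
    simp only [crossMoment, meanCross, Matrix.of_apply, Finset.sum_sub_distrib]
    ring
  simp only [e]
  refine ⟨key.1.const_mul _, ?_⟩
  rw [integral_const_mul]
  exact mul_le_mul_of_nonneg_left (key.2.trans (le_of_eq (by unfold varConst; ring))) (sq_nonneg _)

variable [Fintype I] [Fintype J]

theorem integral_norm_crossMoment_sub_sq_le (hu : BoundedProc μ 𝔉 γ K T u)
    (hv : BoundedProc μ 𝔉 γ K T v) (hmx : Mixing μ 𝔉 γ a A) (hγ : 2 < γ) (hK : 0 < K)
    (hS : Admissible T h S) :
    Integrable (fun ω => ‖crossMoment c S h (fun t => u t ω) (fun t => v t ω) -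
      meanCross μ c S h u v‖ ^ 2) μ ∧
    ∫ ω, ‖crossMoment c S h (fun t => u t ω) (fun t => v t ω) - meanCross μ c S h u v‖ ^ 2 ∂μ ≤
      c ^ 2 * (varConst γ K A h * S.card) * (Fintype.card I * Fintype.card J) := by
  have key := fun i j => hu.integral_crossMoment_sub_sq_le hv hmx hγ hK hS i j (c := c)
  simp only [frob_sq, Matrix.sub_apply]
  refine ⟨integrable_finsetSum _ fun i _ => integrable_finsetSum _ fun j _ => (key i j).1, ?_⟩
  rw [integral_finsetSum _ fun i _ => integrable_finsetSum _ fun j _ => (key i j).1]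
  calc _ ≤ ∑ _i : I, ∑ _j : J, c ^ 2 * (varConst γ K A h * S.card) := by
        refine Finset.sum_le_sum fun i _ => ?_
        rw [integral_finsetSum _ fun j _ => (key i j).1]
        exact Finset.sum_le_sum fun j _ => (key i j).2
    _ = _ := by
        simp only [Finset.sum_const, Finset.card_univ, nsmul_eq_mul]; ring

/-- No centring and no decay in the sample size. This serves pairs of processes whose lagged cross
moments need not vanish, such as factors and regressors at different times. -/
theorem integral_norm_crossMoment_sq_le (hu : BoundedProc μ 𝔉 γ K T u)
    (hv : BoundedProc μ 𝔉 γ K T v) (hmx : Mixing μ 𝔉 γ a A) (hγ : 2 < γ)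
    (hS : Admissible T h S) :
    Integrable (fun ω => ‖crossMoment c S h (fun t => u t ω) (fun t => v t ω)‖ ^ 2) μ ∧
    ∫ ω, ‖crossMoment c S h (fun t => u t ω) (fun t => v t ω)‖ ^ 2 ∂μ ≤
      (c * S.card) ^ 2 * (1 + 2 * K) * (Fintype.card I * Fintype.card J) := by
  have hin : ∀ s ∈ S, s ∈ Finset.Icc (1 : ℤ) T ∧ s + h ∈ Finset.Icc (1 : ℤ) T := fun s hs => by
    have := hS s hs
    simp only [Finset.mem_Icc]
    omega
  have hm : ∀ i j, Measurable fun ω => crossMoment c S h (fun t => u t ω) (fun t => v t ω) i j :=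
    fun i j => (Finset.measurable_fun_sum _ fun s _ =>
      (hu.measurable hmx s i).mul (hv.measurable hmx (s + h) j)).const_mul c
  have hd : ∀ i j, Integrable (fun ω => c ^ 2 * (S.card *
      ∑ s ∈ S, (u s ω i * v (s + h) ω j) ^ 2)) μ := fun i j =>
    ((integrable_finsetSum _ fun s hs => (hu.integrable_mul_sq hv hmx hγ (hin s hs).1
      (hin s hs).2 i j).1).const_mul _).const_mul _
  have hle : ∀ i j ω, crossMoment c S h (fun t => u t ω) (fun t => v t ω) i j ^ 2 ≤
      c ^ 2 * (S.card * ∑ s ∈ S, (u s ω i * v (s + h) ω j) ^ 2) := fun i j ω => by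
    simp only [crossMoment, Matrix.of_apply, mul_pow]
    refine mul_le_mul_of_nonneg_left ?_ (sq_nonneg c)
    simpa only [mul_pow] using sq_sum_le_card_mul_sum_sq (s := S)
      (f := fun s => u s ω i * v (s + h) ω j)
  have hi : ∀ i j, Integrable
      (fun ω => crossMoment c S h (fun t => u t ω) (fun t => v t ω) i j ^ 2) μ := fun i j => by
    refine Integrable.mono' (hd i j) ((hm i j).pow_const 2).aestronglyMeasurable
      (Eventually.of_forall fun ω => ?_)
    rw [Real.norm_eq_abs, abs_of_nonneg (sq_nonneg _)]
    exact hle i j ω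
  simp only [frob_sq]
  refine ⟨integrable_finsetSum _ fun i _ => integrable_finsetSum _ fun j _ => hi i j, ?_⟩
  rw [integral_finsetSum _ fun i _ => integrable_finsetSum _ fun j _ => hi i j]
  calc _ ≤ ∑ _i : I, ∑ _j : J, (c * S.card) ^ 2 * (1 + 2 * K) := by
        refine Finset.sum_le_sum fun i _ => ?_
        rw [integral_finsetSum _ fun j _ => hi i j]
        refine Finset.sum_le_sum fun j _ => (integral_mono (hi i j) (hd i j) (hle i j)).trans ?_
        rw [integral_const_mul, integral_const_mul, integral_finsetSum _ fun s hs =>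
          (hu.integrable_mul_sq hv hmx hγ (hin s hs).1 (hin s hs).2 i j).1]
        have : ∑ s ∈ S, ∫ ω, (u s ω i * v (s + h) ω j) ^ 2 ∂μ ≤ S.card * (1 + 2 * K) := by
          rw [← nsmul_eq_mul]
          exact Finset.sum_le_card_nsmul _ _ _ fun s hs =>
            (hu.integrable_mul_sq hv hmx hγ (hin s hs).1 (hin s hs).2 i j).2
        calc _ ≤ c ^ 2 * (S.card * (S.card * (1 + 2 * K))) := by gcongr
          _ = _ := by ring
    _ = _ := by
        simp only [Finset.sum_const, Finset.card_univ, nsmul_eq_mul]; ring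

theorem integral_norm_sq_le (hu : BoundedProc μ 𝔉 γ K T u)
    (hmx : Mixing μ 𝔉 γ a A) (hγ : 2 < γ) {t : ℤ} (ht : t ∈ Finset.Icc (1 : ℤ) T) :
    Integrable (fun ω => ∑ i, u t ω i ^ 2) μ ∧
    ∫ ω, ∑ i, u t ω i ^ 2 ∂μ ≤ (1 + K) * Fintype.card I := by
  have key := fun i => hu.integrable_sq hmx hγ ht i
  refine ⟨integrable_finsetSum _ fun i _ => (key i).1, ?_⟩
  rw [integral_finsetSum _ fun i _ => (key i).1]
  calc _ ≤ ∑ _i : I, (1 + K) := Finset.sum_le_sum fun i _ => (key i).2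
    _ = _ := by simp only [Finset.sum_const, Finset.card_univ, nsmul_eq_mul]; ring

end BoundedProc

end CrossMoment

end MatFactor

namespace MatFactor

open scoped Matrix.Norms.Frobenius

/-! ### Truncated random matrices and trace identities. -/

section Truncation

variable {Ω P Q : Type*} [Fintype P] [Fintype Q]

open Classical in
/-- A random matrix, truncated where its norm exceeds `b`. -/
noncomputable def truncMat (b : ℝ) (X : Ω → Matrix P Q ℝ) : Ω → Matrix P Q ℝ :=
  fun ω => if ‖X ω‖ ≤ b then X ω else 0

theorem norm_truncMat_le (X : Ω → Matrix P Q ℝ) {b : ℝ} (hb : 0 ≤ b) (ω : Ω) :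
    ‖truncMat b X ω‖ ≤ b := by
  unfold truncMat
  split_ifs with h
  · exact h
  · simpa using hb

end Truncation

section MeasurableMatrix

variable {Ω : Type*} {mm : MeasurableSpace Ω} {P Q R : Type*} [Fintype Q]

theorem measurable_mul_entry {X : Ω → Matrix P Q ℝ} {Y : Ω → Matrix Q R ℝ}
    (hX : ∀ i j, Measurable fun ω => X ω i j) (hY : ∀ i j, Measurable fun ω => Y ω i j)
    (i : P) (j : R) : Measurable fun ω => (X ω * Y ω) i j := by
  simp only [Matrix.mul_apply]
  exact Finset.measurable_fun_sum _ fun l _ => (hX i l).mul (hY l j)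

theorem measurable_frob [Fintype P] {X : Ω → Matrix P Q ℝ}
    (hX : ∀ i j, Measurable fun ω => X ω i j) : Measurable fun ω => ‖X ω‖ := by
  have : (fun ω => ‖X ω‖) = fun ω => √(∑ i, ∑ j, X ω i j ^ 2) := by
    ext ω
    rw [← frob_sq, Real.sqrt_sq (norm_nonneg _)]
  rw [this]
  exact (Finset.measurable_fun_sum _ fun i _ =>
    Finset.measurable_fun_sum _ fun j _ => (hX i j).pow_const 2).sqrt

theorem measurable_truncMat [Fintype P] {X : Ω → Matrix P Q ℝ}
    (hX : ∀ i j, Measurable fun ω => X ω i j) (b : ℝ) (i : P) (j : Q) :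
    Measurable fun ω => truncMat b X ω i j := by
  have : (fun ω => truncMat b X ω i j) = {ω | ‖X ω‖ ≤ b}.indicator fun ω => X ω i j := by
    ext ω
    by_cases h : ‖X ω‖ ≤ b <;> simp [truncMat, h]
  rw [this]
  exact (hX i j).indicator (measurableSet_le (measurable_frob hX) measurable_const)

end MeasurableMatrix

section TraceIdentities

variable {P Q J J' : Type*} [Fintype P] [Fintype Q] [Fintype J] [Fintype J']

theorem frob_sq_eq_trace (M : Matrix P Q ℝ) : ‖M‖ ^ 2 = (M * Mᵀ).trace := by
  rw [frob_sq]
  simp [Matrix.trace, Matrix.mul_apply, sq]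

/-- The squared form is the inner product of (xxᵀ) ⊗ (zzᵀ) with e ⊗ e. Random coefficients are thus
separated from the noise, and the covariance inequality for vectors can decouple them. -/
theorem frob_sq_transpose_mul_mul (x : Matrix P J ℝ) (e : Matrix P Q ℝ) (z : Matrix Q J' ℝ) :
    ‖xᵀ * e * z‖ ^ 2 = ∑ I : (P × P) × (Q × Q),
      (x * xᵀ) I.1.1 I.1.2 * (z * zᵀ) I.2.1 I.2.2 * (e I.1.2 I.2.1 * e I.1.1 I.2.2) := by
  have h : (xᵀ * e * z * (xᵀ * e * z)ᵀ).trace = ((x * xᵀ) * (e * (z * zᵀ) * eᵀ)).trace := by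
    rw [Matrix.transpose_mul, Matrix.transpose_mul, Matrix.transpose_transpose, Matrix.mul_assoc x,
      Matrix.trace_mul_comm x]
    simp only [Matrix.mul_assoc]
  rw [frob_sq_eq_trace, h]
  simp only [Matrix.trace, Matrix.diag_apply, Fintype.sum_prod_type]
  refine Finset.sum_congr rfl fun a _ => ?_
  rw [Matrix.mul_apply]
  refine Finset.sum_congr rfl fun a' _ => ?_
  rw [Matrix.mul_apply (M := e * (z * zᵀ)), Finset.mul_sum, Finset.sum_comm]
  refine Finset.sum_congr rfl fun b' _ => ?_
  rw [Matrix.mul_apply (M := e), Finset.sum_mul, Finset.mul_sum]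
  refine Finset.sum_congr rfl fun b _ => ?_
  rw [Matrix.transpose_apply]
  ring

/-- Here e is grouped with x and only z is separated, for the case in which x and z lie on opposite
sides of e in time. -/
theorem frob_sq_transpose_mul_mul' (x : Matrix P J ℝ) (e : Matrix P Q ℝ) (z : Matrix Q J' ℝ) :
    ‖xᵀ * e * z‖ ^ 2 = ∑ I : Q × Q, (eᵀ * (x * xᵀ) * e) I.1 I.2 * (z * zᵀ) I.1 I.2 := by
  have h : (xᵀ * e * z * (xᵀ * e * z)ᵀ).trace = ((eᵀ * (x * xᵀ) * e) * (z * zᵀ)).trace := by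
    have h1 : xᵀ * e * z * (xᵀ * e * z)ᵀ = xᵀ * e * (z * zᵀ) * (eᵀ * x) := by
      rw [Matrix.transpose_mul, Matrix.transpose_mul, Matrix.transpose_transpose]
      simp only [Matrix.mul_assoc]
    rw [h1, Matrix.trace_mul_comm]
    simp only [Matrix.mul_assoc]
  rw [frob_sq_eq_trace, h]
  simp only [Matrix.trace, Matrix.diag_apply, Fintype.sum_prod_type]
  refine Finset.sum_congr rfl fun b _ => ?_
  rw [Matrix.mul_apply]
  refine Finset.sum_congr rfl fun b' _ => ?_
  congr 1
  rw [← Matrix.transpose_apply (z * zᵀ), Matrix.transpose_mul, Matrix.transpose_transpose]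

theorem norm_mul_transpose_self_le (x : Matrix P J ℝ) : ‖x * xᵀ‖ ≤ ‖x‖ ^ 2 := by
  refine (frob_mul_le _ _).trans ?_
  rw [frob_transpose, sq]

theorem frob_sq_bilinear (x : Matrix P J ℝ) (e : Matrix P Q ℝ) (z : Matrix Q J' ℝ) :
    ‖xᵀ * e * z‖ ^ 2 = ∑ j, ∑ l, (∑ a, ∑ b, x a j * z b l * e a b) ^ 2 := by
  rw [frob_sq]
  refine Finset.sum_congr rfl fun j _ => Finset.sum_congr rfl fun l _ => ?_
  congr 1
  simp only [Matrix.mul_apply, Matrix.transpose_apply, Finset.sum_mul]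
  rw [Finset.sum_comm]
  exact Finset.sum_congr rfl fun a _ => Finset.sum_congr rfl fun b _ => by ring

end TraceIdentities

/-! ### Noise between random coefficients that are nearly independent of it. -/

section Decoupling

variable {Ω : Type*} {m₁ m₂ : MeasurableSpace Ω} {m₀ : MeasurableSpace Ω} {μ : Measure Ω}
  {P Q J J' : Type*} [Fintype P] [Fintype Q] [Fintype J] [Fintype J']

/-- A random matrix whose entries have moments of order `2γ` bounded by `K`, and whose linear
functionals have second moment at most `σ` times the squared norm of the coefficients. -/
structure NoiseMat (μ : Measure Ω) (γ K σ : ℝ) (e : Ω → Matrix P Q ℝ) : Prop where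
  meas : ∀ i j, Measurable fun ω => e ω i j
  integrable : ∀ i j, Integrable (fun ω => |e ω i j| ^ (2 * γ)) μ
  le : ∀ i j, ∫ ω, |e ω i j| ^ (2 * γ) ∂μ ≤ K
  quad : ∀ w : Matrix P Q ℝ, ∫ ω, (∑ i, ∑ j, w i j * e ω i j) ^ 2 ∂μ ≤ σ * ‖w‖ ^ 2

variable {γ K σ : ℝ} {e : Ω → Matrix P Q ℝ}

theorem NoiseMat.transpose (he : NoiseMat μ γ K σ e) : NoiseMat μ γ K σ fun ω => (e ω)ᵀ where
  meas i j := he.meas j i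
  integrable i j := he.integrable j i
  le i j := he.le j i
  quad w := by
    have := he.quad wᵀ
    rw [frob_transpose] at this
    simp only [Matrix.transpose_apply] at this ⊢
    convert! this using 4
    exact Finset.sum_comm

variable [IsProbabilityMeasure μ]

theorem NoiseMat.integrable_mul (he : NoiseMat μ γ K σ e) (hγ : 2 < γ) (i i' : P) (j j' : Q) :
    Integrable (fun ω => e ω i j * e ω i' j') μ :=
  integrable_mul_of_rpow (by linarith) (he.meas i j) (he.meas i' j') (he.integrable i j)
    (he.integrable i' j')

/-- With fixed coefficients each entry of the form is a linear functional of the noise, and the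
squared norms of the coefficient matrices add up to ‖x‖²‖z‖². -/
theorem NoiseMat.integral_norm_sq_le (he : NoiseMat μ γ K σ e) (hγ : 2 < γ)
    (x : Matrix P J ℝ) (z : Matrix Q J' ℝ) :
    ∫ ω, ‖xᵀ * e ω * z‖ ^ 2 ∂μ ≤ σ * (‖x‖ ^ 2 * ‖z‖ ^ 2) := by
  have hint : ∀ w : Matrix P Q ℝ, Integrable (fun ω => (∑ i, ∑ j, w i j * e ω i j) ^ 2) μ :=
    fun w => by
      simp only [sq (Finset.sum _ _), Finset.sum_mul_sum]
      refine integrable_finsetSum _ fun i _ => integrable_finsetSum _ fun i' _ =>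
        integrable_finsetSum _ fun j _ => integrable_finsetSum _ fun j' _ => ?_
      convert! (he.integrable_mul hγ i i' j j').const_mul (w i j * w i' j') using 2
      ring
  simp only [frob_sq_bilinear]
  have hint' := fun j l => hint (Matrix.of fun a b => x a j * z b l)
  have hq := fun j l => he.quad (Matrix.of fun a b => x a j * z b l)
  simp only [Matrix.of_apply] at hint' hq
  rw [integral_finsetSum _ fun j _ => integrable_finsetSum _ fun l _ => hint' j l]
  calc _ ≤ ∑ j, ∑ l, σ * ‖Matrix.of fun a b => x a j * z b l‖ ^ 2 := by
        refine Finset.sum_le_sum fun j _ => ?_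
        rw [integral_finsetSum _ fun l _ => hint' j l]
        exact Finset.sum_le_sum fun l _ => hq j l
    _ = _ := by
        simp only [frob_sq, Matrix.of_apply, mul_pow, ← Finset.mul_sum]
        congr 1
        rw [Finset.sum_comm (f := fun a j => x a j ^ 2), Finset.sum_comm (f := fun b l => z b l ^ 2)]
        rw [Finset.sum_mul_sum]
        refine Finset.sum_congr rfl fun j _ => Finset.sum_congr rfl fun l _ => ?_
        rw [Finset.sum_mul_sum]
        refine Finset.sum_congr rfl fun a _ => ?_
        rw [Finset.mul_sum]

/-- By the power mean inequality over the D = |P||Q| entries, the γ-th moment of ‖e‖² has γ-th root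
of order D. -/
theorem NoiseMat.integral_norm_rpow_le (he : NoiseMat μ γ K σ e) (hγ : 2 < γ) (hK : 0 < K)
    [Nonempty P] [Nonempty Q] :
    Integrable (fun ω => (‖e ω‖ ^ 2) ^ γ) μ ∧ ∫ ω, (‖e ω‖ ^ 2) ^ γ ∂μ ≤
      (Fintype.card P * Fintype.card Q * K ^ (1 / γ)) ^ γ := by
  have hγ0 : 0 < γ := by linarith
  set D : ℝ := Fintype.card P * Fintype.card Q with hD
  have hD0 : 0 < D := by positivity
  have hpt : ∀ ω, (‖e ω‖ ^ 2) ^ γ ≤ D ^ (γ - 1) * ∑ x : P × Q, |e ω x.1 x.2| ^ (2 * γ) :=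
    fun ω => by
      have h1 := Real.rpow_sum_le_const_mul_sum_rpow (Finset.univ : Finset (P × Q))
        (fun x => e ω x.1 x.2 ^ 2) (show 1 ≤ γ by linarith)
      have h2 : ‖e ω‖ ^ 2 = ∑ x : P × Q, |e ω x.1 x.2 ^ 2| := by
        rw [frob_sq, Fintype.sum_prod_type]; simp
      rw [h2]
      refine h1.trans (le_of_eq ?_)
      congr 1
      · rw [hD]; simp
      · refine Finset.sum_congr rfl fun x _ => ?_
        rw [abs_pow, ← Real.rpow_two, ← Real.rpow_mul (abs_nonneg _)]
  have hi : Integrable (fun ω => D ^ (γ - 1) * ∑ x : P × Q, |e ω x.1 x.2| ^ (2 * γ)) μ :=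
    (integrable_finsetSum _ fun x _ => he.integrable x.1 x.2).const_mul _
  have hi' : Integrable (fun ω => (‖e ω‖ ^ 2) ^ γ) μ := by
    refine Integrable.mono' hi (((measurable_frob he.meas).pow_const 2).pow_const
      γ).aestronglyMeasurable (Eventually.of_forall fun ω => ?_)
    rw [Real.norm_eq_abs, abs_of_nonneg (by positivity)]
    exact hpt ω
  refine ⟨hi', (integral_mono hi' hi hpt).trans ?_⟩
  rw [integral_const_mul, integral_finsetSum _ fun x _ => he.integrable x.1 x.2]
  have h3 : ∑ x : P × Q, ∫ ω, |e ω x.1 x.2| ^ (2 * γ) ∂μ ≤ D * K := by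
    calc _ ≤ ∑ _x : P × Q, K := Finset.sum_le_sum fun x _ => he.le x.1 x.2
      _ = _ := by rw [hD]; simp
  calc _ ≤ D ^ (γ - 1) * (D * K) := by gcongr
    _ = D ^ γ * K := by
        rw [← mul_assoc, ← Real.rpow_add_one hD0.ne', sub_add_cancel]
    _ = _ := by
        rw [Real.mul_rpow hD0.le (by positivity), ← Real.rpow_mul hK.le, one_div_mul_cancel hγ0.ne',
          Real.rpow_one]

/-- Both coefficients lie on the same side of the noise. With e replaced by an independent copy the
form would have mean square at most σ(bc)², and the covariance inequality bounds the cost of this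
replacement. -/
theorem integral_norm_sq_le_of_alphaLe [Nonempty P] [Nonempty Q] {a : ℝ}
    (h : AlphaLe m₁ m₂ μ a) (hm₁ : m₁ ≤ m₀)
    (hm₂ : m₂ ≤ m₀) (hγ : 2 < γ) (hK : 0 < K) (hσ : 0 ≤ σ) (he : NoiseMat μ γ K σ e)
    (hem : ∀ i j, Measurable[m₂] fun ω => e ω i j) {X : Ω → Matrix P J ℝ} {Z : Ω → Matrix Q J' ℝ}
    (hX : ∀ i j, Measurable[m₁] fun ω => X ω i j) (hZ : ∀ i j, Measurable[m₁] fun ω => Z ω i j)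
    {b c : ℝ} (hb : 0 < b) (hc : 0 < c) (hXb : ∀ ω, ‖X ω‖ ≤ b) (hZc : ∀ ω, ‖Z ω‖ ≤ c) :
    Integrable (fun ω => ‖(X ω)ᵀ * e ω * Z ω‖ ^ 2) μ ∧
    ∫ ω, ‖(X ω)ᵀ * e ω * Z ω‖ ^ 2 ∂μ ≤ (b * c) ^ 2 *
      (σ + covConst γ * a ^ (1 - 2 / γ) * (Fintype.card P * Fintype.card Q * K ^ (1 / γ))) := by
  set ξ : (P × P) × (Q × Q) → Ω → ℝ := fun I ω =>
    (X ω * (X ω)ᵀ) I.1.1 I.1.2 * (Z ω * (Z ω)ᵀ) I.2.1 I.2.2 with hξ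
  set η : (P × P) × (Q × Q) → Ω → ℝ := fun I ω => e ω I.1.2 I.2.1 * e ω I.1.1 I.2.2 with hη
  have mξ : ∀ I, Measurable[m₁] (ξ I) := fun I =>
    (measurable_mul_entry hX (fun i j => hX j i) _ _).mul
      (measurable_mul_entry hZ (fun i j => hZ j i) _ _)
  have mη : ∀ I, Measurable[m₂] (η I) := fun I => (hem _ _).mul (hem _ _)
  have sξ : ∀ ω, ∑ I, ξ I ω ^ 2 = (‖X ω * (X ω)ᵀ‖ * ‖Z ω * (Z ω)ᵀ‖) ^ 2 := fun ω => by
    rw [mul_pow, frob_sq, frob_sq]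
    simp only [hξ, mul_pow, Fintype.sum_prod_type, ← Finset.mul_sum, ← Finset.sum_mul]
  have sη : ∀ ω, ∑ I, η I ω ^ 2 = (‖e ω‖ ^ 2) ^ 2 := fun ω => by
    rw [sq (‖e ω‖ ^ 2), frob_sq]
    simp only [hη, mul_pow, Fintype.sum_prod_type]
    rw [Finset.sum_mul_sum]
    refine Finset.sum_congr rfl fun i _ => Finset.sum_congr rfl fun i' _ => ?_
    rw [Finset.sum_mul_sum, Finset.sum_comm]
    exact Finset.sum_congr rfl fun _ _ => Finset.sum_congr rfl fun _ _ => mul_comm _ _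
  have bξ : ∀ ω, ‖X ω * (X ω)ᵀ‖ * ‖Z ω * (Z ω)ᵀ‖ ≤ (b * c) ^ 2 := fun ω => by
    rw [mul_pow]
    refine mul_le_mul ((norm_mul_transpose_self_le _).trans ?_)
      ((norm_mul_transpose_self_le _).trans ?_) (norm_nonneg _) (by positivity)
    · exact pow_le_pow_left₀ (norm_nonneg _) (hXb ω) 2
    · exact pow_le_pow_left₀ (norm_nonneg _) (hZc ω) 2
  have mξ0 : ∀ I, Measurable (ξ I) := fun I => (mξ I).mono hm₁ le_rfl
  have bξI : ∀ I ω, |ξ I ω| ≤ (b * c) ^ 2 := fun I ω => by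
    refine le_trans ?_ (bξ ω)
    refine abs_le_of_sq_le_sq ?_ (mul_nonneg (norm_nonneg _) (norm_nonneg _))
    rw [← sξ]
    exact Finset.single_le_sum (f := fun I => ξ I ω ^ 2) (fun I _ => sq_nonneg _)
      (Finset.mem_univ I)
  have pξ : ∀ ω, (∑ I, ξ I ω ^ 2) ^ (γ / 2) ≤ ((b * c) ^ 2) ^ γ := fun ω => by
    rw [sξ, sq_rpow_half, abs_of_nonneg (by positivity)]
    exact Real.rpow_le_rpow (by positivity) (bξ ω) (by linarith)
  have hξi : Integrable (fun ω => (∑ I, ξ I ω ^ 2) ^ (γ / 2)) μ := by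
    refine integrable_of_abs_le (c := ((b * c) ^ 2) ^ γ)
      ((Finset.measurable_fun_sum _ fun I _ => (mξ0 I).pow_const 2).pow_const _) fun ω => ?_
    rw [abs_of_nonneg (Real.rpow_nonneg (Finset.sum_nonneg fun _ _ => sq_nonneg _) _)]
    exact pξ ω
  have hξx : ∫ ω, (∑ I, ξ I ω ^ 2) ^ (γ / 2) ∂μ ≤ ((b * c) ^ 2) ^ γ := by
    refine (integral_mono hξi (integrable_const _) pξ).trans (by simp)
  obtain ⟨hei, hele⟩ := he.integral_norm_rpow_le hγ hK
  have pη : ∀ ω, (∑ I, η I ω ^ 2) ^ (γ / 2) = (‖e ω‖ ^ 2) ^ γ := fun ω => by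
    rw [sη, sq_rpow_half, abs_of_nonneg (by positivity)]
  have iη : ∀ I, Integrable (η I) μ := fun I => he.integrable_mul hγ _ _ _ _
  have iξη : ∀ I, Integrable (fun ω => ξ I ω * η I ω) μ := fun I =>
    (iη I).bdd_mul (mξ0 I).aestronglyMeasurable (Eventually.of_forall (bξI I))
  have iξ : ∀ I, Integrable (ξ I) μ := fun I => integrable_of_abs_le (mξ0 I) (bξI I)
  have hsum : ∀ ω, ‖(X ω)ᵀ * e ω * Z ω‖ ^ 2 = ∑ I, ξ I ω * η I ω := fun ω =>
    frob_sq_transpose_mul_mul _ _ _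
  simp only [hsum]
  refine ⟨integrable_finsetSum _ fun I _ => iξη I, ?_⟩
  have hcov := h.abs_sum_cov_le hm₁ hm₂ hγ mξ mη hξi (by simpa only [pη] using hei)
    (x := (b * c) ^ 2) (y := Fintype.card P * Fintype.card Q * K ^ (1 / γ)) (by positivity)
    (by positivity) hξx (by simpa only [pη] using hele)
  -- The product of the means is the mean of the form with an independent copy of e: freeze the
  -- coefficients at ω and integrate the noise over ω'.
  have hmain : ∑ I, (∫ ω, ξ I ω ∂μ) * ∫ ω, η I ω ∂μ ≤ (b * c) ^ 2 * σ := by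
    have h1 : ∑ I, (∫ ω, ξ I ω ∂μ) * ∫ ω, η I ω ∂μ =
        ∫ ω, ∑ I, ξ I ω * (∫ ω', η I ω' ∂μ) ∂μ := by
      rw [integral_finsetSum _ fun I _ => (iξ I).mul_const _]
      exact Finset.sum_congr rfl fun I _ => (integral_mul_const _ _).symm
    have h2 : ∀ ω, ∑ I, ξ I ω * (∫ ω', η I ω' ∂μ) ≤ (b * c) ^ 2 * σ := fun ω => by
      have h3 : ∑ I, ξ I ω * (∫ ω', η I ω' ∂μ) = ∫ ω', ‖(X ω)ᵀ * e ω' * Z ω‖ ^ 2 ∂μ := by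
        simp only [frob_sq_transpose_mul_mul]
        rw [integral_finsetSum _ fun I _ => (iη I).const_mul _]
        exact Finset.sum_congr rfl fun I _ => (integral_const_mul _ _).symm
      rw [h3]
      refine (he.integral_norm_sq_le hγ _ _).trans ?_
      rw [mul_comm, ← mul_pow]
      refine mul_le_mul_of_nonneg_right (pow_le_pow_left₀ (by positivity) ?_ 2) hσ
      exact mul_le_mul (hXb ω) (hZc ω) (norm_nonneg _) hb.le
    rw [h1]
    refine (integral_mono (integrable_finsetSum _ fun I _ => (iξ I).mul_const _)
      (integrable_const _) h2).trans (by simp)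
  rw [integral_finsetSum _ fun I _ => iξη I]
  rw [Finset.sum_sub_distrib] at hcov
  have := (abs_le.1 hcov).2
  linarith

/-- The right coefficient is decoupled from the pair formed by the left coefficient and the noise.
What remains has a frozen right coefficient, and G is the bound for it. -/
theorem integral_norm_sq_le_add_of_alphaLe [Nonempty P] [Nonempty Q] {a : ℝ}
    (h : AlphaLe m₁ m₂ μ a) (hm₁ : m₁ ≤ m₀)
    (hm₂ : m₂ ≤ m₀) (hγ : 2 < γ) (hK : 0 < K) (he : NoiseMat μ γ K σ e)
    (hem : ∀ i j, Measurable[m₁] fun ω => e ω i j) {X : Ω → Matrix P J ℝ} {Z : Ω → Matrix Q J' ℝ}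
    (hX : ∀ i j, Measurable[m₁] fun ω => X ω i j) (hZ : ∀ i j, Measurable[m₂] fun ω => Z ω i j)
    {b c G : ℝ} (hb : 0 < b) (hc : 0 < c) (hXb : ∀ ω, ‖X ω‖ ≤ b) (hZc : ∀ ω, ‖Z ω‖ ≤ c)
    (hG : ∀ z : Matrix Q J' ℝ, ‖z‖ ≤ c → ∫ ω, ‖(X ω)ᵀ * e ω * z‖ ^ 2 ∂μ ≤ G) :
    Integrable (fun ω => ‖(X ω)ᵀ * e ω * Z ω‖ ^ 2) μ ∧
    ∫ ω, ‖(X ω)ᵀ * e ω * Z ω‖ ^ 2 ∂μ ≤ G + (b * c) ^ 2 *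
      (covConst γ * a ^ (1 - 2 / γ) * (Fintype.card P * Fintype.card Q * K ^ (1 / γ))) := by
  have hγ0 : 0 < γ := by linarith
  set ξ : Q × Q → Ω → ℝ := fun I ω => ((e ω)ᵀ * (X ω * (X ω)ᵀ) * e ω) I.1 I.2 with hξ
  set η : Q × Q → Ω → ℝ := fun I ω => (Z ω * (Z ω)ᵀ) I.1 I.2 with hη
  have mξ : ∀ I, Measurable[m₁] (ξ I) := fun I =>
    measurable_mul_entry (measurable_mul_entry (fun i j => hem j i)
      (measurable_mul_entry hX fun i j => hX j i)) hem _ _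
  have mη : ∀ I, Measurable[m₂] (η I) := fun I => measurable_mul_entry hZ (fun i j => hZ j i) _ _
  have mξ0 : ∀ I, Measurable (ξ I) := fun I => (mξ I).mono hm₁ le_rfl
  have mη0 : ∀ I, Measurable (η I) := fun I => (mη I).mono hm₂ le_rfl
  have sξ : ∀ ω, ∑ I, ξ I ω ^ 2 = ‖(e ω)ᵀ * (X ω * (X ω)ᵀ) * e ω‖ ^ 2 := fun ω => by
    rw [frob_sq, Fintype.sum_prod_type]
  have sη : ∀ ω, ∑ I, η I ω ^ 2 = ‖Z ω * (Z ω)ᵀ‖ ^ 2 := fun ω => by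
    rw [frob_sq, Fintype.sum_prod_type]
  have bξ : ∀ ω, ‖(e ω)ᵀ * (X ω * (X ω)ᵀ) * e ω‖ ≤ b ^ 2 * ‖e ω‖ ^ 2 := fun ω => by
    calc _ ≤ ‖(e ω)ᵀ‖ * ‖X ω * (X ω)ᵀ‖ * ‖e ω‖ := (frob_mul_le _ _).trans
          (mul_le_mul_of_nonneg_right (frob_mul_le _ _) (norm_nonneg _))
      _ ≤ ‖e ω‖ * b ^ 2 * ‖e ω‖ := by
          rw [frob_transpose]
          have := (norm_mul_transpose_self_le (X ω)).trans
            (pow_le_pow_left₀ (norm_nonneg _) (hXb ω) 2)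
          gcongr
      _ = _ := by ring
  have bη : ∀ ω, ‖Z ω * (Z ω)ᵀ‖ ≤ c ^ 2 := fun ω =>
    (norm_mul_transpose_self_le _).trans (pow_le_pow_left₀ (norm_nonneg _) (hZc ω) 2)
  have bηI : ∀ I ω, |η I ω| ≤ c ^ 2 := fun I ω => by
    refine le_trans ?_ (bη ω)
    refine abs_le_of_sq_le_sq ?_ (norm_nonneg _)
    rw [← sη]
    exact Finset.single_le_sum (f := fun I => η I ω ^ 2) (fun I _ => sq_nonneg _)
      (Finset.mem_univ I)
  obtain ⟨hei, hele⟩ := he.integral_norm_rpow_le hγ hK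
  have pξ : ∀ ω, (∑ I, ξ I ω ^ 2) ^ (γ / 2) ≤ (b ^ 2) ^ γ * (‖e ω‖ ^ 2) ^ γ := fun ω => by
    rw [sξ, sq_rpow_half, abs_of_nonneg (norm_nonneg _),
      ← Real.mul_rpow (by positivity) (by positivity)]
    exact Real.rpow_le_rpow (norm_nonneg _) (bξ ω) hγ0.le
  have hξi : Integrable (fun ω => (∑ I, ξ I ω ^ 2) ^ (γ / 2)) μ := by
    refine Integrable.mono' (hei.const_mul ((b ^ 2) ^ γ)) ((Finset.measurable_fun_sum _ fun I _ =>
      (mξ0 I).pow_const 2).pow_const _).aestronglyMeasurable (Eventually.of_forall fun ω => ?_)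
    rw [Real.norm_eq_abs,
      abs_of_nonneg (Real.rpow_nonneg (Finset.sum_nonneg fun _ _ => sq_nonneg _) _)]
    exact pξ ω
  set D : ℝ := Fintype.card P * Fintype.card Q * K ^ (1 / γ) with hD
  have hD0 : 0 < D := by positivity
  have hξx : ∫ ω, (∑ I, ξ I ω ^ 2) ^ (γ / 2) ∂μ ≤ (b ^ 2 * D) ^ γ := by
    refine (integral_mono hξi (hei.const_mul _) pξ).trans ?_
    rw [integral_const_mul, Real.mul_rpow (by positivity) hD0.le]
    gcongr
  have pη : ∀ ω, (∑ I, η I ω ^ 2) ^ (γ / 2) ≤ (c ^ 2) ^ γ := fun ω => by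
    rw [sη, sq_rpow_half, abs_of_nonneg (norm_nonneg _)]
    exact Real.rpow_le_rpow (norm_nonneg _) (bη ω) hγ0.le
  have hηi : Integrable (fun ω => (∑ I, η I ω ^ 2) ^ (γ / 2)) μ := by
    refine integrable_of_abs_le (c := (c ^ 2) ^ γ)
      ((Finset.measurable_fun_sum _ fun I _ => (mη0 I).pow_const 2).pow_const _) fun ω => ?_
    rw [abs_of_nonneg (Real.rpow_nonneg (Finset.sum_nonneg fun _ _ => sq_nonneg _) _)]
    exact pη ω
  have hηx : ∫ ω, (∑ I, η I ω ^ 2) ^ (γ / 2) ∂μ ≤ (c ^ 2) ^ γ :=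
    (integral_mono hηi (integrable_const _) pη).trans (by simp)
  have iξ : ∀ I, Integrable (ξ I) μ := fun I => by
    refine integrable_of_rpow (γ := γ) (by linarith) (mξ0 I) (Integrable.mono' hξi
      ((mξ0 I).norm.pow_const γ).aestronglyMeasurable (Eventually.of_forall fun ω => ?_))
    rw [Real.norm_eq_abs, abs_of_nonneg (by positivity), ← sq_rpow_half]
    exact Real.rpow_le_rpow (sq_nonneg _) (Finset.single_le_sum (f := fun I => ξ I ω ^ 2)
      (fun I _ => sq_nonneg _) (Finset.mem_univ I)) (by positivity)
  have iη : ∀ I, Integrable (η I) μ := fun I => integrable_of_abs_le (mη0 I) (bηI I)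
  have iξη : ∀ I, Integrable (fun ω => ξ I ω * η I ω) μ := fun I =>
    (iξ I).mul_bdd (mη0 I).aestronglyMeasurable (Eventually.of_forall (bηI I))
  have hsum : ∀ ω, ‖(X ω)ᵀ * e ω * Z ω‖ ^ 2 = ∑ I, ξ I ω * η I ω := fun ω =>
    frob_sq_transpose_mul_mul' _ _ _
  simp only [hsum]
  refine ⟨integrable_finsetSum _ fun I _ => iξη I, ?_⟩
  have hcov := h.abs_sum_cov_le hm₁ hm₂ hγ mξ mη hξi hηi
    (x := b ^ 2 * D) (y := c ^ 2) (by positivity) (by positivity) hξx hηx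
  have hmain : ∑ I, (∫ ω, ξ I ω ∂μ) * ∫ ω, η I ω ∂μ ≤ G := by
    have h1 : ∑ I, (∫ ω, ξ I ω ∂μ) * ∫ ω, η I ω ∂μ =
        ∫ ω, ∑ I, (∫ ω', ξ I ω' ∂μ) * η I ω ∂μ := by
      rw [integral_finsetSum _ fun I _ => (iη I).const_mul _]
      exact Finset.sum_congr rfl fun I _ => (integral_const_mul _ _).symm
    have h2 : ∀ ω, ∑ I, (∫ ω', ξ I ω' ∂μ) * η I ω ≤ G := fun ω => by
      refine le_trans (le_of_eq ?_) (hG (Z ω) (hZc ω))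
      simp only [frob_sq_transpose_mul_mul']
      rw [integral_finsetSum _ fun I _ => (iξ I).mul_const _]
      exact Finset.sum_congr rfl fun I _ => (integral_mul_const _ _).symm
    rw [h1]
    exact (integral_mono (integrable_finsetSum _ fun I _ => (iη I).const_mul _)
      (integrable_const _) h2).trans (by simp)
  rw [integral_finsetSum _ fun I _ => iξη I]
  rw [Finset.sum_sub_distrib] at hcov
  have := (abs_le.1 hcov).2
  linarith

end Decoupling

end MatFactor

namespace MatFactor

open scoped Matrix.Norms.Frobenius

/-! ### Flattenings of pair-indexed matrices and Gram matrices built from them. -/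

section Flattening

variable {P Q J J' : Type*}

/-- The entries of a matrix as a vector indexed by pairs. -/
def unc (M : Matrix P Q ℝ) : P × Q → ℝ := fun x => M x.1 x.2

/-- Regroup a matrix with row index `P × Q` into a matrix with row index `P`. -/
def leftFlat (t : Matrix (P × Q) J ℝ) : Matrix P (Q × J) ℝ := Matrix.of fun a x => t (a, x.1) x.2

/-- Regroup a matrix with row index `P × Q` into a matrix with row index `Q`. -/
def rightFlat (t : Matrix (P × Q) J ℝ) : Matrix Q (P × J) ℝ := Matrix.of fun i x => t (x.1, i) x.2

theorem leftFlat_add (t t' : Matrix (P × Q) J ℝ) :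
    leftFlat (t + t') = leftFlat t + leftFlat t' := rfl

theorem rightFlat_add (t t' : Matrix (P × Q) J ℝ) :
    rightFlat (t + t') = rightFlat t + rightFlat t' := rfl

theorem leftFlat_sub (t t' : Matrix (P × Q) J ℝ) :
    leftFlat (t - t') = leftFlat t - leftFlat t' := rfl

theorem rightFlat_sub (t t' : Matrix (P × Q) J ℝ) :
    rightFlat (t - t') = rightFlat t - rightFlat t' := rfl

variable [Fintype P] [Fintype Q] [Fintype J] [Fintype J']

theorem norm_leftFlat (t : Matrix (P × Q) J ℝ) : ‖leftFlat t‖ = ‖t‖ := by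
  rw [← pow_left_inj₀ (norm_nonneg _) (norm_nonneg _) two_ne_zero, frob_sq, frob_sq]
  simp [leftFlat, Fintype.sum_prod_type]

theorem norm_rightFlat (t : Matrix (P × Q) J ℝ) : ‖rightFlat t‖ = ‖t‖ := by
  rw [← pow_left_inj₀ (norm_nonneg _) (norm_nonneg _) two_ne_zero, frob_sq, frob_sq]
  simp only [rightFlat, Fintype.sum_prod_type, Matrix.of_apply]
  exact Finset.sum_comm

/-- `∑_{h ∈ H} t_h t_hᵀ`. -/
def gramSum (H : Finset ℕ) (t : ℕ → Matrix P J ℝ) : Matrix P P ℝ := ∑ h ∈ H, t h * (t h)ᵀ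

theorem gramSum_transpose (H : Finset ℕ) (t : ℕ → Matrix P J ℝ) :
    (gramSum H t)ᵀ = gramSum H t := by
  simp [gramSum, Matrix.transpose_sum]

theorem gramSum_isHermitian (H : Finset ℕ) (t : ℕ → Matrix P J ℝ) :
    (gramSum H t).IsHermitian := by
  rw [Matrix.IsHermitian, Matrix.conjTranspose_eq_transpose_of_trivial, gramSum_transpose]

theorem norm_gramSum_sub_le (H : Finset ℕ) (t t' : ℕ → Matrix P J ℝ) :
    ‖gramSum H t - gramSum H t'‖ ≤ ∑ h ∈ H, ‖t h - t' h‖ * (‖t h‖ + ‖t' h‖) := by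
  rw [gramSum, gramSum, ← Finset.sum_sub_distrib]
  refine (norm_sum_le _ _).trans (Finset.sum_le_sum fun h _ => ?_)
  have e : t h * (t h)ᵀ - t' h * (t' h)ᵀ = (t h - t' h) * (t h)ᵀ + t' h * (t h - t' h)ᵀ := by
    rw [Matrix.transpose_sub, Matrix.sub_mul, Matrix.mul_sub]; abel
  rw [e]
  refine (norm_add_le _ _).trans ?_
  have h1 := frob_mul_le (t h - t' h) (t h)ᵀ
  have h2 := frob_mul_le (t' h) (t h - t' h)ᵀ
  rw [frob_transpose] at h1 h2
  linarith

variable [DecidableEq P] [DecidableEq Q]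

/-- The largest eigenvalue of `∑ N_h N_hᵀ` with `N_h = R G_h`. -/
theorem singVal_pow_mul_norm_sq_le_eigDesc {κ : Type*} [Fintype κ] [DecidableEq κ] {H : Finset ℕ}
    {t : ℕ → Matrix P J ℝ} {R : Matrix P κ ℝ} {h : ℕ} (hh : h ∈ H) {G : Matrix κ J ℝ}
    (hG : t h = R * G) :
    singVal R (Fintype.card κ - 1) ^ 4 * ‖t h‖ ^ 2 ≤ eigDesc (gramSum H t) 0 * ‖R‖ ^ 4 := by
  -- The quadratic form of the Gram matrix is tested on the columns of R.
  have h1 : ∑ h ∈ H, ‖(t h)ᵀ * R‖ ^ 2 ≤ eigDesc (gramSum H t) 0 * ‖R‖ ^ 2 := by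
    have h2 : ∀ x : P → ℝ, x ⬝ᵥ gramSum H t *ᵥ x =
        ∑ h ∈ H, ((t h)ᵀ *ᵥ x) ⬝ᵥ ((t h)ᵀ *ᵥ x) := fun x => by
      rw [gramSum, Matrix.sum_mulVec, dotProduct_sum]
      refine Finset.sum_congr rfl fun h _ => ?_
      rw [← Matrix.mulVec_mulVec, Matrix.dotProduct_mulVec, ← Matrix.mulVec_transpose]
    rw [frob_sq_eq_sum_col R, Finset.mul_sum]
    calc _ = ∑ j, (R.col j) ⬝ᵥ gramSum H t *ᵥ (R.col j) := by
          simp only [h2]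
          rw [Finset.sum_comm]
          refine Finset.sum_congr rfl fun h _ => ?_
          rw [frob_sq_eq_sum_col]
          refine Finset.sum_congr rfl fun j _ => ?_
          rw [dotProduct_self_eq_norm_sq]
          rfl
      _ ≤ _ := by
          refine Finset.sum_le_sum fun j _ => ?_
          rw [← dotProduct_self_eq_norm_sq]
          exact dotProduct_mulVec_le_eigDesc_zero (gramSum_isHermitian H t) _
  have h3 : ‖(t h)ᵀ * R‖ ^ 2 ≤ ∑ h ∈ H, ‖(t h)ᵀ * R‖ ^ 2 :=
    Finset.single_le_sum (f := fun h => ‖(t h)ᵀ * R‖ ^ 2) (fun _ _ => sq_nonneg _) hh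
  -- Up to transposition (t h)ᵀ R is RᵀR G, from which G is recovered by the smallest singular value
  -- of R.
  have h4 : singVal R (Fintype.card κ - 1) ^ 2 * ‖G‖ ≤ ‖(t h)ᵀ * R‖ := by
    have := singVal_last_sq_mul_frob_le R G
    rwa [Matrix.mul_assoc, ← hG, ← frob_transpose (Rᵀ * t h), Matrix.transpose_mul,
      Matrix.transpose_transpose] at this
  have h5 : ‖t h‖ ≤ ‖R‖ * ‖G‖ := by rw [hG]; exact frob_mul_le _ _
  set s := singVal R (Fintype.card κ - 1)
  calc s ^ 4 * ‖t h‖ ^ 2 ≤ s ^ 4 * (‖R‖ * ‖G‖) ^ 2 := by gcongr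
    _ = (s ^ 2 * ‖G‖) ^ 2 * ‖R‖ ^ 2 := by ring
    _ ≤ ‖(t h)ᵀ * R‖ ^ 2 * ‖R‖ ^ 2 := by gcongr
    _ ≤ (eigDesc (gramSum H t) 0 * ‖R‖ ^ 2) * ‖R‖ ^ 2 := by
        gcongr; exact h3.trans h1
    _ = _ := by ring

/-- The part of the noise that survives the projections on the estimated loading spaces. -/
theorem norm_transpose_mul_mul_le {d d' : ℕ} {H : Finset ℕ}
    {t : ℕ → Matrix P J ℝ} {t' : ℕ → Matrix Q J' ℝ} {V : Matrix P (Fin d) ℝ}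
    {V' : Matrix Q (Fin d') ℝ} {c c' : ℝ} (hV : IsTopEigvecs (gramSum H t) V)
    (hV' : IsTopEigvecs (gramSum H t') V') (hc : 0 < c) (hc' : 0 < c')
    (h : ∀ i : Fin d, c ≤ eigDesc (gramSum H t) i)
    (h' : ∀ i : Fin d', c' ≤ eigDesc (gramSum H t') i) (e : Matrix P Q ℝ) :
    ‖Vᵀ * e * V'‖ ≤ (d / c) * (d' / c') *
      ∑ l ∈ H, ∑ l' ∈ H, ‖t l‖ * ‖(t l)ᵀ * e * t' l'‖ * ‖t' l'‖ := by
  have e1 := hV.eq_mul fun i => (hc.trans_le (h i)).ne'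
  have e2 := hV'.eq_mul fun i => (hc'.trans_le (h' i)).ne'
  set U := invTopEig (gramSum H t) d with hU
  set U' := invTopEig (gramSum H t') d' with hU'
  -- Substituting V = M V Λ⁻¹ on both sides puts the two Gram matrices, hence the t h themselves,
  -- next to the noise.
  have e3 : Vᵀ * e * V' = Uᵀ * Vᵀ * (gramSum H t * e * gramSum H t') * (V' * U') := by
    conv_lhs => rw [e1, e2]
    rw [Matrix.transpose_mul, Matrix.transpose_mul, gramSum_transpose]
    simp only [Matrix.mul_assoc]
  have e4 : ‖gramSum H t * e * gramSum H t'‖ ≤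
      ∑ l ∈ H, ∑ l' ∈ H, ‖t l‖ * ‖(t l)ᵀ * e * t' l'‖ * ‖t' l'‖ := by
    simp only [gramSum, Matrix.sum_mul, Matrix.mul_sum]
    refine (norm_sum_le _ _).trans ?_
    rw [Finset.sum_comm]
    refine Finset.sum_le_sum fun l _ => (norm_sum_le _ _).trans (Finset.sum_le_sum fun l' _ => ?_)
    have e5 : t l' * (t l')ᵀ * e * (t' l * (t' l)ᵀ) =
        t l' * ((t l')ᵀ * e * t' l) * (t' l)ᵀ := by simp only [Matrix.mul_assoc]
    rw [e5]
    refine (frob_mul_le _ _).trans ?_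
    rw [frob_transpose]
    exact mul_le_mul_of_nonneg_right (frob_mul_le _ _) (norm_nonneg _)
  have n1 : ‖Uᵀ * Vᵀ‖ ≤ d / c := by
    refine (frob_mul_le _ _).trans ?_
    rw [frob_transpose, frob_transpose, ← Real.sqrt_sq (norm_nonneg V),
      frob_sq_of_orthonormal hV.1]
    calc _ ≤ √d / c * √d := mul_le_mul_of_nonneg_right (norm_invTopEig_le hc h) (by positivity)
      _ = _ := by rw [div_mul_eq_mul_div, Real.mul_self_sqrt (Nat.cast_nonneg _)]
  have n2 : ‖V' * U'‖ ≤ d' / c' := by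
    refine (frob_mul_le _ _).trans ?_
    rw [← Real.sqrt_sq (norm_nonneg V'), frob_sq_of_orthonormal hV'.1]
    calc _ ≤ √d' * (√d' / c') := mul_le_mul_of_nonneg_left (norm_invTopEig_le hc' h') (by positivity)
      _ = _ := by rw [← mul_div_assoc, Real.mul_self_sqrt (Nat.cast_nonneg _)]
  rw [e3]
  calc _ ≤ ‖Uᵀ * Vᵀ‖ * ‖gramSum H t * e * gramSum H t'‖ * ‖V' * U'‖ := (frob_mul_le _ _).trans
        (mul_le_mul_of_nonneg_right (frob_mul_le _ _) (norm_nonneg _))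
    _ ≤ (d / c) * (∑ l ∈ H, ∑ l' ∈ H, ‖t l‖ * ‖(t l)ᵀ * e * t' l'‖ * ‖t' l'‖) * (d' / c') := by
        have : 0 ≤ ∑ l ∈ H, ∑ l' ∈ H, ‖t l‖ * ‖(t l)ᵀ * e * t' l'‖ * ‖t' l'‖ := by positivity
        gcongr
    _ = _ := by ring

end Flattening

/-! ### The loadings of vec F and their flattenings. -/

section Loadings

variable {P Q κ κ' J : Type*} [Fintype P] [Fintype Q] [Fintype κ] [Fintype κ'] [Fintype J]

/-- The matrix of `vec F ↦ R F Cᵀ`. -/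
def loadMat (R : Matrix P κ ℝ) (C : Matrix Q κ' ℝ) : Matrix (P × Q) (κ' × κ) ℝ :=
  Matrix.of fun x y => R x.1 y.2 * C x.2 y.1

theorem unc_mul_mul_transpose (R : Matrix P κ ℝ) (C : Matrix Q κ' ℝ) (F : Matrix κ κ' ℝ) :
    unc (R * F * Cᵀ) = loadMat R C *ᵥ F.vec := by
  ext x
  simp only [unc, loadMat, Matrix.mulVec, dotProduct, Matrix.of_apply, Fintype.sum_prod_type,
    Matrix.vec, Matrix.mul_apply, Matrix.transpose_apply, Finset.sum_mul]
  exact Finset.sum_congr rfl fun _ _ => Finset.sum_congr rfl fun _ _ => by ring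

theorem norm_loadMat (R : Matrix P κ ℝ) (C : Matrix Q κ' ℝ) : ‖loadMat R C‖ = ‖R‖ * ‖C‖ := by
  rw [← pow_left_inj₀ (norm_nonneg _) (by positivity) two_ne_zero, mul_pow, frob_sq, frob_sq,
    frob_sq, Finset.sum_mul_sum]
  simp only [loadMat, Matrix.of_apply, Fintype.sum_prod_type, mul_pow]
  refine Finset.sum_congr rfl fun a _ => Finset.sum_congr rfl fun i _ => ?_
  rw [Finset.sum_comm, Finset.sum_mul_sum]

/-- The row flattening has its columns in the column space of R, which is why M₁ identifies that
space. The column flattening does the same for C and M₂. -/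
theorem leftFlat_loadMat_mul (R : Matrix P κ ℝ) (C : Matrix Q κ' ℝ) (B : Matrix (κ' × κ) J ℝ) :
    leftFlat (loadMat R C * B) =
      R * Matrix.of fun c x => (C * leftFlat B) x.1 (c, x.2) := by
  ext a x
  simp only [leftFlat, loadMat, Matrix.mul_apply, Matrix.of_apply, Fintype.sum_prod_type,
    Finset.mul_sum]
  rw [Finset.sum_comm]
  exact Finset.sum_congr rfl fun _ _ => Finset.sum_congr rfl fun _ _ => by ring

theorem rightFlat_loadMat_mul (R : Matrix P κ ℝ) (C : Matrix Q κ' ℝ) (B : Matrix (κ' × κ) J ℝ) :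
    rightFlat (loadMat R C * B) =
      C * Matrix.of fun d x => (R * rightFlat B) x.1 (d, x.2) := by
  ext a x
  simp only [rightFlat, loadMat, Matrix.mul_apply, Matrix.of_apply, Fintype.sum_prod_type,
    Finset.mul_sum]
  exact Finset.sum_congr rfl fun _ _ => Finset.sum_congr rfl fun _ _ => by ring

variable [DecidableEq P] [DecidableEq Q] [DecidableEq κ] [DecidableEq κ']

/-- The two loadings are stripped off one at a time: R through the row flattening, then C from the
flattening of B. -/
theorem singVal_mul_singVal_mul_norm_le (R : Matrix P κ ℝ) (C : Matrix Q κ' ℝ)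
    (B : Matrix (κ' × κ) J ℝ) :
    singVal R (Fintype.card κ - 1) * singVal C (Fintype.card κ' - 1) * ‖B‖ ≤
      ‖loadMat R C * B‖ := by
  have h1 : ‖Matrix.of fun (c : κ) (x : Q × J) => (C * leftFlat B) x.1 (c, x.2)‖ =
      ‖C * leftFlat B‖ := by
    rw [← pow_left_inj₀ (norm_nonneg _) (norm_nonneg _) two_ne_zero, frob_sq, frob_sq]
    simp only [Fintype.sum_prod_type, Matrix.of_apply]
    exact Finset.sum_comm
  rw [← norm_leftFlat (loadMat R C * B), leftFlat_loadMat_mul, mul_assoc]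
  refine le_trans ?_ (singVal_last_mul_frob_le R _)
  refine mul_le_mul_of_nonneg_left ?_ (singVal_nonneg _ _)
  rw [h1, ← norm_leftFlat B]
  exact singVal_last_mul_frob_le C _

theorem singVal_sq_mul_norm_le (R : Matrix P κ ℝ) (C : Matrix Q κ' ℝ)
    (B : Matrix (κ' × κ) (κ' × κ) ℝ) :
    (singVal R (Fintype.card κ - 1) * singVal C (Fintype.card κ' - 1)) ^ 2 * ‖B‖ ≤
      ‖loadMat R C * B * (loadMat R C)ᵀ‖ := by
  have h1 := singVal_mul_singVal_mul_norm_le R C (B * (loadMat R C)ᵀ)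
  have h2 := singVal_mul_singVal_mul_norm_le R C Bᵀ
  rw [frob_transpose, ← frob_transpose (_ * _), Matrix.transpose_mul,
    Matrix.transpose_transpose] at h2
  rw [Matrix.mul_assoc]
  refine le_trans ?_ h1
  rw [sq, mul_assoc]
  exact mul_le_mul_of_nonneg_left h2 (mul_nonneg (singVal_nonneg _ _) (singVal_nonneg _ _))

end Loadings

/-! ### Left multiplication inside a cross moment. -/

section CrossMomentOfProduct

variable {P Q M J : Type*} [Fintype P] [Fintype Q] [Fintype M] [Fintype J]
  (c : ℝ) (S : Finset ℤ) (h : ℕ)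

/-- D acts on the first index of each pair only. Flattening that index gives the factor ‖D‖, whereas
the Frobenius norm of D ⊗ 1 would cost a further √q. -/
theorem norm_crossMoment_mul_left_le (D : Matrix P M ℝ) (X : ℤ → Matrix M Q ℝ) (v : ℤ → J → ℝ) :
    ‖crossMoment c S h (fun s => unc (D * X s)) v‖ ≤
      ‖D‖ * ‖crossMoment c S h (fun s => unc (X s)) v‖ := by
  have e : leftFlat (crossMoment c S h (fun s => unc (D * X s)) v) =
      D * leftFlat (crossMoment c S h (fun s => unc (X s)) v) := by
    ext a x
    simp only [leftFlat, crossMoment, unc, Matrix.of_apply, Matrix.mul_apply, Finset.mul_sum,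
      Finset.sum_mul]
    rw [Finset.sum_comm]
    exact Finset.sum_congr rfl fun _ _ => Finset.sum_congr rfl fun _ _ => by ring
  rw [← norm_leftFlat, e]
  refine (frob_mul_le _ _).trans ?_
  rw [norm_leftFlat]

theorem norm_crossMoment_mul_right_le (D : Matrix P M ℝ) (X : ℤ → Matrix M Q ℝ) (u : ℤ → J → ℝ) :
    ‖crossMoment c S h u (fun s => unc (D * X s))‖ ≤
      ‖D‖ * ‖crossMoment c S h u (fun s => unc (X s))‖ := by
  have e : leftFlat (crossMoment c S h u (fun s => unc (D * X s)))ᵀ =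
      D * leftFlat (crossMoment c S h u (fun s => unc (X s)))ᵀ := by
    ext a x
    simp only [leftFlat, crossMoment, unc, Matrix.of_apply, Matrix.mul_apply, Finset.mul_sum,
      Matrix.transpose_apply]
    rw [Finset.sum_comm]
    exact Finset.sum_congr rfl fun _ _ => Finset.sum_congr rfl fun _ _ => by ring
  rw [← frob_transpose, ← norm_leftFlat, e]
  refine (frob_mul_le _ _).trans ?_
  rw [norm_leftFlat, frob_transpose]

end CrossMomentOfProduct

/-! ### Sample and population autocovariances as tensors. -/

section Estimators

variable {p q : ℕ} (T : ℕ)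

/-- The lagged sample moments of a matrix process. -/
noncomputable def sampleTensor (T : ℕ) (W : ℤ → Matrix (Fin p) (Fin q) ℝ) (h : ℕ) :
    Matrix (Fin p × Fin q) (Fin p × Fin q) ℝ :=
  crossMoment ((T : ℝ) - h)⁻¹ (Finset.Icc (1 : ℤ) (T - h)) h (fun s => unc (W s))
    fun s => unc (W s)

theorem sampleOmega_apply (h : ℕ) (W : ℤ → Matrix (Fin p) (Fin q) ℝ) (i j : Fin q)
    (a b : Fin p) : sampleOmega T h W i j a b = sampleTensor T W h (a, i) (b, j) := by
  simp [sampleOmega, sampleTensor, crossMoment, unc, Matrix.sum_apply, Matrix.vecMulVec_apply]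

/-- A single tensor serves both estimators: its row flattening gives the matrix for Q₁, its column
flattening the one for Q₂. -/
theorem sampleM_eq_gramSum (h₀ : ℕ) (W : ℤ → Matrix (Fin p) (Fin q) ℝ) :
    sampleM T h₀ W = gramSum (Finset.Icc 1 h₀) fun h => leftFlat (sampleTensor T W h) := by
  unfold sampleM gramSum
  refine Finset.sum_congr rfl fun h _ => ?_
  ext a a'
  simp only [Matrix.sum_apply, Matrix.mul_apply, Matrix.transpose_apply, sampleOmega_apply,
    leftFlat, Matrix.of_apply, Fintype.sum_prod_type]
  exact Finset.sum_congr rfl fun i _ => Finset.sum_comm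

theorem sampleM_transpose_eq_gramSum (h₀ : ℕ) (W : ℤ → Matrix (Fin p) (Fin q) ℝ) :
    sampleM T h₀ (fun s => (W s)ᵀ) =
      gramSum (Finset.Icc 1 h₀) fun h => rightFlat (sampleTensor T W h) := by
  unfold sampleM gramSum
  refine Finset.sum_congr rfl fun h _ => ?_
  ext a a'
  simp only [Matrix.sum_apply, Matrix.mul_apply, Matrix.transpose_apply, sampleOmega_apply,
    rightFlat, Matrix.of_apply, Fintype.sum_prod_type]
  rfl

variable {Ω : Type*} [MeasurableSpace Ω] (μ : Measure Ω)

/-- The lagged autocovariances of a matrix process. -/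
noncomputable def popTensor (T : ℕ) (W : ℤ → Ω → Matrix (Fin p) (Fin q) ℝ) (h : ℕ) :
    Matrix (Fin p × Fin q) (Fin p × Fin q) ℝ :=
  Matrix.of fun x y => ((T : ℝ) - h)⁻¹ * ∑ s ∈ Finset.Icc (1 : ℤ) (T - h),
    cov[fun ω => W s ω x.1 x.2, fun ω => W (s + h) ω y.1 y.2; μ]

theorem avgLagCov_col_apply (h : ℕ) (W : ℤ → Ω → Matrix (Fin p) (Fin q) ℝ) (i j : Fin q)
    (a b : Fin p) :
    avgLagCov μ T h (fun t ω => (W t ω).col i) (fun t ω => (W t ω).col j) a b =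
      popTensor μ T W h (a, i) (b, j) := by
  simp [avgLagCov, popTensor, covMat, Matrix.sum_apply]

theorem popM_eq_gramSum (h₀ : ℕ) (W : ℤ → Ω → Matrix (Fin p) (Fin q) ℝ) :
    popM μ T h₀ W = gramSum (Finset.Icc 1 h₀) fun h => leftFlat (popTensor μ T W h) := by
  unfold popM gramSum
  refine Finset.sum_congr rfl fun h _ => ?_
  ext a a'
  simp only [Matrix.sum_apply, Matrix.mul_apply, Matrix.transpose_apply, avgLagCov_col_apply,
    leftFlat, Matrix.of_apply, Fintype.sum_prod_type]
  exact Finset.sum_congr rfl fun i _ => Finset.sum_comm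

theorem popM_transpose_eq_gramSum (h₀ : ℕ) (W : ℤ → Ω → Matrix (Fin p) (Fin q) ℝ) :
    popM μ T h₀ (fun s ω => (W s ω)ᵀ) =
      gramSum (Finset.Icc 1 h₀) fun h => rightFlat (popTensor μ T W h) := by
  unfold popM gramSum
  refine Finset.sum_congr rfl fun h _ => ?_
  ext a a'
  simp only [Matrix.sum_apply, Matrix.mul_apply, Matrix.transpose_apply, avgLagCov_col_apply,
    rightFlat, Matrix.of_apply, Fintype.sum_prod_type]
  rfl

end Estimators

/-! ### Deterministic decomposition of the signal error. -/

section FinalDecomposition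

variable {p q k r m : ℕ}

/-- The noise enters only through the k × r matrix Vᵀ e V'. Bounding e itself would cost its full
norm, of order √(pq). -/
theorem norm_signal_error_le {D : Matrix (Fin p) (Fin m) ℝ} {X : Matrix (Fin m) (Fin q) ℝ}
    {R : Matrix (Fin p) (Fin k) ℝ} {F : Matrix (Fin k) (Fin r) ℝ} {C : Matrix (Fin q) (Fin r) ℝ}
    {e : Matrix (Fin p) (Fin q) ℝ} {V : Matrix (Fin p) (Fin k) ℝ} {V' : Matrix (Fin q) (Fin r) ℝ}
    (hV : Vᵀ * V = 1) (hV' : V'ᵀ * V' = 1) :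
    ‖D * X + V * Vᵀ * (R * F * Cᵀ + e - D * X) * V' * V'ᵀ - R * F * Cᵀ‖ ≤
      (1 + k * r) * (‖D‖ * ‖X‖) + ‖R - V * Vᵀ * R‖ * (‖F‖ * ‖C‖) +
        k * (‖R‖ * ‖F‖ * ‖C - V' * V'ᵀ * C‖) + √k * √r * ‖Vᵀ * e * V'‖ := by
  have e1 : D * X + V * Vᵀ * (R * F * Cᵀ + e - D * X) * V' * V'ᵀ - R * F * Cᵀ =
      D * X - (V * Vᵀ) * (D * X) * (V' * V'ᵀ) - (R - V * Vᵀ * R) * (F * Cᵀ) -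
        V * Vᵀ * ((R * F) * (C - V' * V'ᵀ * C)ᵀ) + V * (Vᵀ * e * V') * V'ᵀ := by
    simp only [Matrix.transpose_sub, Matrix.transpose_mul, Matrix.transpose_transpose,
      Matrix.mul_sub, Matrix.sub_mul, Matrix.mul_add, Matrix.add_mul, Matrix.mul_assoc]
    abel
  have nV : ‖V‖ = √k := by rw [← frob_sq_of_orthonormal hV, Real.sqrt_sq (norm_nonneg _)]
  have nV' : ‖V'‖ = √r := by rw [← frob_sq_of_orthonormal hV', Real.sqrt_sq (norm_nonneg _)]
  have nVV : ‖V * Vᵀ‖ ≤ k := by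
    refine (frob_mul_le _ _).trans ?_
    rw [frob_transpose, nV, Real.mul_self_sqrt (Nat.cast_nonneg _)]
  have nVV' : ‖V' * V'ᵀ‖ ≤ r := by
    refine (frob_mul_le _ _).trans ?_
    rw [frob_transpose, nV', Real.mul_self_sqrt (Nat.cast_nonneg _)]
  have b1 : ‖D * X‖ ≤ ‖D‖ * ‖X‖ := frob_mul_le _ _
  have b2 : ‖(V * Vᵀ) * (D * X) * (V' * V'ᵀ)‖ ≤ k * (‖D‖ * ‖X‖) * r := by
    refine (frob_mul_le _ _).trans ?_
    refine mul_le_mul ((frob_mul_le _ _).trans ?_) nVV' (norm_nonneg _) (by positivity)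
    exact mul_le_mul nVV b1 (norm_nonneg _) (by positivity)
  have b3 : ‖(R - V * Vᵀ * R) * (F * Cᵀ)‖ ≤ ‖R - V * Vᵀ * R‖ * (‖F‖ * ‖C‖) := by
    refine (frob_mul_le _ _).trans (mul_le_mul_of_nonneg_left ?_ (norm_nonneg _))
    rw [← frob_transpose C]
    exact frob_mul_le _ _
  have b4 : ‖V * Vᵀ * ((R * F) * (C - V' * V'ᵀ * C)ᵀ)‖ ≤
      k * (‖R‖ * ‖F‖ * ‖C - V' * V'ᵀ * C‖) := by
    refine (frob_mul_le _ _).trans (mul_le_mul nVV ?_ (norm_nonneg _) (Nat.cast_nonneg _))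
    refine (frob_mul_le _ _).trans ?_
    rw [frob_transpose]
    exact mul_le_mul_of_nonneg_right (frob_mul_le _ _) (norm_nonneg _)
  have b5 : ‖V * (Vᵀ * e * V') * V'ᵀ‖ ≤ √k * √r * ‖Vᵀ * e * V'‖ := by
    refine (frob_mul_le _ _).trans ?_
    rw [frob_transpose, nV']
    calc _ ≤ ‖V‖ * ‖Vᵀ * e * V'‖ * √r :=
          mul_le_mul_of_nonneg_right (frob_mul_le _ _) (Real.sqrt_nonneg _)
      _ = _ := by rw [nV]; ring
  rw [e1]
  refine (norm_add_le _ _).trans ?_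
  have s1 := norm_sub_le (D * X - (V * Vᵀ) * (D * X) * (V' * V'ᵀ) - (R - V * Vᵀ * R) * (F * Cᵀ))
    (V * Vᵀ * ((R * F) * (C - V' * V'ᵀ * C)ᵀ))
  have s2 := norm_sub_le (D * X - (V * Vᵀ) * (D * X) * (V' * V'ᵀ)) ((R - V * Vᵀ * R) * (F * Cᵀ))
  have s3 := norm_sub_le (D * X) ((V * Vᵀ) * (D * X) * (V' * V'ᵀ))
  linarith

end FinalDecomposition

end MatFactor

/-! ### The triangular array, its rates and its cross moments. -/

namespace MatFactor

open scoped Matrix.Norms.Frobenius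

/-- A triangular array of matrix factor models with mixing, moment and strength bounds that are
uniform along the array; `νR²` and `νC²` are the orders of the squared loadings. -/
structure FactorModel {Ω : Type*} [MeasurableSpace Ω] (μ : Measure Ω) (k r m : ℕ) where
  (p q T : ℕ → ℕ)
  A : ∀ n, Matrix (Fin (p n)) (Fin m) ℝ
  R : ∀ n, Matrix (Fin (p n)) (Fin k) ℝ
  C : ∀ n, Matrix (Fin (q n)) (Fin r) ℝ
  X : ∀ n, ℤ → Ω → Matrix (Fin m) (Fin (q n)) ℝ
  F : ∀ _n : ℕ, ℤ → Ω → Matrix (Fin k) (Fin r) ℝ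
  E : ∀ n, ℤ → Ω → Matrix (Fin (p n)) (Fin (q n)) ℝ
  field : ℕ → ℤ → MeasurableSpace Ω
  (γ K mixBound σ loadBound loadLow gramLow : ℝ)
  α : ℕ → ℕ → ℝ
  (νR νC : ℕ → ℝ)
  two_lt : 2 < γ
  K_pos : 0 < K
  σ_nonneg : 0 ≤ σ
  loadLow_pos : 0 < loadLow
  gramLow_pos : 0 < gramLow
  tendsto_p : Tendsto p atTop atTop
  tendsto_q : Tendsto q atTop atTop
  tendsto_T : Tendsto T atTop atTop
  mixing : ∀ n, Mixing μ (field n) γ (α n) mixBound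
  decay : ∀ n (l : ℕ), 1 ≤ l → (l : ℝ) * α n l ^ (1 - 2 / γ) ≤ mixBound
  boundedX : ∀ n, BoundedProc μ (field n) γ K (T n) fun s ω => unc (X n s ω)
  boundedF : ∀ n, BoundedProc μ (field n) γ K (T n) fun s ω => (F n s ω).vec
  boundedE : ∀ n, BoundedProc μ (field n) γ K (T n) fun s ω => unc (E n s ω)
  noise : ∀ n, ∀ s ∈ Finset.Icc (1 : ℤ) (T n), NoiseMat μ γ K σ (E n s)
  orth_EE : ∀ n, ∀ s ∈ Finset.Icc (1 : ℤ) (T n), ∀ t ∈ Finset.Icc (1 : ℤ) (T n), s ≠ t →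
    ∀ x y, ∫ ω, unc (E n s ω) x * unc (E n t ω) y ∂μ = 0
  orth_EX : ∀ n, ∀ s ∈ Finset.Icc (1 : ℤ) (T n), ∀ t ∈ Finset.Icc (1 : ℤ) (T n),
    ∀ x y, ∫ ω, unc (E n s ω) x * unc (X n t ω) y ∂μ = 0
  orth_EF : ∀ n, ∀ s ∈ Finset.Icc (1 : ℤ) (T n), ∀ t ∈ Finset.Icc (1 : ℤ) (T n),
    ∀ x y, ∫ ω, unc (E n s ω) x * (F n t ω).vec y ∂μ = 0
  orth_FX : ∀ n, ∀ s ∈ Finset.Icc (1 : ℤ) (T n),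
    ∀ x y, ∫ ω, (F n s ω).vec x * unc (X n s ω) y ∂μ = 0
  mean_E : ∀ n, ∀ s ∈ Finset.Icc (1 : ℤ) (T n), ∀ x, ∫ ω, unc (E n s ω) x ∂μ = 0
  mean_F : ∀ n, ∀ s ∈ Finset.Icc (1 : ℤ) (T n), ∀ x, ∫ ω, (F n s ω).vec x ∂μ = 0
  νR_mem : ∀ᶠ n in atTop, 1 ≤ νR n ∧ νR n ≤ √(p n)
  νC_mem : ∀ᶠ n in atTop, 1 ≤ νC n ∧ νC n ≤ √(q n)
  norm_R_le : ∀ᶠ n in atTop, ‖R n‖ ≤ loadBound * νR n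
  norm_C_le : ∀ᶠ n in atTop, ‖C n‖ ≤ loadBound * νC n
  le_singVal_R : ∀ᶠ n in atTop, loadLow * νR n ≤ singVal (R n) (k - 1)
  le_singVal_C : ∀ᶠ n in atTop, loadLow * νC n ≤ singVal (C n) (r - 1)
  gram : ∀ᶠ n in atTop, ∀ x : Fin m → ℝ, gramLow * q n * (x ⬝ᵥ x) ≤
    x ⬝ᵥ ((T n : ℝ)⁻¹ • ∑ t ∈ Finset.Icc (1 : ℤ) (T n), secondMoment μ (X n t)) *ᵥ x
  growth : Tendsto (fun n => (√(p n) * √(q n)) ^ 2 / ((νR n * νC n) ^ 2 * √(T n))) atTop (𝓝 0)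

namespace FactorModel

variable {Ω : Type*} [MeasurableSpace Ω] {μ : Measure Ω} {k r m : ℕ}
  (M : FactorModel μ k r m)

/-- `√(pq)`. -/
noncomputable def g (n : ℕ) : ℝ := √(M.p n) * √(M.q n)

/-- The order of the norm of the loadings of `vec F`. -/
noncomputable def ν (n : ℕ) : ℝ := M.νR n * M.νC n

/-- The relative order of the error of the sample autocovariances. -/
noncomputable def ρ (n : ℕ) : ℝ := M.g n ^ 2 / (M.ν n ^ 2 * √(M.T n))

theorem g_sq (n : ℕ) : M.g n ^ 2 = M.p n * M.q n := by
  rw [g, mul_pow, Real.sq_sqrt (Nat.cast_nonneg _), Real.sq_sqrt (Nat.cast_nonneg _)]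

/-- The inequality g² ≤ ν²√T says that ρ ≤ 1, and 2h ≤ T keeps T - h at least T/2. -/
theorem eventually_rates (h : ℕ) : ∀ᶠ n in atTop, 1 ≤ √(M.p n) ∧ 1 ≤ √(M.q n) ∧ 1 ≤ √(M.T n) ∧
    1 ≤ M.ν n ∧ M.ν n ≤ M.g n ∧ M.g n ^ 2 ≤ M.ν n ^ 2 * √(M.T n) ∧ 2 * h ≤ M.T n := by
  filter_upwards [M.tendsto_p.eventually_ge_atTop 1, M.tendsto_q.eventually_ge_atTop 1,
    M.tendsto_T.eventually_ge_atTop (2 * h + 1), M.νR_mem, M.νC_mem,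
    M.growth.eventually (gt_mem_nhds one_pos)] with n h1 h2 h3 h4 h5 h6
  have hT : (1 : ℝ) ≤ √(M.T n) := Real.one_le_sqrt.2 (by exact_mod_cast (by omega : 1 ≤ M.T n))
  refine ⟨Real.one_le_sqrt.2 (by exact_mod_cast h1), Real.one_le_sqrt.2 (by exact_mod_cast h2),
    hT, one_le_mul_of_one_le_of_one_le h4.1 h5.1,
    mul_le_mul h4.2 h5.2 (by linarith) (Real.sqrt_nonneg _), ?_, by omega⟩
  have hν : 0 < M.νR n * M.νC n := mul_pos (by linarith) (by linarith)
  rw [div_lt_one (by positivity)] at h6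
  exact h6.le

theorem tendsto_ρ : Tendsto M.ρ atTop (𝓝 0) := M.growth

variable {M}

section CrossMoments

variable [IsProbabilityMeasure μ] {I J : ℕ → Type} [∀ n, Fintype (I n)] [∀ n, Fintype (J n)]
  {u : ∀ n, ℤ → Ω → I n → ℝ} {v : ∀ n, ℤ → Ω → J n → ℝ} {h : ℕ} {S : ℕ → Finset ℤ} {b : ℕ → ℝ}
  {B : ℝ}

theorem inv_sub_le {T h : ℕ} (hT : 0 < T) (h2 : 2 * h ≤ T) : ((T : ℝ) - h)⁻¹ ≤ 2 / T := by
  have h1 : (0 : ℝ) < T := by exact_mod_cast hT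
  have h3 : 2 * (h : ℝ) ≤ T := by exact_mod_cast h2
  rw [← inv_div]
  exact inv_anti₀ (by positivity) (by linarith)

theorem card_le_of_admissible {T h : ℕ} (hT : h ≤ T) {S : Finset ℤ} (hS : Admissible T h S) :
    (S.card : ℝ) ≤ T - h := by
  have h1 : S ⊆ Finset.Icc (1 : ℤ) (T - h) := fun s hs => by
    have := hS s hs
    simp only [Finset.mem_Icc]
    omega
  have h2 := Finset.card_le_card h1
  simp only [Int.card_Icc] at h2
  have h3 : S.card ≤ T - h := by omega
  rw [← Nat.cast_sub hT]
  exact_mod_cast h3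

/-- Chebyshev with the variance bound; the factor 4 comes from (T - h)⁻¹ ≤ 2/T. The cardinality of
`S n` is kept, so that sums over a short window get a better rate. -/
theorem isBigOp_crossMoment_sub
    (hu : ∀ n, BoundedProc μ (M.field n) M.γ M.K (M.T n) (u n))
    (hv : ∀ n, BoundedProc μ (M.field n) M.γ M.K (M.T n) (v n))
    (hS : ∀ n, Admissible (M.T n) h (S n)) (hb0 : ∀ᶠ n in atTop, 0 < b n)
    (hb : ∀ᶠ n in atTop, ((S n).card : ℝ) * (Fintype.card (I n) * Fintype.card (J n)) ≤
      B * (M.T n * b n) ^ 2) :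
    IsBigOp μ (fun n ω => ‖crossMoment ((M.T n : ℝ) - h)⁻¹ (S n) h (fun t => u n t ω)
      (fun t => v n t ω) - meanCross μ ((M.T n : ℝ) - h)⁻¹ (S n) h (u n) (v n)‖) b := by
  refine IsBigOp.of_integral_sq (C := 4 * |varConst M.γ M.K M.mixBound h| * B) hb0 ?_
  filter_upwards [hb, M.eventually_rates h, M.tendsto_T.eventually_gt_atTop 0] with n hn hr hT
  obtain ⟨h1, h2⟩ := (hu n).integral_norm_crossMoment_sub_sq_le (hv n) (M.mixing n) M.two_lt
    M.K_pos (hS n) (c := ((M.T n : ℝ) - h)⁻¹)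
  refine ⟨h1, h2.trans ?_⟩
  have hT' : (0 : ℝ) < M.T n := by exact_mod_cast hT
  have hc := inv_sub_le hT hr.2.2.2.2.2.2
  have hc0 : 0 ≤ ((M.T n : ℝ) - h)⁻¹ := by
    have : 2 * (h : ℝ) ≤ M.T n := by exact_mod_cast hr.2.2.2.2.2.2
    exact inv_nonneg.2 (by linarith [Nat.cast_nonneg (α := ℝ) h])
  set V := varConst M.γ M.K M.mixBound h
  calc _ = ((M.T n : ℝ) - h)⁻¹ ^ 2 * V *
        ((S n).card * (Fintype.card (I n) * Fintype.card (J n))) := by ring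
    _ ≤ (2 / M.T n) ^ 2 * |V| * (B * (M.T n * b n) ^ 2) := by
        refine mul_le_mul ?_ hn (by positivity) (by positivity)
        exact (mul_le_mul_of_nonneg_left (le_abs_self V) (sq_nonneg _)).trans
          (mul_le_mul_of_nonneg_right (pow_le_pow_left₀ hc0 hc 2) (abs_nonneg _))
    _ = _ := by field_simp; ring

theorem isBigOp_crossMoment_of_orth
    (hu : ∀ n, BoundedProc μ (M.field n) M.γ M.K (M.T n) (u n))
    (hv : ∀ n, BoundedProc μ (M.field n) M.γ M.K (M.T n) (v n))
    (hS : ∀ n, Admissible (M.T n) h (S n))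
    (h0 : ∀ n, ∀ s ∈ S n, ∀ i j, ∫ ω, u n s ω i * v n (s + h) ω j ∂μ = 0)
    (hb0 : ∀ᶠ n in atTop, 0 < b n)
    (hb : ∀ᶠ n in atTop, ((S n).card : ℝ) * (Fintype.card (I n) * Fintype.card (J n)) ≤
      B * (M.T n * b n) ^ 2) :
    IsBigOp μ (fun n ω => ‖crossMoment ((M.T n : ℝ) - h)⁻¹ (S n) h (fun t => u n t ω)
      (fun t => v n t ω)‖) b := by
  have key := isBigOp_crossMoment_sub hu hv hS hb0 hb
  have h1 : ∀ n, meanCross μ ((M.T n : ℝ) - h)⁻¹ (S n) h (u n) (v n) = 0 := fun n => by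
    ext i j
    rw [meanCross, Matrix.of_apply, Finset.sum_eq_zero fun s hs => h0 n s hs i j]
    simp
  simpa only [h1, sub_zero] using key

theorem isBigOp_crossMoment
    (hu : ∀ n, BoundedProc μ (M.field n) M.γ M.K (M.T n) (u n))
    (hv : ∀ n, BoundedProc μ (M.field n) M.γ M.K (M.T n) (v n))
    (hS : ∀ n, Admissible (M.T n) h (S n)) (hb0 : ∀ᶠ n in atTop, 0 < b n)
    (hb : ∀ᶠ n in atTop, (Fintype.card (I n) * Fintype.card (J n) : ℝ) ≤ B * b n ^ 2) :
    IsBigOp μ (fun n ω => ‖crossMoment ((M.T n : ℝ) - h)⁻¹ (S n) h (fun t => u n t ω)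
      (fun t => v n t ω)‖) b := by
  refine IsBigOp.of_integral_sq (C := (1 + 2 * M.K) * B) hb0 ?_
  filter_upwards [hb, M.tendsto_T.eventually_gt_atTop h] with n hn hT
  obtain ⟨h1, h2⟩ := (hu n).integral_norm_crossMoment_sq_le (hv n) (M.mixing n) M.two_lt
    (hS n) (c := ((M.T n : ℝ) - h)⁻¹)
  refine ⟨h1, h2.trans ?_⟩
  have hT' : (0 : ℝ) < (M.T n : ℝ) - h := sub_pos.2 (by exact_mod_cast hT)
  have hc : ((M.T n : ℝ) - h)⁻¹ * (S n).card ≤ 1 := by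
    rw [inv_mul_le_iff₀ hT', mul_one]
    exact card_le_of_admissible hT.le (hS n)
  have hK := M.K_pos
  calc _ ≤ 1 ^ 2 * (1 + 2 * M.K) * (B * b n ^ 2) := by gcongr
    _ = _ := by ring

end CrossMoments

/-! ### Partial traces of cross moments. -/

section DiagonalSums

/-- Partial trace over the second index. -/
def diagSum {P P' Q : Type*} [Fintype Q] (Z : Matrix (P × Q) (P' × Q) ℝ) : Matrix P P' ℝ :=
  Matrix.of fun a b => ∑ j, Z (a, j) (b, j)

variable [IsProbabilityMeasure μ] {P P' Q : ℕ → Type} [∀ n, Fintype (P n)] [∀ n, Fintype (P' n)]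
  [∀ n, Fintype (Q n)] {u : ∀ n, ℤ → Ω → P n × Q n → ℝ} {v : ∀ n, ℤ → Ω → P' n × Q n → ℝ}
  {b : ℕ → ℝ} {B : ℝ}

/-- Cauchy-Schwarz over the traced index costs a factor |Q|, since dependence across that index is
not restricted. -/
theorem isBigOp_diagSum_crossMoment_sub
    (hu : ∀ n, BoundedProc μ (M.field n) M.γ M.K (M.T n) (u n))
    (hv : ∀ n, BoundedProc μ (M.field n) M.γ M.K (M.T n) (v n))
    (hb0 : ∀ᶠ n in atTop, 0 < b n)
    (hb : ∀ᶠ n in atTop, (Fintype.card (P n) * Fintype.card (P' n) * Fintype.card (Q n) ^ 2 : ℝ) ≤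
      B * (√(M.T n) * b n) ^ 2) :
    IsBigOp μ (fun n ω => ‖diagSum (crossMoment (M.T n : ℝ)⁻¹ (Finset.Icc (1 : ℤ) (M.T n)) 0
      (fun t => u n t ω) (fun t => v n t ω) -
      meanCross μ (M.T n : ℝ)⁻¹ (Finset.Icc (1 : ℤ) (M.T n)) 0 (u n) (v n))‖) b := by
  refine IsBigOp.of_integral_sq (C := |varConst M.γ M.K M.mixBound 0| * B) hb0 ?_
  filter_upwards [hb, M.tendsto_T.eventually_gt_atTop 0] with n hn hT
  set S := Finset.Icc (1 : ℤ) (M.T n) with hSdef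
  have hS : Admissible (M.T n) 0 S := fun s hs => by
    simpa [hSdef] using hs
  have hcard : (S.card : ℝ) = M.T n := by simp [hSdef]
  have hT' : (0 : ℝ) < M.T n := by exact_mod_cast hT
  set V := varConst M.γ M.K M.mixBound 0
  set Z : Ω → Matrix (P n × Q n) (P' n × Q n) ℝ := fun ω =>
    crossMoment (M.T n : ℝ)⁻¹ S 0 (fun t => u n t ω) (fun t => v n t ω) -
      meanCross μ (M.T n : ℝ)⁻¹ S 0 (u n) (v n) with hZ
  have key : ∀ i j, Integrable (fun ω => Z ω i j ^ 2) μ ∧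
      ∫ ω, Z ω i j ^ 2 ∂μ ≤ (M.T n : ℝ)⁻¹ ^ 2 * (V * S.card) := fun i j =>
    (hu n).integral_crossMoment_sub_sq_le (hv n) (M.mixing n) M.two_lt M.K_pos hS i j
  have hm : ∀ i j, Measurable fun ω => Z ω i j := fun i j => by
    simp only [hZ, Matrix.sub_apply, crossMoment, Matrix.of_apply]
    exact ((Finset.measurable_fun_sum _ fun s _ => ((hu n).measurable (M.mixing n) s i).mul
      ((hv n).measurable (M.mixing n) (s + (0 : ℕ)) j)).const_mul _).sub_const _
  have hpt : ∀ ω, ‖diagSum (Z ω)‖ ^ 2 ≤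
      Fintype.card (Q n) * ∑ a, ∑ b, ∑ j, Z ω (a, j) (b, j) ^ 2 := fun ω => by
    rw [frob_sq]
    simp only [diagSum, Matrix.of_apply, Finset.mul_sum (a := (Fintype.card (Q n) : ℝ))]
    refine Finset.sum_le_sum fun a _ => Finset.sum_le_sum fun b _ => ?_
    rw [← Finset.mul_sum]
    exact sq_sum_le_card_mul_sum_sq
  have hd : Integrable (fun ω => (Fintype.card (Q n) : ℝ) *
      ∑ a, ∑ b, ∑ j, Z ω (a, j) (b, j) ^ 2) μ :=
    (integrable_finsetSum _ fun a _ => integrable_finsetSum _ fun b _ =>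
      integrable_finsetSum _ fun j _ => (key _ _).1).const_mul _
  have hi : Integrable (fun ω => ‖diagSum (Z ω)‖ ^ 2) μ := by
    refine Integrable.mono' hd ((measurable_frob fun a b => ?_).pow_const 2).aestronglyMeasurable
      (Eventually.of_forall fun ω => ?_)
    · exact Finset.measurable_fun_sum _ fun j _ => hm _ _
    · rw [Real.norm_eq_abs, abs_of_nonneg (sq_nonneg _)]
      exact hpt ω
  refine ⟨hi, (integral_mono hi hd hpt).trans ?_⟩
  rw [integral_const_mul, integral_finsetSum _ fun a _ => integrable_finsetSum _ fun b _ =>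
      integrable_finsetSum _ fun j _ => (key _ _).1]
  have h1 : ∑ a, ∫ ω, ∑ b, ∑ j, Z ω (a, j) (b, j) ^ 2 ∂μ ≤
      ∑ _a : P n, ∑ _b : P' n, ∑ _j : Q n, (M.T n : ℝ)⁻¹ ^ 2 * (V * S.card) := by
    refine Finset.sum_le_sum fun a _ => ?_
    rw [integral_finsetSum _ fun b _ => integrable_finsetSum _ fun j _ => (key _ _).1]
    refine Finset.sum_le_sum fun b _ => ?_
    rw [integral_finsetSum _ fun j _ => (key _ _).1]
    exact Finset.sum_le_sum fun j _ => (key _ _).2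
  calc _ ≤ (Fintype.card (Q n) : ℝ) *
        ∑ _a : P n, ∑ _b : P' n, ∑ _j : Q n, (M.T n : ℝ)⁻¹ ^ 2 * (V * S.card) := by gcongr
    _ = (M.T n : ℝ)⁻¹ * V *
        (Fintype.card (P n) * Fintype.card (P' n) * Fintype.card (Q n) ^ 2) := by
        simp only [Finset.sum_const, Finset.card_univ, nsmul_eq_mul, hcard]
        field_simp
    _ ≤ (M.T n : ℝ)⁻¹ * |V| * (B * (√(M.T n) * b n) ^ 2) := by
        refine mul_le_mul ?_ hn (by positivity) (by positivity)
        exact mul_le_mul_of_nonneg_left (le_abs_self V) (by positivity)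
    _ = _ := by
        rw [mul_pow, Real.sq_sqrt hT'.le]
        field_simp

end DiagonalSums

end FactorModel

end MatFactor

namespace MatFactor

open scoped Matrix.Norms.Frobenius

/-! ### The least squares estimator of A. -/

section CoerciveMatrix

variable {ι P : Type*} [Fintype ι] [DecidableEq ι] [Fintype P] {G : Matrix ι ι ℝ} {c : ℝ}

theorem isUnit_det_of_coercive (hc : 0 < c) (hG : ∀ x, c * (x ⬝ᵥ x) ≤ x ⬝ᵥ G *ᵥ x) :
    IsUnit G.det := by
  rw [← Matrix.isUnit_iff_isUnit_det, ← Matrix.mulVec_injective_iff_isUnit]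
  refine (injective_iff_map_eq_zero G.mulVecLin).2 fun x hx => ?_
  have h1 := hG x
  rw [show G *ᵥ x = 0 from hx, dotProduct_zero] at h1
  have h2 : x ⬝ᵥ x ≤ 0 := by
    by_contra hcon
    have := mul_pos hc (not_le.1 hcon)
    linarith
  rw [dotProduct_self_eq_norm_sq] at h2
  have h3 : WithLp.toLp 2 x = 0 := by
    have := sq_eq_zero_iff.1 (le_antisymm h2 (sq_nonneg _))
    exact norm_eq_zero.1 this
  simpa using h3

theorem mul_norm_le_norm_mul_of_coercive (hG : ∀ x, c * (x ⬝ᵥ x) ≤ x ⬝ᵥ G *ᵥ x)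
    (D : Matrix P ι ℝ) : c * ‖D‖ ≤ ‖D * G‖ := by
  have h1 : c * ‖D‖ ^ 2 ≤ ‖D‖ * ‖D * G‖ := by
    have h2 : ∀ x : ι → ℝ, c * (x ⬝ᵥ x) ≤ x ⬝ᵥ Matrix.vecMul x G := fun x =>
      (hG x).trans (le_of_eq (by rw [Matrix.dotProduct_mulVec, dotProduct_comm]))
    have h3 : ∀ Z : Matrix P ι ℝ, ∑ x : P × ι, Z x.1 x.2 ^ 2 = ‖Z‖ ^ 2 := fun Z => by
      rw [frob_sq, Fintype.sum_prod_type]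
    calc c * ‖D‖ ^ 2 = ∑ a, c * (D a ⬝ᵥ D a) := by
          rw [frob_sq, Finset.mul_sum]
          simp [dotProduct, sq]
      _ ≤ ∑ a, D a ⬝ᵥ (D * G) a := Finset.sum_le_sum fun a _ => h2 (D a)
      _ = ∑ x : P × ι, D x.1 x.2 * (D * G) x.1 x.2 := by
          simp [dotProduct, Fintype.sum_prod_type]
      _ ≤ √(∑ x : P × ι, D x.1 x.2 ^ 2) * √(∑ x : P × ι, (D * G) x.1 x.2 ^ 2) :=
          Real.sum_mul_le_sqrt_mul_sqrt _ _ _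
      _ = _ := by
          rw [h3, h3, Real.sqrt_sq (norm_nonneg _), Real.sqrt_sq (norm_nonneg _)]
  rcases (norm_nonneg D).eq_or_lt with h | h
  · rw [← h, mul_zero]; exact norm_nonneg _
  · rw [sq] at h1
    exact le_of_mul_le_mul_left (by linarith) h

end CoerciveMatrix

namespace FactorModel

variable {Ω : Type*} [MeasurableSpace Ω] {μ : Measure Ω} {k r m : ℕ} {M : FactorModel μ k r m}

section LeastSquares

variable (M)

/-- The observations. -/
def Y (n : ℕ) (t : ℤ) (ω : Ω) : Matrix (Fin (M.p n)) (Fin (M.q n)) ℝ :=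
  observation (M.A n) (M.R n) (M.C n) (M.X n t ω) (M.F n t ω) (M.E n t ω)

/-- The unobserved part of the model. -/
def W (n : ℕ) (t : ℤ) (ω : Ω) : Matrix (Fin (M.p n)) (Fin (M.q n)) ℝ :=
  residual (M.R n) (M.C n) (M.F n t ω) (M.E n t ω)

/-- The estimation error of the least squares estimator. -/
noncomputable def dev (n : ℕ) (ω : Ω) : Matrix (Fin (M.p n)) (Fin m) ℝ :=
  lsEstimator (M.T n) (fun t => M.Y n t ω) (fun t => M.X n t ω) - M.A n

/-- The sample second moment matrix of the regressors. -/
noncomputable def gramX (n : ℕ) (ω : Ω) : Matrix (Fin m) (Fin m) ℝ :=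
  (M.T n : ℝ)⁻¹ • ∑ t ∈ Finset.Icc (1 : ℤ) (M.T n), M.X n t ω * (M.X n t ω)ᵀ

/-- The sample cross moment matrix of the unobserved part and the regressors. -/
noncomputable def crossWX (n : ℕ) (ω : Ω) : Matrix (Fin (M.p n)) (Fin m) ℝ :=
  (M.T n : ℝ)⁻¹ • ∑ t ∈ Finset.Icc (1 : ℤ) (M.T n), M.W n t ω * (M.X n t ω)ᵀ

theorem residualEst_eq (n : ℕ) (t : ℤ) (ω : Ω) :
    residualEst (M.T n) (fun t => M.Y n t ω) (fun t => M.X n t ω) t =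
      M.W n t ω - M.dev n ω * M.X n t ω := by
  simp only [residualEst, dev, Y, W, observation, residual, Matrix.sub_mul]
  abel

variable {M}

/-- The normal equations. Invertibility matters because the matrix inverse is zero by convention at
singular matrices. -/
theorem dev_mul_gramX {n : ℕ} {ω : Ω} (h : IsUnit (M.gramX n ω).det) :
    M.dev n ω * M.gramX n ω = M.crossWX n ω := by
  have h1 : (M.T n : ℝ)⁻¹ • ∑ t ∈ Finset.Icc (1 : ℤ) (M.T n), M.Y n t ω * (M.X n t ω)ᵀ =
      M.A n * M.gramX n ω + M.crossWX n ω := by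
    have h2 : ∀ t, M.Y n t ω * (M.X n t ω)ᵀ =
        M.A n * (M.X n t ω * (M.X n t ω)ᵀ) + M.W n t ω * (M.X n t ω)ᵀ := fun t => by
      simp only [Y, W, observation, residual, Matrix.add_mul, Matrix.mul_assoc]
      abel
    simp only [h2, Finset.sum_add_distrib, smul_add, gramX, crossWX, Matrix.mul_smul,
      Matrix.mul_sum]
  have h3 : lsEstimator (M.T n) (fun t => M.Y n t ω) (fun t => M.X n t ω) =
      (M.A n * M.gramX n ω + M.crossWX n ω) * (M.gramX n ω)⁻¹ := by
    rw [← h1]; rfl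
  rw [dev, h3, Matrix.sub_mul, Matrix.mul_assoc, Matrix.nonsing_inv_mul _ h, Matrix.mul_one]
  abel

theorem smul_sum_mul_transpose_eq_diagSum {P P' Q : Type*} [Fintype Q] (T : ℕ)
    (U : ℤ → Matrix P Q ℝ) (V : ℤ → Matrix P' Q ℝ) :
    (T : ℝ)⁻¹ • ∑ t ∈ Finset.Icc (1 : ℤ) T, U t * (V t)ᵀ =
      diagSum (crossMoment (T : ℝ)⁻¹ (Finset.Icc (1 : ℤ) T) 0 (fun t => unc (U t))
        fun t => unc (V t)) := by
  ext a b
  simp only [Matrix.smul_apply, Matrix.sum_apply, Matrix.mul_apply, Matrix.transpose_apply,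
    diagSum, crossMoment, unc, Matrix.of_apply, smul_eq_mul, Nat.cast_zero, add_zero,
    ← Finset.mul_sum]
  rw [Finset.sum_comm]

variable [IsProbabilityMeasure μ]

theorem diagSum_meanCross_XX (n : ℕ) :
    diagSum (meanCross μ (M.T n : ℝ)⁻¹ (Finset.Icc (1 : ℤ) (M.T n)) 0 (fun t ω => unc (M.X n t ω))
      fun t ω => unc (M.X n t ω)) =
    (M.T n : ℝ)⁻¹ • ∑ t ∈ Finset.Icc (1 : ℤ) (M.T n), secondMoment μ (M.X n t) := by
  ext a b
  simp only [Matrix.smul_apply, Matrix.sum_apply, Matrix.mul_apply, Matrix.transpose_apply,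
    diagSum, meanCross, unc, Matrix.of_apply, smul_eq_mul, Nat.cast_zero, add_zero,
    ← Finset.mul_sum, secondMoment]
  rw [Finset.sum_comm]
  congr 1
  refine Finset.sum_congr rfl fun t ht => ?_
  rw [integral_finsetSum _ fun j _ => ?_]
  exact (M.boundedX n).integrable_mul (M.boundedX n) (M.mixing n) M.two_lt ht ht (a, j) (b, j)

/-- The sample Gram matrix deviates from its mean by O_p(q/√T), while the mean is coercive with a
constant of order q, half of which is given up. -/
theorem gramX_coercive : HoldsWhp μ fun n ω => ∀ x : Fin m → ℝ,
    M.gramLow / 2 * M.q n * (x ⬝ᵥ x) ≤ x ⬝ᵥ M.gramX n ω *ᵥ x := by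
  have h1 := isBigOp_diagSum_crossMoment_sub M.boundedX M.boundedX (B := (m : ℝ) * m)
    (b := fun n => (√(M.T n))⁻¹ * M.q n)
    (by filter_upwards [M.tendsto_q.eventually_gt_atTop 0, M.tendsto_T.eventually_gt_atTop 0] with n h1 h2
        positivity)
    (by filter_upwards [M.tendsto_T.eventually_gt_atTop 0] with n h2
        have : √(M.T n : ℝ) ≠ 0 := by positivity
        rw [mul_inv_cancel_left₀ this]
        simp)
  have h2 : IsBigOp μ (fun n ω => (M.q n : ℝ)⁻¹ * ‖M.gramX n ω -
      (M.T n : ℝ)⁻¹ • ∑ t ∈ Finset.Icc (1 : ℤ) (M.T n), secondMoment μ (M.X n t)‖)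
      fun n => (√(M.T n))⁻¹ := by
    have h3 : IsBigOp μ (fun n (_ : Ω) => (M.q n : ℝ)⁻¹) fun n => (M.q n : ℝ)⁻¹ :=
      IsBigOp.of_le (C := 1) (Eventually.of_forall fun n ω => by
        rw [one_mul, abs_of_nonneg (by positivity)])
    refine ((h3.mul h1 (Eventually.of_forall fun n => by positivity)
      (Eventually.of_forall fun n => by positivity)).mono ?_).rate_mono (C := 1)
      (Eventually.of_forall fun n => by positivity) ?_
    · refine Eventually.of_forall fun n ω => ?_
      have e : ∀ Z Z' : Matrix (Fin m × Fin (M.q n)) (Fin m × Fin (M.q n)) ℝ,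
          diagSum (Z - Z') = diagSum Z - diagSum Z' := fun Z Z' => by
        ext a b; simp [diagSum]
      rw [e, diagSum_meanCross_XX, ← smul_sum_mul_transpose_eq_diagSum]
      rfl
    · filter_upwards [M.tendsto_q.eventually_gt_atTop 0] with n h1
      have : (M.q n : ℝ) ≠ 0 := by positivity
      field_simp
      exact le_rfl
  have hT : Tendsto (fun n => (√(M.T n : ℝ))⁻¹) atTop (𝓝 0) :=
    tendsto_inv_atTop_zero.comp (Real.tendsto_sqrt_atTop.comp
      (tendsto_natCast_atTop_atTop.comp M.tendsto_T))
  refine (h2.holdsWhp hT (half_pos M.gramLow_pos)).mono ?_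
  filter_upwards [M.gram, M.tendsto_q.eventually_gt_atTop 0] with n hn hq ω hω x
  have hq' : (0 : ℝ) < M.q n := by exact_mod_cast hq
  rw [abs_of_nonneg (by positivity), inv_mul_le_iff₀ hq'] at hω
  have h4 := hn x
  set G := (M.T n : ℝ)⁻¹ • ∑ t ∈ Finset.Icc (1 : ℤ) (M.T n), secondMoment μ (M.X n t)
  have h5 := (abs_le.1 (abs_dotProduct_mulVec_le_frob (M.gramX n ω - G) x)).1
  rw [Matrix.sub_mulVec, dotProduct_sub] at h5
  have h6 : 0 ≤ x ⬝ᵥ x := by rw [dotProduct_self_eq_norm_sq]; positivity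
  have h7 := mul_le_mul_of_nonneg_right hω h6
  linarith

/-- The noise part is a partial trace of order √p q/√T. In the factor part the moment of F and X, of
order √q/√T, is contracted with both loadings; this gives ν√q/√T, which is no larger because ν ≤ g.
-/
theorem isBigOp_crossWX : IsBigOp μ (fun n ω => ‖M.crossWX n ω‖)
    fun n => √(M.p n) * M.q n / √(M.T n) := by
  have hpos : ∀ᶠ n in atTop, 0 < √(M.p n) * M.q n / √(M.T n) := by
    filter_upwards [M.tendsto_p.eventually_gt_atTop 0, M.tendsto_q.eventually_gt_atTop 0,
      M.tendsto_T.eventually_gt_atTop 0] with n h0 h1 h2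
    positivity
  have hnn := hpos.mono fun n hn => hn.le
  have hE : IsBigOp μ (fun n ω => ‖(M.T n : ℝ)⁻¹ • ∑ t ∈ Finset.Icc (1 : ℤ) (M.T n),
      M.E n t ω * (M.X n t ω)ᵀ‖) fun n => √(M.p n) * M.q n / √(M.T n) := by
    have h1 := isBigOp_diagSum_crossMoment_sub M.boundedE M.boundedX (B := m)
      (b := fun n => √(M.p n) * M.q n / √(M.T n)) hpos
      (by filter_upwards [M.tendsto_T.eventually_gt_atTop 0] with n h2
          have : √(M.T n : ℝ) ≠ 0 := by positivity
          rw [mul_div_cancel₀ _ this, mul_pow, Real.sq_sqrt (Nat.cast_nonneg _)]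
          simp only [Fintype.card_fin]
          linarith)
    refine h1.mono (Eventually.of_forall fun n ω => le_of_eq ?_)
    have h0 : meanCross μ (M.T n : ℝ)⁻¹ (Finset.Icc (1 : ℤ) (M.T n)) 0
        (fun t ω => unc (M.E n t ω)) (fun t ω => unc (M.X n t ω)) = 0 := by
      ext x y
      rw [meanCross, Matrix.of_apply, Finset.sum_eq_zero fun s hs => ?_, mul_zero, Matrix.zero_apply]
      simpa using M.orth_EX n s hs s hs x y
    rw [h0, sub_zero, smul_sum_mul_transpose_eq_diagSum]
  have hF : IsBigOp μ (fun n ω => ‖(M.T n : ℝ)⁻¹ • ∑ t ∈ Finset.Icc (1 : ℤ) (M.T n),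
      M.R n * M.F n t ω * (M.C n)ᵀ * (M.X n t ω)ᵀ‖) fun n => √(M.p n) * M.q n / √(M.T n) := by
    have h1 := isBigOp_crossMoment_of_orth (h := 0) (S := fun n => Finset.Icc (1 : ℤ) (M.T n))
      M.boundedF M.boundedX (B := r * k * m) (b := fun n => √(M.q n) / √(M.T n))
      (fun n s hs => by simpa using hs)
      (fun n s hs x y => by simpa using M.orth_FX n s hs x y)
      (by filter_upwards [M.tendsto_q.eventually_gt_atTop 0,
            M.tendsto_T.eventually_gt_atTop 0] with n h1 h2
          positivity)
      (by filter_upwards [M.tendsto_T.eventually_gt_atTop 0] with n h2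
          have : (M.T n : ℝ) ≠ 0 := by positivity
          rw [mul_pow, div_pow, Real.sq_sqrt (Nat.cast_nonneg _), Real.sq_sqrt (Nat.cast_nonneg _)]
          simp only [Int.card_Icc, Fintype.card_prod, Fintype.card_fin, add_sub_cancel_right,
            Int.toNat_natCast, Nat.cast_mul]
          field_simp
          exact le_rfl)
    have h2 : IsBigOp μ (fun n (_ : Ω) => ‖M.R n‖ * ‖M.C n‖) M.ν := by
      refine IsBigOp.of_le (C := M.loadBound * M.loadBound) ?_
      filter_upwards [M.norm_R_le, M.norm_C_le] with n h1 h2 ω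
      rw [abs_of_nonneg (by positivity), ν]
      calc _ ≤ (M.loadBound * M.νR n) * (M.loadBound * M.νC n) :=
            mul_le_mul h1 h2 (norm_nonneg _) ((norm_nonneg _).trans h1)
        _ = _ := by ring
    have hν := (M.eventually_rates 0).mono fun n hn => zero_le_one.trans hn.2.2.2.1
    refine ((h2.mul h1 hν (Eventually.of_forall fun n => by positivity)).mono ?_).rate_mono
      (C := 1) (hν.mono fun n hn => by positivity) ?_
    · refine Eventually.of_forall fun n ω => ?_
      rw [abs_of_nonneg (norm_nonneg _), abs_of_nonneg (by positivity)]
      set Z := crossMoment ((M.T n : ℝ) - (0 : ℕ))⁻¹ (Finset.Icc (1 : ℤ) (M.T n)) 0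
        (fun t => (M.F n t ω).vec) (fun t => unc (M.X n t ω)) with hZ
      -- Reindexed in this way, contraction with C is a matrix-vector product and costs only ‖C‖.
      set Z' : Matrix (Fin k × Fin m) (Fin r × Fin (M.q n)) ℝ :=
        Matrix.of fun x y => Z (y.1, x.1) (x.2, y.2) with hZ'
      have nZ : ‖Z'‖ = ‖Z‖ := by
        rw [← pow_left_inj₀ (norm_nonneg _) (norm_nonneg _) two_ne_zero, frob_sq, frob_sq]
        simp only [hZ', Matrix.of_apply, Fintype.sum_prod_type]
        exact (Finset.sum_congr rfl fun c _ => Finset.sum_comm).trans Finset.sum_comm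
      set V : Matrix (Fin k) (Fin m) ℝ := Matrix.of fun c l => ∑ d, ∑ j, Z' (c, l) (d, j) * M.C n j d
        with hV
      have e : (M.T n : ℝ)⁻¹ • ∑ t ∈ Finset.Icc (1 : ℤ) (M.T n),
          M.R n * M.F n t ω * (M.C n)ᵀ * (M.X n t ω)ᵀ = M.R n * V := by
        have e1 : V = (M.T n : ℝ)⁻¹ • ∑ t ∈ Finset.Icc (1 : ℤ) (M.T n),
            M.F n t ω * ((M.C n)ᵀ * (M.X n t ω)ᵀ) := by
          ext c l
          simp only [hV, hZ', hZ, crossMoment, unc, Matrix.vec, Matrix.of_apply, Matrix.smul_apply,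
            Matrix.sum_apply, Matrix.mul_apply, Matrix.transpose_apply, smul_eq_mul, Nat.cast_zero,
            add_zero, sub_zero, Finset.mul_sum, Finset.sum_mul]
          refine (Finset.sum_congr rfl fun d _ => Finset.sum_comm).trans ?_
          rw [Finset.sum_comm]
          exact Finset.sum_congr rfl fun _ _ => Finset.sum_congr rfl fun _ _ =>
            Finset.sum_congr rfl fun _ _ => by ring
        simp only [e1, Matrix.mul_smul, Matrix.mul_sum, Matrix.mul_assoc]
      have nV : ‖V‖ ≤ ‖Z'‖ * ‖M.C n‖ := by
        have e1 := norm_mulVec_le_frob Z' fun x => M.C n x.2 x.1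
        have e2 : ‖WithLp.toLp 2 (Z' *ᵥ fun x => M.C n x.2 x.1)‖ = ‖V‖ := by
          rw [← pow_left_inj₀ (norm_nonneg _) (norm_nonneg _) two_ne_zero, frob_sq,
            EuclideanSpace.norm_sq_eq]
          simp [hV, Matrix.mulVec, dotProduct, Fintype.sum_prod_type]
        have e3 : ‖WithLp.toLp 2 fun x : Fin r × Fin (M.q n) => M.C n x.2 x.1‖ = ‖M.C n‖ := by
          rw [← pow_left_inj₀ (norm_nonneg _) (norm_nonneg _) two_ne_zero, frob_sq,
            EuclideanSpace.norm_sq_eq]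
          simp only [Real.norm_eq_abs, sq_abs, Fintype.sum_prod_type]
          exact Finset.sum_comm
        rwa [e2, e3] at e1
      rw [e, ← nZ]
      refine (frob_mul_le _ _).trans ?_
      calc _ ≤ ‖M.R n‖ * (‖Z'‖ * ‖M.C n‖) := mul_le_mul_of_nonneg_left nV (norm_nonneg _)
        _ = _ := by ring
    · filter_upwards [M.eventually_rates 0] with n hn
      have hg : M.ν n ≤ √(M.p n) * √(M.q n) := hn.2.2.2.2.1
      have hq := Real.mul_self_sqrt (Nat.cast_nonneg (α := ℝ) (M.q n))
      rw [one_mul, ← mul_div_assoc]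
      refine div_le_div_of_nonneg_right ?_ (Real.sqrt_nonneg _)
      calc _ ≤ √(M.p n) * √(M.q n) * √(M.q n) :=
            mul_le_mul_of_nonneg_right hg (Real.sqrt_nonneg _)
        _ = _ := by rw [mul_assoc, hq]
  refine (hF.add_same hE hnn).mono (Eventually.of_forall fun n ω => ?_)
  rw [abs_of_nonneg (norm_nonneg _), abs_of_nonneg (by positivity)]
  refine le_trans (le_of_eq ?_) (norm_add_le _ _)
  rw [crossWX, ← smul_add, ← Finset.sum_add_distrib]
  simp only [W, residual, Matrix.add_mul]

/-- The cross moment, of order √p q/√T, is divided by a coercivity constant of order q. -/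
theorem isBigOp_dev : IsBigOp μ (fun n ω => ‖M.dev n ω‖) fun n => √(M.p n) / √(M.T n) := by
  have h1 : IsBigOp μ (fun n (_ : Ω) => 2 / (M.gramLow * M.q n)) fun n => (M.q n : ℝ)⁻¹ :=
    IsBigOp.of_le (C := 2 / M.gramLow) (Eventually.of_forall fun n ω => by
      have := M.gramLow_pos
      rw [abs_of_nonneg (by positivity), ← div_eq_mul_inv, div_div])
  refine ((h1.mul M.isBigOp_crossWX (Eventually.of_forall fun n => by positivity)
    (Eventually.of_forall fun n => by positivity)).mono_whp
    (M.gramX_coercive.mono ?_)).rate_mono (C := 1) (Eventually.of_forall fun n => by positivity) ?_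
  · filter_upwards [M.tendsto_q.eventually_gt_atTop 0] with n hq ω hω
    have hq' : (0 : ℝ) < M.q n := by exact_mod_cast hq
    have hg := M.gramLow_pos
    have hc : 0 < M.gramLow / 2 * M.q n := by positivity
    have h2 := mul_norm_le_norm_mul_of_coercive hω (M.dev n ω)
    rw [dev_mul_gramX (isUnit_det_of_coercive hc hω)] at h2
    rw [abs_of_nonneg (norm_nonneg _), abs_of_nonneg (by positivity)]
    rw [div_mul_eq_mul_div, le_div_iff₀ (by positivity)]
    linarith
  · filter_upwards [M.tendsto_q.eventually_gt_atTop 0] with n h1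
    have : (M.q n : ℝ) ≠ 0 := by positivity
    field_simp
    exact le_rfl

end LeastSquares

end FactorModel

end MatFactor

namespace MatFactor

open scoped Matrix.Norms.Frobenius

theorem BoundedProc.integrable_entry {Ω I : Type*} {m₀ : MeasurableSpace Ω} {μ : Measure Ω}
    [IsProbabilityMeasure μ] {𝔉 : ℤ → MeasurableSpace Ω} {γ K A : ℝ} {T : ℕ} {a : ℕ → ℝ}
    {u : ℤ → Ω → I → ℝ} (hu : BoundedProc μ 𝔉 γ K T u) (hmx : Mixing μ 𝔉 γ a A) (hγ : 2 < γ)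
    {t : ℤ} (ht : t ∈ Finset.Icc (1 : ℤ) T) (i : I) : Integrable (fun ω => u t ω i) μ :=
  integrable_of_rpow (γ := 2 * γ) (by linarith) (hu.measurable hmx t i) (hu.integrable t ht i)

namespace FactorModel

variable {Ω : Type*} [MeasurableSpace Ω] {μ : Measure Ω} {k r m : ℕ} (M : FactorModel μ k r m)

/-- The loadings of `vec F`. -/
def load (n : ℕ) : Matrix (Fin (M.p n) × Fin (M.q n)) (Fin r × Fin k) ℝ :=
  loadMat (M.R n) (M.C n)

/-- The lagged autocovariances of `vec F`. -/
noncomputable def popF (n h : ℕ) : Matrix (Fin r × Fin k) (Fin r × Fin k) ℝ :=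
  meanCross μ ((M.T n : ℝ) - h)⁻¹ (Finset.Icc (1 : ℤ) (M.T n - h)) h (fun s ω => (M.F n s ω).vec)
    fun s ω => (M.F n s ω).vec

theorem unc_W (n : ℕ) (t : ℤ) (ω : Ω) :
    unc (M.W n t ω) = M.load n *ᵥ (M.F n t ω).vec + unc (M.E n t ω) := by
  rw [load, ← unc_mul_mul_transpose]
  rfl

variable {M}

theorem admissible_Icc (T h : ℕ) : Admissible T h (Finset.Icc (1 : ℤ) (T - h)) := fun s hs => by
  simp only [Finset.mem_Icc] at hs
  omega

/-! ### Population autocovariances of the unobserved part. -/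

section Population

variable [IsProbabilityMeasure μ]

theorem integral_unc_W {n : ℕ} {s : ℤ} (hs : s ∈ Finset.Icc (1 : ℤ) (M.T n))
    (x : Fin (M.p n) × Fin (M.q n)) : ∫ ω, unc (M.W n s ω) x ∂μ = 0 := by
  have iF := fun a => (M.boundedF n).integrable_entry (M.mixing n) M.two_lt hs a
  have iE := (M.boundedE n).integrable_entry (M.mixing n) M.two_lt hs x
  simp only [unc_W, Pi.add_apply, Matrix.mulVec, dotProduct]
  rw [integral_add (integrable_finsetSum _ fun a _ => (iF a).const_mul _) iE,
    integral_finsetSum _ fun a _ => (iF a).const_mul _, M.mean_E n s hs x, add_zero]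
  refine Finset.sum_eq_zero fun a _ => ?_
  rw [integral_const_mul, M.mean_F n s hs a, mul_zero]

theorem integral_unc_W_mul {n : ℕ} {s t : ℤ} (hs : s ∈ Finset.Icc (1 : ℤ) (M.T n))
    (ht : t ∈ Finset.Icc (1 : ℤ) (M.T n)) (hst : s ≠ t) (x y : Fin (M.p n) × Fin (M.q n)) :
    ∫ ω, unc (M.W n s ω) x * unc (M.W n t ω) y ∂μ = ∑ a, ∑ b, M.load n x a *
      (∫ ω, (M.F n s ω).vec a * (M.F n t ω).vec b ∂μ) * M.load n y b := by
  have iFF := fun a b => (M.boundedF n).integrable_mul (M.boundedF n) (M.mixing n) M.two_lt hs ht a b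
  have iEE := (M.boundedE n).integrable_mul (M.boundedE n) (M.mixing n) M.two_lt hs ht x y
  have iEF : ∀ {s t : ℤ}, s ∈ Finset.Icc (1 : ℤ) (M.T n) → t ∈ Finset.Icc (1 : ℤ) (M.T n) →
      ∀ x a, Integrable (fun ω => unc (M.E n s ω) x * (M.F n t ω).vec a) μ := fun hs ht x a => by
    refine integrable_mul_of_rpow (γ := 2 * M.γ) (by linarith [M.two_lt])
      ((M.boundedE n).measurable (M.mixing n) _ _) ((M.boundedF n).measurable (M.mixing n) _ _)
      ((M.boundedE n).integrable _ hs _) ((M.boundedF n).integrable _ ht _)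
  have e : ∀ ω, unc (M.W n s ω) x * unc (M.W n t ω) y =
      ((∑ a, ∑ b, M.load n x a * M.load n y b * ((M.F n s ω).vec a * (M.F n t ω).vec b)) +
        unc (M.E n s ω) x * unc (M.E n t ω) y) +
      ((∑ a, M.load n x a * (unc (M.E n t ω) y * (M.F n s ω).vec a)) +
        ∑ b, M.load n y b * (unc (M.E n s ω) x * (M.F n t ω).vec b)) := fun ω => by
    have e1 : ∑ a, ∑ b, M.load n x a * M.load n y b * ((M.F n s ω).vec a * (M.F n t ω).vec b) =
        (∑ a, M.load n x a * (M.F n s ω).vec a) * ∑ b, M.load n y b * (M.F n t ω).vec b := by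
      rw [Finset.sum_mul_sum]
      exact Finset.sum_congr rfl fun _ _ => Finset.sum_congr rfl fun _ _ => by ring
    have e2 : ∑ a, M.load n x a * (unc (M.E n t ω) y * (M.F n s ω).vec a) =
        (∑ a, M.load n x a * (M.F n s ω).vec a) * unc (M.E n t ω) y := by
      rw [Finset.sum_mul]
      exact Finset.sum_congr rfl fun _ _ => by ring
    have e3 : ∑ b, M.load n y b * (unc (M.E n s ω) x * (M.F n t ω).vec b) =
        unc (M.E n s ω) x * ∑ b, M.load n y b * (M.F n t ω).vec b := by
      rw [Finset.mul_sum]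
      exact Finset.sum_congr rfl fun _ _ => by ring
    rw [e1, e2, e3]
    simp only [unc_W, Pi.add_apply, Matrix.mulVec, dotProduct]
    ring
  have i1 : Integrable (fun ω => ∑ a, ∑ b, M.load n x a * M.load n y b *
      ((M.F n s ω).vec a * (M.F n t ω).vec b)) μ :=
    integrable_finsetSum _ fun a _ => integrable_finsetSum _ fun b _ => (iFF a b).const_mul _
  have i2 : Integrable (fun ω => ∑ a, M.load n x a * (unc (M.E n t ω) y * (M.F n s ω).vec a)) μ :=
    integrable_finsetSum _ fun a _ => (iEF ht hs y a).const_mul _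
  have i3 : Integrable (fun ω => ∑ b, M.load n y b * (unc (M.E n s ω) x * (M.F n t ω).vec b)) μ :=
    integrable_finsetSum _ fun b _ => (iEF hs ht x b).const_mul _
  have i4 : Integrable (fun ω => (∑ a, ∑ b, M.load n x a * M.load n y b *
      ((M.F n s ω).vec a * (M.F n t ω).vec b)) + unc (M.E n s ω) x * unc (M.E n t ω) y) μ :=
    i1.add iEE
  have i5 : Integrable (fun ω => (∑ a, M.load n x a * (unc (M.E n t ω) y * (M.F n s ω).vec a)) +
      ∑ b, M.load n y b * (unc (M.E n s ω) x * (M.F n t ω).vec b)) μ := i2.add i3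
  simp only [e]
  rw [integral_add i4 i5, integral_add i1 iEE, integral_add i2 i3,
    M.orth_EE n s hs t ht hst x y, integral_finsetSum _ fun a _ => (iEF ht hs y a).const_mul _,
    integral_finsetSum _ fun b _ => (iEF hs ht x b).const_mul _,
    integral_finsetSum _ fun a _ => integrable_finsetSum _ fun b _ => (iFF a b).const_mul _]
  simp only [integral_const_mul, M.orth_EF n t ht s hs, M.orth_EF n s hs t ht, mul_zero,
    Finset.sum_const_zero, add_zero]
  refine Finset.sum_congr rfl fun a _ => ?_
  rw [integral_finsetSum _ fun b _ => (iFF a b).const_mul _]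
  refine Finset.sum_congr rfl fun b _ => ?_
  rw [integral_const_mul]
  ring

/-- At positive lags the noise is uncorrelated with itself and with the factors, so only the factor
autocovariance remains, between the loadings. -/
theorem popTensor_eq (n : ℕ) {h : ℕ} (hh : 1 ≤ h) :
    popTensor μ (M.T n) (M.W n) h = M.load n * M.popF n h * (M.load n)ᵀ := by
  ext x y
  simp only [popTensor, Matrix.of_apply, Matrix.mul_apply, Matrix.transpose_apply, popF, meanCross]
  have e : ∀ s ∈ Finset.Icc (1 : ℤ) (M.T n - h),
      cov[fun ω => M.W n s ω x.1 x.2, fun ω => M.W n (s + h) ω y.1 y.2; μ] =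
      ∑ a, ∑ b, M.load n x a *
      (∫ ω, (M.F n s ω).vec a * (M.F n (s + h) ω).vec b ∂μ) * M.load n y b := fun s hs => by
    have h1 := admissible_Icc _ _ s hs
    have hs1 : s ∈ Finset.Icc (1 : ℤ) (M.T n) := by simp only [Finset.mem_Icc]; omega
    have hs2 : s + h ∈ Finset.Icc (1 : ℤ) (M.T n) := by simp only [Finset.mem_Icc]; omega
    have i1 : ∫ ω, M.W n s ω x.1 x.2 ∂μ = 0 := integral_unc_W hs1 x
    have i2 : ∫ ω, M.W n (s + h) ω y.1 y.2 ∂μ = 0 := integral_unc_W hs2 y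
    rw [covariance, i1, i2]
    simp only [sub_zero]
    exact integral_unc_W_mul hs1 hs2 (by omega) x y
  rw [Finset.sum_congr rfl e]
  simp only [Finset.mul_sum, Finset.sum_mul]
  rw [Finset.sum_comm' (t' := Finset.univ) (s' := fun _ => Finset.Icc (1 : ℤ) (M.T n - h))
    (by simp)]
  refine (Finset.sum_congr rfl fun a _ => Finset.sum_comm).trans ?_
  rw [Finset.sum_comm]
  exact Finset.sum_congr rfl fun _ _ => Finset.sum_congr rfl fun _ _ =>
    Finset.sum_congr rfl fun _ _ => by ring

theorem norm_popF_le {n h : ℕ} (hT : h < M.T n) :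
    ‖M.popF n h‖ ≤ (r * k : ℝ) * (2 + 2 * M.K) := by
  have hK := M.K_pos
  refine le_of_sq_le_sq ?_ (by positivity)
  have h1 : ∀ a b, (M.popF n h a b) ^ 2 ≤ (2 + 2 * M.K) ^ 2 := fun a b => by
    rw [sq_le_sq, abs_of_pos (show 0 < 2 + 2 * M.K by positivity), popF, meanCross, Matrix.of_apply]
    have hT' : (0 : ℝ) < (M.T n : ℝ) - h := sub_pos.2 (by exact_mod_cast hT)
    rw [abs_mul, abs_of_pos (inv_pos.2 hT'), inv_mul_le_iff₀ hT']
    refine (Finset.abs_sum_le_sum_abs _ _).trans ?_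
    calc _ ≤ ∑ _s ∈ Finset.Icc (1 : ℤ) (M.T n - h), (2 + 2 * M.K) := by
          refine Finset.sum_le_sum fun s hs => ?_
          have h1 := admissible_Icc _ _ s hs
          exact (M.boundedF n).abs_integral_mul_le (M.boundedF n) (M.mixing n) M.two_lt
            (by simp only [Finset.mem_Icc]; omega) (by simp only [Finset.mem_Icc]; omega) a b
      _ ≤ _ := by
          rw [Finset.sum_const, nsmul_eq_mul]
          exact mul_le_mul_of_nonneg_right (card_le_of_admissible hT.le (admissible_Icc _ _))
            (by positivity)
  rw [frob_sq]
  calc _ ≤ ∑ _a : Fin r × Fin k, ∑ _b : Fin r × Fin k, (2 + 2 * M.K) ^ 2 :=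
        Finset.sum_le_sum fun a _ => Finset.sum_le_sum fun b _ => h1 a b
    _ = _ := by simp; ring

theorem norm_load_le : ∀ᶠ n in atTop, ‖M.load n‖ ≤ M.loadBound ^ 2 * M.ν n := by
  filter_upwards [M.norm_R_le, M.norm_C_le] with n h1 h2
  rw [load, norm_loadMat, ν]
  calc _ ≤ (M.loadBound * M.νR n) * (M.loadBound * M.νC n) :=
        mul_le_mul h1 h2 (norm_nonneg _) ((norm_nonneg _).trans h1)
    _ = _ := by ring

theorem isBigOp_load : IsBigOp μ (fun n (_ : Ω) => ‖M.load n‖) M.ν :=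
  IsBigOp.of_le (M.norm_load_le.mono fun n hn _ => by rwa [abs_of_nonneg (norm_nonneg _)])

theorem norm_popTensor_le {h : ℕ} (hh : 1 ≤ h) : ∀ᶠ n in atTop,
    ‖popTensor μ (M.T n) (M.W n) h‖ ≤
      (M.loadBound ^ 4 * ((r * k : ℝ) * (2 + 2 * M.K))) * M.ν n ^ 2 := by
  have hK := M.K_pos
  filter_upwards [M.norm_load_le, M.tendsto_T.eventually_gt_atTop h] with n h1 h2
  rw [popTensor_eq n hh]
  have h3 := M.norm_popF_le h2
  have h4 := (norm_nonneg _).trans h1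
  calc _ ≤ ‖M.load n‖ * ‖M.popF n h‖ * ‖M.load n‖ := by
        refine (frob_mul_le _ _).trans ?_
        rw [frob_transpose]
        exact mul_le_mul_of_nonneg_right (frob_mul_le _ _) (norm_nonneg _)
    _ ≤ (M.loadBound ^ 2 * M.ν n) * ((r * k : ℝ) * (2 + 2 * M.K)) * (M.loadBound ^ 2 * M.ν n) := by
        gcongr
    _ = _ := by ring

end Population

/-! ### Splitting the sample into times before, near and after a given time. -/

section Windows

variable (M) (t : ℕ → ℤ)

/-- The half width of the window of times that are not treated as nearly independent. -/
noncomputable def halfWidth (n : ℕ) : ℕ := ⌈M.g n ^ 2 / M.ν n ^ 2⌉₊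

/-- The times before the window. -/
noncomputable def pastTimes (h n : ℕ) : Finset ℤ :=
  (Finset.Icc (1 : ℤ) (M.T n - h)).filter fun s => s + h ≤ t n - M.halfWidth n

/-- The times after the window. -/
noncomputable def futureTimes (h n : ℕ) : Finset ℤ :=
  ((Finset.Icc (1 : ℤ) (M.T n - h)).filter fun s => ¬ s + h ≤ t n - M.halfWidth n).filter
    fun s => t n + M.halfWidth n ≤ s

/-- The times in the window. -/
noncomputable def nearTimes (h n : ℕ) : Finset ℤ :=
  ((Finset.Icc (1 : ℤ) (M.T n - h)).filter fun s => ¬ s + h ≤ t n - M.halfWidth n).filter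
    fun s => ¬ t n + M.halfWidth n ≤ s

/-- The lagged sample moments of the noise over a set of times. -/
noncomputable def noiseMoment (S : ℕ → ℕ → Finset ℤ) (h n : ℕ) (ω : Ω) :
    Matrix (Fin (M.p n) × Fin (M.q n)) (Fin (M.p n) × Fin (M.q n)) ℝ :=
  crossMoment ((M.T n : ℝ) - h)⁻¹ (S h n) h (fun s => unc (M.E n s ω)) fun s => unc (M.E n s ω)

variable {M t}

theorem admissible_pastTimes (h n : ℕ) : Admissible (M.T n) h (M.pastTimes t h n) := fun s hs =>
  admissible_Icc _ _ s (Finset.mem_filter.1 hs).1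

theorem admissible_futureTimes (h n : ℕ) : Admissible (M.T n) h (M.futureTimes t h n) :=
  fun s hs => admissible_Icc _ _ s (Finset.mem_filter.1 (Finset.mem_filter.1 hs).1).1

theorem admissible_nearTimes (h n : ℕ) : Admissible (M.T n) h (M.nearTimes t h n) :=
  fun s hs => admissible_Icc _ _ s (Finset.mem_filter.1 (Finset.mem_filter.1 hs).1).1

theorem card_nearTimes_le (h n : ℕ) :
    ((M.nearTimes t h n).card : ℝ) ≤ 2 * M.halfWidth n + h := by
  have h1 : M.nearTimes t h n ⊆
      Finset.Ioo (t n - M.halfWidth n - h) (t n + M.halfWidth n) := fun s hs => by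
    simp only [nearTimes, Finset.mem_filter, not_le] at hs
    simp only [Finset.mem_Ioo]
    omega
  have h2 := Finset.card_le_card h1
  simp only [Int.card_Ioo] at h2
  have h3 : (M.nearTimes t h n).card ≤ 2 * M.halfWidth n + h := by omega
  exact_mod_cast h3

theorem noiseMoment_split (h n : ℕ) (ω : Ω) :
    M.noiseMoment (fun h n => Finset.Icc (1 : ℤ) (M.T n - h)) h n ω =
      M.noiseMoment (M.pastTimes t) h n ω + (M.noiseMoment (M.futureTimes t) h n ω +
        M.noiseMoment (M.nearTimes t) h n ω) := by
  ext x y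
  simp only [noiseMoment, crossMoment, Matrix.of_apply, Matrix.add_apply, ← mul_add, pastTimes,
    futureTimes, nearTimes]
  rw [Finset.sum_filter_add_sum_filter_not, Finset.sum_filter_add_sum_filter_not]

/-- The half width L ≈ g²/ν² is a compromise. It is large enough for α(L)^(1-2/γ) = O(1/L) to give
α(L)^(1-2/γ) pq = O(ν²), and small enough for the noise moments inside the window to be negligible.
-/
theorem halfWidth_bounds : ∀ᶠ n in atTop, 1 ≤ M.halfWidth n ∧
    M.g n ^ 2 ≤ M.halfWidth n * M.ν n ^ 2 ∧ M.halfWidth n * M.ν n ^ 2 ≤ 2 * M.g n ^ 2 := by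
  filter_upwards [M.eventually_rates 0] with n hn
  obtain ⟨-, -, -, h1, h2, -, -⟩ := hn
  have hν : 0 < M.ν n ^ 2 := by positivity
  have h3 : 1 ≤ M.g n ^ 2 / M.ν n ^ 2 := by
    rw [one_le_div hν]
    exact pow_le_pow_left₀ (by linarith) h2 2
  have h4 := Nat.le_ceil (M.g n ^ 2 / M.ν n ^ 2)
  have h5 := (Nat.ceil_lt_add_one (zero_le_one.trans h3)).le
  refine ⟨Nat.one_le_ceil_iff.2 (by linarith), ?_, ?_⟩
  · rwa [div_le_iff₀ hν] at h4
  · have : (M.halfWidth n : ℝ) ≤ 2 * (M.g n ^ 2 / M.ν n ^ 2) := by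
      rw [halfWidth]; linarith
    calc _ ≤ 2 * (M.g n ^ 2 / M.ν n ^ 2) * M.ν n ^ 2 := mul_le_mul_of_nonneg_right this hν.le
      _ = _ := by rw [mul_assoc, div_mul_cancel₀ _ hν.ne']

end Windows

end FactorModel

end MatFactor

/-! ### Expansion of the residual autocovariances and order of the remainder. -/

namespace MatFactor

open scoped Matrix.Norms.Frobenius

theorem IsBigOp.mul_rate {Ω : Type*} [MeasurableSpace Ω] {μ : Measure Ω} {x y : ℕ → Ω → ℝ}
    {b b' b'' : ℕ → ℝ} {C : ℝ} (hx : IsBigOp μ x b) (hy : IsBigOp μ y b')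
    (hb : ∀ᶠ n in atTop, 0 ≤ b n) (hb' : ∀ᶠ n in atTop, 0 ≤ b' n)
    (hbb : ∀ᶠ n in atTop, b n * b' n ≤ C * b'' n) : IsBigOp μ (fun n ω => x n ω * y n ω) b'' :=
  (hx.mul hy hb hb').rate_mono (by filter_upwards [hb, hb'] with n h h' using mul_nonneg h h') hbb

section Expansion

variable {I J : Type*} [Fintype I] [Fintype J] (c : ℝ) (S : Finset ℤ) (h : ℕ)

theorem crossMoment_expansion (K : Matrix I J ℝ) (f : ℤ → J → ℝ) (e d : ℤ → I → ℝ)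
    (G : Matrix J J ℝ) :
    crossMoment c S h (fun s => K *ᵥ f s + e s - d s) (fun s => K *ᵥ f s + e s - d s) =
      K * G * Kᵀ + crossMoment c S h e e + (K * (crossMoment c S h f f - G) * Kᵀ +
        K * crossMoment c S h f e + crossMoment c S h e f * Kᵀ - K * crossMoment c S h f d -
        crossMoment c S h d f * Kᵀ - crossMoment c S h e d - crossMoment c S h d e +
        crossMoment c S h d d) := by
  rw [crossMoment_sub_left, crossMoment_sub_right, crossMoment_sub_right, crossMoment_add_left,
    crossMoment_add_left, crossMoment_add_right, crossMoment_add_right, crossMoment_add_right,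
    crossMoment_mulVec_left, crossMoment_mulVec_left, crossMoment_mulVec_left,
    crossMoment_mulVec_right, crossMoment_mulVec_right, crossMoment_mulVec_right, Matrix.mul_sub,
    Matrix.sub_mul, ← Matrix.mul_assoc]
  abel

end Expansion

namespace FactorModel

variable {Ω : Type*} [MeasurableSpace Ω] {μ : Measure Ω} {k r m : ℕ} {M : FactorModel μ k r m}

theorem g_nonneg (n : ℕ) : 0 ≤ M.g n := by unfold g; positivity

theorem eventually_ν_nonneg : ∀ᶠ n in atTop, 0 ≤ M.ν n :=
  (M.eventually_rates 0).mono fun _ hn => zero_le_one.trans hn.2.2.2.1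

variable (M)

/-- The residual lagged sample moments. -/
noncomputable def sampleW (h n : ℕ) (ω : Ω) :
    Matrix (Fin (M.p n) × Fin (M.q n)) (Fin (M.p n) × Fin (M.q n)) ℝ :=
  sampleTensor (M.T n) (residualEst (M.T n) (fun t => M.Y n t ω) fun t => M.X n t ω) h

/-- The part of the residual lagged sample moments that is negligible in norm. -/
noncomputable def remainder (t : ℕ → ℤ) (h n : ℕ) (ω : Ω) :
    Matrix (Fin (M.p n) × Fin (M.q n)) (Fin (M.p n) × Fin (M.q n)) ℝ :=
  M.sampleW h n ω - popTensor μ (M.T n) (M.W n) h - M.noiseMoment (M.pastTimes t) h n ω -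
    M.noiseMoment (M.futureTimes t) h n ω

/-- The lagged sample moments over the whole sample. -/
noncomputable def mom (h n : ℕ) {I J : Type*} (u : ℤ → I → ℝ) (v : ℤ → J → ℝ) : Matrix I J ℝ :=
  crossMoment ((M.T n : ℝ) - h)⁻¹ (Finset.Icc (1 : ℤ) (M.T n - h)) h u v

variable {M} [IsProbabilityMeasure μ]

theorem card_Icc_mul_le {T h : ℕ} (hT : h ≤ T) {x y : ℝ} (hx : 0 ≤ x) (hxy : x ≤ T * y) :
    ((Finset.Icc (1 : ℤ) (T - h)).card : ℝ) * x ≤ T * (T * y) := by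
  have h1 := card_le_of_admissible hT (admissible_Icc T h)
  have h2 : (0 : ℝ) ≤ h := Nat.cast_nonneg h
  have h3 : (0 : ℝ) ≤ T := Nat.cast_nonneg T
  calc _ ≤ (T : ℝ) * x := mul_le_mul_of_nonneg_right (by linarith) hx
    _ ≤ _ := mul_le_mul_of_nonneg_left hxy h3

theorem isBigOp_mom_ff (h : ℕ) : IsBigOp μ (fun n ω => ‖M.mom h n (fun s => (M.F n s ω).vec)
    (fun s => (M.F n s ω).vec) - M.popF n h‖) fun n => 1 / √(M.T n) := by
  refine isBigOp_crossMoment_sub (B := (r * k : ℝ) ^ 2) M.boundedF M.boundedF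
    (fun n => admissible_Icc _ _) ?_ ?_
  · filter_upwards [M.tendsto_T.eventually_gt_atTop 0] with n h2
    positivity
  · filter_upwards [M.tendsto_T.eventually_gt_atTop 0, M.tendsto_T.eventually_ge_atTop h] with n h2 h3
    have hT : (M.T n : ℝ) ≠ 0 := by positivity
    refine (card_Icc_mul_le h3 (by positivity)
      (y := (r * k : ℝ) ^ 2 * (1 / M.T n)) (le_of_eq ?_)).trans (le_of_eq ?_)
    · simp; field_simp
    · rw [mul_pow (M.T n : ℝ), div_pow, Real.sq_sqrt (Nat.cast_nonneg _)]; ring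

theorem card_prod_eq (n : ℕ) :
    (Fintype.card (Fin (M.p n) × Fin (M.q n)) : ℝ) = M.g n ^ 2 := by
  rw [g_sq]; simp

theorem isBigOp_mom_fe (h : ℕ) : IsBigOp μ (fun n ω => ‖M.mom h n (fun s => (M.F n s ω).vec)
    (fun s => unc (M.E n s ω))‖) fun n => M.g n / √(M.T n) := by
  refine isBigOp_crossMoment_of_orth (B := (r * k : ℝ)) M.boundedF M.boundedE
    (fun n => admissible_Icc _ _) (fun n s hs x y => ?_) ?_ ?_
  · have h1 := admissible_Icc _ _ s hs
    rw [← M.orth_EF n (s + h) (by simp only [Finset.mem_Icc]; omega) s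
      (by simp only [Finset.mem_Icc]; omega) y x]
    simp only [mul_comm]
  · filter_upwards [M.eventually_rates 0] with n hn
    have := hn.2.2.1
    have := hn.2.2.2.1.trans hn.2.2.2.2.1
    positivity
  · filter_upwards [M.tendsto_T.eventually_gt_atTop 0, M.tendsto_T.eventually_ge_atTop h] with n h2 h3
    have hT : (M.T n : ℝ) ≠ 0 := by positivity
    refine (card_Icc_mul_le h3 (by positivity)
      (y := (r * k : ℝ) * M.g n ^ 2 * (1 / M.T n)) (le_of_eq ?_)).trans (le_of_eq ?_)
    · rw [card_prod_eq]; simp; field_simp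
    · rw [mul_pow, div_pow, Real.sq_sqrt (Nat.cast_nonneg _)]; ring

theorem isBigOp_mom_ef (h : ℕ) : IsBigOp μ (fun n ω => ‖M.mom h n (fun s => unc (M.E n s ω))
    (fun s => (M.F n s ω).vec)‖) fun n => M.g n / √(M.T n) := by
  refine isBigOp_crossMoment_of_orth (B := (r * k : ℝ)) M.boundedE M.boundedF
    (fun n => admissible_Icc _ _) (fun n s hs x y => ?_) ?_ ?_
  · have h1 := admissible_Icc _ _ s hs
    exact M.orth_EF n s (by simp only [Finset.mem_Icc]; omega) (s + h)
      (by simp only [Finset.mem_Icc]; omega) x y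
  · filter_upwards [M.eventually_rates 0] with n hn
    have := hn.2.2.1
    have := hn.2.2.2.1.trans hn.2.2.2.2.1
    positivity
  · filter_upwards [M.tendsto_T.eventually_gt_atTop 0, M.tendsto_T.eventually_ge_atTop h] with n h2 h3
    have hT : (M.T n : ℝ) ≠ 0 := by positivity
    refine (card_Icc_mul_le h3 (by positivity)
      (y := (r * k : ℝ) * M.g n ^ 2 * (1 / M.T n)) (le_of_eq ?_)).trans (le_of_eq ?_)
    · rw [card_prod_eq]; simp; field_simp
    · rw [mul_pow, div_pow, Real.sq_sqrt (Nat.cast_nonneg _)]; ring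

theorem isBigOp_mom_ex (h : ℕ) : IsBigOp μ (fun n ω => ‖M.mom h n (fun s => unc (M.E n s ω))
    (fun s => unc (M.X n s ω))‖) fun n => √(M.q n) * M.g n / √(M.T n) := by
  refine isBigOp_crossMoment_of_orth (B := (m : ℝ)) M.boundedE M.boundedX
    (fun n => admissible_Icc _ _) (fun n s hs x y => ?_) ?_ ?_
  · have h1 := admissible_Icc _ _ s hs
    exact M.orth_EX n s (by simp only [Finset.mem_Icc]; omega) (s + h)
      (by simp only [Finset.mem_Icc]; omega) x y
  · filter_upwards [M.eventually_rates 0] with n hn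
    have := hn.2.1
    have := hn.2.2.1
    have := hn.2.2.2.1.trans hn.2.2.2.2.1
    positivity
  · filter_upwards [M.tendsto_T.eventually_gt_atTop 0, M.tendsto_T.eventually_ge_atTop h] with n h2 h3
    have hT : (M.T n : ℝ) ≠ 0 := by positivity
    refine (card_Icc_mul_le h3 (by positivity)
      (y := (m : ℝ) * M.q n * M.g n ^ 2 * (1 / M.T n)) (le_of_eq ?_)).trans (le_of_eq ?_)
    · rw [card_prod_eq]; simp; field_simp
    · rw [mul_pow, div_pow, mul_pow, Real.sq_sqrt (Nat.cast_nonneg _),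
        Real.sq_sqrt (Nat.cast_nonneg _)]; ring

theorem isBigOp_mom_xe (h : ℕ) : IsBigOp μ (fun n ω => ‖M.mom h n (fun s => unc (M.X n s ω))
    (fun s => unc (M.E n s ω))‖) fun n => √(M.q n) * M.g n / √(M.T n) := by
  refine isBigOp_crossMoment_of_orth (B := (m : ℝ)) M.boundedX M.boundedE
    (fun n => admissible_Icc _ _) (fun n s hs x y => ?_) ?_ ?_
  · have h1 := admissible_Icc _ _ s hs
    rw [← M.orth_EX n (s + h) (by simp only [Finset.mem_Icc]; omega) s
      (by simp only [Finset.mem_Icc]; omega) y x]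
    simp only [mul_comm]
  · filter_upwards [M.eventually_rates 0] with n hn
    have := hn.2.1
    have := hn.2.2.1
    have := hn.2.2.2.1.trans hn.2.2.2.2.1
    positivity
  · filter_upwards [M.tendsto_T.eventually_gt_atTop 0, M.tendsto_T.eventually_ge_atTop h] with n h2 h3
    have hT : (M.T n : ℝ) ≠ 0 := by positivity
    refine (card_Icc_mul_le h3 (by positivity)
      (y := (m : ℝ) * M.q n * M.g n ^ 2 * (1 / M.T n)) (le_of_eq ?_)).trans (le_of_eq ?_)
    · rw [card_prod_eq]; simp; field_simp
    · rw [mul_pow, div_pow, mul_pow, Real.sq_sqrt (Nat.cast_nonneg _),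
        Real.sq_sqrt (Nat.cast_nonneg _)]; ring

theorem eventually_sqrt_q_pos : ∀ᶠ n in atTop, 0 < √(M.q n) :=
  (M.eventually_rates 0).mono fun _ hn => zero_lt_one.trans_le hn.2.1

/-- Factors and regressors may be correlated at different times, so there is no decay in T. In the
remainder this moment comes with the factor ‖Â - A‖, which supplies the decay. -/
theorem isBigOp_mom_fx (h : ℕ) : IsBigOp μ (fun n ω => ‖M.mom h n (fun s => (M.F n s ω).vec)
    (fun s => unc (M.X n s ω))‖) fun n => √(M.q n) :=
  isBigOp_crossMoment (B := (r * k * m : ℝ)) M.boundedF M.boundedX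
    (fun n => admissible_Icc _ _) eventually_sqrt_q_pos (Eventually.of_forall fun n => by
      rw [Real.sq_sqrt (Nat.cast_nonneg _)]; simp; linarith)

theorem isBigOp_mom_xf (h : ℕ) : IsBigOp μ (fun n ω => ‖M.mom h n (fun s => unc (M.X n s ω))
    (fun s => (M.F n s ω).vec)‖) fun n => √(M.q n) :=
  isBigOp_crossMoment (B := (r * k * m : ℝ)) M.boundedX M.boundedF
    (fun n => admissible_Icc _ _) eventually_sqrt_q_pos (Eventually.of_forall fun n => by
      rw [Real.sq_sqrt (Nat.cast_nonneg _)]; simp; linarith)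

theorem isBigOp_mom_xx (h : ℕ) : IsBigOp μ (fun n ω => ‖M.mom h n (fun s => unc (M.X n s ω))
    (fun s => unc (M.X n s ω))‖) fun n => √(M.q n) ^ 2 :=
  isBigOp_crossMoment (B := (m : ℝ) ^ 2) M.boundedX M.boundedX
    (fun n => admissible_Icc _ _) (eventually_sqrt_q_pos.mono fun _ _ => by positivity)
    (Eventually.of_forall fun n => by
      rw [Real.sq_sqrt (Nat.cast_nonneg _)]; simp; nlinarith)

theorem isBigOp_noiseMoment {S : ℕ → ℕ → Finset ℤ} {h : ℕ} (hh : 1 ≤ h)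
    (hS : ∀ n, Admissible (M.T n) h (S h n)) :
    IsBigOp μ (fun n ω => ‖M.noiseMoment S h n ω‖) fun n => M.g n ^ 2 / √(M.T n) := by
  refine isBigOp_crossMoment_of_orth (B := 1) M.boundedE M.boundedE hS
    (fun n s hs x y => ?_) ?_ ?_
  · have h1 := hS n s hs
    exact M.orth_EE n s (by simp only [Finset.mem_Icc]; omega) (s + h)
      (by simp only [Finset.mem_Icc]; omega) (by omega) x y
  · filter_upwards [M.eventually_rates 0] with n hn
    have := hn.2.2.1
    have := hn.2.2.2.1.trans hn.2.2.2.2.1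
    positivity
  · filter_upwards [M.tendsto_T.eventually_gt_atTop 0, M.tendsto_T.eventually_ge_atTop h] with n h2 h3
    have hT : (M.T n : ℝ) ≠ 0 := by positivity
    have h4 := card_le_of_admissible h3 (hS n)
    rw [card_prod_eq, mul_pow, div_pow, Real.sq_sqrt (Nat.cast_nonneg _)]
    calc _ ≤ (M.T n : ℝ) * (M.g n ^ 2 * M.g n ^ 2) :=
          mul_le_mul_of_nonneg_right (h4.trans (by simp)) (by positivity)
      _ = _ := by field_simp

/-- About L ≈ g²/ν² products contribute, which gives the order √L g²/T ≈ g³/(νT). This is at most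
νg/√T because ρ ≤ 1. -/
theorem isBigOp_noiseMoment_near {t : ℕ → ℤ} {h : ℕ} (hh : 1 ≤ h) :
    IsBigOp μ (fun n ω => ‖M.noiseMoment (M.nearTimes t) h n ω‖)
      fun n => M.ν n * M.g n / √(M.T n) := by
  refine isBigOp_crossMoment_of_orth (B := 4 + h) M.boundedE M.boundedE
    (fun n => admissible_nearTimes _ _) (fun n s hs x y => ?_) ?_ ?_
  · have h1 := admissible_nearTimes _ _ s hs
    exact M.orth_EE n s (by simp only [Finset.mem_Icc]; omega) (s + h)
      (by simp only [Finset.mem_Icc]; omega) (by omega) x y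
  · filter_upwards [M.eventually_rates 0] with n hn
    have := hn.2.2.1
    have := hn.2.2.2.1
    have := hn.2.2.2.1.trans hn.2.2.2.2.1
    positivity
  · filter_upwards [M.tendsto_T.eventually_gt_atTop 0, M.halfWidth_bounds,
      M.eventually_rates 0] with n h2 h3 h4
    have hT : (M.T n : ℝ) ≠ 0 := by positivity
    have h5 := card_nearTimes_le (M := M) (t := t) h n
    obtain ⟨-, -, hs, hν1, hνg, hgν, -⟩ := h4
    rw [card_prod_eq, mul_pow, div_pow, mul_pow, Real.sq_sqrt (Nat.cast_nonneg _)]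
    have hν : 0 < M.ν n := by linarith
    have hg : 0 < M.g n := by linarith
    have h6 : ((M.nearTimes t h n).card : ℝ) * M.ν n ^ 2 ≤ (4 + h) * M.g n ^ 2 := by
      have h7 : M.ν n ^ 2 ≤ M.g n ^ 2 := pow_le_pow_left₀ hν.le hνg 2
      have h8 := mul_le_mul_of_nonneg_right h5 (sq_nonneg (M.ν n))
      have h9 := mul_le_mul_of_nonneg_left h7 (Nat.cast_nonneg (α := ℝ) h)
      nlinarith [h3.2.2]
    have h10 : M.g n ^ 4 ≤ M.ν n ^ 4 * M.T n := by
      have h11 := pow_le_pow_left₀ (sq_nonneg _) hgν 2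
      rw [mul_pow, Real.sq_sqrt (Nat.cast_nonneg _)] at h11
      calc _ = (M.g n ^ 2) ^ 2 := by ring
        _ ≤ _ := h11
        _ = _ := by ring
    refine le_of_mul_le_mul_right ?_ (show 0 < M.ν n ^ 2 by positivity)
    calc _ = ((M.nearTimes t h n).card : ℝ) * M.ν n ^ 2 * M.g n ^ 4 := by ring
      _ ≤ (4 + h) * M.g n ^ 2 * (M.ν n ^ 4 * M.T n) := by gcongr
      _ = _ := by field_simp

theorem norm_remainder_le (t : ℕ → ℤ) {h : ℕ} (hh : 1 ≤ h) (n : ℕ) (ω : Ω) :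
    ‖M.remainder t h n ω‖ ≤ ‖M.noiseMoment (M.nearTimes t) h n ω‖ +
      ‖M.load n‖ * (‖M.mom h n (fun s => (M.F n s ω).vec) (fun s => (M.F n s ω).vec) -
        M.popF n h‖) * ‖M.load n‖ +
      ‖M.load n‖ * ‖M.mom h n (fun s => (M.F n s ω).vec) (fun s => unc (M.E n s ω))‖ +
      ‖M.load n‖ * ‖M.mom h n (fun s => unc (M.E n s ω)) (fun s => (M.F n s ω).vec)‖ +
      ‖M.load n‖ * (‖M.dev n ω‖ *
        ‖M.mom h n (fun s => (M.F n s ω).vec) (fun s => unc (M.X n s ω))‖) +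
      ‖M.load n‖ * (‖M.dev n ω‖ *
        ‖M.mom h n (fun s => unc (M.X n s ω)) (fun s => (M.F n s ω).vec)‖) +
      ‖M.dev n ω‖ * ‖M.mom h n (fun s => unc (M.E n s ω)) (fun s => unc (M.X n s ω))‖ +
      ‖M.dev n ω‖ * ‖M.mom h n (fun s => unc (M.X n s ω)) (fun s => unc (M.E n s ω))‖ +
      ‖M.dev n ω‖ * (‖M.dev n ω‖ *
        ‖M.mom h n (fun s => unc (M.X n s ω)) (fun s => unc (M.X n s ω))‖) := by
  set K := M.load n with hK
  set D := M.dev n ω with hD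
  set f : ℤ → Fin r × Fin k → ℝ := fun s => (M.F n s ω).vec with hf
  set e : ℤ → Fin (M.p n) × Fin (M.q n) → ℝ := fun s => unc (M.E n s ω) with he
  set x : ℤ → Fin m × Fin (M.q n) → ℝ := fun s => unc (M.X n s ω) with hx
  set d : ℤ → Fin (M.p n) × Fin (M.q n) → ℝ := fun s => unc (D * M.X n s ω) with hd
  have e0 : M.sampleW h n ω = M.mom h n (fun s => K *ᵥ f s + e s - d s)
      (fun s => K *ᵥ f s + e s - d s) := by
    have e1 : ∀ s, unc (residualEst (M.T n) (fun t => M.Y n t ω) (fun t => M.X n t ω) s) =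
        K *ᵥ f s + e s - d s := fun s => by
      rw [residualEst_eq, hK, hf, he, ← unc_W]
      rfl
    rw [sampleW, sampleTensor, mom]
    simp only [e1]
  have e2 : M.remainder t h n ω = M.noiseMoment (M.nearTimes t) h n ω +
      (K * (M.mom h n f f - M.popF n h) * Kᵀ +
        K * M.mom h n f e + M.mom h n e f * Kᵀ - K * M.mom h n f d -
        M.mom h n d f * Kᵀ - M.mom h n e d - M.mom h n d e + M.mom h n d d) := by
    have e3 : M.mom h n e e = M.noiseMoment (M.pastTimes t) h n ω +
        (M.noiseMoment (M.futureTimes t) h n ω + M.noiseMoment (M.nearTimes t) h n ω) :=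
      M.noiseMoment_split h n ω
    have e4 : M.mom h n (fun s => K *ᵥ f s + e s - d s) (fun s => K *ᵥ f s + e s - d s) =
        K * M.popF n h * Kᵀ + M.mom h n e e + (K * (M.mom h n f f - M.popF n h) * Kᵀ +
        K * M.mom h n f e + M.mom h n e f * Kᵀ - K * M.mom h n f d -
        M.mom h n d f * Kᵀ - M.mom h n e d - M.mom h n d e + M.mom h n d d) :=
      crossMoment_expansion _ _ _ K f e d (M.popF n h)
    rw [remainder, e0, e4, e3, popTensor_eq n hh, ← hK]
    abel
  rw [e2]
  have dl : ∀ {J : Type} [Fintype J] (v : ℤ → J → ℝ),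
      ‖M.mom h n d v‖ ≤ ‖D‖ * ‖M.mom h n x v‖ := fun v =>
    norm_crossMoment_mul_left_le _ _ _ D (fun s => M.X n s ω) v
  have dr : ∀ {J : Type} [Fintype J] (v : ℤ → J → ℝ),
      ‖M.mom h n v d‖ ≤ ‖D‖ * ‖M.mom h n v x‖ := fun v =>
    norm_crossMoment_mul_right_le _ _ _ D (fun s => M.X n s ω) v
  have b1 : ‖K * (M.mom h n f f - M.popF n h) * Kᵀ‖ ≤ ‖K‖ * ‖M.mom h n f f - M.popF n h‖ * ‖K‖ := by
    refine (frob_mul_le _ _).trans ?_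
    rw [frob_transpose]
    exact mul_le_mul_of_nonneg_right (frob_mul_le _ _) (norm_nonneg _)
  have b2 : ‖K * M.mom h n f e‖ ≤ ‖K‖ * ‖M.mom h n f e‖ := frob_mul_le _ _
  have b3 : ‖M.mom h n e f * Kᵀ‖ ≤ ‖K‖ * ‖M.mom h n e f‖ := by
    refine (frob_mul_le _ _).trans ?_
    rw [frob_transpose, mul_comm]
  have b4 : ‖K * M.mom h n f d‖ ≤ ‖K‖ * (‖D‖ * ‖M.mom h n f x‖) :=
    (frob_mul_le _ _).trans (mul_le_mul_of_nonneg_left (dr f) (norm_nonneg _))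
  have b5 : ‖M.mom h n d f * Kᵀ‖ ≤ ‖K‖ * (‖D‖ * ‖M.mom h n x f‖) := by
    refine (frob_mul_le _ _).trans ?_
    rw [frob_transpose, mul_comm]
    exact mul_le_mul_of_nonneg_left (dl f) (norm_nonneg _)
  have b6 := dr e
  have b7 := dl e
  have b8 : ‖M.mom h n d d‖ ≤ ‖D‖ * (‖D‖ * ‖M.mom h n x x‖) :=
    (dl d).trans (mul_le_mul_of_nonneg_left (dr x) (norm_nonneg _))
  refine (norm_add_le _ _).trans ?_
  have s1 := norm_add_le (K * (M.mom h n f f - M.popF n h) * Kᵀ +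
        K * M.mom h n f e + M.mom h n e f * Kᵀ - K * M.mom h n f d -
        M.mom h n d f * Kᵀ - M.mom h n e d - M.mom h n d e) (M.mom h n d d)
  have s2 := norm_sub_le (K * (M.mom h n f f - M.popF n h) * Kᵀ +
        K * M.mom h n f e + M.mom h n e f * Kᵀ - K * M.mom h n f d -
        M.mom h n d f * Kᵀ - M.mom h n e d) (M.mom h n d e)
  have s3 := norm_sub_le (K * (M.mom h n f f - M.popF n h) * Kᵀ +
        K * M.mom h n f e + M.mom h n e f * Kᵀ - K * M.mom h n f d -
        M.mom h n d f * Kᵀ) (M.mom h n e d)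
  have s4 := norm_sub_le (K * (M.mom h n f f - M.popF n h) * Kᵀ +
        K * M.mom h n f e + M.mom h n e f * Kᵀ - K * M.mom h n f d) (M.mom h n d f * Kᵀ)
  have s5 := norm_sub_le (K * (M.mom h n f f - M.popF n h) * Kᵀ +
        K * M.mom h n f e + M.mom h n e f * Kᵀ) (K * M.mom h n f d)
  have s6 := norm_add₃_le (a := K * (M.mom h n f f - M.popF n h) * Kᵀ)
    (b := K * M.mom h n f e) (c := M.mom h n e f * Kᵀ)
  linarith

/-- The order of the negligible part. -/
theorem isBigOp_remainder (t : ℕ → ℤ) {h : ℕ} (hh : 1 ≤ h) :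
    IsBigOp μ (fun n ω => ‖M.remainder t h n ω‖) fun n => M.ν n * M.g n / √(M.T n) := by
  have hr := M.eventually_rates 0
  have hν := M.eventually_ν_nonneg
  have hg : ∀ n, 0 ≤ M.g n := M.g_nonneg
  have hΛ : ∀ᶠ n in atTop, 0 ≤ M.ν n * M.g n / √(M.T n) := hν.mono fun n hn => by
    have := hg n; positivity
  have nn : ∀ n, 0 ≤ √(M.p n : ℝ) / √(M.T n) := fun n => by positivity
  have nn2 : ∀ n, 0 ≤ M.g n / √(M.T n) := fun n => by have := hg n; positivity
  have nn3 : ∀ n, 0 ≤ √(M.q n) * M.g n / √(M.T n) := fun n => by have := hg n; positivity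
  -- The left side is g²/T, and g ≤ ν√T follows from ρ ≤ 1 and √T ≥ 1.
  have small : ∀ᶠ n in atTop, (√(M.p n) / √(M.T n)) * (√(M.q n) * M.g n / √(M.T n)) ≤
      1 * (M.ν n * M.g n / √(M.T n)) := by
    filter_upwards [hr] with n hn
    obtain ⟨-, -, hs, hν1, hνg, hgν, -⟩ := hn
    have hs0 : 0 < √(M.T n : ℝ) := by linarith
    have h1 : M.g n ≤ M.ν n * √(M.T n) := by
      refine abs_le_of_sq_le_sq' ?_ (by positivity) |>.2
      rw [mul_pow]
      refine hgν.trans (mul_le_mul_of_nonneg_left ?_ (sq_nonneg _))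
      nlinarith
    calc _ = M.g n * M.g n / (√(M.T n) * √(M.T n)) := by unfold g; field_simp
      _ ≤ (M.ν n * √(M.T n)) * M.g n / (√(M.T n) * √(M.T n)) := by
          have := hg n
          gcongr
      _ = _ := by field_simp
  have h1 := M.isBigOp_noiseMoment_near (t := t) hh
  have h2 := ((M.isBigOp_load.mul (M.isBigOp_mom_ff h) hν
    (Eventually.of_forall fun n => by positivity)).mul_rate M.isBigOp_load
    (b'' := fun n => M.ν n * M.g n / √(M.T n)) (C := 1)
    (hν.mono fun n hn => by positivity) hν (by
      filter_upwards [hr] with n hn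
      obtain ⟨-, -, hs, hν1, hνg, hgν, -⟩ := hn
      calc _ = M.ν n * M.ν n / √(M.T n) := by ring
        _ ≤ M.ν n * M.g n / √(M.T n) := by gcongr
        _ = _ := by ring))
  have r3 : ∀ᶠ n in atTop, M.ν n * (M.g n / √(M.T n)) ≤ 1 * (M.ν n * M.g n / √(M.T n)) :=
    Eventually.of_forall fun n => by rw [one_mul, mul_div_assoc]
  have h3 := M.isBigOp_load.mul_rate (M.isBigOp_mom_fe h) hν (Eventually.of_forall nn2) r3
  have h4 := M.isBigOp_load.mul_rate (M.isBigOp_mom_ef h) hν (Eventually.of_forall nn2) r3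
  have r5 : ∀ᶠ n in atTop, M.ν n * (√(M.p n) / √(M.T n) * √(M.q n)) ≤
      1 * (M.ν n * M.g n / √(M.T n)) :=
    Eventually.of_forall fun n => le_of_eq (by unfold g; ring)
  have nn5 : ∀ᶠ n in atTop, 0 ≤ √(M.p n : ℝ) / √(M.T n) * √(M.q n) :=
    Eventually.of_forall fun n => by positivity
  have h5 := M.isBigOp_load.mul_rate (M.isBigOp_dev.mul (M.isBigOp_mom_fx h)
    (Eventually.of_forall nn) (Eventually.of_forall fun n => Real.sqrt_nonneg _)) hν nn5 r5
  have h6 := M.isBigOp_load.mul_rate (M.isBigOp_dev.mul (M.isBigOp_mom_xf h)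
    (Eventually.of_forall nn) (Eventually.of_forall fun n => Real.sqrt_nonneg _)) hν nn5 r5
  have h7 := M.isBigOp_dev.mul_rate (M.isBigOp_mom_ex h) (Eventually.of_forall nn)
    (Eventually.of_forall nn3) small
  have h8 := M.isBigOp_dev.mul_rate (M.isBigOp_mom_xe h) (Eventually.of_forall nn)
    (Eventually.of_forall nn3) small
  have h9 := M.isBigOp_dev.mul_rate (M.isBigOp_dev.mul (M.isBigOp_mom_xx h)
    (Eventually.of_forall nn) (Eventually.of_forall fun n => sq_nonneg _))
    (Eventually.of_forall nn) (Eventually.of_forall fun n => by positivity)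
    (small.mono fun n hn => (le_of_eq (by unfold g; ring)).trans hn)
  refine ((((((((h1.add_same h2 hΛ).add_same h3 hΛ).add_same h4 hΛ).add_same h5 hΛ).add_same
    h6 hΛ).add_same h7 hΛ).add_same h8 hΛ).add_same h9 hΛ).mono (Eventually.of_forall fun n ω => ?_)
  rw [abs_of_nonneg (norm_nonneg _), abs_of_nonneg (by positivity)]
  exact norm_remainder_le t hh n ω

end FactorModel

end MatFactor

/-! ### The noise at one time between past and future coefficients. -/

namespace MatFactor

open scoped Matrix.Norms.Frobenius

theorem covConst_nonneg {γ : ℝ} (hγ : 2 < γ) : 0 ≤ covConst γ := by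
  unfold covConst
  have := khinConst_nonneg (show 0 < γ by linarith)
  positivity

section Sided

variable {Ω : Type*} {m₀ : MeasurableSpace Ω} {μ : Measure Ω} {P Q J J' : Type*}

/-- A random matrix that depends on the times up to `i` only, or on the times from `j` on only. -/
def Sided (𝔉 : ℤ → MeasurableSpace Ω) (i j : ℤ) (X : Ω → Matrix P J ℝ) : Prop :=
  (∀ a b, Measurable[pastField 𝔉 i] fun ω => X ω a b) ∨
    ∀ a b, Measurable[futureField 𝔉 j] fun ω => X ω a b

variable [Fintype P] [Fintype Q] [Fintype J] [Fintype J'] {𝔉 : ℤ → MeasurableSpace Ω}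

theorem Sided.truncMat {i j : ℤ} {X : Ω → Matrix P J ℝ} (hX : Sided 𝔉 i j X) (b : ℝ) :
    Sided 𝔉 i j (truncMat b X) :=
  hX.imp (fun h => measurable_truncMat h b) fun h => measurable_truncMat h b

variable [IsProbabilityMeasure μ] {γ K A σ : ℝ} {a : ℕ → ℝ}

/-- Coefficients on the same side of t need one decoupling and coefficients on opposite sides need
two, hence the factor 2. If the left coefficient lies in the future, the transposed form is treated
instead. -/
theorem integral_norm_sq_le_of_sided [Nonempty P] [Nonempty Q] (hmx : Mixing μ 𝔉 γ a A)
    (hγ : 2 < γ) (hK : 0 < K) (hσ : 0 ≤ σ) {e : Ω → Matrix P Q ℝ} (he : NoiseMat μ γ K σ e) {t : ℤ}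
    (hem : ∀ i j, Measurable[𝔉 t] fun ω => e ω i j) {L : ℕ} (hL : 1 ≤ L)
    {X : Ω → Matrix P J ℝ} {Z : Ω → Matrix Q J' ℝ} (hX : Sided 𝔉 (t - L) (t + L) X)
    (hZ : Sided 𝔉 (t - L) (t + L) Z) {b c : ℝ} (hb : 0 < b) (hc : 0 < c) (hXb : ∀ ω, ‖X ω‖ ≤ b)
    (hZc : ∀ ω, ‖Z ω‖ ≤ c) :
    Integrable (fun ω => ‖(X ω)ᵀ * e ω * Z ω‖ ^ 2) μ ∧
    ∫ ω, ‖(X ω)ᵀ * e ω * Z ω‖ ^ 2 ∂μ ≤ (b * c) ^ 2 * (σ + 2 *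
      (covConst γ * a L ^ (1 - 2 / γ) * (Fintype.card P * Fintype.card Q * K ^ (1 / γ)))) := by
  have hpf : AlphaLe (pastField 𝔉 (t - L)) (futureField 𝔉 t) μ (a L) := by
    simpa using hmx.alphaLe (t - L) L hL
  have hpf' : AlphaLe (pastField 𝔉 t) (futureField 𝔉 (t + L)) μ (a L) := hmx.alphaLe t L hL
  have hpp : pastField 𝔉 (t - L) ≤ pastField 𝔉 t :=
    biSup_mono fun s (hs : s ≤ t - L) => show s ≤ t by omega
  have lp := pastField_le hmx.le
  have lf := futureField_le hmx.le
  have hV : 0 ≤ covConst γ * a L ^ (1 - 2 / γ) *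
      (Fintype.card P * Fintype.card Q * K ^ (1 / γ)) := by
    have h1 := hpf.nonneg
    have h2 := covConst_nonneg hγ
    positivity
  have emf : ∀ i j, Measurable[futureField 𝔉 t] fun ω => e ω i j := fun i j =>
    (hem i j).mono (le_futureField le_rfl) le_rfl
  have emp : ∀ i j, Measurable[pastField 𝔉 t] fun ω => e ω i j := fun i j =>
    (hem i j).mono (le_pastField le_rfl) le_rfl
  set V := covConst γ * a L ^ (1 - 2 / γ) * (Fintype.card P * Fintype.card Q * K ^ (1 / γ)) with hVd
  have hle : (b * c) ^ 2 * (σ + V) ≤ (b * c) ^ 2 * (σ + 2 * V) :=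
    mul_le_mul_of_nonneg_left (by linarith) (sq_nonneg _)
  rcases hX with hX | hX <;> rcases hZ with hZ | hZ
  · obtain ⟨h1, h2⟩ := integral_norm_sq_le_of_alphaLe hpf (lp _) (lf _) hγ hK hσ he emf hX hZ hb hc
      hXb hZc
    exact ⟨h1, h2.trans hle⟩
  · have hG : ∀ z : Matrix Q J' ℝ, ‖z‖ ≤ c →
        ∫ ω, ‖(X ω)ᵀ * e ω * z‖ ^ 2 ∂μ ≤ (b * c) ^ 2 * (σ + V) := fun z hz =>
      (integral_norm_sq_le_of_alphaLe (Z := fun _ => z) hpf (lp _) (lf _) hγ hK hσ he emf hX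
        (fun i j => measurable_const) hb hc hXb fun _ => hz).2
    obtain ⟨h1, h2⟩ := integral_norm_sq_le_add_of_alphaLe hpf' (lp _) (lf _) hγ hK he emp
      (fun i j => (hX i j).mono hpp le_rfl) hZ hb hc hXb hZc hG
    exact ⟨h1, h2.trans (le_of_eq (by rw [← hVd]; ring))⟩
  · have hG : ∀ z : Matrix P J ℝ, ‖z‖ ≤ b →
        ∫ ω, ‖(Z ω)ᵀ * (e ω)ᵀ * z‖ ^ 2 ∂μ ≤ (c * b) ^ 2 * (σ + V) := fun z hz => by
      have := (integral_norm_sq_le_of_alphaLe (Z := fun _ => z) hpf (lp _) (lf _) hγ hK hσ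
        he.transpose (fun i j => emf j i) hZ (fun i j => measurable_const) hc hb hZc fun _ => hz).2
      rwa [mul_comm (Fintype.card Q : ℝ), ← hVd] at this
    have key := integral_norm_sq_le_add_of_alphaLe hpf' (lp _) (lf _) hγ hK he.transpose
      (fun i j => emp j i) (fun i j => (hZ i j).mono hpp le_rfl) hX hc hb hZc hXb hG
    rw [mul_comm (Fintype.card Q : ℝ), ← hVd] at key
    have e1 : ∀ ω, ‖(Z ω)ᵀ * (e ω)ᵀ * X ω‖ = ‖(X ω)ᵀ * e ω * Z ω‖ := fun ω => by
      rw [← frob_transpose]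
      simp only [Matrix.transpose_mul, Matrix.transpose_transpose, Matrix.mul_assoc]
    simp only [e1] at key
    exact ⟨key.1, key.2.trans (le_of_eq (by ring))⟩
  · obtain ⟨h1, h2⟩ := integral_norm_sq_le_of_alphaLe hpf'.symm (lf _) (lp _) hγ hK hσ he emp hX hZ
      hb hc hXb hZc
    exact ⟨h1, h2.trans hle⟩

end Sided

/-- It suffices to control a variable on the events where two others are of their order. -/
theorem IsBigOp.of_truncated {Ω : Type*} [MeasurableSpace Ω] {μ : Measure Ω} {u v x : ℕ → Ω → ℝ}
    {b b' b'' : ℕ → ℝ} (hu : IsBigOp μ u b) (hv : IsBigOp μ v b') (hb : ∀ᶠ n in atTop, 0 ≤ b n)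
    (hb' : ∀ᶠ n in atTop, 0 ≤ b' n)
    (h : ∀ K K' : ℝ, 0 < K → 0 < K' → ∃ y, IsBigOp μ y b'' ∧ ∀ᶠ n in atTop, ∀ ω,
      |u n ω| ≤ K * b n → |v n ω| ≤ K' * b' n → |x n ω| ≤ |y n ω|) : IsBigOp μ x b'' := by
  intro ε hε
  obtain ⟨K, hK0, hK⟩ := hu.exists_pos hb (show 0 < ε / 3 by positivity)
  obtain ⟨K', hK0', hK'⟩ := hv.exists_pos hb' (show 0 < ε / 3 by positivity)
  obtain ⟨y, hy, hxy⟩ := h K K' hK0 hK0'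
  obtain ⟨K'', hK''⟩ := hy (ε / 3) (by positivity)
  refine ⟨K'', ?_⟩
  filter_upwards [hK, hK', hK'', hxy] with n h1 h2 h3 h4
  calc _ ≤ μ (({ω | K * b n < |u n ω|} ∪ {ω | K' * b' n < |v n ω|}) ∪
        {ω | K'' * b'' n < |y n ω|}) := by
        refine measure_mono fun ω hω => ?_
        by_contra hcon
        simp only [Set.mem_union, Set.mem_ofPred_eq, not_or, not_lt] at hcon hω
        have := h4 ω hcon.1.1 hcon.1.2
        linarith [hcon.2]
    _ ≤ ENNReal.ofReal (ε / 3) + ENNReal.ofReal (ε / 3) + ENNReal.ofReal (ε / 3) :=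
        (measure_union_le _ _).trans (add_le_add ((measure_union_le _ _).trans
          (add_le_add h1 h2)) h3)
    _ = _ := by
        rw [← ENNReal.ofReal_add (by positivity) (by positivity),
          ← ENNReal.ofReal_add (by positivity) (by positivity)]
        congr 1
        ring

namespace FactorModel

variable {Ω : Type*} [MeasurableSpace Ω] {μ : Measure Ω} {k r m : ℕ} {M : FactorModel μ k r m}
  [IsProbabilityMeasure μ] {t : ℕ → ℤ}

theorem isBigOp_norm_E (ht : ∀ᶠ n in atTop, t n ∈ Finset.Icc (1 : ℤ) (M.T n)) :
    IsBigOp μ (fun n ω => ‖M.E n (t n) ω‖) M.g := by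
  refine IsBigOp.of_integral_sq (C := 1 + M.K) ?_ ?_
  · exact (M.eventually_rates 0).mono fun n hn => by
      have := hn.2.2.2.1.trans hn.2.2.2.2.1
      linarith
  · filter_upwards [ht] with n hn
    have key := (M.boundedE n).integral_norm_sq_le (M.mixing n) M.two_lt hn
    rw [card_prod_eq] at key
    simpa only [frob_sq, unc, Fintype.sum_prod_type] using key

theorem isBigOp_norm_X (ht : ∀ᶠ n in atTop, t n ∈ Finset.Icc (1 : ℤ) (M.T n)) :
    IsBigOp μ (fun n ω => ‖M.X n (t n) ω‖) fun n => √(M.q n) := by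
  refine IsBigOp.of_integral_sq (C := (1 + M.K) * m) eventually_sqrt_q_pos ?_
  filter_upwards [ht] with n hn
  have key := (M.boundedX n).integral_norm_sq_le (M.mixing n) M.two_lt hn
  rw [Real.sq_sqrt (Nat.cast_nonneg _), mul_assoc]
  simpa only [frob_sq, unc, Fintype.sum_prod_type, Fintype.card_prod, Fintype.card_fin,
    Nat.cast_mul] using key

theorem isBigOp_norm_F (ht : ∀ᶠ n in atTop, t n ∈ Finset.Icc (1 : ℤ) (M.T n)) :
    IsBigOp μ (fun n ω => ‖M.F n (t n) ω‖) fun _ => 1 := by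
  refine IsBigOp.of_integral_sq (C := (1 + M.K) * (k * r))
    (Eventually.of_forall fun _ => one_pos) ?_
  filter_upwards [ht] with n hn
  have key := (M.boundedF n).integral_norm_sq_le (M.mixing n) M.two_lt hn
  have e : ∀ ω, ‖M.F n (t n) ω‖ ^ 2 = ∑ x, (M.F n (t n) ω).vec x ^ 2 := fun ω => by
    rw [frob_sq, Finset.sum_comm, Fintype.sum_prod_type]
    rfl
  simp only [e, one_pow, mul_one]
  refine ⟨key.1, key.2.trans (le_of_eq ?_)⟩
  rw [Fintype.card_prod, Fintype.card_fin, Fintype.card_fin, Nat.cast_mul, mul_comm (r : ℝ)]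

theorem measurable_E (n : ℕ) (s : ℤ) (i : Fin (M.p n)) (j : Fin (M.q n)) :
    Measurable[M.field n s] fun ω => M.E n s ω i j := (M.boundedE n).meas s (i, j)

/-- Truncation at the known orders makes the coefficients bounded, as decoupling requires, and
preserves measurability on their side of t. The factor ν is the price of the distance L. -/
theorem isBigOp_sided (ht : ∀ᶠ n in atTop, t n ∈ Finset.Icc (1 : ℤ) (M.T n))
    {J J' : ℕ → Type} [∀ n, Fintype (J n)] [∀ n, Fintype (J' n)]
    {X : ∀ n, Ω → Matrix (Fin (M.p n)) (J n) ℝ} {Z : ∀ n, Ω → Matrix (Fin (M.q n)) (J' n) ℝ}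
    (hX : ∀ n, Sided (M.field n) (t n - M.halfWidth n) (t n + M.halfWidth n) (X n))
    (hZ : ∀ n, Sided (M.field n) (t n - M.halfWidth n) (t n + M.halfWidth n) (Z n)) {b b' : ℕ → ℝ}
    (hb : ∀ᶠ n in atTop, 0 < b n) (hb' : ∀ᶠ n in atTop, 0 < b' n)
    (hXb : IsBigOp μ (fun n ω => ‖X n ω‖) b) (hZb : IsBigOp μ (fun n ω => ‖Z n ω‖) b') :
    IsBigOp μ (fun n ω => ‖(X n ω)ᵀ * M.E n (t n) ω * Z n ω‖) fun n => b n * b' n * M.ν n := by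
  refine hXb.of_truncated hZb (hb.mono fun _ h => h.le) (hb'.mono fun _ h => h.le)
    fun K K' hK hK' => ⟨fun n ω => ‖(truncMat (K * b n) (X n) ω)ᵀ * M.E n (t n) ω *
      truncMat (K' * b' n) (Z n) ω‖, ?_, ?_⟩
  · have hc0 := covConst_nonneg M.two_lt
    refine IsBigOp.of_integral_sq
      (C := (K * K') ^ 2 * (M.σ + 2 * (covConst M.γ * M.mixBound * M.K ^ (1 / M.γ)))) ?_ ?_
    · filter_upwards [hb, hb', M.eventually_rates 0] with n h1 h2 h3
      have := h3.2.2.2.1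
      positivity
    · filter_upwards [ht, hb, hb', M.eventually_rates 0, M.halfWidth_bounds,
        M.tendsto_p.eventually_gt_atTop 0, M.tendsto_q.eventually_gt_atTop 0]
        with n h0 h1 h2 h3 h4 hp hq
      have : Nonempty (Fin (M.p n)) := ⟨⟨0, hp⟩⟩
      have : Nonempty (Fin (M.q n)) := ⟨⟨0, hq⟩⟩
      obtain ⟨i1, i2⟩ := integral_norm_sq_le_of_sided (M.mixing n) M.two_lt M.K_pos M.σ_nonneg
        (M.noise n _ h0) (measurable_E n (t n)) h4.1 ((hX n).truncMat (K * b n))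
        ((hZ n).truncMat (K' * b' n)) (mul_pos hK h1) (mul_pos hK' h2)
        (norm_truncMat_le _ (mul_pos hK h1).le) (norm_truncMat_le _ (mul_pos hK' h2).le)
      refine ⟨i1, i2.trans ?_⟩
      have hν : 1 ≤ M.ν n ^ 2 := one_le_pow₀ h3.2.2.2.1
      have hK0 := M.K_pos
      have hσ := M.σ_nonneg
      have ha : 0 ≤ M.α n (M.halfWidth n) ^ (1 - 2 / M.γ) :=
        Real.rpow_nonneg ((M.mixing n).nonneg h4.1) _
      -- Here the half width enters: pq = g² ≤ L ν², and L α(L)^(1-2/γ) is bounded.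
      have h5 : M.α n (M.halfWidth n) ^ (1 - 2 / M.γ) * M.g n ^ 2 ≤ M.mixBound * M.ν n ^ 2 := by
        calc _ ≤ M.α n (M.halfWidth n) ^ (1 - 2 / M.γ) * (M.halfWidth n * M.ν n ^ 2) :=
              mul_le_mul_of_nonneg_left h4.2.1 ha
          _ = (M.halfWidth n * M.α n (M.halfWidth n) ^ (1 - 2 / M.γ)) * M.ν n ^ 2 := by ring
          _ ≤ _ := mul_le_mul_of_nonneg_right (M.decay n _ h4.1) (sq_nonneg _)
      have h6 : M.σ + 2 * (covConst M.γ * M.α n (M.halfWidth n) ^ (1 - 2 / M.γ) *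
          (Fintype.card (Fin (M.p n)) * Fintype.card (Fin (M.q n)) * M.K ^ (1 / M.γ))) ≤
          (M.σ + 2 * (covConst M.γ * M.mixBound * M.K ^ (1 / M.γ))) * M.ν n ^ 2 := by
        have h7 : covConst M.γ * M.K ^ (1 / M.γ) *
            (M.α n (M.halfWidth n) ^ (1 - 2 / M.γ) * M.g n ^ 2) ≤
            covConst M.γ * M.K ^ (1 / M.γ) * (M.mixBound * M.ν n ^ 2) :=
          mul_le_mul_of_nonneg_left h5 (by positivity)
        simp only [Fintype.card_fin]
        rw [g_sq] at h7
        nlinarith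
      calc _ ≤ (K * b n * (K' * b' n)) ^ 2 *
            ((M.σ + 2 * (covConst M.γ * M.mixBound * M.K ^ (1 / M.γ))) * M.ν n ^ 2) :=
            mul_le_mul_of_nonneg_left h6 (sq_nonneg _)
        _ = _ := by ring
  · refine Eventually.of_forall fun n ω h1 h2 => le_of_eq ?_
    rw [abs_of_nonneg (norm_nonneg _)] at h1 h2
    simp only [truncMat, if_pos h1, if_pos h2]

theorem sided_const {n : ℕ} {P J : Type*} {i j : ℤ} (x : Matrix P J ℝ) :
    Sided (M.field n) i j fun _ => x := Or.inl fun _ _ => @measurable_const _ _ _ (_) _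

theorem noiseMoment_past_measurable (h n : ℕ) (x y : Fin (M.p n) × Fin (M.q n)) :
    Measurable[pastField (M.field n) (t n - M.halfWidth n)] fun ω =>
      M.noiseMoment (M.pastTimes t) h n ω x y := by
  refine Measurable.const_mul (Finset.measurable_fun_sum _ fun s hs => ?_) _
  have h1 := (Finset.mem_filter.1 hs).2
  exact ((measurable_E n s x.1 x.2).mono (le_pastField (by omega)) le_rfl).mul
    ((measurable_E n (s + h) y.1 y.2).mono (le_pastField (by omega)) le_rfl)

theorem noiseMoment_future_measurable (h n : ℕ) (x y : Fin (M.p n) × Fin (M.q n)) :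
    Measurable[futureField (M.field n) (t n + M.halfWidth n)] fun ω =>
      M.noiseMoment (M.futureTimes t) h n ω x y := by
  refine Measurable.const_mul (Finset.measurable_fun_sum _ fun s hs => ?_) _
  have h1 := (Finset.mem_filter.1 hs).2
  exact ((measurable_E n s x.1 x.2).mono (le_futureField (by omega)) le_rfl).mul
    ((measurable_E n (s + h) y.1 y.2).mono (le_futureField (by omega)) le_rfl)

theorem sampleW_eq (t : ℕ → ℤ) (h n : ℕ) (ω : Ω) : M.sampleW h n ω =
    popTensor μ (M.T n) (M.W n) h + M.noiseMoment (M.pastTimes t) h n ω +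
      M.noiseMoment (M.futureTimes t) h n ω + M.remainder t h n ω := by
  unfold remainder
  abel

theorem sq_div_sqrt_eq : ∀ᶠ n in atTop, M.g n ^ 2 / √(M.T n) = M.ν n ^ 2 * M.ρ n ∧
    M.ν n * M.g n / √(M.T n) * M.g n = M.ν n ^ 3 * M.ρ n ∧
    M.ν n * M.g n / √(M.T n) ≤ M.ν n ^ 2 * M.ρ n ∧ 0 < M.ρ n ∧ M.ρ n ≤ 1 := by
  filter_upwards [M.eventually_rates 0] with n hn
  obtain ⟨-, -, hs, hν1, hνg, hgν, -⟩ := hn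
  have hs0 : 0 < √(M.T n : ℝ) := by linarith
  have hν : 0 < M.ν n := by linarith
  have hg : 0 < M.g n := by linarith
  have e1 : M.g n ^ 2 / √(M.T n) = M.ν n ^ 2 * M.ρ n := by unfold ρ; field_simp
  refine ⟨e1, by unfold ρ; field_simp, ?_, by unfold ρ; positivity, ?_⟩
  · rw [← e1]
    refine div_le_div_of_nonneg_right ?_ hs0.le
    nlinarith
  · unfold ρ
    rwa [div_le_one (by positivity)]

theorem isBigOp_popTensor {h : ℕ} (hh : 1 ≤ h) :
    IsBigOp μ (fun n (_ : Ω) => ‖popTensor μ (M.T n) (M.W n) h‖) fun n => M.ν n ^ 2 :=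
  IsBigOp.of_le ((M.norm_popTensor_le hh).mono fun n hn _ => by rwa [abs_of_nonneg (norm_nonneg _)])

theorem isBigOp_sampleW_sub {h : ℕ} (hh : 1 ≤ h) :
    IsBigOp μ (fun n ω => ‖M.sampleW h n ω - popTensor μ (M.T n) (M.W n) h‖)
      fun n => M.ν n ^ 2 * M.ρ n := by
  -- The decomposition holds for every time point and any choice serves to bound the total, since
  -- past and future moments are bounded here without decoupling.
  let t0 : ℕ → ℤ := fun _ => 0
  have hr := M.sq_div_sqrt_eq
  have h1 := (M.isBigOp_noiseMoment (S := M.pastTimes t0) hh fun n => admissible_pastTimes _ _)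
  have h2 := (M.isBigOp_noiseMoment (S := M.futureTimes t0) hh fun n => admissible_futureTimes _ _)
  have nn : ∀ᶠ n in atTop, 0 ≤ M.ν n ^ 2 * M.ρ n := hr.mono fun n hn => by
    have := hn.2.2.2.1; positivity
  have nn' : ∀ᶠ n in atTop, 0 ≤ M.g n ^ 2 / √(M.T n) := Eventually.of_forall fun n => by positivity
  have h3 := (M.isBigOp_remainder t0 hh).rate_mono (C := 1)
    (b' := fun n => M.ν n ^ 2 * M.ρ n) (M.eventually_ν_nonneg.mono fun n hn => by
    have := M.g_nonneg n; positivity) (hr.mono fun n hn => by rw [one_mul]; exact hn.2.2.1)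
  have h1' := h1.rate_mono (C := 1) (b' := fun n => M.ν n ^ 2 * M.ρ n) nn'
    (hr.mono fun n hn => by rw [one_mul]; exact hn.1.le)
  have h2' := h2.rate_mono (C := 1) (b' := fun n => M.ν n ^ 2 * M.ρ n) nn'
    (hr.mono fun n hn => by rw [one_mul]; exact hn.1.le)
  refine ((h1'.add_same h2' nn).add_same h3 nn).mono (Eventually.of_forall fun n ω => ?_)
  rw [abs_of_nonneg (norm_nonneg _), abs_of_nonneg (by positivity)]
  have e : M.sampleW h n ω - popTensor μ (M.T n) (M.W n) h =
      M.noiseMoment (M.pastTimes t0) h n ω + M.noiseMoment (M.futureTimes t0) h n ω +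
        M.remainder t0 h n ω := by
    rw [M.sampleW_eq t0]
    abel
  rw [e]
  exact norm_add₃_le

theorem isBigOp_sampleW {h : ℕ} (hh : 1 ≤ h) :
    IsBigOp μ (fun n ω => ‖M.sampleW h n ω‖) fun n => M.ν n ^ 2 := by
  have nn : ∀ᶠ n in atTop, 0 ≤ M.ν n ^ 2 := Eventually.of_forall fun n => sq_nonneg _
  have h1 := (M.isBigOp_sampleW_sub hh).rate_mono (C := 1) (b' := fun n => M.ν n ^ 2)
    (M.sq_div_sqrt_eq.mono fun n hn => by have := hn.2.2.2.1; positivity)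
    (M.sq_div_sqrt_eq.mono fun n hn => by
      rw [one_mul]
      exact mul_le_of_le_one_right (sq_nonneg _) hn.2.2.2.2)
  refine (h1.add_same (M.isBigOp_popTensor hh) nn).mono (Eventually.of_forall fun n ω => ?_)
  rw [abs_of_nonneg (norm_nonneg _), abs_of_nonneg (by positivity)]
  exact norm_le_norm_sub_add _ _

end FactorModel

end MatFactor

namespace MatFactor

open scoped Matrix.Norms.Frobenius

/-! ### Consistency of leading eigenvector spaces along the array. -/

section LeadingEigenvectors

variable {Ω : Type*} [MeasurableSpace Ω] {μ : Measure Ω} {P J : ℕ → Type} [∀ n, Fintype (P n)]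
  [∀ n, Fintype (J n)] [∀ n, DecidableEq (P n)] {d : ℕ} {H : Finset ℕ}
  {s : ℕ → ∀ n, Ω → Matrix (P n) (J n) ℝ} {τ : ℕ → ∀ n, Matrix (P n) (J n) ℝ} {N ρ : ℕ → ℝ}
  {B c : ℝ}

theorem isBigOp_gramSum_sub (hN : ∀ᶠ n in atTop, 0 < N n) (hρ : ∀ᶠ n in atTop, 0 ≤ ρ n)
    (hs : ∀ h ∈ H, IsBigOp μ (fun n ω => ‖s h n ω - τ h n‖) fun n => N n * ρ n)
    (hs' : ∀ h ∈ H, IsBigOp μ (fun n ω => ‖s h n ω‖) N)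
    (hτ : ∀ h ∈ H, IsBigOp μ (fun n (_ : Ω) => ‖τ h n‖) N) :
    IsBigOp μ (fun n ω => ‖gramSum H (fun h => s h n ω) - gramSum H fun h => τ h n‖)
      fun n => N n ^ 2 * ρ n := by
  have hN' : ∀ᶠ n in atTop, 0 ≤ N n := hN.mono fun n h => h.le
  have h0 : ∀ᶠ n in atTop, 0 ≤ N n * ρ n := by
    filter_upwards [hN, hρ] with n h1 h2
    positivity
  have h1 : IsBigOp μ (fun n ω => ∑ h ∈ H, ‖s h n ω - τ h n‖ * (‖s h n ω‖ + ‖τ h n‖))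
      fun n => N n ^ 2 * ρ n :=
    IsBigOp.sum H (fun h hh => (hs h hh).mul_rate (C := 1) ((hs' h hh).add_same (hτ h hh) hN') h0 hN'
      (Eventually.of_forall fun n => le_of_eq (by ring))) (by
        filter_upwards [hN, hρ] with n h1 h2
        positivity)
  refine h1.mono (Eventually.of_forall fun n ω => ?_)
  rw [abs_of_nonneg (norm_nonneg _), abs_of_nonneg (by positivity)]
  exact norm_gramSum_sub_le _ _ _

theorem holdsWhp_le_eigDesc (hd : 0 < d) (hN : ∀ᶠ n in atTop, 0 < N n) (hρ0 : Tendsto ρ atTop (𝓝 0))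
    (hG : IsBigOp μ (fun n ω => ‖gramSum H (fun h => s h n ω) - gramSum H fun h => τ h n‖)
      fun n => N n ^ 2 * ρ n) (hc : 0 < c) (hcard : ∀ᶠ n in atTop, d ≤ Fintype.card (P n))
    (hlow : ∀ᶠ n in atTop, c * N n ^ 2 ≤ eigDesc (gramSum H fun h => τ h n) (d - 1))
    {ε : ℝ} (hε : 0 < ε) :
    HoldsWhp μ fun n ω => ‖gramSum H (fun h => s h n ω) - gramSum H fun h => τ h n‖ ≤ ε * N n ^ 2 ∧
      ∀ i : Fin d, c / 2 * N n ^ 2 ≤ eigDesc (gramSum H fun h => s h n ω) i := by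
  have h1 : IsBigOp μ (fun n (_ : Ω) => (N n ^ 2)⁻¹) fun n => (N n ^ 2)⁻¹ :=
    IsBigOp.of_le (C := 1) (Eventually.of_forall fun n ω => by
      rw [one_mul, abs_of_nonneg (by positivity)])
  have h2 : IsBigOp μ (fun n ω => (N n ^ 2)⁻¹ *
      -- No sign of ρ is assumed, so the rate is passed to |ρ|.
      ‖gramSum H (fun h => s h n ω) - gramSum H fun h => τ h n‖) fun n => |ρ n| := by
    refine h1.mul_rate (C := 1) (b' := fun n => N n ^ 2 * |ρ n|) ?_
      (Eventually.of_forall fun n => by positivity) (Eventually.of_forall fun n => by positivity) ?_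
    · intro δ hδ
      obtain ⟨K, hK⟩ := hG δ hδ
      refine ⟨|K|, hK.mono fun n hn => (measure_mono fun ω hω => ?_).trans hn⟩
      rw [Set.mem_ofPred_eq] at hω ⊢
      refine lt_of_le_of_lt ?_ hω
      calc _ ≤ |K * (N n ^ 2 * ρ n)| := le_abs_self _
        _ = _ := by rw [abs_mul, abs_mul, abs_of_nonneg (sq_nonneg (N n))]
    · filter_upwards [hN] with n hn
      rw [one_mul, inv_mul_cancel_left₀ (by positivity)]
  have hρ1 : Tendsto (fun n => |ρ n|) atTop (𝓝 0) := by simpa using hρ0.abs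
  refine (h2.holdsWhp hρ1 (show 0 < min ε (c / 2) by positivity)).mono ?_
  filter_upwards [hN, hcard, hlow] with n hn h3 h4 ω hω
  rw [abs_of_nonneg (by positivity), inv_mul_le_iff₀ (by positivity)] at hω
  have hN2 : 0 < N n ^ 2 := by positivity
  refine ⟨hω.trans (by rw [mul_comm]; exact mul_le_mul_of_nonneg_right (min_le_left _ _) hN2.le),
    le_eigDesc_of_le_last (gramSum_isHermitian _ _) h3 ?_⟩
  have h5 := eigDesc_sub_le (gramSum_isHermitian H fun h => τ h n)
    (gramSum_isHermitian H fun h => s h n ω) (j := d - 1) (by omega)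
  have h6 : ‖gramSum H (fun h => s h n ω) - gramSum H fun h => τ h n‖ ≤ c / 2 * N n ^ 2 :=
    hω.trans (by rw [mul_comm]; exact mul_le_mul_of_nonneg_right (min_le_right _ _) hN2.le)
  linarith

/-- Consistency of the space spanned by the leading eigenvectors. -/
theorem isBigOp_sub_proj {R : ∀ n, Matrix (P n) (Fin d) ℝ} {G : ℕ → ∀ n, Matrix (Fin d) (J n) ℝ}
    {Q : ∀ n, Ω → Matrix (P n) (Fin d) ℝ} {rR : ℕ → ℝ} (hd : 0 < d)
    (hN : ∀ᶠ n in atTop, 0 < N n) (hρ : ∀ᶠ n in atTop, 0 ≤ ρ n) (hρ0 : Tendsto ρ atTop (𝓝 0))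
    (hG : IsBigOp μ (fun n ω => ‖gramSum H (fun h => s h n ω) - gramSum H fun h => τ h n‖)
      fun n => N n ^ 2 * ρ n) (hc : 0 < c) (hcard : ∀ᶠ n in atTop, d ≤ Fintype.card (P n))
    (hlow : ∀ᶠ n in atTop, c * N n ^ 2 ≤ eigDesc (gramSum H fun h => τ h n) (d - 1))
    (hQ : ∀ᶠ n in atTop, ∀ ω, IsTopEigvecs (gramSum H fun h => s h n ω) (Q n ω))
    (hRG : ∀ n, ∀ h ∈ H, τ h n = R n * G h n) (hrR : ∀ᶠ n in atTop, 0 ≤ rR n)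
    (hR : IsBigOp μ (fun n (_ : Ω) => ‖R n‖) rR) :
    IsBigOp μ (fun n ω => ‖R n - Q n ω * (Q n ω)ᵀ * R n‖) fun n => ρ n * rR n := by
  have hd' : (0 : ℝ) < d := by exact_mod_cast hd
  have h1 : IsBigOp μ (fun n (_ : Ω) => 2 * (1 + d) * (d / (c / 2 * N n ^ 2)) : ℕ → Ω → ℝ)
      fun n => (N n ^ 2)⁻¹ :=
    IsBigOp.of_le (C := 2 * (1 + d) * (d / (c / 2))) (Eventually.of_forall fun n ω => by
      rw [abs_of_nonneg (by positivity)]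
      refine le_of_eq ?_
      rw [← div_div]
      ring)
  have h2 : IsBigOp μ (fun n ω => 2 * (1 + d) * (d / (c / 2 * N n ^ 2)) *
      ‖gramSum H (fun h => s h n ω) - gramSum H fun h => τ h n‖) ρ := by
    refine h1.mul_rate (C := 1) hG (Eventually.of_forall fun n => by positivity) ?_ ?_
    · filter_upwards [hρ] with n h1
      positivity
    · filter_upwards [hN] with n hn
      rw [one_mul, inv_mul_cancel_left₀ (by positivity)]
  -- The tolerance c/(4d) is chosen so that, with eigenvalues at least (c/2)N², the smallness
  -- condition of `norm_sub_proj_le` holds with equality at 1/2.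
  refine (h2.mul hR hρ hrR).mono_whp ((holdsWhp_le_eigDesc hd hN hρ0 hG hc hcard hlow
    (show 0 < c / (4 * d) by positivity)).mono ?_)
  filter_upwards [hQ, hN] with n hq hn ω hω
  rw [abs_of_nonneg (norm_nonneg _), abs_of_nonneg (by positivity)]
  have hcN : 0 < c / 2 * N n ^ 2 := by positivity
  have h3 : gramSum H (fun h => τ h n) = R n * ∑ h ∈ H, G h n * (τ h n)ᵀ := by
    rw [Matrix.mul_sum, gramSum]
    refine Finset.sum_congr rfl fun h hh => ?_
    rw [← Matrix.mul_assoc, ← hRG n h hh]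
  have h4 := norm_sub_proj_le (G := ∑ h ∈ H, G h n * (τ h n)ᵀ)
    (δ := ‖gramSum H (fun h => s h n ω) - gramSum H fun h => τ h n‖) (hq ω) hcN hω.2
    (by rw [← h3]) (by
    calc _ ≤ c / (4 * d) * N n ^ 2 * (d / (c / 2 * N n ^ 2)) :=
          mul_le_mul_of_nonneg_right hω.1 (by positivity)
      _ = 1 / 2 := by field_simp; norm_num)
  exact h4.trans (le_of_eq (by ring))

end LeadingEigenvectors

end MatFactor

/-! ### The noise that survives both estimated projections. -/

namespace MatFactor

open scoped Matrix.Norms.Frobenius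

theorem NoiseMat.integrable_norm_sq {Ω : Type*} [MeasurableSpace Ω] {μ : Measure Ω}
    [IsProbabilityMeasure μ] {P Q J J' : Type*} [Fintype P] [Fintype Q] [Fintype J] [Fintype J']
    {γ K σ : ℝ} {e : Ω → Matrix P Q ℝ} (he : NoiseMat μ γ K σ e) (hγ : 2 < γ) (x : Matrix P J ℝ)
    (z : Matrix Q J' ℝ) : Integrable (fun ω => ‖xᵀ * e ω * z‖ ^ 2) μ := by
  simp only [frob_sq_transpose_mul_mul]
  exact integrable_finsetSum _ fun I _ => (he.integrable_mul hγ _ _ _ _).const_mul _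

namespace FactorModel

variable {Ω : Type*} [MeasurableSpace Ω] {μ : Measure Ω} {k r m : ℕ} {M : FactorModel μ k r m}
  [IsProbabilityMeasure μ] {t : ℕ → ℤ}

variable (M) in
/-- The order of the noise between two lagged sample moments. -/
noncomputable def noiseRate (n : ℕ) : ℝ := M.ν n ^ 4 * (1 + M.ν n * M.ρ n)

theorem eventually_ν_pos : ∀ᶠ n in atTop, 0 < M.ν n :=
  (M.eventually_rates 0).mono fun _ hn => zero_lt_one.trans_le hn.2.2.2.1

theorem eventually_ν_sq_pos : ∀ᶠ n in atTop, 0 < M.ν n ^ 2 :=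
  M.eventually_ν_pos.mono fun _ hn => by positivity

theorem eventually_ν_sq_mul_ρ_pos : ∀ᶠ n in atTop, 0 < M.ν n ^ 2 * M.ρ n := by
  filter_upwards [M.eventually_ν_pos, M.sq_div_sqrt_eq] with n h1 h2
  have := h2.2.2.2.1
  positivity

theorem eventually_noiseRate_nonneg : ∀ᶠ n in atTop, 0 ≤ M.noiseRate n := by
  filter_upwards [M.eventually_ν_pos, M.sq_div_sqrt_eq] with n h1 h2
  have := h2.2.2.2.1
  unfold noiseRate
  positivity

theorem mul_le_noiseRate : ∀ᶠ n in atTop,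
    M.ν n ^ 2 * (M.ν n ^ 2 * M.ρ n) * M.ν n ≤ 1 * M.noiseRate n := by
  filter_upwards [M.eventually_ν_pos] with n h1
  unfold noiseRate
  nlinarith [show 0 < M.ν n ^ 4 by positivity]

theorem mul_mul_le_noiseRate : ∀ᶠ n in atTop,
    M.ν n ^ 2 * M.ρ n * (M.ν n ^ 2 * M.ρ n) * M.ν n ≤ 1 * M.noiseRate n := by
  filter_upwards [M.mul_le_noiseRate, M.eventually_ν_pos, M.sq_div_sqrt_eq] with n h0 h1 h2
  refine le_trans ?_ h0
  have h3 := h2.2.2.2.1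
  have h4 := h2.2.2.2.2
  have h5 : M.ν n ^ 2 * M.ρ n ≤ M.ν n ^ 2 := mul_le_of_le_one_right (by positivity) h4
  gcongr

theorem isBigOp_noiseMoment' {S : ℕ → ℕ → Finset ℤ} {h : ℕ} (hh : 1 ≤ h)
    (hS : ∀ n, Admissible (M.T n) h (S h n)) :
    IsBigOp μ (fun n ω => ‖M.noiseMoment S h n ω‖) fun n => M.ν n ^ 2 * M.ρ n :=
  (M.isBigOp_noiseMoment hh hS).rate_mono (C := 1) (Eventually.of_forall fun n => by positivity)
    (M.sq_div_sqrt_eq.mono fun n hn => by rw [one_mul]; exact hn.1.le)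

variable (M) in
/-- A random matrix indexed by the entries of the observations. -/
abbrev Tensor (Ω : Type*) : Type _ :=
  ∀ n, Ω → Matrix (Fin (M.p n) × Fin (M.q n)) (Fin (M.p n) × Fin (M.q n)) ℝ

variable (M) in
/-- The noise between two matrices. -/
def between (s : ℕ → ℤ) (x z : M.Tensor Ω) (n : ℕ) (ω : Ω) :
    Matrix (Fin (M.q n) × (Fin (M.p n) × Fin (M.q n)))
      (Fin (M.p n) × (Fin (M.p n) × Fin (M.q n))) ℝ :=
  (leftFlat (x n ω))ᵀ * M.E n (s n) ω * rightFlat (z n ω)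

theorem norm_between_le (s : ℕ → ℤ) (x z : M.Tensor Ω) (n : ℕ) (ω : Ω) :
    ‖M.between s x z n ω‖ ≤ ‖x n ω‖ * (‖M.E n (s n) ω‖ * ‖z n ω‖) := by
  rw [between, Matrix.mul_assoc]
  refine (frob_mul_le _ _).trans ?_
  rw [frob_transpose, norm_leftFlat, ← norm_rightFlat (z n ω)]
  exact mul_le_mul_of_nonneg_left (frob_mul_le _ _) (norm_nonneg _)

theorem isBigOp_between_of_sided (ht : ∀ᶠ n in atTop, t n ∈ Finset.Icc (1 : ℤ) (M.T n))
    (x z : M.Tensor Ω) {b b' : ℕ → ℝ}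
    (hx : ∀ n, Sided (M.field n) (t n - M.halfWidth n) (t n + M.halfWidth n)
      fun ω => leftFlat (x n ω))
    (hz : ∀ n, Sided (M.field n) (t n - M.halfWidth n) (t n + M.halfWidth n)
      fun ω => rightFlat (z n ω))
    (hb : ∀ᶠ n in atTop, 0 < b n) (hb' : ∀ᶠ n in atTop, 0 < b' n)
    (hxb : IsBigOp μ (fun n ω => ‖x n ω‖) b) (hzb : IsBigOp μ (fun n ω => ‖z n ω‖) b')
    (hbb : ∀ᶠ n in atTop, b n * b' n * M.ν n ≤ 1 * M.noiseRate n) :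
    IsBigOp μ (fun n ω => ‖M.between t x z n ω‖) M.noiseRate := by
  refine (isBigOp_sided ht hx hz hb hb' (hxb.mono (Eventually.of_forall fun n ω => ?_))
    (hzb.mono (Eventually.of_forall fun n ω => ?_))).rate_mono ?_ hbb
  · rw [norm_leftFlat]
  · rw [norm_rightFlat]
  · filter_upwards [hb, hb', M.eventually_ν_pos] with n h1 h2 h3
    positivity

variable (M μ) in
/-- The lagged autocovariances as a constant random matrix. -/
noncomputable def popT (h : ℕ) : M.Tensor Ω := fun n _ => popTensor μ (M.T n) (M.W n) h

/-- Both coefficients are deterministic of order ν², so the bound on linear functionals of the noise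
applies directly and no factor ν is lost. -/
theorem isBigOp_between_pop (ht : ∀ᶠ n in atTop, t n ∈ Finset.Icc (1 : ℤ) (M.T n))
    {h h' : ℕ} (hh : 1 ≤ h) (hh' : 1 ≤ h') :
    IsBigOp μ (fun n ω => ‖M.between t (M.popT μ h) (M.popT μ h') n ω‖) M.noiseRate := by
  have hν := M.eventually_ν_pos
  set B := M.loadBound ^ 4 * ((r * k : ℝ) * (2 + 2 * M.K))
  have h1 : IsBigOp μ (fun n ω => ‖M.between t (M.popT μ h) (M.popT μ h') n ω‖)
      fun n => M.ν n ^ 4 := by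
    refine IsBigOp.of_integral_sq (C := M.σ * B ^ 4) (hν.mono fun n hn => by positivity) ?_
    filter_upwards [ht, M.norm_popTensor_le hh, M.norm_popTensor_le hh', hν] with n h1 h2 h3 h4
    rw [← norm_leftFlat] at h2
    rw [← norm_rightFlat] at h3
    refine ⟨(M.noise n _ h1).integrable_norm_sq M.two_lt _ _,
      ((M.noise n _ h1).integral_norm_sq_le M.two_lt _ _).trans ?_⟩
    have hσ := M.σ_nonneg
    calc _ ≤ M.σ * ((B * M.ν n ^ 2) ^ 2 * (B * M.ν n ^ 2) ^ 2) := by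
          exact mul_le_mul_of_nonneg_left (mul_le_mul (pow_le_pow_left₀ (norm_nonneg _) h2 2)
            (pow_le_pow_left₀ (norm_nonneg _) h3 2) (sq_nonneg _) (sq_nonneg _)) hσ
      _ = _ := by ring
  refine h1.rate_mono (C := 1) (hν.mono fun n hn => by positivity) ?_
  filter_upwards [hν, M.sq_div_sqrt_eq] with n h1 h2
  have := h2.2.2.2.1
  unfold noiseRate
  nlinarith [show 0 < M.ν n ^ 4 * (M.ν n * M.ρ n) by positivity]

/-- No decoupling is needed: ν² · g · (νg/√T) = ν⁵ρ, with ‖E_t‖ bounded by its full order g. -/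
theorem isBigOp_crude (ht : ∀ᶠ n in atTop, t n ∈ Finset.Icc (1 : ℤ) (M.T n)) {h : ℕ} (hh : 1 ≤ h)
    {x : M.Tensor Ω} (hx : IsBigOp μ (fun n ω => ‖x n ω‖) fun n => M.ν n ^ 2) :
    IsBigOp μ (fun n ω => ‖x n ω‖ * (‖M.E n (t n) ω‖ * ‖M.remainder t h n ω‖)) M.noiseRate := by
  have hν := M.eventually_ν_pos
  refine hx.mul_rate (C := 1) ((isBigOp_norm_E ht).mul (M.isBigOp_remainder t hh)
    (Eventually.of_forall M.g_nonneg) (hν.mono fun n hn => ?_))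
    (Eventually.of_forall fun n => sq_nonneg _) (hν.mono fun n hn => ?_) ?_
  · have := M.g_nonneg n; positivity
  · have := M.g_nonneg n; positivity
  · filter_upwards [M.mul_le_noiseRate, M.sq_div_sqrt_eq] with n h1 h2
    rw [mul_comm (M.g n), h2.2.1]
    exact (le_of_eq (by ring)).trans h1

theorem isBigOp_between_sampleW (ht : ∀ᶠ n in atTop, t n ∈ Finset.Icc (1 : ℤ) (M.T n))
    {h' : ℕ} (hh' : 1 ≤ h') {x : M.Tensor Ω}
    (hx : IsBigOp μ (fun n ω => ‖x n ω‖) fun n => M.ν n ^ 2)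
    (h1 : IsBigOp μ (fun n ω => ‖M.between t x (M.popT μ h') n ω‖) M.noiseRate)
    (h2 : IsBigOp μ (fun n ω => ‖M.between t x (M.noiseMoment (M.pastTimes t) h') n ω‖) M.noiseRate)
    (h3 : IsBigOp μ (fun n ω => ‖M.between t x (M.noiseMoment (M.futureTimes t) h') n ω‖)
      M.noiseRate) :
    IsBigOp μ (fun n ω => ‖M.between t x (M.sampleW h') n ω‖) M.noiseRate := by
  have hb0 := M.eventually_noiseRate_nonneg
  refine (((h1.add_same h2 hb0).add_same h3 hb0).add_same (isBigOp_crude ht hh' hx) hb0).mono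
    (Eventually.of_forall fun n ω => ?_)
  have e : M.between t x (M.sampleW h') n ω = M.between t x (M.popT μ h') n ω +
      M.between t x (M.noiseMoment (M.pastTimes t) h') n ω +
      M.between t x (M.noiseMoment (M.futureTimes t) h') n ω +
      M.between t x (M.remainder t h') n ω := by
    unfold between
    rw [M.sampleW_eq t h', rightFlat_add, rightFlat_add, rightFlat_add, Matrix.mul_add,
      Matrix.mul_add, Matrix.mul_add]
    rfl
  rw [abs_of_nonneg (norm_nonneg _), abs_of_nonneg (by positivity), e]
  exact (norm_add_le _ _).trans (add_le_add norm_add₃_le (norm_between_le t x _ n ω))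

/-- The noise between two lagged sample moments. -/
theorem isBigOp_sampleW_mul_E_mul (ht : ∀ᶠ n in atTop, t n ∈ Finset.Icc (1 : ℤ) (M.T n))
    {h h' : ℕ} (hh : 1 ≤ h) (hh' : 1 ≤ h') :
    IsBigOp μ (fun n ω => ‖M.between t (M.sampleW h) (M.sampleW h') n ω‖) M.noiseRate := by
  have hν2 := M.eventually_ν_sq_pos
  have hνρ := M.eventually_ν_sq_mul_ρ_pos
  have hb0 := M.eventually_noiseRate_nonneg
  have rAB := M.mul_le_noiseRate
  have rBB := M.mul_mul_le_noiseRate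
  have rBA : ∀ᶠ n in atTop, M.ν n ^ 2 * M.ρ n * M.ν n ^ 2 * M.ν n ≤ 1 * M.noiseRate n :=
    rAB.mono fun n hn => (le_of_eq (by ring)).trans hn
  have past : ∀ {h}, 1 ≤ h → IsBigOp μ (fun n ω => ‖M.noiseMoment (M.pastTimes t) h n ω‖)
      fun n => M.ν n ^ 2 * M.ρ n := fun hh =>
    isBigOp_noiseMoment' hh fun n => admissible_pastTimes _ _
  have fut : ∀ {h}, 1 ≤ h → IsBigOp μ (fun n ω => ‖M.noiseMoment (M.futureTimes t) h n ω‖)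
      fun n => M.ν n ^ 2 * M.ρ n := fun hh =>
    isBigOp_noiseMoment' hh fun n => admissible_futureTimes _ _
  have pop : ∀ {h}, 1 ≤ h → IsBigOp μ (fun n ω => ‖M.popT μ h n ω‖) fun n => M.ν n ^ 2 := fun hh =>
    M.isBigOp_popTensor hh
  have sC : ∀ h n, Sided (M.field n) (t n - M.halfWidth n) (t n + M.halfWidth n)
      fun ω => leftFlat (M.popT μ h n ω) := fun h n => sided_const _
  have sC' : ∀ h n, Sided (M.field n) (t n - M.halfWidth n) (t n + M.halfWidth n)
      fun ω => rightFlat (M.popT μ h n ω) := fun h n => sided_const _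
  have sP : ∀ h n, Sided (M.field n) (t n - M.halfWidth n) (t n + M.halfWidth n)
      fun ω => leftFlat (M.noiseMoment (M.pastTimes t) h n ω) := fun h n =>
    Or.inl fun _ _ => noiseMoment_past_measurable h n _ _
  have sP' : ∀ h n, Sided (M.field n) (t n - M.halfWidth n) (t n + M.halfWidth n)
      fun ω => rightFlat (M.noiseMoment (M.pastTimes t) h n ω) := fun h n =>
    Or.inl fun _ _ => noiseMoment_past_measurable h n _ _
  have sF : ∀ h n, Sided (M.field n) (t n - M.halfWidth n) (t n + M.halfWidth n)
      fun ω => leftFlat (M.noiseMoment (M.futureTimes t) h n ω) := fun h n =>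
    Or.inr fun _ _ => noiseMoment_future_measurable h n _ _
  have sF' : ∀ h n, Sided (M.field n) (t n - M.halfWidth n) (t n + M.halfWidth n)
      fun ω => rightFlat (M.noiseMoment (M.futureTimes t) h n ω) := fun h n =>
    Or.inr fun _ _ => noiseMoment_future_measurable h n _ _
  have toν : ∀ {x : ℕ → Ω → ℝ}, IsBigOp μ x (fun n => M.ν n ^ 2 * M.ρ n) →
      IsBigOp μ x fun n => M.ν n ^ 2 := fun hx =>
    hx.rate_mono (C := 1) (hνρ.mono fun n hn => hn.le) (M.sq_div_sqrt_eq.mono fun n hn => by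
      rw [one_mul]
      exact mul_le_of_le_one_right (sq_nonneg _) hn.2.2.2.2)
  have pair := isBigOp_between_of_sided ht
  -- The left factor is split into its four parts. Each of the first three is paired with the four
  -- parts of the right factor, while the left remainder is bounded crudely against the whole right
  -- factor.
  have c1 := isBigOp_between_sampleW ht hh' (x := M.popT μ h) (pop hh) (isBigOp_between_pop ht hh hh')
    (pair _ _ (sC h) (sP' h') hν2 hνρ (pop hh) (past hh') rAB)
    (pair _ _ (sC h) (sF' h') hν2 hνρ (pop hh) (fut hh') rAB)
  have c2 := isBigOp_between_sampleW ht hh' (x := M.noiseMoment (M.pastTimes t) h) (toν (past hh))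
    (pair _ _ (sP h) (sC' h') hνρ hν2 (past hh) (pop hh') rBA)
    (pair _ _ (sP h) (sP' h') hνρ hνρ (past hh) (past hh') rBB)
    (pair _ _ (sP h) (sF' h') hνρ hνρ (past hh) (fut hh') rBB)
  have c3 := isBigOp_between_sampleW ht hh' (x := M.noiseMoment (M.futureTimes t) h) (toν (fut hh))
    (pair _ _ (sF h) (sC' h') hνρ hν2 (fut hh) (pop hh') rBA)
    (pair _ _ (sF h) (sP' h') hνρ hνρ (fut hh) (past hh') rBB)
    (pair _ _ (sF h) (sF' h') hνρ hνρ (fut hh) (fut hh') rBB)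
  have c4 := isBigOp_crude ht hh (x := M.sampleW h') (M.isBigOp_sampleW hh')
  refine (((c1.add_same c2 hb0).add_same c3 hb0).add_same c4 hb0).mono
    (Eventually.of_forall fun n ω => ?_)
  have e : M.between t (M.sampleW h) (M.sampleW h') n ω =
      M.between t (M.popT μ h) (M.sampleW h') n ω +
      M.between t (M.noiseMoment (M.pastTimes t) h) (M.sampleW h') n ω +
      M.between t (M.noiseMoment (M.futureTimes t) h) (M.sampleW h') n ω +
      M.between t (M.remainder t h) (M.sampleW h') n ω := by
    unfold between
    rw [M.sampleW_eq t h, leftFlat_add, leftFlat_add, leftFlat_add, Matrix.transpose_add,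
      Matrix.transpose_add, Matrix.transpose_add, Matrix.add_mul, Matrix.add_mul, Matrix.add_mul,
      Matrix.add_mul, Matrix.add_mul, Matrix.add_mul]
    rfl
  rw [abs_of_nonneg (norm_nonneg _), abs_of_nonneg (by positivity), e]
  refine (norm_add_le _ _).trans (add_le_add norm_add₃_le
    ((norm_between_le t _ _ n ω).trans (le_of_eq ?_)))
  ring

/-- The noise that survives the projections on the estimated loading spaces. -/
theorem isBigOp_transpose_mul_E_mul (ht : ∀ᶠ n in atTop, t n ∈ Finset.Icc (1 : ℤ) (M.T n))
    {h₀ : ℕ} {Q₁ : ∀ n, Ω → Matrix (Fin (M.p n)) (Fin k) ℝ}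
    {Q₂ : ∀ n, Ω → Matrix (Fin (M.q n)) (Fin r) ℝ}
    (hQ₁ : ∀ᶠ n in atTop, ∀ ω, IsTopEigvecs
      (gramSum (Finset.Icc 1 h₀) fun h => leftFlat (M.sampleW h n ω)) (Q₁ n ω))
    (hQ₂ : ∀ᶠ n in atTop, ∀ ω, IsTopEigvecs
      (gramSum (Finset.Icc 1 h₀) fun h => rightFlat (M.sampleW h n ω)) (Q₂ n ω)) {c c' : ℝ}
    (hc : 0 < c) (hc' : 0 < c')
    (h₁ : HoldsWhp μ fun n ω => ∀ i : Fin k, c * (M.ν n ^ 2) ^ 2 ≤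
      eigDesc (gramSum (Finset.Icc 1 h₀) fun h => leftFlat (M.sampleW h n ω)) i)
    (h₂ : HoldsWhp μ fun n ω => ∀ i : Fin r, c' * (M.ν n ^ 2) ^ 2 ≤
      eigDesc (gramSum (Finset.Icc 1 h₀) fun h => rightFlat (M.sampleW h n ω)) i) :
    IsBigOp μ (fun n ω => ‖(Q₁ n ω)ᵀ * M.E n (t n) ω * Q₂ n ω‖) fun n => 1 + M.ν n * M.ρ n := by
  have hν : ∀ᶠ n in atTop, 0 < M.ν n :=
    (M.eventually_rates 0).mono fun n hn => zero_lt_one.trans_le hn.2.2.2.1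
  have hψ : ∀ᶠ n in atTop, 0 ≤ 1 + M.ν n * M.ρ n := by
    filter_upwards [hν, M.sq_div_sqrt_eq] with n h1 h2
    have := h2.2.2.2.1
    positivity
  have n2 : ∀ᶠ n in atTop, 0 ≤ M.ν n ^ 2 := Eventually.of_forall fun n => sq_nonneg _
  have n4 := M.eventually_noiseRate_nonneg
  have n8 : ∀ᶠ n in atTop, 0 ≤ M.ν n ^ 8 * (1 + M.ν n * M.ρ n) :=
    hψ.mono fun n hn => by positivity
  have key : IsBigOp μ (fun n ω => ∑ l ∈ Finset.Icc 1 h₀, ∑ l' ∈ Finset.Icc 1 h₀,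
      ‖leftFlat (M.sampleW l n ω)‖ * ‖M.between t (M.sampleW l) (M.sampleW l') n ω‖ *
        ‖rightFlat (M.sampleW l' n ω)‖)
      fun n => M.ν n ^ 8 * (1 + M.ν n * M.ρ n) := by
    refine IsBigOp.sum _ (fun l hl => IsBigOp.sum _ (fun l' hl' => ?_) n8) n8
    simp only [norm_leftFlat, norm_rightFlat]
    have hl1 := (Finset.mem_Icc.1 hl).1
    have hl1' := (Finset.mem_Icc.1 hl').1
    refine ((M.isBigOp_sampleW hl1).mul (isBigOp_sampleW_mul_E_mul ht hl1 hl1') n2 n4).mul_rate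
      (C := 1) (M.isBigOp_sampleW hl1') ?_ n2
      (Eventually.of_forall fun n => le_of_eq (by unfold noiseRate; ring))
    filter_upwards [n2, n4] with n h1 h2
    exact mul_nonneg h1 h2
  -- Each of the two inverse eigenvalue matrices contributes ν⁻⁴, which cancels the ν⁸ of the double
  -- sum.
  have hcoef : IsBigOp μ (fun n (_ : Ω) => (k / (c * (M.ν n ^ 2) ^ 2)) * (r / (c' * (M.ν n ^ 2) ^ 2)))
      fun n => (M.ν n ^ 8)⁻¹ :=
    IsBigOp.of_le (C := k / c * (r / c')) (Eventually.of_forall fun n ω => by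
      rw [abs_of_nonneg (by positivity)]
      refine le_of_eq ?_
      rw [← div_div, ← div_div, ← pow_mul]
      ring)
  refine (hcoef.mul_rate (C := 1) key (Eventually.of_forall fun n => by positivity) n8 ?_).mono_whp
    ((h₁.and h₂).mono ?_)
  · filter_upwards [hν] with n hn
    rw [one_mul, inv_mul_cancel_left₀ (by positivity)]
  · filter_upwards [hQ₁, hQ₂, hν] with n q1 q2 hn ω hω
    rw [abs_of_nonneg (norm_nonneg _), abs_of_nonneg (by positivity)]
    exact norm_transpose_mul_mul_le (q1 ω) (q2 ω) (by positivity) (by positivity) hω.1 hω.2 _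

end FactorModel

end MatFactor

namespace MatFactor

open scoped Matrix.Norms.Frobenius

/-- The 1 in the denominator keeps it positive without any assumption on L. -/
theorem le_of_pow_mul_le {l L ν s x b y e : ℝ} (hl : 0 < l) (hν : 0 < ν) (hb : 0 < b)
    (hs : l * ν ≤ s) (hx : b ≤ x) (hy0 : 0 ≤ y) (hy : y ≤ L * ν)
    (h : s ^ 4 * x ^ 2 ≤ e * y ^ 4) : l ^ 4 * b ^ 2 / (L ^ 4 + 1) ≤ e := by
  have h1 : (l * ν) ^ 4 * b ^ 2 ≤ s ^ 4 * x ^ 2 := by gcongr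
  have h2 : 0 < (l * ν) ^ 4 * b ^ 2 := by positivity
  have he : 0 < e := by
    by_contra hcon
    have := mul_nonpos_of_nonpos_of_nonneg (not_lt.1 hcon) (pow_nonneg hy0 4)
    linarith
  have h3 : e * y ^ 4 ≤ e * (L * ν) ^ 4 := by gcongr
  have h4 : l ^ 4 * b ^ 2 * ν ^ 4 ≤ e * L ^ 4 * ν ^ 4 := by
    calc _ = (l * ν) ^ 4 * b ^ 2 := by ring
      _ ≤ _ := h1.trans (h.trans h3)
      _ = _ := by ring
  have h5 := le_of_mul_le_mul_right h4 (by positivity)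
  rw [div_le_iff₀ (by positivity)]
  linarith

namespace FactorModel

variable {Ω : Type*} [MeasurableSpace Ω] {μ : Measure Ω} {k r m : ℕ} {M : FactorModel μ k r m}
  [IsProbabilityMeasure μ] {t : ℕ → ℤ} {h h₀ : ℕ} {c c' : ℝ}

/-! ### Lower bounds for the leading population eigenvalues. -/

section Strength

theorem eventually_le_norm_popTensor (hh : 1 ≤ h) (hpop : ∀ᶠ n in atTop, c ≤ ‖M.popF n h‖) :
    ∀ᶠ n in atTop, M.loadLow ^ 4 * c * M.ν n ^ 2 ≤ ‖popTensor μ (M.T n) (M.W n) h‖ := by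
  filter_upwards [hpop, M.le_singVal_R, M.le_singVal_C, M.νR_mem, M.νC_mem] with n h1 h2 h3 h4 h5
  have key := singVal_sq_mul_norm_le (M.R n) (M.C n) (M.popF n h)
  rw [Fintype.card_fin, Fintype.card_fin] at key
  rw [M.popTensor_eq n hh]
  refine le_trans ?_ key
  have hl := M.loadLow_pos
  have h6 : 0 ≤ M.loadLow * M.νR n := mul_nonneg hl.le (by linarith)
  have h7 : 0 ≤ M.loadLow * M.νC n := mul_nonneg hl.le (by linarith)
  calc _ = ((M.loadLow * M.νR n) * (M.loadLow * M.νC n)) ^ 2 * c := by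
        rw [FactorModel.ν]; ring
    _ ≤ ((M.loadLow * M.νR n) * (M.loadLow * M.νC n)) ^ 2 * ‖M.popF n h‖ := by gcongr
    _ ≤ _ := mul_le_mul_of_nonneg_right (pow_le_pow_left₀ (mul_nonneg h6 h7)
        (mul_le_mul h2 h3 h7 (h6.trans h2)) 2) (norm_nonneg _)

variable (M) in
/-- The right factor of the row flattening of the lagged autocovariances. -/
noncomputable def leftCoef (h n : ℕ) :
    Matrix (Fin k) (Fin (M.q n) × (Fin (M.p n) × Fin (M.q n))) ℝ :=
  Matrix.of fun c x => (M.C n * leftFlat (M.popF n h * (M.load n)ᵀ)) x.1 (c, x.2)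

variable (M) in
/-- The right factor of the column flattening of the lagged autocovariances. -/
noncomputable def rightCoef (h n : ℕ) :
    Matrix (Fin r) (Fin (M.p n) × (Fin (M.p n) × Fin (M.q n))) ℝ :=
  Matrix.of fun d x => (M.R n * rightFlat (M.popF n h * (M.load n)ᵀ)) x.1 (d, x.2)

theorem leftFlat_popTensor (n : ℕ) (hh : 1 ≤ h) :
    leftFlat (popTensor μ (M.T n) (M.W n) h) = M.R n * M.leftCoef h n := by
  rw [M.popTensor_eq n hh, Matrix.mul_assoc]
  exact leftFlat_loadMat_mul _ _ _

theorem rightFlat_popTensor (n : ℕ) (hh : 1 ≤ h) :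
    rightFlat (popTensor μ (M.T n) (M.W n) h) = M.C n * M.rightCoef h n := by
  rw [M.popTensor_eq n hh, Matrix.mul_assoc]
  exact rightFlat_loadMat_mul _ _ _

/-- One lag with a nonvanishing factor autocovariance makes the largest eigenvalue at least of order
ν⁴; the uniform eigenvalue ratio carries this to the k-th one. -/
theorem exists_le_eigDesc_left (hh : h ∈ Finset.Icc 1 h₀) (hc : 0 < c)
    (hpop : ∀ᶠ n in atTop, c ≤ ‖M.popF n h‖) (hc' : 0 < c') (hunif : ∀ᶠ n in atTop,
      c' * eigDesc (gramSum (Finset.Icc 1 h₀) fun h => leftFlat (popTensor μ (M.T n) (M.W n) h)) 0 ≤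
      eigDesc (gramSum (Finset.Icc 1 h₀) fun h => leftFlat (popTensor μ (M.T n) (M.W n) h))
        (k - 1)) :
    ∃ a, 0 < a ∧ ∀ᶠ n in atTop, a * (M.ν n ^ 2) ^ 2 ≤
      eigDesc (gramSum (Finset.Icc 1 h₀) fun h => leftFlat (popTensor μ (M.T n) (M.W n) h))
        (k - 1) := by
  have hl := M.loadLow_pos
  refine ⟨c' * (M.loadLow ^ 4 * (M.loadLow ^ 4 * c) ^ 2 / (M.loadBound ^ 4 + 1)), by positivity, ?_⟩
  have hh1 := (Finset.mem_Icc.1 hh).1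
  filter_upwards [hunif, eventually_le_norm_popTensor hh1 hpop, M.le_singVal_R, M.norm_R_le,
    M.νR_mem, M.eventually_ν_pos] with n h1 h2 h3 h4 h5 h6
  refine le_trans ?_ h1
  rw [mul_assoc]
  refine mul_le_mul_of_nonneg_left ?_ hc'.le
  have key := singVal_pow_mul_norm_sq_le_eigDesc (H := Finset.Icc 1 h₀)
    (t := fun h => leftFlat (popTensor μ (M.T n) (M.W n) h)) hh (leftFlat_popTensor n hh1)
  rw [Fintype.card_fin, norm_leftFlat] at key
  refine le_trans (le_of_eq ?_) (le_of_pow_mul_le hl (zero_lt_one.trans_le h5.1)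
    (b := M.loadLow ^ 4 * c * M.ν n ^ 2) (by positivity) h3 h2 (norm_nonneg _) h4 key)
  ring

theorem exists_le_eigDesc_right (hh : h ∈ Finset.Icc 1 h₀) (hc : 0 < c)
    (hpop : ∀ᶠ n in atTop, c ≤ ‖M.popF n h‖) (hc' : 0 < c') (hunif : ∀ᶠ n in atTop,
      c' * eigDesc (gramSum (Finset.Icc 1 h₀) fun h => rightFlat (popTensor μ (M.T n) (M.W n) h)) 0 ≤
      eigDesc (gramSum (Finset.Icc 1 h₀) fun h => rightFlat (popTensor μ (M.T n) (M.W n) h))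
        (r - 1)) :
    ∃ a, 0 < a ∧ ∀ᶠ n in atTop, a * (M.ν n ^ 2) ^ 2 ≤
      eigDesc (gramSum (Finset.Icc 1 h₀) fun h => rightFlat (popTensor μ (M.T n) (M.W n) h))
        (r - 1) := by
  have hl := M.loadLow_pos
  refine ⟨c' * (M.loadLow ^ 4 * (M.loadLow ^ 4 * c) ^ 2 / (M.loadBound ^ 4 + 1)), by positivity, ?_⟩
  have hh1 := (Finset.mem_Icc.1 hh).1
  filter_upwards [hunif, eventually_le_norm_popTensor hh1 hpop, M.le_singVal_C, M.norm_C_le,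
    M.νC_mem, M.eventually_ν_pos] with n h1 h2 h3 h4 h5 h6
  refine le_trans ?_ h1
  rw [mul_assoc]
  refine mul_le_mul_of_nonneg_left ?_ hc'.le
  have key := singVal_pow_mul_norm_sq_le_eigDesc (H := Finset.Icc 1 h₀)
    (t := fun h => rightFlat (popTensor μ (M.T n) (M.W n) h)) hh (rightFlat_popTensor n hh1)
  rw [Fintype.card_fin, norm_rightFlat] at key
  refine le_trans (le_of_eq ?_) (le_of_pow_mul_le hl (zero_lt_one.trans_le h5.1)
    (b := M.loadLow ^ 4 * c * M.ν n ^ 2) (by positivity) h3 h2 (norm_nonneg _) h4 key)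
  ring

end Strength

/-! ### Estimated loading spaces and the total error. -/

section Spaces

theorem isBigOp_gramSum_left : IsBigOp μ (fun n ω =>
    ‖gramSum (Finset.Icc 1 h₀) (fun h => leftFlat (M.sampleW h n ω)) -
      gramSum (Finset.Icc 1 h₀) fun h => leftFlat (popTensor μ (M.T n) (M.W n) h)‖)
    fun n => (M.ν n ^ 2) ^ 2 * M.ρ n := by
  refine isBigOp_gramSum_sub (H := Finset.Icc 1 h₀) (s := fun h n ω => leftFlat (M.sampleW h n ω))
    (τ := fun h n => leftFlat (popTensor μ (M.T n) (M.W n) h)) M.eventually_ν_sq_pos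
    (M.sq_div_sqrt_eq.mono fun n hn => hn.2.2.2.1.le) (fun h hh => ?_) (fun h hh => ?_)
    (fun h hh => ?_)
  · simp only [← leftFlat_sub, norm_leftFlat]
    exact M.isBigOp_sampleW_sub (Finset.mem_Icc.1 hh).1
  · simp only [norm_leftFlat]
    exact M.isBigOp_sampleW (Finset.mem_Icc.1 hh).1
  · simp only [norm_leftFlat]
    exact M.isBigOp_popTensor (Finset.mem_Icc.1 hh).1

theorem isBigOp_gramSum_right : IsBigOp μ (fun n ω =>
    ‖gramSum (Finset.Icc 1 h₀) (fun h => rightFlat (M.sampleW h n ω)) -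
      gramSum (Finset.Icc 1 h₀) fun h => rightFlat (popTensor μ (M.T n) (M.W n) h)‖)
    fun n => (M.ν n ^ 2) ^ 2 * M.ρ n := by
  refine isBigOp_gramSum_sub (H := Finset.Icc 1 h₀) (s := fun h n ω => rightFlat (M.sampleW h n ω))
    (τ := fun h n => rightFlat (popTensor μ (M.T n) (M.W n) h)) M.eventually_ν_sq_pos
    (M.sq_div_sqrt_eq.mono fun n hn => hn.2.2.2.1.le) (fun h hh => ?_) (fun h hh => ?_)
    (fun h hh => ?_)
  · simp only [← rightFlat_sub, norm_rightFlat]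
    exact M.isBigOp_sampleW_sub (Finset.mem_Icc.1 hh).1
  · simp only [norm_rightFlat]
    exact M.isBigOp_sampleW (Finset.mem_Icc.1 hh).1
  · simp only [norm_rightFlat]
    exact M.isBigOp_popTensor (Finset.mem_Icc.1 hh).1

theorem eventually_le_card_left : ∀ᶠ n in atTop, k ≤ Fintype.card (Fin (M.p n)) :=
  (M.tendsto_p.eventually_ge_atTop k).mono fun n hn => by rwa [Fintype.card_fin]

theorem eventually_le_card_right : ∀ᶠ n in atTop, r ≤ Fintype.card (Fin (M.q n)) :=
  (M.tendsto_q.eventually_ge_atTop r).mono fun n hn => by rwa [Fintype.card_fin]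

theorem eventually_ρ_nonneg : ∀ᶠ n in atTop, 0 ≤ M.ρ n :=
  M.sq_div_sqrt_eq.mono fun _ hn => hn.2.2.2.1.le

theorem holdsWhp_left (hk : 0 < k) (hc : 0 < c) (hlow : ∀ᶠ n in atTop, c * (M.ν n ^ 2) ^ 2 ≤
      eigDesc (gramSum (Finset.Icc 1 h₀) fun h => leftFlat (popTensor μ (M.T n) (M.W n) h))
        (k - 1)) :
    HoldsWhp μ fun n ω => ∀ i : Fin k, c / 2 * (M.ν n ^ 2) ^ 2 ≤
      eigDesc (gramSum (Finset.Icc 1 h₀) fun h => leftFlat (M.sampleW h n ω)) i :=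
  (holdsWhp_le_eigDesc (s := fun h n ω => leftFlat (M.sampleW h n ω))
    (τ := fun h n => leftFlat (popTensor μ (M.T n) (M.W n) h)) hk M.eventually_ν_sq_pos M.tendsto_ρ
    isBigOp_gramSum_left hc M.eventually_le_card_left hlow one_pos).mono
    (Eventually.of_forall fun _ _ h => h.2)

theorem holdsWhp_right (hr : 0 < r) (hc : 0 < c) (hlow : ∀ᶠ n in atTop, c * (M.ν n ^ 2) ^ 2 ≤
      eigDesc (gramSum (Finset.Icc 1 h₀) fun h => rightFlat (popTensor μ (M.T n) (M.W n) h))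
        (r - 1)) :
    HoldsWhp μ fun n ω => ∀ i : Fin r, c / 2 * (M.ν n ^ 2) ^ 2 ≤
      eigDesc (gramSum (Finset.Icc 1 h₀) fun h => rightFlat (M.sampleW h n ω)) i :=
  (holdsWhp_le_eigDesc (s := fun h n ω => rightFlat (M.sampleW h n ω))
    (τ := fun h n => rightFlat (popTensor μ (M.T n) (M.W n) h)) hr M.eventually_ν_sq_pos M.tendsto_ρ
    isBigOp_gramSum_right hc M.eventually_le_card_right hlow one_pos).mono
    (Eventually.of_forall fun _ _ h => h.2)

theorem isBigOp_norm_R : IsBigOp μ (fun n (_ : Ω) => ‖M.R n‖) M.νR :=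
  IsBigOp.of_le (M.norm_R_le.mono fun n hn _ => by rwa [abs_of_nonneg (norm_nonneg _)])

theorem isBigOp_norm_C : IsBigOp μ (fun n (_ : Ω) => ‖M.C n‖) M.νC :=
  IsBigOp.of_le (M.norm_C_le.mono fun n hn _ => by rwa [abs_of_nonneg (norm_nonneg _)])

theorem eventually_νR_nonneg : ∀ᶠ n in atTop, 0 ≤ M.νR n :=
  M.νR_mem.mono fun _ hn => by linarith

theorem eventually_νC_nonneg : ∀ᶠ n in atTop, 0 ≤ M.νC n :=
  M.νC_mem.mono fun _ hn => by linarith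

variable {Q₁ : ∀ n, Ω → Matrix (Fin (M.p n)) (Fin k) ℝ}
  {Q₂ : ∀ n, Ω → Matrix (Fin (M.q n)) (Fin r) ℝ}

theorem isBigOp_R_sub_proj (hk : 0 < k) (hc : 0 < c) (hlow : ∀ᶠ n in atTop, c * (M.ν n ^ 2) ^ 2 ≤
      eigDesc (gramSum (Finset.Icc 1 h₀) fun h => leftFlat (popTensor μ (M.T n) (M.W n) h))
        (k - 1))
    (hQ₁ : ∀ᶠ n in atTop, ∀ ω, IsTopEigvecs
      (gramSum (Finset.Icc 1 h₀) fun h => leftFlat (M.sampleW h n ω)) (Q₁ n ω)) :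
    IsBigOp μ (fun n ω => ‖M.R n - Q₁ n ω * (Q₁ n ω)ᵀ * M.R n‖) fun n => M.ρ n * M.νR n :=
  isBigOp_sub_proj (s := fun h n ω => leftFlat (M.sampleW h n ω))
    (τ := fun h n => leftFlat (popTensor μ (M.T n) (M.W n) h)) (G := M.leftCoef) hk
    M.eventually_ν_sq_pos M.eventually_ρ_nonneg M.tendsto_ρ isBigOp_gramSum_left hc
    M.eventually_le_card_left hlow hQ₁
    (fun n _ hh => leftFlat_popTensor n (Finset.mem_Icc.1 hh).1) M.eventually_νR_nonneg
    M.isBigOp_norm_R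

theorem isBigOp_C_sub_proj (hr : 0 < r) (hc : 0 < c) (hlow : ∀ᶠ n in atTop, c * (M.ν n ^ 2) ^ 2 ≤
      eigDesc (gramSum (Finset.Icc 1 h₀) fun h => rightFlat (popTensor μ (M.T n) (M.W n) h))
        (r - 1))
    (hQ₂ : ∀ᶠ n in atTop, ∀ ω, IsTopEigvecs
      (gramSum (Finset.Icc 1 h₀) fun h => rightFlat (M.sampleW h n ω)) (Q₂ n ω)) :
    IsBigOp μ (fun n ω => ‖M.C n - Q₂ n ω * (Q₂ n ω)ᵀ * M.C n‖) fun n => M.ρ n * M.νC n :=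
  isBigOp_sub_proj (s := fun h n ω => rightFlat (M.sampleW h n ω))
    (τ := fun h n => rightFlat (popTensor μ (M.T n) (M.W n) h)) (G := M.rightCoef) hr
    M.eventually_ν_sq_pos M.eventually_ρ_nonneg M.tendsto_ρ isBigOp_gramSum_right hc
    M.eventually_le_card_right hlow hQ₂
    (fun n _ hh => rightFlat_popTensor n (Finset.mem_Icc.1 hh).1) M.eventually_νC_nonneg
    M.isBigOp_norm_C

theorem sqrt_mul_le_rate : ∀ᶠ n in atTop,
    √(M.p n) / √(M.T n) * √(M.q n) ≤ 1 * (1 + M.ν n * M.ρ n) := by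
  filter_upwards [M.eventually_rates 0, M.tendsto_T.eventually_gt_atTop 0] with n h1 h2
  obtain ⟨-, -, hT, h3, h4, -, -⟩ := h1
  have hν : 0 < M.ν n := by linarith
  have hT' : 0 < √(M.T n) := by linarith
  have e1 : √(M.p n) / √(M.T n) * √(M.q n) = M.g n / √(M.T n) := by rw [FactorModel.g]; ring
  -- So νρ exceeds the regression error g/√T by the factor g/ν, which is at least 1.
  have e2 : M.ν n * M.ρ n = M.g n / √(M.T n) * (M.g n / M.ν n) := by
    rw [FactorModel.ρ]
    field_simp
  rw [e1, e2, one_mul]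
  have h5 : 1 ≤ M.g n / M.ν n := by rwa [le_div_iff₀ hν, one_mul]
  have h6 : 0 ≤ M.g n / √(M.T n) := div_nonneg (M.g_nonneg n) hT'.le
  nlinarith

/-- The error of the estimated signal. -/
theorem isBigOp_signalEst_sub (hk : 0 < k) (hr : 0 < r)
    (ht : ∀ᶠ n in atTop, t n ∈ Finset.Icc (1 : ℤ) (M.T n)) (hc : 0 < c) (hc' : 0 < c')
    (hlow : ∀ᶠ n in atTop, c * (M.ν n ^ 2) ^ 2 ≤
      eigDesc (gramSum (Finset.Icc 1 h₀) fun h => leftFlat (popTensor μ (M.T n) (M.W n) h))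
        (k - 1))
    (hlow' : ∀ᶠ n in atTop, c' * (M.ν n ^ 2) ^ 2 ≤
      eigDesc (gramSum (Finset.Icc 1 h₀) fun h => rightFlat (popTensor μ (M.T n) (M.W n) h))
        (r - 1))
    (hQ₁ : ∀ᶠ n in atTop, ∀ ω, IsTopEigvecs
      (gramSum (Finset.Icc 1 h₀) fun h => leftFlat (M.sampleW h n ω)) (Q₁ n ω))
    (hQ₂ : ∀ᶠ n in atTop, ∀ ω, IsTopEigvecs
      (gramSum (Finset.Icc 1 h₀) fun h => rightFlat (M.sampleW h n ω)) (Q₂ n ω)) :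
    IsBigOp μ (fun n ω => ‖signalEst (M.T n) (fun s => M.Y n s ω) (fun s => M.X n s ω) (Q₁ n ω)
        (Q₂ n ω) (t n) - signal (M.A n) (M.R n) (M.C n) (M.X n (t n) ω) (M.F n (t n) ω)‖)
      fun n => 1 + M.ν n * M.ρ n := by
  have hψ : ∀ᶠ n in atTop, 0 ≤ 1 + M.ν n * M.ρ n := by
    filter_upwards [M.eventually_ν_nonneg, M.eventually_ρ_nonneg] with n h1 h2
    positivity
  have hρR : ∀ᶠ n in atTop, 0 ≤ M.ρ n * M.νR n := by
    filter_upwards [M.eventually_ρ_nonneg, M.eventually_νR_nonneg] with n h1 h2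
    positivity
  have hρC : ∀ᶠ n in atTop, 0 ≤ M.ρ n * M.νC n := by
    filter_upwards [M.eventually_ρ_nonneg, M.eventually_νC_nonneg] with n h1 h2
    positivity
  have hone : ∀ᶠ _n : ℕ in atTop, (0 : ℝ) ≤ 1 := Eventually.of_forall fun _ => zero_le_one
  have b1 := (M.isBigOp_dev.mul_rate (isBigOp_norm_X ht)
    (Eventually.of_forall fun n => by positivity) (Eventually.of_forall fun n => by positivity)
    M.sqrt_mul_le_rate).const_mul (1 + k * r) hψ
  -- The orders multiply to ρ νR · 1 · νC = νρ; the other projection error is symmetric.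
  have b2 := (isBigOp_R_sub_proj hk hc hlow hQ₁).mul_rate (C := 1)
    (b'' := fun n => 1 + M.ν n * M.ρ n)
    ((isBigOp_norm_F ht).mul M.isBigOp_norm_C hone M.eventually_νC_nonneg) hρR
    (M.eventually_νC_nonneg.mono fun n hn => by linarith) (Eventually.of_forall fun n => by
      rw [FactorModel.ν]
      nlinarith)
  have b3 := ((M.isBigOp_norm_R.mul (isBigOp_norm_F ht) M.eventually_νR_nonneg hone).mul_rate
    (C := 1) (b'' := fun n => 1 + M.ν n * M.ρ n) (isBigOp_C_sub_proj hr hc' hlow' hQ₂)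
    (M.eventually_νR_nonneg.mono fun n hn => by linarith) hρC (Eventually.of_forall fun n => by
      rw [FactorModel.ν]
      nlinarith)).const_mul k hψ
  have b4 := (isBigOp_transpose_mul_E_mul ht hQ₁ hQ₂ (half_pos hc) (half_pos hc')
    (holdsWhp_left hk hc hlow) (holdsWhp_right hr hc' hlow')).const_mul (√k * √r) hψ
  refine (((b1.add_same b2 hψ).add_same b3 hψ).add_same b4 hψ).mono ?_
  filter_upwards [hQ₁, hQ₂] with n q1 q2 ω
  have key := norm_signal_error_le (D := M.dev n ω) (X := M.X n (t n) ω) (R := M.R n)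
    (F := M.F n (t n) ω) (C := M.C n) (e := M.E n (t n) ω) (q1 ω).1 (q2 ω).1
  rw [abs_of_nonneg (norm_nonneg _), abs_of_nonneg (by positivity)]
  refine le_trans (le_of_eq ?_) key
  congr 1
  rw [signalEst, signal, residualEst_eq, W, residual, dev]
  simp only [Matrix.sub_mul]
  abel

end Spaces

end FactorModel

end MatFactor

namespace MatFactor

open scoped Matrix.Norms.Frobenius

/-! ### Mixing coefficients of a process and their decay. -/

section StrongMixing

variable {Ω β : Type*} [MeasurableSpace Ω] [MeasurableSpace β] {μ : Measure Ω}
  [IsProbabilityMeasure μ] {Z : ℤ → Ω → β} {γ : ℝ} {α : ℕ → ℝ}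

/-- The σ-field of a process at one time. -/
abbrev procField {Ω β : Type*} [MeasurableSpace β] (Z : ℤ → Ω → β) (t : ℤ) : MeasurableSpace Ω :=
  MeasurableSpace.comap (Z t) inferInstance

theorem abs_real_mul_sub_le_one (A B : Set Ω) : |μ.real A * μ.real B - μ.real (A ∩ B)| ≤ 1 := by
  have h1 : 0 ≤ μ.real A * μ.real B := mul_nonneg measureReal_nonneg measureReal_nonneg
  have h2 : μ.real A * μ.real B ≤ 1 :=
    mul_le_one₀ measureReal_le_one measureReal_nonneg measureReal_le_one
  have h3 : 0 ≤ μ.real (A ∩ B) := measureReal_nonneg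
  have h4 : μ.real (A ∩ B) ≤ 1 := measureReal_le_one
  rw [abs_le]
  constructor <;> linarith

theorem alphaLe_alphaMix (Z : ℤ → Ω → β) (i : ℤ) (l : ℕ) :
    AlphaLe (pastField (procField Z) i) (futureField (procField Z) (i + l)) μ (alphaMix μ Z l) :=
  fun A B hA hB => le_csSup
    ⟨1, by rintro d ⟨i, A, B, -, -, rfl⟩; exact abs_real_mul_sub_le_one A B⟩ ⟨i, A, B, hA, hB, rfl⟩

theorem alphaMix_nonneg (Z : ℤ → Ω → β) (l : ℕ) : 0 ≤ alphaMix μ Z l :=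
  (alphaLe_alphaMix Z 0 l).nonneg

theorem alphaMix_antitone (Z : ℤ → Ω → β) : Antitone (alphaMix μ Z) := fun l l' hl => by
  refine csSup_le_csSup
    ⟨1, by rintro d ⟨i, A, B, -, -, rfl⟩; exact abs_real_mul_sub_le_one A B⟩
    ⟨_, 0, ∅, ∅, @MeasurableSet.empty _ (_), @MeasurableSet.empty _ (_), rfl⟩ ?_
  rintro d ⟨i, A, B, hA, hB, rfl⟩
  refine ⟨i, A, B, hA, ?_, rfl⟩
  have hle : (⨆ t ∈ Set.Ici (i + l'), MeasurableSpace.comap (Z t) inferInstance) ≤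
      ⨆ t ∈ Set.Ici (i + l), MeasurableSpace.comap (Z t) inferInstance :=
    biSup_mono fun t ht => by
      simp only [Set.mem_Ici] at ht ⊢
      omega
  exact hle _ hB

theorem sum_alphaMix_rpow_le (hγ : 2 < γ) (hsum : Summable fun l => α (l + 1) ^ (1 - 2 / γ))
    (hle : ∀ l, 1 ≤ l → alphaMix μ Z l ≤ α l) (s : Finset ℕ) :
    ∑ l ∈ s, alphaMix μ Z (l + 1) ^ (1 - 2 / γ) ≤ ∑' l, α (l + 1) ^ (1 - 2 / γ) := by
  have hκ : 0 ≤ 1 - 2 / γ := by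
    rw [sub_nonneg, div_le_one (by linarith)]
    exact hγ.le
  refine (Finset.sum_le_sum fun l _ => Real.rpow_le_rpow (alphaMix_nonneg Z _)
    (hle (l + 1) (by omega)) hκ).trans (hsum.sum_le_tsum s fun l _ => Real.rpow_nonneg ?_ _)
  exact (alphaMix_nonneg Z _).trans (hle (l + 1) (by omega))

theorem mixing_of_alphaMix_le (hγ : 2 < γ) (hZ : ∀ t, Measurable (Z t))
    (hsum : Summable fun l => α (l + 1) ^ (1 - 2 / γ))
    (hle : ∀ l, 1 ≤ l → alphaMix μ Z l ≤ α l) :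
    Mixing μ (procField Z) γ (alphaMix μ Z) (∑' l, α (l + 1) ^ (1 - 2 / γ)) where
  le t := (hZ t).comap_le
  alphaLe i l _ := alphaLe_alphaMix Z i l
  sum_le := sum_alphaMix_rpow_le hγ hsum hle

/-- The mixing coefficients are antitone even if the bounding sequence is not, so l times the l-th
term is at most the sum of the first l terms. -/
theorem mul_alphaMix_rpow_le (hγ : 2 < γ) (hsum : Summable fun l => α (l + 1) ^ (1 - 2 / γ))
    (hle : ∀ l, 1 ≤ l → alphaMix μ Z l ≤ α l) (l : ℕ) :
    (l : ℝ) * alphaMix μ Z l ^ (1 - 2 / γ) ≤ ∑' l, α (l + 1) ^ (1 - 2 / γ) := by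
  have hκ : 0 ≤ 1 - 2 / γ := by
    rw [sub_nonneg, div_le_one (by linarith)]
    exact hγ.le
  refine le_trans ?_ (sum_alphaMix_rpow_le (Z := Z) hγ hsum hle (Finset.range l))
  calc _ = ∑ _j ∈ Finset.range l, alphaMix μ Z l ^ (1 - 2 / γ) := by simp
    _ ≤ _ := Finset.sum_le_sum fun j hj => Real.rpow_le_rpow (alphaMix_nonneg Z _)
      (alphaMix_antitone Z (Finset.mem_range.1 hj)) hκ

end StrongMixing

/-! ### Moments, covariances and white noise. -/

section Moments

variable {Ω : Type*} {m₀ : MeasurableSpace Ω} {μ : Measure Ω} {a b T : ℕ} {s K K' γ : ℝ}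
  {U : ℤ → Ω → Matrix (Fin a) (Fin b) ℝ}

theorem integrable_rpow_of_lintegral_le {f : Ω → ℝ} (hf : Measurable f) (hK : 0 ≤ K)
    (h : ∫⁻ ω, ENNReal.ofReal (|f ω| ^ s) ∂μ ≤ ENNReal.ofReal K) :
    Integrable (fun ω => |f ω| ^ s) μ ∧ ∫ ω, |f ω| ^ s ∂μ ≤ K := by
  have h0 : 0 ≤ᵐ[μ] fun ω => |f ω| ^ s :=
    Eventually.of_forall fun ω => Real.rpow_nonneg (abs_nonneg _) _
  have hm : AEStronglyMeasurable (fun ω => |f ω| ^ s) μ :=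
    (hf.abs.pow_const s).aestronglyMeasurable
  refine ⟨⟨hm, (hasFiniteIntegral_iff_ofReal h0).2 (h.trans_lt ENNReal.ofReal_lt_top)⟩, ?_⟩
  rw [integral_eq_lintegral_of_nonneg_ae h0 hm]
  exact ENNReal.toReal_le_of_le_ofReal hK h

theorem MomentBound.integrable (hU : MomentBound μ T U s K) (hK : K ≤ K') (hK' : 0 ≤ K')
    (hm : ∀ t i j, Measurable fun ω => U t ω i j) {t : ℤ} (ht : t ∈ Finset.Icc (1 : ℤ) T)
    (i : Fin a) (j : Fin b) : Integrable (fun ω => |U t ω i j| ^ s) μ ∧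
      ∫ ω, |U t ω i j| ^ s ∂μ ≤ K' :=
  integrable_rpow_of_lintegral_le (hm t i j) hK'
    ((hU t ht i j).trans (ENNReal.ofReal_le_ofReal hK))

variable [IsProbabilityMeasure μ]

theorem MomentBound.integrable_entry (hU : MomentBound μ T U (2 * γ) K) (hγ : 2 < γ)
    (hm : ∀ t i j, Measurable fun ω => U t ω i j) {t : ℤ} (ht : t ∈ Finset.Icc (1 : ℤ) T)
    (i : Fin a) (j : Fin b) : Integrable (fun ω => U t ω i j) μ :=
  integrable_of_rpow (γ := 2 * γ) (by linarith) (hm t i j)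
    (hU.integrable (le_max_left K 0) (le_max_right K 0) hm ht i j).1

theorem MomentBound.integrable_mul {c d : ℕ} {V : ℤ → Ω → Matrix (Fin c) (Fin d) ℝ}
    (hU : MomentBound μ T U (2 * γ) K) (hV : MomentBound μ T V (2 * γ) K') (hγ : 2 < γ)
    (hm : ∀ t i j, Measurable fun ω => U t ω i j) (hm' : ∀ t i j, Measurable fun ω => V t ω i j)
    {t t' : ℤ} (ht : t ∈ Finset.Icc (1 : ℤ) T) (ht' : t' ∈ Finset.Icc (1 : ℤ) T)
    (i : Fin a) (j : Fin b) (i' : Fin c) (j' : Fin d) :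
    Integrable (fun ω => U t ω i j * V t' ω i' j') μ :=
  integrable_mul_of_rpow (γ := 2 * γ) (by linarith) (hm t i j) (hm' t' i' j')
    (hU.integrable (le_max_left K 0) (le_max_right K 0) hm ht i j).1
    (hV.integrable (le_max_left K' 0) (le_max_right K' 0) hm' ht' i' j').1

theorem covariance_eq_integral_mul {X Y : Ω → ℝ} (hX : Integrable X μ)
    (hXY : Integrable (fun ω => X ω * Y ω) μ) (h0 : ∫ ω, X ω ∂μ = 0) :
    cov[X, Y; μ] = ∫ ω, X ω * Y ω ∂μ := by
  rw [covariance, h0]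
  simp only [sub_zero, mul_sub]
  rw [integral_sub hXY (hX.mul_const _), integral_mul_const, h0, zero_mul, sub_zero]

/-- Cross moments of a centered process are covariances. -/
theorem integral_mul_eq_covMat {c d : ℕ} {V : ℤ → Ω → Matrix (Fin c) (Fin d) ℝ}
    (hU : MomentBound μ T U (2 * γ) K) (hV : MomentBound μ T V (2 * γ) K') (hγ : 2 < γ)
    (hm : ∀ t i j, Measurable fun ω => U t ω i j) (hm' : ∀ t i j, Measurable fun ω => V t ω i j)
    (h0 : Centered μ T U) {t t' : ℤ} (ht : t ∈ Finset.Icc (1 : ℤ) T)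
    (ht' : t' ∈ Finset.Icc (1 : ℤ) T) (i : Fin a) (j : Fin b) (i' : Fin c) (j' : Fin d) :
    ∫ ω, U t ω i j * V t' ω i' j' ∂μ =
      covMat μ (fun ω => (U t ω).vec) (fun ω => (V t' ω).vec) (j, i) (j', i') :=
  (covariance_eq_integral_mul (hU.integrable_entry hγ hm ht i j)
    (hU.integrable_mul hV hγ hm hm' ht ht' i j i' j') (h0 t ht i j)).symm

theorem integral_sq_linear_le {v : Ω → Fin b × Fin a → ℝ}
    {S : Matrix (Fin b × Fin a) (Fin b × Fin a) ℝ} (hi : ∀ x y, Integrable (fun ω => v ω x * v ω y) μ)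
    (hS : ∀ x y, ∫ ω, v ω x * v ω y ∂μ = S x y) (z : Fin b × Fin a → ℝ) :
    ∫ ω, (∑ x, z x * v ω x) ^ 2 ∂μ ≤ specNorm S * (z ⬝ᵥ z) := by
  refine le_trans (le_of_eq ?_) (dotProduct_mulVec_le_specNorm S z)
  have e : ∀ ω, (∑ x, z x * v ω x) ^ 2 = ∑ x, ∑ y, z x * z y * (v ω x * v ω y) := fun ω => by
    rw [sq, Finset.sum_mul_sum]
    exact Finset.sum_congr rfl fun _ _ => Finset.sum_congr rfl fun _ _ => by ring
  simp only [e]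
  rw [integral_finsetSum _ fun x _ => integrable_finsetSum _ fun y _ => (hi x y).const_mul _]
  simp only [dotProduct, Matrix.mulVec, Finset.mul_sum]
  refine Finset.sum_congr rfl fun x _ => ?_
  rw [integral_finsetSum _ fun y _ => (hi x y).const_mul _]
  refine Finset.sum_congr rfl fun y _ => ?_
  rw [integral_const_mul, hS]
  ring

theorem noiseMat_of_isWhiteNoise {S : Matrix (Fin b × Fin a) (Fin b × Fin a) ℝ} {σ : ℝ}
    (hU : MomentBound μ T U (2 * γ) K) (hK : K ≤ K') (hK' : 0 ≤ K') (hγ : 2 < γ)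
    (hm : ∀ t i j, Measurable fun ω => U t ω i j) (hW : IsWhiteNoise μ T U S)
    (hS : specNorm S ≤ σ) {t : ℤ} (ht : t ∈ Finset.Icc (1 : ℤ) T) : NoiseMat μ γ K' σ (U t) where
  meas := hm t
  integrable i j := (hU.integrable hK hK' hm ht i j).1
  le i j := (hU.integrable hK hK' hm ht i j).2
  quad w := by
    have key := integral_sq_linear_le (v := fun ω => (U t ω).vec) (S := S)
      (fun x y => hU.integrable_mul hU hγ hm hm ht ht x.2 x.1 y.2 y.1) (fun x y => by
        have h1 := integral_mul_eq_covMat hU hU hγ hm hm hW.1 ht ht x.2 x.1 y.2 y.1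
        rw [hW.2 t ht t ht, if_pos rfl] at h1
        exact h1) w.vec
    have e1 : ∀ ω, ∑ x, w.vec x * (U t ω).vec x = ∑ i, ∑ j, w i j * U t ω i j := fun ω => by
      rw [Fintype.sum_prod_type, Finset.sum_comm]
      rfl
    have e2 : w.vec ⬝ᵥ w.vec = ‖w‖ ^ 2 := by
      rw [frob_sq, dotProduct, Fintype.sum_prod_type, Finset.sum_comm]
      exact Finset.sum_congr rfl fun _ _ => Finset.sum_congr rfl fun _ _ => (sq _).symm
    simp only [e1, e2] at key
    exact key.trans (mul_le_mul_of_nonneg_right hS (sq_nonneg _))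

end Moments

/-! ### From asymptotic orders to constants, and arithmetic of the rates. -/

section Strengths

theorem exists_loading_bounds {P : ℕ → Type} [∀ n, Fintype (P n)] [∀ n, DecidableEq (P n)] {d : ℕ}
    {R : ∀ n, Matrix (P n) (Fin d) ℝ} {ν : ℕ → ℝ} (hν : ∀ n, 0 ≤ ν n)
    (hmax : (fun n => specNorm (R n) ^ 2) =Θ[atTop] fun n => ν n ^ 2)
    (hmin : (fun n => singVal (R n) (d - 1) ^ 2) =Θ[atTop] fun n => ν n ^ 2) :
    ∃ L l, 0 < l ∧ ∀ᶠ n in atTop, ‖R n‖ ≤ L * ν n ∧ l * ν n ≤ singVal (R n) (d - 1) := by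
  obtain ⟨c, hc, h1⟩ := hmax.1.exists_pos
  obtain ⟨c', hc', h2⟩ := hmin.2.exists_pos
  refine ⟨√(d * c), √c'⁻¹, Real.sqrt_pos.2 (inv_pos.2 hc'), ?_⟩
  filter_upwards [h1.bound, h2.bound] with n h3 h4
  simp only [Real.norm_eq_abs, abs_pow, sq_abs] at h3 h4
  constructor
  · refine le_of_sq_le_sq ?_ (mul_nonneg (Real.sqrt_nonneg _) (hν n))
    rw [mul_pow, Real.sq_sqrt (by positivity)]
    refine (frob_sq_le_specNorm _).trans ?_
    rw [Fintype.card_fin, mul_assoc]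
    gcongr
  · refine le_of_sq_le_sq ?_ (singVal_nonneg _ _)
    rw [mul_pow, Real.sq_sqrt (by positivity), inv_mul_le_iff₀ hc']
    exact h4

theorem exists_le_norm_of_specNorm {ι κ : Type*} [Fintype ι] [Fintype κ] [DecidableEq ι]
    [DecidableEq κ] {S : ℕ → Matrix ι κ ℝ}
    (h : (fun n => specNorm (S n)) =Θ[atTop] fun _ => (1 : ℝ)) :
    ∃ c, 0 < c ∧ ∀ᶠ n in atTop, c ≤ ‖S n‖ := by
  obtain ⟨c, hc, h1⟩ := h.2.exists_pos
  refine ⟨c⁻¹, inv_pos.2 hc, h1.bound.mono fun n hn => ?_⟩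
  rw [norm_one, Real.norm_eq_abs, abs_of_nonneg (specNorm_nonneg _)] at hn
  rw [inv_le_iff_one_le_mul₀' hc]
  exact hn.trans (mul_le_mul_of_nonneg_left (specNorm_le_frob _) hc.le)

theorem rpow_half_sq {x : ℝ} (hx : 0 ≤ x) (s : ℝ) : (x ^ (s / 2)) ^ 2 = x ^ s := by
  rw [← Real.rpow_natCast, ← Real.rpow_mul hx]
  congr 1
  push_cast
  ring

theorem rpow_mem_of_mem_Icc {δ : ℝ} (hδ : δ ∈ Set.Icc (0 : ℝ) 1) {x : ℝ} (hx : 1 ≤ x) :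
    1 ≤ x ^ ((1 - δ) / 2) ∧ x ^ ((1 - δ) / 2) ≤ √x := by
  refine ⟨Real.one_le_rpow hx (by linarith [hδ.2]), ?_⟩
  rw [Real.sqrt_eq_rpow]
  exact Real.rpow_le_rpow_of_exponent_le hx (by linarith [hδ.1])

/-- The dimension is fixed, so entrywise convergence is norm convergence. The deviation is
eventually at most c⁻¹/2, hence at most half of the coercivity constant c⁻¹ q. -/
theorem coercive_of_tendsto {d : ℕ} {P G : ℕ → Matrix (Fin d) (Fin d) ℝ} {q : ℕ → ℕ}
    (hq : Tendsto q atTop atTop) (hP : ∀ n, (P n).PosDef)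
    (hlim : ∀ i j, Tendsto (fun n => G n i j - P n i j) atTop (𝓝 0))
    (hmin : (fun n => eigDesc (P n) (d - 1)) =Θ[atTop] fun n => (q n : ℝ)) :
    ∃ c, 0 < c ∧ ∀ᶠ n in atTop, ∀ x : Fin d → ℝ, c * q n * (x ⬝ᵥ x) ≤ x ⬝ᵥ G n *ᵥ x := by
  obtain ⟨c, hc, h1⟩ := hmin.2.exists_pos
  have hnorm : Tendsto (fun n => ‖G n - P n‖ ^ 2) atTop (𝓝 0) := by
    simp only [frob_sq, Matrix.sub_apply]
    have := tendsto_finsetSum (Finset.univ : Finset (Fin d)) fun i _ =>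
      tendsto_finsetSum (Finset.univ : Finset (Fin d)) fun j _ => (hlim i j).pow 2
    simpa using this
  refine ⟨c⁻¹ / 2, by positivity, ?_⟩
  filter_upwards [h1.bound, hnorm.eventually (gt_mem_nhds (show 0 < (c⁻¹ / 2) ^ 2 by positivity)),
    hq.eventually_ge_atTop 1] with n h2 h3 h4 x
  have hq1 : (1 : ℝ) ≤ q n := by exact_mod_cast h4
  have hxx : 0 ≤ x ⬝ᵥ x := by
    rw [dotProduct_self_eq_norm_sq]
    positivity
  have h5 : ‖G n - P n‖ ≤ c⁻¹ / 2 := (lt_of_pow_lt_pow_left₀ 2 (by positivity) h3).le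
  have h6 := eigDesc_last_mul_le (hP n).1 x
  rw [Fintype.card_fin] at h6
  have h7 := neg_le_of_abs_le (abs_dotProduct_mulVec_le_frob (G n - P n) x)
  rw [Matrix.sub_mulVec, dotProduct_sub] at h7
  -- The order relation compares absolute values; positive definiteness removes the one around the
  -- eigenvalue.
  have h8 : 0 ≤ eigDesc (P n) (d - 1) := by
    unfold eigDesc
    split_ifs with h
    · have : h.1.eigenvalues₀ ⟨d - 1, h.2⟩ =
          h.1.eigenvalues ((Fintype.equivOfCardEq (Fintype.card_fin _)) ⟨d - 1, h.2⟩) := by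
        simp [Matrix.IsHermitian.eigenvalues]
      rw [this]
      exact ((hP n).eigenvalues_pos _).le
    · exact le_rfl
  rw [Real.norm_eq_abs, Real.norm_eq_abs, abs_of_nonneg (by positivity : (0 : ℝ) ≤ q n),
    abs_of_nonneg h8] at h2
  have h9 : c⁻¹ * q n ≤ eigDesc (P n) (d - 1) := by rwa [inv_mul_le_iff₀ hc]
  have h10 : c⁻¹ / 2 ≤ c⁻¹ / 2 * q n := le_mul_of_one_le_right (by positivity) hq1
  have h11 : (c⁻¹ * q n) * (x ⬝ᵥ x) ≤ eigDesc (P n) (d - 1) * (x ⬝ᵥ x) :=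
    mul_le_mul_of_nonneg_right h9 hxx
  have h12 : ‖G n - P n‖ * (x ⬝ᵥ x) ≤ c⁻¹ / 2 * q n * (x ⬝ᵥ x) :=
    mul_le_mul_of_nonneg_right (h5.trans h10) hxx
  nlinarith

theorem growth_rate_eq {p q T δ₁ δ₂ : ℝ} (hp : 0 < p) (hq : 0 < q) (hT : 0 < T) :
    (√p * √q) ^ 2 / ((p ^ ((1 - δ₁) / 2) * q ^ ((1 - δ₂) / 2)) ^ 2 * √T) =
      p ^ δ₁ * q ^ δ₂ * T ^ (-(1 / 2) : ℝ) := by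
  rw [mul_pow, mul_pow, Real.sq_sqrt hp.le, Real.sq_sqrt hq.le, rpow_half_sq hp.le,
    rpow_half_sq hq.le, Real.rpow_sub hp, Real.rpow_sub hq, Real.rpow_one, Real.rpow_one,
    Real.rpow_neg hT.le, ← Real.sqrt_eq_rpow]
  have := Real.rpow_pos_of_pos hp δ₁
  have := Real.rpow_pos_of_pos hq δ₂
  have := Real.sqrt_pos.2 hT
  field_simp

/-- The rate of the signal estimator in terms of the dimensions. -/
theorem signal_rate_eq {p q T δ₁ δ₂ : ℝ} (hp : 0 < p) (hq : 0 < q) :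
    p ^ (-(1 / 2) : ℝ) * q ^ (-(1 / 2) : ℝ) * (1 + p ^ ((1 - δ₁) / 2) * q ^ ((1 - δ₂) / 2) *
      (p ^ δ₁ * q ^ δ₂ * T ^ (-(1 / 2) : ℝ))) =
    p ^ (δ₁ / 2) * q ^ (δ₂ / 2) * T ^ (-(1 / 2) : ℝ) + p ^ (-(1 / 2) : ℝ) * q ^ (-(1 / 2) : ℝ) := by
  have e : ∀ {x δ : ℝ}, 0 < x → x ^ (-(1 / 2) : ℝ) * x ^ ((1 - δ) / 2) * x ^ δ = x ^ (δ / 2) :=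
    fun hx => by
      rw [← Real.rpow_add hx, ← Real.rpow_add hx]
      congr 1
      ring
  rw [← e (δ := δ₁) hp, ← e (δ := δ₂) hq]
  ring

end Strengths

/-! ### Measurability of the noise and the factor autocovariances. -/

section Observation

variable {Ω : Type*} {mm : MeasurableSpace Ω} {p q k r m : ℕ} {A : Matrix (Fin p) (Fin m) ℝ}
  {R : Matrix (Fin p) (Fin k) ℝ} {C : Matrix (Fin q) (Fin r) ℝ} {X : Ω → Matrix (Fin m) (Fin q) ℝ}
  {F : Ω → Matrix (Fin k) (Fin r) ℝ} {E : Ω → Matrix (Fin p) (Fin q) ℝ}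

theorem measurable_signal (hX : ∀ i j, Measurable fun ω => X ω i j)
    (hF : ∀ i j, Measurable fun ω => F ω i j) (i : Fin p) (j : Fin q) :
    Measurable fun ω => signal A R C (X ω) (F ω) i j := by
  have hc : ∀ {a b : Type} (Z : Matrix a b ℝ) i j, Measurable fun _ : Ω => Z i j :=
    fun _ _ _ => measurable_const
  exact (measurable_mul_entry (hc A) hX i j).add (measurable_mul_entry
    (measurable_mul_entry (hc R) hF) (hc Cᵀ) i j)

theorem measurable_observation (hX : ∀ i j, Measurable fun ω => X ω i j)
    (hF : ∀ i j, Measurable fun ω => F ω i j) (hE : ∀ i j, Measurable fun ω => E ω i j)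
    (i : Fin p) (j : Fin q) : Measurable fun ω => observation A R C (X ω) (F ω) (E ω) i j :=
  (measurable_signal hX hF i j).add (hE i j)

/-- The mixing σ-fields are generated by Y, X and F. The noise is Y minus the signal, hence adapted
to them. -/
theorem measurable_noise_of_observation
    (hY : ∀ i j, Measurable fun ω => observation A R C (X ω) (F ω) (E ω) i j)
    (hX : ∀ i j, Measurable fun ω => X ω i j) (hF : ∀ i j, Measurable fun ω => F ω i j)
    (i : Fin p) (j : Fin q) : Measurable fun ω => E ω i j := by
  have e : (fun ω => E ω i j) = fun ω =>
      observation A R C (X ω) (F ω) (E ω) i j - signal A R C (X ω) (F ω) i j := by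
    funext ω
    exact (add_sub_cancel_left _ _).symm
  rw [e]
  exact (hY i j).sub (measurable_signal hX hF i j)

end Observation

/-- The autocovariances of centered factors are their averaged lagged moments. -/
theorem sigmaF_eq_meanCross {Ω : Type*} {m₀ : MeasurableSpace Ω} {μ : Measure Ω}
    [IsProbabilityMeasure μ] {k r T : ℕ} {γ K : ℝ} {F : ℤ → Ω → Matrix (Fin k) (Fin r) ℝ}
    (hF : MomentBound μ T F (2 * γ) K) (hγ : 2 < γ) (hm : ∀ t i j, Measurable fun ω => F t ω i j)
    (h0 : Centered μ T F) (h : ℕ) : sigmaF μ T h F =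
      meanCross μ ((T : ℝ) - h)⁻¹ (Finset.Icc (1 : ℤ) (T - h)) h (fun s ω => (F s ω).vec)
        fun s ω => (F s ω).vec := by
  ext x y
  simp only [sigmaF, avgLagCov, meanCross, Matrix.smul_apply, Matrix.of_apply, smul_eq_mul,
    Matrix.sum_apply]
  congr 1
  refine Finset.sum_congr rfl fun s hs => ?_
  have h1 : s ∈ Finset.Icc (1 : ℤ) T ∧ s + h ∈ Finset.Icc (1 : ℤ) T := by
    simp only [Finset.mem_Icc] at hs ⊢
    omega
  exact (integral_mul_eq_covMat hF hF hγ hm hm h0 h1.1 h1.2 x.2 x.1 y.2 y.1).symm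

end MatFactor

/-! ### The theorem: reduction to the triangular array. -/

theorem theorem4
    {Ω : Type*} [MeasurableSpace Ω] (μ : Measure Ω) [IsProbabilityMeasure μ]
    -- fixed dimensions, maximal lag, and the growing dimensions and sample size
    (k r m h₀ : ℕ) (hk : 0 < k) (hr : 0 < r) (hm : 0 < m)
    (p q T : ℕ → ℕ) (hp : Tendsto p atTop atTop) (hq : Tendsto q atTop atTop)
    (hT : Tendsto T atTop atTop)
    -- the model
    (A : ∀ n, Matrix (Fin (p n)) (Fin m) ℝ)
    (R : ∀ n, Matrix (Fin (p n)) (Fin k) ℝ)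
    (C : ∀ n, Matrix (Fin (q n)) (Fin r) ℝ)
    (X : ∀ n, ℤ → Ω → Matrix (Fin m) (Fin (q n)) ℝ)
    (F : ∀ _n : ℕ, ℤ → Ω → Matrix (Fin k) (Fin r) ℝ)
    (E : ∀ n, ℤ → Ω → Matrix (Fin (p n)) (Fin (q n)) ℝ)
    (Y : ∀ n, ℤ → Ω → Matrix (Fin (p n)) (Fin (q n)) ℝ)
    (hY : ∀ n t ω, Y n t ω
      = MatFactor.observation (A n) (R n) (C n) (X n t ω) (F n t ω) (E n t ω))
    (W : ∀ n, ℤ → Ω → Matrix (Fin (p n)) (Fin (q n)) ℝ)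
    (hW : ∀ n t ω, W n t ω = MatFactor.residual (R n) (C n) (F n t ω) (E n t ω))
    (hXmeas : ∀ n t i j, Measurable fun ω => X n t ω i j)
    (hFmeas : ∀ n t i j, Measurable fun ω => F n t ω i j)
    (hEmeas : ∀ n t i j, Measurable fun ω => E n t ω i j)
    -- standing assumptions on means and correlations
    (Sigma_e : ∀ n, Matrix (Fin (q n) × Fin (p n)) (Fin (q n) × Fin (p n)) ℝ)
    (hEwn : ∀ n, MatFactor.IsWhiteNoise μ (T n) (E n) (Sigma_e n))
    (hEX : ∀ n, MatFactor.Uncorrelated μ (T n) (E n) (X n))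
    (hEF : ∀ n, MatFactor.Uncorrelated μ (T n) (E n) (F n))
    (hXF : ∀ n, ∀ t ∈ Finset.Icc (1 : ℤ) (T n),
      MatFactor.covMat μ (fun ω => (X n t ω).vec) (fun ω => (F n t ω).vec) = 0)
    (hFmean : ∀ n, MatFactor.Centered μ (T n) (F n))
    -- alpha-mixing, uniformly along the sequence
    (γ : ℝ) (hγ : 2 < γ)
    (hmix : ∃ α : ℕ → ℝ, Summable (fun l => α (l + 1) ^ (1 - 2 / γ)) ∧
      ∀ n l, 1 ≤ l → MatFactor.alphaMix μ
        (fun t ω => ((Y n t ω).vec, (X n t ω).vec, (F n t ω).vec)) l ≤ α l)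
    -- bounded moments
    (hmom : ∃ K : ℝ, ∀ n, MatFactor.MomentBound μ (T n) (F n) (2 * γ) K ∧
      MatFactor.MomentBound μ (T n) (X n) (2 * γ) K ∧
      MatFactor.MomentBound μ (T n) (E n) (2 * γ) K)
    -- serial dependence of the latent factors
    (hfac : ∃ h : ℕ, 1 ≤ h ∧ h ≤ h₀ ∧
      (∀ᶠ n in atTop, max k r ≤ (MatFactor.sigmaF μ (T n) h (F n)).rank) ∧
      ((fun n => MatFactor.specNorm (MatFactor.sigmaF μ (T n) h (F n)))
        =Θ[atTop] fun _ => (1 : ℝ)) ∧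
      ((fun n => MatFactor.singVal (MatFactor.sigmaF μ (T n) h (F n)) (max k r - 1))
        =Θ[atTop] fun _ => (1 : ℝ)) ∧
      (∀ᶠ n in atTop, ∀ i : Fin k, MatFactor.avgLagCov μ (T n) h
        (fun t ω => (F n t ω).row i) (fun t ω => (F n t ω).row i) ≠ 0) ∧
      (∀ᶠ n in atTop, ∀ j : Fin r, MatFactor.avgLagCov μ (T n) h
        (fun t ω => (F n t ω).col j) (fun t ω => (F n t ω).col j) ≠ 0))
    -- second moments of the known factors
    (P : ∀ _n : ℕ, Matrix (Fin m) (Fin m) ℝ)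
    (hPt : ∀ n, ∀ t ∈ Finset.Icc (1 : ℤ) (T n), (MatFactor.secondMoment μ (X n t)).PosDef)
    (hPpos : ∀ n, (P n).PosDef)
    (hPlim : ∀ l l', Tendsto (fun n => ((T n : ℝ)⁻¹ •
      ∑ t ∈ Finset.Icc (1 : ℤ) (T n), MatFactor.secondMoment μ (X n t)) l l' - P n l l')
      atTop (𝓝 0))
    (hPmin : (fun n => MatFactor.eigDesc (P n) (m - 1)) =Θ[atTop] fun n => (q n : ℝ))
    -- bounded entries of the noise covariance
    (hSe : ∃ K : ℝ, ∀ n a b, |Sigma_e n a b| ≤ K)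
    -- strength of the row and column factors
    (δ₁ δ₂ : ℝ) (hδ₁ : δ₁ ∈ Set.Icc (0 : ℝ) 1) (hδ₂ : δ₂ ∈ Set.Icc (0 : ℝ) 1)
    (hRmax : (fun n => MatFactor.specNorm (R n) ^ 2) =Θ[atTop] fun n => (p n : ℝ) ^ (1 - δ₁))
    (hRmin : (fun n => MatFactor.singVal (R n) (k - 1) ^ 2)
      =Θ[atTop] fun n => (p n : ℝ) ^ (1 - δ₁))
    (hCmax : (fun n => MatFactor.specNorm (C n) ^ 2) =Θ[atTop] fun n => (q n : ℝ) ^ (1 - δ₂))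
    (hCmin : (fun n => MatFactor.singVal (C n) (r - 1) ^ 2)
      =Θ[atTop] fun n => (q n : ℝ) ^ (1 - δ₂))
    -- distinct positive eigenvalues, with positivity uniform along the sequence
    (M₁ : ∀ n, Matrix (Fin (p n)) (Fin (p n)) ℝ)
    (hM₁ : ∀ n, M₁ n = MatFactor.popM μ (T n) h₀ (W n))
    (M₂ : ∀ n, Matrix (Fin (q n)) (Fin (q n)) ℝ)
    (hM₂ : ∀ n, M₂ n = MatFactor.popM μ (T n) h₀ (fun t ω => (W n t ω)ᵀ))
    (hM₁eig : ∀ᶠ n in atTop, MatFactor.HasDistinctPosEig (M₁ n) k)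
    (hM₂eig : ∀ᶠ n in atTop, MatFactor.HasDistinctPosEig (M₂ n) r)
    (hM₁unif : ∃ c : ℝ, 0 < c ∧ ∀ᶠ n in atTop,
      c * MatFactor.eigDesc (M₁ n) 0 ≤ MatFactor.eigDesc (M₁ n) (k - 1))
    (hM₂unif : ∃ c : ℝ, 0 < c ∧ ∀ᶠ n in atTop,
      c * MatFactor.eigDesc (M₂ n) 0 ≤ MatFactor.eigDesc (M₂ n) (r - 1))
    -- growth condition and bounded spectral norm of the noise covariance
    (hgrowth : Tendsto (fun n => (p n : ℝ) ^ δ₁ * (q n : ℝ) ^ δ₂ * (T n : ℝ) ^ (-(1 / 2) : ℝ))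
      atTop (𝓝 0))
    (hSe2 : ∃ K : ℝ, ∀ n, MatFactor.specNorm (Sigma_e n) ≤ K)
    -- the estimated loading spaces: any choice of leading orthonormal eigenvectors
    (Q₁ : ∀ n, Ω → Matrix (Fin (p n)) (Fin k) ℝ)
    (Q₂ : ∀ n, Ω → Matrix (Fin (q n)) (Fin r) ℝ)
    (hQ₁ : ∀ᶠ n in atTop, ∀ ω, MatFactor.IsTopEigvecs
      (MatFactor.sampleM (T n) h₀
        (MatFactor.residualEst (T n) (fun t => Y n t ω) (fun t => X n t ω))) (Q₁ n ω))
    (hQ₂ : ∀ᶠ n in atTop, ∀ ω, MatFactor.IsTopEigvecs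
      (MatFactor.sampleM (T n) h₀ (fun t =>
        (MatFactor.residualEst (T n) (fun t => Y n t ω) (fun t => X n t ω) t)ᵀ)) (Q₂ n ω))
    -- the time point, which may vary with `n` within the sample
    (t : ℕ → ℤ) (ht : ∀ᶠ n in atTop, t n ∈ Finset.Icc (1 : ℤ) (T n)) :
    MatFactor.IsBigOp μ
      (fun n ω => (p n : ℝ) ^ (-(1 / 2) : ℝ) * (q n : ℝ) ^ (-(1 / 2) : ℝ) *
        MatFactor.specNorm
          (MatFactor.signalEst (T n) (fun s => Y n s ω) (fun s => X n s ω) (Q₁ n ω) (Q₂ n ω) (t n)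
            - MatFactor.signal (A n) (R n) (C n) (X n (t n) ω) (F n (t n) ω)))
      (fun n => (p n : ℝ) ^ (δ₁ / 2) * (q n : ℝ) ^ (δ₂ / 2) * (T n : ℝ) ^ (-(1 / 2) : ℝ)
        + (p n : ℝ) ^ (-(1 / 2) : ℝ) * (q n : ℝ) ^ (-(1 / 2) : ℝ)) := by
  obtain rfl : Y = fun n t ω => MatFactor.observation (A n) (R n) (C n) (X n t ω) (F n t ω)
      (E n t ω) := by
    funext n t ω
    exact hY n t ω
  obtain rfl : W = fun n t ω => MatFactor.residual (R n) (C n) (F n t ω) (E n t ω) := by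
    funext n t ω
    exact hW n t ω
  obtain rfl : M₁ = _ := funext hM₁
  obtain rfl : M₂ = _ := funext hM₂
  obtain ⟨α, hαs, hα⟩ := hmix
  obtain ⟨K, hK⟩ := hmom
  obtain ⟨σ, hσ⟩ := hSe2
  obtain ⟨h, hh1, hh2, -, hpop, -⟩ := hfac
  obtain ⟨c₁, hc₁, hu₁⟩ := hM₁unif
  obtain ⟨c₂, hc₂, hu₂⟩ := hM₂unif
  -- The orders become squares with halved exponents, to be compared with squared norms and singular
  -- values.
  have hpow : ∀ {d : ℕ → ℕ} {δ : ℝ}, (fun n => ((d n : ℝ) ^ ((1 - δ) / 2)) ^ 2) =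
      fun n => (d n : ℝ) ^ (1 - δ) := funext fun n => MatFactor.rpow_half_sq (Nat.cast_nonneg _) _
  rw [← hpow] at hRmax hRmin hCmax hCmin
  obtain ⟨L₁, l₁, hl₁, hR⟩ := MatFactor.exists_loading_bounds
    (fun n => Real.rpow_nonneg (Nat.cast_nonneg _) _) hRmax hRmin
  obtain ⟨L₂, l₂, hl₂, hC⟩ := MatFactor.exists_loading_bounds
    (fun n => Real.rpow_nonneg (Nat.cast_nonneg _) _) hCmax hCmin
  obtain ⟨a, ha, hgram⟩ := MatFactor.coercive_of_tendsto hq hPpos hPlim hPmin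
  have hK0 : 0 ≤ max K 1 := zero_le_one.trans (le_max_right _ _)
  have hKle : K ≤ max K 1 := le_max_left _ _
  have evp : ∀ᶠ n in atTop, (1 : ℝ) ≤ p n :=
    (hp.eventually_ge_atTop 1).mono fun n hn => by exact_mod_cast hn
  have evq : ∀ᶠ n in atTop, (1 : ℝ) ≤ q n :=
    (hq.eventually_ge_atTop 1).mono fun n hn => by exact_mod_cast hn
  have evT : ∀ᶠ n in atTop, (1 : ℝ) ≤ T n :=
    (hT.eventually_ge_atTop 1).mono fun n hn => by exact_mod_cast hn
  set Z : ∀ n, ℤ → Ω → (Fin (q n) × Fin (p n) → ℝ) × (Fin (q n) × Fin m → ℝ) ×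
    (Fin r × Fin k → ℝ) := fun n t ω => ((MatFactor.observation (A n) (R n) (C n) (X n t ω)
      (F n t ω) (E n t ω)).vec, (X n t ω).vec, (F n t ω).vec)
  have mZ : ∀ n t, Measurable (Z n t) := fun n t => by
    refine Measurable.prodMk (measurable_pi_lambda _ fun x => ?_) (Measurable.prodMk
      (measurable_pi_lambda _ fun x => hXmeas n t _ _)
      (measurable_pi_lambda _ fun x => hFmeas n t _ _))
    exact MatFactor.measurable_observation (hXmeas n t) (hFmeas n t) (hEmeas n t) _ _
  have fZ : ∀ n t, Measurable[MatFactor.procField (Z n) t] (Z n t) := fun n t =>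
    comap_measurable (Z n t)
  have fX : ∀ n t i j, Measurable[MatFactor.procField (Z n) t] fun ω => X n t ω i j :=
    fun n t i j => (measurable_pi_apply (j, i)).comp
      (measurable_fst.comp (measurable_snd.comp (fZ n t)))
  have fF : ∀ n t i j, Measurable[MatFactor.procField (Z n) t] fun ω => F n t ω i j :=
    fun n t i j => (measurable_pi_apply (j, i)).comp
      (measurable_snd.comp (measurable_snd.comp (fZ n t)))
  have fY : ∀ n t i j, Measurable[MatFactor.procField (Z n) t] fun ω =>
      MatFactor.observation (A n) (R n) (C n) (X n t ω) (F n t ω) (E n t ω) i j :=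
    fun n t i j => (measurable_pi_apply (j, i)).comp (measurable_fst.comp (fZ n t))
  -- Maxima and minima turn the separate constants into common ones; `max K 1` and `max σ 0` secure
  -- the required signs.
  let M : MatFactor.FactorModel μ k r m := {
    p := p, q := q, T := T, A := A, R := R, C := C, X := X, F := F, E := E
    field := fun n => MatFactor.procField (Z n)
    γ := γ, K := max K 1, mixBound := ∑' l, α (l + 1) ^ (1 - 2 / γ), σ := max σ 0
    loadBound := max L₁ L₂, loadLow := min l₁ l₂, gramLow := a
    α := fun n => MatFactor.alphaMix μ (Z n)
    νR := fun n => (p n : ℝ) ^ ((1 - δ₁) / 2)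
    νC := fun n => (q n : ℝ) ^ ((1 - δ₂) / 2)
    two_lt := hγ
    K_pos := zero_lt_one.trans_le (le_max_right _ _)
    σ_nonneg := le_max_right _ _
    loadLow_pos := lt_min hl₁ hl₂
    gramLow_pos := ha
    tendsto_p := hp
    tendsto_q := hq
    tendsto_T := hT
    mixing := fun n => MatFactor.mixing_of_alphaMix_le hγ (mZ n) hαs (hα n)
    decay := fun n l _ => MatFactor.mul_alphaMix_rpow_le hγ hαs (hα n) l
    boundedX := fun n => ⟨fun t x => fX n t _ _,
      fun t ht x => ((hK n).2.1.integrable hKle hK0 (hXmeas n) ht _ _).1,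
      fun t ht x => ((hK n).2.1.integrable hKle hK0 (hXmeas n) ht _ _).2⟩
    boundedF := fun n => ⟨fun t x => fF n t _ _,
      fun t ht x => ((hK n).1.integrable hKle hK0 (hFmeas n) ht _ _).1,
      fun t ht x => ((hK n).1.integrable hKle hK0 (hFmeas n) ht _ _).2⟩
    boundedE := fun n => ⟨fun t x => MatFactor.measurable_noise_of_observation (fY n t) (fX n t)
        (fF n t) _ _,
      fun t ht x => ((hK n).2.2.integrable hKle hK0 (hEmeas n) ht _ _).1,
      fun t ht x => ((hK n).2.2.integrable hKle hK0 (hEmeas n) ht _ _).2⟩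
    noise := fun n s hs => MatFactor.noiseMat_of_isWhiteNoise (hK n).2.2 hKle hK0 hγ (hEmeas n)
      (hEwn n) ((hσ n).trans (le_max_left _ _)) hs
    orth_EE := fun n s hs t ht hst x y => by
      have := MatFactor.integral_mul_eq_covMat (hK n).2.2 (hK n).2.2 hγ (hEmeas n) (hEmeas n)
        (hEwn n).1 hs ht x.1 x.2 y.1 y.2
      rw [(hEwn n).2 s hs t ht, if_neg hst] at this
      exact this
    orth_EX := fun n s hs t ht x y => by
      have := MatFactor.integral_mul_eq_covMat (hK n).2.2 (hK n).2.1 hγ (hEmeas n) (hXmeas n)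
        (hEwn n).1 hs ht x.1 x.2 y.1 y.2
      rw [hEX n s hs t ht] at this
      exact this
    orth_EF := fun n s hs t ht x y => by
      have := MatFactor.integral_mul_eq_covMat (hK n).2.2 (hK n).1 hγ (hEmeas n) (hFmeas n)
        (hEwn n).1 hs ht x.1 x.2 y.2 y.1
      rw [hEF n s hs t ht] at this
      exact this
    orth_FX := fun n s hs x y => by
      have := MatFactor.integral_mul_eq_covMat (hK n).1 (hK n).2.1 hγ (hFmeas n) (hXmeas n)
        (hFmean n) hs hs x.2 x.1 y.1 y.2
      -- The assumption puts the regressors first. The factors are centred but the regressors need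
      -- not be, so the cross moment is a covariance with the factors first, and symmetry exchanges
      -- the two.
      refine this.trans ((covariance_comm _ _).trans ?_)
      exact congrFun (congrFun (hXF n s hs) (y.2, y.1)) x
    mean_E := fun n s hs x => (hEwn n).1 s hs _ _
    mean_F := fun n s hs x => hFmean n s hs _ _
    νR_mem := evp.mono fun n hn => MatFactor.rpow_mem_of_mem_Icc hδ₁ hn
    νC_mem := evq.mono fun n hn => MatFactor.rpow_mem_of_mem_Icc hδ₂ hn
    norm_R_le := hR.mono fun n hn => hn.1.trans (mul_le_mul_of_nonneg_right (le_max_left _ _)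
      (Real.rpow_nonneg (Nat.cast_nonneg _) _))
    norm_C_le := hC.mono fun n hn => hn.1.trans (mul_le_mul_of_nonneg_right (le_max_right _ _)
      (Real.rpow_nonneg (Nat.cast_nonneg _) _))
    le_singVal_R := hR.mono fun n hn => (mul_le_mul_of_nonneg_right (min_le_left _ _)
      (Real.rpow_nonneg (Nat.cast_nonneg _) _)).trans hn.2
    le_singVal_C := hC.mono fun n hn => (mul_le_mul_of_nonneg_right (min_le_right _ _)
      (Real.rpow_nonneg (Nat.cast_nonneg _) _)).trans hn.2
    gram := hgram
    growth := hgrowth.congr' (by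
      filter_upwards [evp, evq, evT] with n h1 h2 h3
      exact (MatFactor.growth_rate_eq (by linarith) (by linarith) (by linarith)).symm) }
  have hpopF : ∀ n, MatFactor.sigmaF μ (T n) h (F n) = M.popF n h := fun n =>
    MatFactor.sigmaF_eq_meanCross (hK n).1 hγ (hFmeas n) (hFmean n) h
  simp only [hpopF] at hpop
  obtain ⟨c, hc, hpop'⟩ := MatFactor.exists_le_norm_of_specNorm hpop
  simp only [MatFactor.popM_eq_gramSum] at hu₁
  simp only [MatFactor.popM_transpose_eq_gramSum] at hu₂
  simp only [MatFactor.sampleM_eq_gramSum] at hQ₁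
  simp only [MatFactor.sampleM_transpose_eq_gramSum] at hQ₂
  have hmem : h ∈ Finset.Icc 1 h₀ := Finset.mem_Icc.2 ⟨hh1, hh2⟩
  obtain ⟨a₁, ha₁, hlow₁⟩ := MatFactor.FactorModel.exists_le_eigDesc_left (M := M) hmem
    hc hpop' hc₁ hu₁
  obtain ⟨a₂, ha₂, hlow₂⟩ := MatFactor.FactorModel.exists_le_eigDesc_right (M := M) hmem
    hc hpop' hc₂ hu₂
  have key := MatFactor.FactorModel.isBigOp_signalEst_sub (M := M) hk hr ht ha₁ ha₂ hlow₁ hlow₂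
    hQ₁ hQ₂
  have hconst : MatFactor.IsBigOp μ
      (fun n (_ : Ω) => (p n : ℝ) ^ (-(1 / 2) : ℝ) * (q n : ℝ) ^ (-(1 / 2) : ℝ))
      fun n => (p n : ℝ) ^ (-(1 / 2) : ℝ) * (q n : ℝ) ^ (-(1 / 2) : ℝ) :=
    MatFactor.IsBigOp.of_le (C := 1) (Eventually.of_forall fun n ω => by
      rw [one_mul, abs_of_nonneg (by positivity)])
  refine (hconst.mul_rate (C := 1) key (Eventually.of_forall fun n => by positivity) ?_ ?_).mono
    (Eventually.of_forall fun n ω => ?_)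
  · filter_upwards [M.eventually_ν_nonneg, M.eventually_ρ_nonneg] with n h1 h2
    positivity
  · filter_upwards [evp, evq, evT] with n h1 h2 h3
    -- Multiplying 1 + νρ by (pq)^(-1/2) gives exactly the claimed rate.
    rw [one_mul, ← MatFactor.signal_rate_eq (by linarith) (by linarith),
      ← MatFactor.growth_rate_eq (by linarith) (by linarith) (by linarith)]
    exact le_rfl
  · rw [abs_of_nonneg (mul_nonneg (by positivity) (MatFactor.specNorm_nonneg _))]
    exact (mul_le_mul_of_nonneg_left (MatFactor.specNorm_le_frob _) (by positivity)).trans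
      (le_abs_self _)
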